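/- Let $n\ge 1$ and let $M$ be a closed $n$-manifold with a finite (generalized) triangulation $\mathcal T$, i.e. $M$ is obtained from finitely many simplices of dimension at most $n$ by affine gluings of faces, in which the link of every $k$-simplex is an $(n-k-1)$-sphere (as for a triangulation of a PL manifold). Suppose that $\mathcal T$ has a single vertex $v$ and is essential: no edge, viewed as a loop at $v$, is null-homotopic. Let $p:\widetilde M\to M$ be the universal covering with the lifted triangulation, let $x_0\in p^{-1}(v)$, let $G=\pi_1(M,v)$ act on $\widetilde M$ by deck transformations, and let $<$ be a left order on $G$ (a linear order with $a<b\Rightarrow ca<cb$). An action $\rho:G\to\mathrm{Homeo}^+(\mathbb R)$ *realizes* $<$ if $g<h\Leftrightarrow\rho(g)(0)<\rho(h)(0)$. A *developing map* for $\rho$ is a continuous $F:\widetilde M\to\mathbb R$ such that $F(gx_0)=\rho(g)(0)$ for all $g\in G$; $F$ is injective on each edge and $F(gx)=\rho(g)(F(x))$ for $x$ in the 1-skeleton; and for each simplex $\Delta$ of the lifted triangulation and each $t\in\mathbb R$, $F^{-1}(t)\cap\Delta$ is the convex hull in $\Delta$ of the points of $F^{-1}(t)$ on the edges of $\Delta$.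 For an enumeration $G=\{s_0,s_1,\dots\}$ (without repetition) with $s_0=1$, the *minimal embedding* $i_0:G\to\mathbb R$ is defined by $i_0(s_0)=0$ and, for $k>0$, $i_0(s_k)=\max_{q<k}i_0(s_q)+1$ if $s_k>s_q$ for all $q<k$; $i_0(s_k)=\min_{q<k}i_0(s_q)-1$ if $s_k<s_q$ for all $q<k$; and otherwise $i_0(s_k)=\tfrac12(i_0(s_a)+i_0(s_b))$, where $s_a<s_k<s_b$ are the neighbours of $s_k$ in $\{s_0,\dots,s_{k-1}\}$. Then: 1. $G$ is countably infinite, so such enumerations exist; for each of them the minimal embedding $i_0$ exists and is strictly increasing, and there is an action $\rho_0:G\to\mathrm{Homeo}^+(\mathbb R)$ with $\rho_0(g)(i_0(h))=i_0(gh)$ for all $g,h$ that is affine on the complementary intervals of $i_0(G)$. In particular $\rho_0$ realizes $<$. 2. Every action $\rho$ that realizes $<$ has a developing map $F$; if $n\le 2$, then $F$ can moreover be chosen affine on each edge whose upper end point (with respect to $F$) is $x_0$. 3. Each developing map $F$ for an action $\rho$ that realizes $<$ satisfies $F(gx)=\rho(g)(F(x))$ for all $g\in G$ and $x\in\widetilde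 M$, so its level sets are permuted by the deck group. There is a unique codimension-one (topological) foliation $\mathcal F$ of $M\setminus\{v\}$ whose lift to $\widetilde M\setminus p^{-1}(v)$ is the foliation by level sets of $F$. Thus $\mathcal F$ is a singular foliation of $M$ with $v$ as its only possible singular point. It is normal to each $n$-simplex of $\mathcal T$: it decomposes the simplex into sections by hyperplanes, each of which meets every edge in at most one point. 4. $\mathcal F$ depends only on the order, up to homeomorphism and up to inserting or collapsing strips of parallel leaves. Precisely, let $F$ be a developing map for an action realizing $<$, and let $F_0$ be a developing map for an action $\rho_0$ realizing $<$ such that $g\mapsto\rho_0(g)(0)$ is the minimal embedding of some enumeration as above. Then there are a $G$-equivariant continuous map $\kappa:\widetilde M\to\widetilde M$ that maps each simplex onto itself and a map $f:\mathbb R\to\mathbb R$, weakly increasing on $F(\widetilde M)$, with $F_0\circ\kappa=f\circ F$ and the following properties. Over each open interval $J$ on which $f$ is constant and which contains no value of $F$ at a vertex, and for each $c\in J$, there is a homeomorphism $F^{-1}(J)\cong F^{-1}(c)\times J$ whose second component is $F$ and whose first component $x\mapsto\ell(x)$ satisfies $\kappa(\ell(x))=\kappa(x)$. If $F(x)=F(y)$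 and $\kappa(x)=\kappa(y)$, then $x=y$ or else $\kappa(x)$ is a vertex and $f(t)=f(F(x))$ for some $t\ne F(x)$ in $F(\widetilde M)$. In particular, the foliations of any two actions realizing $<$ become equal, up to such maps, to the one of a minimal embedding. -/

import Mathlib

open Set Topology

/-- The open standard simplex: all barycentric coordinates are positive. -/
def openSimplex (k : ℕ) : Set (Fin (k + 1) → ℝ) :=
  {y | y ∈ stdSimplex ℝ (Fin (k + 1)) ∧ ∀ i, 0 < y i}

/-- The affine inclusion of a simplex as the face spanned by the vertices in the range of `f`. -/
noncomputable def faceMap {d k : ℕ} (f : Fin (d + 1) ↪ Fin (k + 1)) (y : Fin (d + 1) → ℝ) :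
    Fin (k + 1) → ℝ :=
  Function.extend f y 0

/-- The 1-skeleton of the standard simplex: at most two barycentric coordinates are nonzero. -/
def oneSkeleton (k : ℕ) : Set (Fin (k + 1) → ℝ) :=
  {y | y ∈ stdSimplex ℝ (Fin (k + 1)) ∧ (Function.support y).ncard ≤ 2}

/-- A finite (generalized) triangulation of a space `M`, i.e. a presentation of `M` as a finite
union of simplices glued along their faces by affine isomorphisms; faces of one simplex may be
glued to each other. `Cell k` is the set of `k`-simplices, and `char σ`, which only matters on the
standard simplex, is the characteristic map of `σ`. -/
structure Triangulation (M : Type*) [TopologicalSpace M] where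
  Cell : ℕ → Type
  finite_cells : Finite (Σ k, Cell k)
  char : ∀ {k : ℕ}, Cell k → (Fin (k + 1) → ℝ) → M
  continuousOn_char : ∀ {k : ℕ} (σ : Cell k), ContinuousOn (char σ) (stdSimplex ℝ (Fin (k + 1)))
  injOn_char : ∀ {k : ℕ} (σ : Cell k), InjOn (char σ) (openSimplex k)
  existsUnique_cell : ∀ x : M, ∃! σ : (Σ k, Cell k), x ∈ char σ.2 '' openSimplex σ.1
  char_face : ∀ {k d : ℕ} (σ : Cell k) (f : Fin (d + 1) ↪ Fin (k + 1)),
    ∃ (τ : Cell d) (π : Equiv.Perm (Fin (d + 1))),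
      ∀ y ∈ stdSimplex ℝ (Fin (d + 1)), char σ (faceMap f y) = char τ (y ∘ π)

namespace Triangulation

variable {M X : Type*} [TopologicalSpace M] [TopologicalSpace X]

/-- `v` is the only vertex of the triangulation. -/
def HasUniqueVertex (T : Triangulation M) (v : M) : Prop :=
  ∀ (σ : T.Cell 0), ∀ y ∈ stdSimplex ℝ (Fin 1), T.char σ y = v

/-- The link of a `k`-simplex `σ`, realized inside `M` close to the barycentre of `σ`: in every
simplex `τ` having `σ` as a face, it consists of the points whose `k + 1` barycentric coordinates
at the vertices of `σ` are all equal to `2 / (2 * k + 3)`, the remaining ones adding up to the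
smaller number `1 / (2 * k + 3)`. -/
def link (T : Triangulation M) {k : ℕ} (σ : T.Cell k) : Set M :=
  {x | ∃ (l : ℕ) (τ : T.Cell l) (f : Fin (k + 1) ↪ Fin (l + 1)),
    (∀ y ∈ stdSimplex ℝ (Fin (k + 1)), T.char τ (faceMap f y) = T.char σ y) ∧
    ∃ y ∈ stdSimplex ℝ (Fin (l + 1)), (∀ i, y (f i) = 2 / (2 * (k : ℝ) + 3)) ∧ T.char τ y = x}

/-- The triangulation is `n`-dimensional and the link of each `k`-simplex is an
`(n - k - 1)`-sphere, as is the case for the triangulations of a PL manifold. -/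
def HasSphericalLinks (T : Triangulation M) (n : ℕ) : Prop :=
  ∀ (k : ℕ) (σ : T.Cell k), ∃ j : ℕ, k + j = n ∧
    Nonempty (T.link σ ≃ₜ Metric.sphere (0 : EuclideanSpace ℝ (Fin j)) 1)

/-- A triangulation with unique vertex `v` is essential if no edge, viewed as a loop at `v`, is
null-homotopic. -/
def IsEssential (T : Triangulation M) (v : M) : Prop :=
  ∀ (σ : T.Cell 1) (γ : Path v v), (∀ t : unitInterval, γ t = T.char σ ![1 - (t : ℝ), (t : ℝ)]) →
    ¬ γ.Homotopic (Path.refl v)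

/-- `s` is a simplex of the lifted triangulation of `X` over the simplex `σ` of `M`. -/
def IsLift (T : Triangulation M) (p : X → M) {k : ℕ} (σ : T.Cell k)
    (s : (Fin (k + 1) → ℝ) → X) : Prop :=
  ContinuousOn s (stdSimplex ℝ (Fin (k + 1))) ∧
    ∀ y ∈ stdSimplex ℝ (Fin (k + 1)), p (s y) = T.char σ y

end Triangulation

/-- `τ` is the deck transformation of the universal covering `p` corresponding to the element `g`
of the fundamental group, with respect to the base point `x₀` of the covering space. As the product
`g * h` of `FundamentalGroup M v` is the class of the loop `h` followed by the loop `g`, the deck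
transformation of `g` has to send `x₀` to the end point of the lift of `g⁻¹` starting at `x₀` in
order that `g ↦ τ` be a homomorphism. -/
def IsDeck {M X : Type*} [TopologicalSpace M] [TopologicalSpace X] {p : X → M}
    (cov : IsCoveringMap p) {v : M} (x₀ : p ⁻¹' {v}) (g : FundamentalGroup M v) (τ : X ≃ₜ X) :
    Prop :=
  (∀ x, p (τ x) = p x) ∧ (cov.monodromy (FundamentalGroup.toPath g⁻¹) x₀ : X) = τ x₀

/-- The minimal embedding of a totally ordered countable set `{s 0, s 1, …}` into `ℝ`. -/
structure IsMinimalEmbedding {G : Type*} [LinearOrder G] (s : ℕ ≃ G) (i : G → ℝ) : Prop where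
  zero : i (s 0) = 0
  above : ∀ n, 0 < n → (∀ q < n, s q < s n) →
    IsGreatest ((fun q => i (s q)) '' Iio n) (i (s n) - 1)
  below : ∀ n, 0 < n → (∀ q < n, s n < s q) →
    IsLeast ((fun q => i (s q)) '' Iio n) (i (s n) + 1)
  between : ∀ n a b, a < n → b < n → s a < s n → s n < s b →
    (∀ q < n, s q ≤ s a ∨ s b ≤ s q) → i (s n) = (i (s a) + i (s b)) / 2

/-- `ρ` is the action on the line given by an embedding `i`: it extends the action of `G` on `i(G)`
by left multiplication, and it is affine on the complementary intervals of `i(G)`. -/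
structure IsActionOfEmbedding {G : Type*} [Group G] (i : G → ℝ) (ρ : G →* (ℝ ≃o ℝ)) : Prop where
  map_embedding : ∀ g h, ρ g (i h) = i (g * h)
  affine_on_gaps : ∀ (g : G) (a b : ℝ), a < b → Disjoint (Ioo a b) (range i) →
    ∃ c d : ℝ, ∀ t ∈ Icc a b, ρ g t = c * t + d

section Developing

variable {M X : Type*} [TopologicalSpace M] [TopologicalSpace X] {p : X → M}

/-- `F : X → ℝ` is a map built from the lifted triangulation and the action `ρ` on the line:
the vertex `g x₀` is sent to `ρ(g)(0)`, on the edges `F` is strictly monotone and satisfies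
`F(g x) = ρ(g)(F(x))`, and the intersection of each level set with each simplex is the polytope
spanned by the points of that level on the 1-skeleton of the simplex. -/
structure IsDevelopingMap (T : Triangulation M) (cov : IsCoveringMap p) {v : M} (x₀ : p ⁻¹' {v})
    (ρ : FundamentalGroup M v →* (ℝ ≃o ℝ)) (F : X → ℝ) : Prop where
  continuous : Continuous F
  vertex : ∀ g τ, IsDeck cov x₀ g τ → F (τ x₀) = ρ g 0
  edge_injOn : ∀ (σ : T.Cell 1) (s : (Fin 2 → ℝ) → X), T.IsLift p σ s →
    InjOn (fun y => F (s y)) (stdSimplex ℝ (Fin 2))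
  edge_equivariant : ∀ g τ, IsDeck cov x₀ g τ → ∀ (σ : T.Cell 1) (s : (Fin 2 → ℝ) → X),
    T.IsLift p σ s → ∀ y ∈ stdSimplex ℝ (Fin 2), F (τ (s y)) = ρ g (F (s y))
  level_polytope : ∀ (k : ℕ) (σ : T.Cell k) (s : (Fin (k + 1) → ℝ) → X), T.IsLift p σ s →
    ∀ t : ℝ, {y | y ∈ stdSimplex ℝ (Fin (k + 1)) ∧ F (s y) = t} =
      convexHull ℝ {y | y ∈ oneSkeleton k ∧ F (s y) = t}

/-- `F` is affine on each edge of the lifted triangulation whose upper end point is `x₀`. -/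
def IsAffineOnBaseEdges (T : Triangulation M) (p : X → M) (x₀ : X) (F : X → ℝ) : Prop :=
  ∀ (σ : T.Cell 1) (s : (Fin 2 → ℝ) → X), T.IsLift p σ s →
    (∃ j, s (Pi.single j 1) = x₀) → (∀ y ∈ stdSimplex ℝ (Fin 2), F (s y) ≤ F x₀) →
    ∀ y ∈ stdSimplex ℝ (Fin 2), F (s y) = ∑ j, y j * F (s (Pi.single j 1))

end Developing

/-- A (topological) singular foliation of codimension one on an `(m + 1)`-manifold `M`, regular
outside `S`: a maximal atlas of foliated charts covering the complement of `S`. The plaques of a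
chart are the sets on which its last coordinate is constant, and two charts are compatible if
locally they have the same plaques. -/
structure SingularFoliation (m : ℕ) (M : Type*) [TopologicalSpace M] (S : Set M) where
  atlas : Set (OpenPartialHomeomorph M (EuclideanSpace ℝ (Fin m) × ℝ))
  source_subset : ∀ e ∈ atlas, e.source ⊆ Sᶜ
  covers : ∀ x ∈ Sᶜ, ∃ e ∈ atlas, x ∈ e.source
  compatible : ∀ e ∈ atlas, ∀ e' ∈ atlas, ∀ x ∈ e.source ∩ e'.source,
    ∃ U ∈ 𝓝 x, ∀ y ∈ U, ∀ z ∈ U, ((e y).2 = (e z).2 ↔ (e' y).2 = (e' z).2)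
  maximal : ∀ e : OpenPartialHomeomorph M (EuclideanSpace ℝ (Fin m) × ℝ), e.source ⊆ Sᶜ →
    (∀ e' ∈ atlas, ∀ x ∈ e.source ∩ e'.source,
      ∃ U ∈ 𝓝 x, ∀ y ∈ U, ∀ z ∈ U, ((e y).2 = (e z).2 ↔ (e' y).2 = (e' z).2)) → e ∈ atlas

namespace SingularFoliation

variable {m : ℕ} {M X : Type*} [TopologicalSpace M] [TopologicalSpace X] {S : Set M}

/-- The lift of the foliation to the covering space `X` is the foliation by level sets of `F`. -/
def IsInducedBy (𝓕 : SingularFoliation m M S) (p : X → M) (F : X → ℝ) : Prop :=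
  ∀ e ∈ 𝓕.atlas, ∀ x : X, p x ∈ e.source →
    ∃ U ∈ 𝓝 x, ∀ y ∈ U, ∀ z ∈ U, (F y = F z ↔ (e (p y)).2 = (e (p z)).2)

/-- The foliation is normal to the simplex `σ`: its restriction to `σ` is a decomposition of `σ`
into sections by hyperplanes (written in barycentric coordinates), each meeting every edge of `σ`
in at most one point. -/
def IsNormalTo (𝓕 : SingularFoliation m M S) (T : Triangulation M) {k : ℕ} (σ : T.Cell k) : Prop :=
  ∃ φ : (Fin (k + 1) → ℝ) → ℝ,
    ContinuousOn φ (stdSimplex ℝ (Fin (k + 1))) ∧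
    (∀ i j, i ≠ j → InjOn φ (segment ℝ (Pi.single i 1) (Pi.single j 1))) ∧
    (∀ t ∈ φ '' stdSimplex ℝ (Fin (k + 1)), ∃ c : Fin (k + 1) → ℝ, c ≠ 0 ∧
      {y | y ∈ stdSimplex ℝ (Fin (k + 1)) ∧ φ y = t} =
        {y | y ∈ stdSimplex ℝ (Fin (k + 1)) ∧ ∑ i, c i * y i = 0}) ∧
    ∀ e ∈ 𝓕.atlas, ∀ x ∈ stdSimplex ℝ (Fin (k + 1)), T.char σ x ∈ e.source →
      ∃ U ∈ 𝓝 x, ∀ y ∈ U ∩ stdSimplex ℝ (Fin (k + 1)), ∀ z ∈ U ∩ stdSimplex ℝ (Fin (k + 1)),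
        (φ y = φ z ↔ (e (T.char σ y)).2 = (e (T.char σ z)).2)

end SingularFoliation

/-- `κ : X → X` exhibits the foliation by level sets of `F'` as obtained from the foliation by
level sets of `F` by collapsing strips of parallel leaves. The map `κ` is equivariant (so it
descends to `M`), maps each simplex onto itself, and maps the `t`-level of `F` to the `f t`-level
of `F'`, where `f` is weakly monotone. If `f` is constant on an open interval that contains no value
of `F` at a vertex, then the part of `X` over that interval is a product of a level set with the
interval, and `κ` collapses the interval factor. On a single level, `κ` is injective, except that a vertex may have several preimages on a
level that belongs to the closure of a strip. -/
structure IsStripCollapse {M X : Type*} [TopologicalSpace M] [TopologicalSpace X]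
    (T : Triangulation M) (p : X → M) (v : M) (F F' : X → ℝ) (f : ℝ → ℝ) (κ : X → X) :
    Prop where
  continuous : Continuous κ
  equivariant : ∀ τ : X ≃ₜ X, (∀ x, p (τ x) = p x) → ∀ x, κ (τ x) = τ (κ x)
  simplex : ∀ (k : ℕ) (σ : T.Cell k) (s : (Fin (k + 1) → ℝ) → X), T.IsLift p σ s →
    κ '' (s '' stdSimplex ℝ (Fin (k + 1))) = s '' stdSimplex ℝ (Fin (k + 1))
  monotone : MonotoneOn f (range F)
  level : ∀ x, F' (κ x) = f (F x)
  strip : ∀ a b c : ℝ, c ∈ Ioo a b → (∀ t ∈ Ioo a b, f t = f c) →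
    (∀ x, F x ∈ Ioo a b → p x ≠ v) →
    ∃ Φ : (F ⁻¹' Ioo a b) ≃ₜ (F ⁻¹' {c}) × (Ioo a b),
      ∀ x, ((Φ x).2 : ℝ) = F x ∧ κ (Φ x).1 = κ x
  injective : ∀ x y, F x = F y → κ x = κ y →
    x = y ∨ (p (κ x) = v ∧ ∃ t ∈ range F, t ≠ F x ∧ f t = f (F x))

/-! The vertices over `v` are labelled by the elements of `G` through monodromy, and essentiality
says that the vertices of a lifted simplex have distinct labels. So every lifted simplex has totally
ordered vertices, and left multiplication respects these orders. All arguments take place on this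
labelled complex.

Canonical action. A minimal embedding bisects gaps, so an interval missed by its image lies between
two consecutive elements of `G` (`IsMinimalEmbedding.exists_consecutive`). By left invariance either
there are no consecutive elements and the image is dense, or the consecutive pairs are the pairs
`h`, `h * u` with `u` the least element above `1`, and the image together with the intervals between
these pairs is dense. The order of `G × [0, 1)` describes this dense set for every action realizing
the order. Monotone extension then gives both the affine action (`exists_isActionOfEmbedding`) and a
continuous weakly increasing semiconjugacy `f` from any realizing action to a minimal one
(`exists_semiconj`).

Developing maps. A function on a simplex that is injective on edges and has levels spanned by their
edge points has hyperplane sections as levels; for each level `t` the sign of one linear form tells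
whether the function is above or below `t` (`exists_isLevelForm`). Conversely, a coherent family of
linear forms moving strictly with the level defines such a function (`IsFormFamily`). The
coefficient `-ρ(g⁻¹)(t)` at the vertex labelled `g` is equivariant and works in all dimensions. In
dimension at most two the crossing points on the edges can be prescribed freely, which yields affine
base edges.

Foliation. Near an interior point of a simplex of positive dimension, the open star is the product
of an open simplex with a cone over a sphere. Shifting mass along an edge from a vertex below the
level to one above it strictly increases `F`, so one coordinate can be replaced by `F`
(`IsTransverseMap.exists_levelChart`). Equivariance of `F` lets these charts descend to `M`, and
maximality of the atlas gives uniqueness.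

Collapse. A point of a simplex is a probability distribution on ordered labels. Multiplying the odds
of its distribution function by a constant defines a projective flow, which restricts to faces,
commutes with left multiplication and depends on the order only. Every transverse function is
strictly monotone along it (`IsTransverse.lt_of_oddsRel`). Hence `κ x` can be defined as the point
of `F₀`-level `f (F x)` on the orbit closure of `x`; continuity, surjectivity on simplices, the
product structure of strips and the injectivity statement all come from uniqueness of this point. -/

/-! ### Extending order-preserving correspondences between subsets of the line. -/

section MonotoneExtension

variable {A : Type*} {α β : A → ℝ}

/-- The monotone extension to the line of the map `α x ↦ β x`. -/
noncomputable def monotoneExtension (α β : A → ℝ) (t : ℝ) : ℝ := sSup (β '' {x | α x ≤ t})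

/-- The set of points lying strictly between two values of `α`. -/
def strictHull (α : A → ℝ) : Set ℝ := {t | (∃ x, α x < t) ∧ ∃ y, t < α y}

theorem isOpen_strictHull (α : A → ℝ) : IsOpen (strictHull α) := by
  have : strictHull α = (⋃ x, Ioi (α x)) ∩ ⋃ y, Iio (α y) := by
    ext t; simp [strictHull]
  rw [this]
  exact (isOpen_iUnion fun _ => isOpen_Ioi).inter (isOpen_iUnion fun _ => isOpen_Iio)

theorem bddAbove_image_of_mem_strictHull (h : ∀ x y, α x ≤ α y ↔ β x ≤ β y) {t : ℝ}
    (ht : t ∈ strictHull α) : BddAbove (β '' {x | α x ≤ t}) := by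
  obtain ⟨-, y, hy⟩ := ht
  refine ⟨β y, ?_⟩
  rintro _ ⟨x, hx, rfl⟩
  exact (h x y).1 (le_trans hx hy.le)

theorem monotoneExtension_apply (h : ∀ x y, α x ≤ α y ↔ β x ≤ β y) (x : A) :
    monotoneExtension α β (α x) = β x := by
  refine le_antisymm (csSup_le ⟨β x, x, (le_rfl : α x ≤ α x), rfl⟩ ?_) (le_csSup ⟨β x, ?_⟩ ⟨x, (le_rfl : α x ≤ α x), rfl⟩)
  all_goals
    rintro _ ⟨y, hy, rfl⟩
    exact (h y x).1 hy

theorem monotoneOn_monotoneExtension (h : ∀ x y, α x ≤ α y ↔ β x ≤ β y) :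
    MonotoneOn (monotoneExtension α β) (strictHull α) := by
  intro s hs t ht hst
  obtain ⟨⟨x, hx⟩, -⟩ := hs
  exact csSup_le_csSup (bddAbove_image_of_mem_strictHull h ht) ⟨β x, x, hx.le, rfl⟩
    (image_mono fun y hy => le_trans hy hst)

/-- A dense set of reals has no extreme elements, and `h` transfers this to the values of `α`. -/
theorem mem_strictHull_of_denseRange (h : ∀ x y, α x ≤ α y ↔ β x ≤ β y) (hβ : DenseRange β)
    (x : A) : α x ∈ strictHull α := by
  have key : ∀ x y, α x < α y ↔ β x < β y := fun x y => by
    rw [← not_le, ← not_le, h]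
  obtain ⟨y, hy⟩ := hβ.exists_mem_open isOpen_Iio ⟨β x - 1, sub_one_lt (β x)⟩
  obtain ⟨z, hz⟩ := hβ.exists_mem_open isOpen_Ioi ⟨β x + 1, lt_add_one (β x)⟩
  exact ⟨⟨y, (key _ _).2 hy⟩, z, (key _ _).2 hz⟩

/-- A monotone function with dense image cannot jump. The values of `α` may leave gaps; the
extension is constant there. -/
theorem continuousOn_monotoneExtension (h : ∀ x y, α x ≤ α y ↔ β x ≤ β y) (hβ : DenseRange β) :
    ContinuousOn (monotoneExtension α β) (strictHull α) := by
  intro t ht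
  refine ContinuousAt.continuousWithinAt ?_
  refine continuousAt_of_monotoneOn_of_exists_between (monotoneOn_monotoneExtension h)
    ((isOpen_strictHull α).mem_nhds ht) (fun b hb => ?_) fun b hb => ?_
  · obtain ⟨x, hx⟩ := hβ.exists_mem_open isOpen_Ioo (nonempty_Ioo.2 hb)
    exact ⟨α x, mem_strictHull_of_denseRange h hβ x, by
      rw [monotoneExtension_apply h]; exact hx⟩
  · obtain ⟨x, hx⟩ := hβ.exists_mem_open isOpen_Ioo (nonempty_Ioo.2 hb)
    exact ⟨α x, mem_strictHull_of_denseRange h hβ x, by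
      rw [monotoneExtension_apply h]; exact hx⟩

theorem strictHull_eq_univ_of_denseRange (hα : DenseRange α) : strictHull α = univ := by
  refine eq_univ_of_forall fun t => ?_
  obtain ⟨y, hy⟩ := hα.exists_mem_open isOpen_Iio ⟨t - 1, sub_one_lt t⟩
  obtain ⟨z, hz⟩ := hα.exists_mem_open isOpen_Ioi ⟨t + 1, lt_add_one t⟩
  exact ⟨⟨y, hy⟩, z, hz⟩

theorem monotone_monotoneExtension (h : ∀ x y, α x ≤ α y ↔ β x ≤ β y) (hα : DenseRange α) :
    Monotone (monotoneExtension α β) := by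
  have := monotoneOn_monotoneExtension h
  rwa [strictHull_eq_univ_of_denseRange hα, monotoneOn_univ] at this

theorem continuous_monotoneExtension (h : ∀ x y, α x ≤ α y ↔ β x ≤ β y) (hα : DenseRange α)
    (hβ : DenseRange β) : Continuous (monotoneExtension α β) := by
  have := continuousOn_monotoneExtension h hβ
  rwa [strictHull_eq_univ_of_denseRange hα, continuousOn_univ] at this

/-- An action on a dense subset of the line by order isomorphisms extends to the line. -/
theorem exists_action_extension {G : Type*} [Group G] (act : G → A → A)
    (act_one : ∀ x, act 1 x = x) (act_mul : ∀ g k x, act (g * k) x = act g (act k x))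
    (hα : DenseRange α) (h : ∀ (g : G) x y, α x ≤ α y ↔ α (act g x) ≤ α (act g y)) :
    ∃ ρ : G →* (ℝ ≃o ℝ), ∀ g x, ρ g (α x) = α (act g x) := by
  have hd : ∀ g : G, DenseRange fun x => α (act g x) := fun g => by
    have : range (fun x => α (act g x)) = range α := by
      ext t
      constructor
      · rintro ⟨x, rfl⟩; exact ⟨act g x, rfl⟩
      · rintro ⟨x, rfl⟩; exact ⟨act g⁻¹ x, by simp [← act_mul, act_one]⟩
    rw [DenseRange, this]; exact hα
  let E : G → ℝ → ℝ := fun g => monotoneExtension α fun x => α (act g x)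
  have hE : ∀ g x, E g (α x) = α (act g x) := fun g x => monotoneExtension_apply (h g) x
  have hc : ∀ g, Continuous (E g) := fun g => continuous_monotoneExtension (h g) hα (hd g)
  have hm : ∀ g, Monotone (E g) := fun g => monotone_monotoneExtension (h g) hα
  -- The group laws hold on the dense range of `α`, hence everywhere by continuity.
  have hmul : ∀ g k t, E (g * k) t = E g (E k t) := fun g k => by
    refine congr_fun (hα.equalizer (hc _) ((hc g).comp (hc k)) ?_)
    funext x
    simp only [Function.comp, hE, act_mul]
  have hone : ∀ t, E 1 t = t := by
    refine congr_fun (hα.equalizer (hc _) continuous_id ?_)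
    funext x
    simp [hE, act_one]
  have hinv : ∀ g t, E g⁻¹ (E g t) = t := fun g t => by rw [← hmul, inv_mul_cancel, hone]
  have hinv' : ∀ g t, E g (E g⁻¹ t) = t := fun g t => by rw [← hmul, mul_inv_cancel, hone]
  refine ⟨{ toFun := fun g => ⟨⟨E g, E g⁻¹, hinv g, hinv' g⟩, ?_⟩, map_one' := ?_, map_mul' := ?_ },
    hE⟩
  · intro s t
    refine ⟨fun hst => ?_, fun hst => hm g hst⟩
    have := hm g⁻¹ hst
    simpa [hinv] using this
  · ext t; exact hone t
  · intro g k; ext t; exact hmul g k t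

end MonotoneExtension

/-! ### Minimal embeddings of countable linear orders. -/

section MinimalEmbedding

variable {G : Type*} [LinearOrder G]

/-- The value at `s n` of the minimal embedding, in terms of the values `f` at the previous
elements. -/
noncomputable def minimalStep (s : ℕ ≃ G) (n : ℕ) (f : ℕ → ℝ) : ℝ :=
  open Classical in
  if {q | q < n ∧ s n < s q} = ∅ then
    -- Both sets are empty only for `n = 0`, as the enumeration has no repetitions.
    if {q | q < n ∧ s q < s n} = ∅ then 0 else sSup (f '' {q | q < n ∧ s q < s n}) + 1
  else if {q | q < n ∧ s q < s n} = ∅ then sInf (f '' {q | q < n ∧ s n < s q}) - 1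
  else (sSup (f '' {q | q < n ∧ s q < s n}) + sInf (f '' {q | q < n ∧ s n < s q})) / 2

/-- Strong recursion: the step at `n` reads only values below `n`, so the truncation by `0`
elsewhere is invisible. -/
theorem exists_minimalStep (s : ℕ ≃ G) : ∃ j : ℕ → ℝ, ∀ n, j n = minimalStep s n j := by
  classical
  refine ⟨WellFounded.fix (C := fun _ => ℝ) Nat.lt_wfRel.wf
    fun n ih => minimalStep s n fun q => if h : q < n then ih q h else 0, fun n => ?_⟩
  rw [WellFounded.fix_eq]
  have key : ∀ (f g : ℕ → ℝ), (∀ q < n, f q = g q) → minimalStep s n f = minimalStep s n g := by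
    intro f g hfg
    have h1 : f '' {q | q < n ∧ s n < s q} = g '' {q | q < n ∧ s n < s q} :=
      image_congr fun q hq => hfg q hq.1
    have h2 : f '' {q | q < n ∧ s q < s n} = g '' {q | q < n ∧ s q < s n} :=
      image_congr fun q hq => hfg q hq.1
    rw [minimalStep, minimalStep, h1, h2]
  refine key _ _ fun q hq => ?_
  simp only [hq, dite_true]

theorem finite_lt_and (n : ℕ) (P : ℕ → Prop) : {q | q < n ∧ P q}.Finite :=
  (finite_Iio n).subset fun _ hq => hq.1

/-- By induction the earlier values are ordered correctly. A new value lies one unit beyond all of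
them, or halfway between the largest value from below and the smallest from above. -/
theorem strict_of_minimalStep {s : ℕ ≃ G} {j : ℕ → ℝ} (hj : ∀ n, j n = minimalStep s n j) :
    ∀ n, ∀ q < n, (s q < s n → j q < j n) ∧ (s n < s q → j n < j q) := by
  intro n
  induction n using Nat.strong_induction_on with
  | _ n ih =>
    have hlt : ∀ a < n, ∀ b < n, s a < s b → j a < j b := by
      intro a ha b hb hab
      rcases lt_trichotomy a b with h | rfl | h
      · exact (ih b hb a h).1 hab
      · exact absurd hab (lt_irrefl _)
      · exact (ih a ha b h).2 hab
    have fL := (finite_lt_and n fun q => s q < s n).image j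
    have fU := (finite_lt_and n fun q => s n < s q).image j
    intro q hq
    have hn := hj n
    rw [minimalStep] at hn
    constructor
    · intro hs
      have hqL : q ∈ {q | q < n ∧ s q < s n} := ⟨hq, hs⟩
      have hL : {q | q < n ∧ s q < s n} ≠ ∅ := ⟨q, hqL⟩ |> nonempty_iff_ne_empty.1
      have h1 : j q ≤ sSup (j '' {q | q < n ∧ s q < s n}) := le_csSup fL.bddAbove ⟨q, hqL, rfl⟩
      split_ifs at hn with hU
      · linarith
      · obtain ⟨a, ha, hae⟩ := (nonempty_iff_ne_empty.2 hL).image j |>.csSup_mem fL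
        obtain ⟨b, hb, hbe⟩ := (nonempty_iff_ne_empty.2 hU).image j |>.csInf_mem fU
        have := hlt a ha.1 b hb.1 (ha.2.trans hb.2)
        linarith
    · intro hs
      have hqU : q ∈ {q | q < n ∧ s n < s q} := ⟨hq, hs⟩
      have hU : {q | q < n ∧ s n < s q} ≠ ∅ := ⟨q, hqU⟩ |> nonempty_iff_ne_empty.1
      have h1 : sInf (j '' {q | q < n ∧ s n < s q}) ≤ j q := csInf_le fU.bddBelow ⟨q, hqU, rfl⟩
      rw [if_neg hU] at hn
      split_ifs at hn with hL
      · linarith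
      · obtain ⟨a, ha, hae⟩ := (nonempty_iff_ne_empty.2 hL).image j |>.csSup_mem fL
        obtain ⟨b, hb, hbe⟩ := (nonempty_iff_ne_empty.2 hU).image j |>.csInf_mem fU
        have := hlt a ha.1 b hb.1 (ha.2.trans hb.2)
        linarith

theorem exists_minimalEmbedding (s : ℕ ≃ G) :
    ∃ i : G → ℝ, IsMinimalEmbedding s i ∧ StrictMono i := by
  obtain ⟨j, hj⟩ := exists_minimalStep s
  have hst := strict_of_minimalStep hj
  have hlt : ∀ a b, s a < s b → j a < j b := by
    intro a b hab
    rcases lt_trichotomy a b with h | rfl | h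
    · exact (hst b a h).1 hab
    · exact absurd hab (lt_irrefl _)
    · exact (hst a b h).2 hab
  have hle : ∀ a b, s a ≤ s b → j a ≤ j b := by
    intro a b hab
    rcases hab.lt_or_eq with h | h
    · exact (hlt _ _ h).le
    · rw [s.injective h]
  refine ⟨fun g => j (s.symm g), ⟨?_, ?_, ?_, ?_⟩, fun g h hgh => hlt _ _ (by simpa using hgh)⟩
  · simp [hj 0, minimalStep]
  · intro n hn h
    have hU : {q | q < n ∧ s n < s q} = ∅ :=
      eq_empty_of_forall_notMem fun q hq => lt_asymm hq.2 (h q hq.1)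
    have hL : {q | q < n ∧ s q < s n} = Iio n := by
      ext q; exact ⟨fun hq => hq.1, fun hq => ⟨hq, h q hq⟩⟩
    have hne : (Iio n).Nonempty := ⟨0, hn⟩
    have e := hj n
    rw [minimalStep, if_pos hU, hL, if_neg hne.ne_empty] at e
    simp only [Equiv.symm_apply_apply, e, add_sub_cancel_right]
    exact ⟨(hne.image j).csSup_mem ((finite_Iio n).image j),
      fun x hx => le_csSup ((finite_Iio n).image j).bddAbove hx⟩
  · intro n hn h
    have hU : {q | q < n ∧ s q < s n} = ∅ :=
      eq_empty_of_forall_notMem fun q hq => lt_asymm hq.2 (h q hq.1)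
    have hL : {q | q < n ∧ s n < s q} = Iio n := by
      ext q; exact ⟨fun hq => hq.1, fun hq => ⟨hq, h q hq⟩⟩
    have hne : (Iio n).Nonempty := ⟨0, hn⟩
    have e := hj n
    rw [minimalStep, hL, if_neg hne.ne_empty, if_pos hU] at e
    simp only [Equiv.symm_apply_apply, e, sub_add_cancel]
    exact ⟨(hne.image j).csInf_mem ((finite_Iio n).image j),
      fun x hx => csInf_le ((finite_Iio n).image j).bddBelow hx⟩
  · intro n a b ha hb han hnb hab
    have e := hj n
    have h1 : IsGreatest (j '' {q | q < n ∧ s q < s n}) (j a) := by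
      refine ⟨⟨a, ⟨ha, han⟩, rfl⟩, ?_⟩
      rintro _ ⟨q, hq, rfl⟩
      exact hle _ _ ((hab q hq.1).resolve_right fun h => (hnb.trans_le h).not_gt hq.2)
    have h2 : IsLeast (j '' {q | q < n ∧ s n < s q}) (j b) := by
      refine ⟨⟨b, ⟨hb, hnb⟩, rfl⟩, ?_⟩
      rintro _ ⟨q, hq, rfl⟩
      exact hle _ _ ((hab q hq.1).resolve_left fun h => (h.trans_lt han).not_gt hq.2)
    have hL : {q | q < n ∧ s q < s n} ≠ ∅ := nonempty_iff_ne_empty.1 ⟨a, ha, han⟩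
    have hU : {q | q < n ∧ s n < s q} ≠ ∅ := nonempty_iff_ne_empty.1 ⟨b, hb, hnb⟩
    rw [minimalStep, if_neg hU, if_neg hL, h1.csSup_eq, h2.csInf_eq] at e
    simpa using e

namespace IsMinimalEmbedding

variable {s : ℕ ≃ G} {i : G → ℝ}

/-- Without a maximum the enumeration sets new records again and again, and each record raises the
value by one. -/
theorem exists_ge [NoMaxOrder G] (hi : IsMinimalEmbedding s i) (N : ℕ) :
    ∃ g, (N : ℝ) ≤ i g := by
  induction N with
  | zero => exact ⟨s 0, by simp [hi.zero]⟩
  | succ N ih =>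
    obtain ⟨g, hg⟩ := ih
    obtain ⟨a, rfl⟩ := s.surjective g
    obtain ⟨m, hm, hmax⟩ := (finite_Iic a).exists_maximalFor s _ ⟨a, mem_Iic.2 le_rfl⟩
    obtain ⟨h, hh⟩ := exists_gt (s m)
    -- The first element beyond `s m`, the maximum of the first `a + 1` elements, exceeds everything
    -- enumerated before it, so the rule `above` applies.
    have hex : ∃ k, s m < s k := ⟨s.symm h, by simpa using hh⟩
    classical
    have hk := Nat.find_spec hex
    have hmin := fun q (hq : q < Nat.find hex) => not_lt.1 (Nat.find_min hex hq)
    have hma : ∀ q ≤ a, s q ≤ s m := fun q hq => by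
      rcases le_total (s q) (s m) with h | h
      · exact h
      · exact hmax hq h
    have hak : a < Nat.find hex := by
      by_contra! hc
      exact (hma _ hc).not_gt hk
    have := (hi.above (Nat.find hex) (Nat.zero_lt_of_lt hak)
      fun q hq => (hmin q hq).trans_lt hk).2 ⟨a, hak, rfl⟩
    refine ⟨s (Nat.find hex), ?_⟩
    push_cast
    simp only at this
    linarith

theorem exists_le [NoMinOrder G] (hi : IsMinimalEmbedding s i) (N : ℕ) :
    ∃ g, i g ≤ -(N : ℝ) := by
  induction N with
  | zero => exact ⟨s 0, by simp [hi.zero]⟩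
  | succ N ih =>
    obtain ⟨g, hg⟩ := ih
    obtain ⟨a, rfl⟩ := s.surjective g
    obtain ⟨m, hm, hmin'⟩ := (finite_Iic a).exists_minimalFor s _ ⟨a, mem_Iic.2 le_rfl⟩
    obtain ⟨h, hh⟩ := exists_lt (s m)
    have hex : ∃ k, s k < s m := ⟨s.symm h, by simpa using hh⟩
    classical
    have hk := Nat.find_spec hex
    have hmin := fun q (hq : q < Nat.find hex) => not_lt.1 (Nat.find_min hex hq)
    have hma : ∀ q ≤ a, s m ≤ s q := fun q hq => by
      rcases le_total (s m) (s q) with h | h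
      · exact h
      · exact hmin' hq h
    have hak : a < Nat.find hex := by
      by_contra! hc
      exact (hma _ hc).not_gt hk
    have := (hi.below (Nat.find hex) (Nat.zero_lt_of_lt hak)
      fun q hq => hk.trans_le (hmin q hq)).2 ⟨a, hak, rfl⟩
    refine ⟨s (Nat.find hex), ?_⟩
    push_cast
    simp only at this
    linarith

/-- A gap of a minimal embedding lies between two consecutive elements. -/
theorem exists_consecutive [NoMaxOrder G] [NoMinOrder G] (hi : IsMinimalEmbedding s i)
    (hmono : StrictMono i) {a b : ℝ} (hab : a < b) (hgap : Disjoint (Ioo a b) (range i)) :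
    ∃ l r, l < r ∧ (∀ h, h ≤ l ∨ r ≤ h) ∧ i l ≤ a ∧ b ≤ i r := by
  have hor : ∀ g, i g ≤ a ∨ b ≤ i g := fun g => by
    by_contra! hc
    exact disjoint_left.1 hgap ⟨hc.1, hc.2⟩ ⟨g, rfl⟩
  by_contra! hcon
  obtain ⟨N, hN⟩ := exists_nat_ge (max |a| |b|)
  obtain ⟨g₁, hg₁⟩ := hi.exists_le N
  obtain ⟨g₂, hg₂⟩ := hi.exists_ge N
  have ha := neg_abs_le a
  have hb := le_abs_self b
  have h1 : i g₁ ≤ a := by linarith [le_max_left |a| |b|]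
  have h2 : b ≤ i g₂ := by linarith [le_max_right |a| |b|]
  -- Bisection: if no consecutive pair spans the gap, there are elements on both sides of it,
  -- adjacent at a finite stage, whose images are as close together as desired. This contradicts `a
  -- < b`.
  have key : ∀ K : ℕ, ∃ n l r, l < n ∧ r < n ∧ i (s l) ≤ a ∧ b ≤ i (s r) ∧
      (∀ q < n, s q ≤ s l ∨ s r ≤ s q) ∧ i (s r) - i (s l) ≤ (i g₂ - i g₁) / 2 ^ K := by
    intro K
    induction K with
    | zero =>
      let n := max (s.symm g₁) (s.symm g₂) + 1
      obtain ⟨l, hl, hlm⟩ := (finite_lt_and n fun q => i (s q) ≤ a).exists_maximalFor s _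
        ⟨s.symm g₁, Nat.lt_succ_of_le (le_max_left _ _), by simpa using h1⟩
      obtain ⟨r, hr, hrm⟩ := (finite_lt_and n fun q => b ≤ i (s q)).exists_minimalFor s _
        ⟨s.symm g₂, Nat.lt_succ_of_le (le_max_right _ _), by simpa using h2⟩
      have hl' : ∀ q < n, i (s q) ≤ a → s q ≤ s l := fun q hq hqa => by
        rcases le_total (s q) (s l) with h | h
        · exact h
        · exact hlm ⟨hq, hqa⟩ h
      have hr' : ∀ q < n, b ≤ i (s q) → s r ≤ s q := fun q hq hqa => by
        rcases le_total (s r) (s q) with h | h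
        · exact h
        · exact hrm ⟨hq, hqa⟩ h
      refine ⟨n, l, r, hl.1, hr.1, hl.2, hr.2, fun q hq => ?_, ?_⟩
      · exact (hor (s q)).imp (hl' q hq) (hr' q hq)
      · have e1 := hmono.monotone (hl' (s.symm g₁) (Nat.lt_succ_of_le (le_max_left _ _))
          (by simpa using h1))
        have e2 := hmono.monotone (hr' (s.symm g₂) (Nat.lt_succ_of_le (le_max_right _ _))
          (by simpa using h2))
        simp only [Equiv.apply_symm_apply] at e1 e2
        simp only [pow_zero, div_one]
        linarith
    | succ K ih =>
      obtain ⟨n, l, r, hl, hr, hla, hrb, hq, hlen⟩ := ih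
      have hlr : s l < s r := hmono.lt_iff_lt.1 (by linarith)
      -- Otherwise `s l`, `s r` would be a consecutive pair across the gap. The first element
      -- enumerated between them is placed at the midpoint.
      have hex : ∃ k, s l < s k ∧ s k < s r := by
        by_contra! hc
        refine (hcon (s l) (s r) hlr (fun h => ?_) hla).not_ge hrb
        have := hc (s.symm h)
        rw [Equiv.apply_symm_apply] at this
        exact (le_or_gt h (s l)).imp id this
      classical
      have hk := Nat.find_spec hex
      have hmin := fun q (hq : q < Nat.find hex) => Nat.find_min hex hq
      set k := Nat.find hex
      have hnk : n ≤ k := by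
        by_contra! hc
        rcases hq k hc with h | h
        · exact h.not_gt hk.1
        · exact h.not_gt hk.2
      have hqk : ∀ q < k, s q ≤ s l ∨ s r ≤ s q := fun q hq => by
        have := hmin q hq
        by_contra! hc
        exact this hc
      have hbet := hi.between k l r (hl.trans_le hnk) (hr.trans_le hnk) hk.1 hk.2 hqk
      have hpow : (i g₂ - i g₁) / 2 ^ (K + 1) = (i g₂ - i g₁) / 2 ^ K / 2 := by
        rw [pow_succ, div_div]
      -- The midpoint is a value of `i`, so it avoids the gap and replaces one of the two ends.
      rcases hor (s k) with h | h
      · refine ⟨k + 1, k, r, by omega, by omega, h, hrb, fun q hq => ?_, by rw [hpow]; linarith⟩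
        rcases Nat.lt_succ_iff_lt_or_eq.1 hq with hq | rfl
        · exact (hqk q hq).imp (fun h => h.trans hk.1.le) id
        · exact Or.inl le_rfl
      · refine ⟨k + 1, l, k, by omega, by omega, hla, h, fun q hq => ?_, by rw [hpow]; linarith⟩
        rcases Nat.lt_succ_iff_lt_or_eq.1 hq with hq | rfl
        · exact (hqk q hq).imp id fun h => hk.2.le.trans h
        · exact Or.inr le_rfl
  have hlim : Filter.Tendsto (fun K : ℕ => (i g₂ - i g₁) / 2 ^ K) Filter.atTop (𝓝 0) :=
    tendsto_const_nhds.div_atTop (tendsto_pow_atTop_atTop_of_one_lt one_lt_two)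
  obtain ⟨K, hK⟩ := (hlim.eventually (gt_mem_nhds (sub_pos.2 hab))).exists
  obtain ⟨n, l, r, -, -, hla, hrb, -, hlen⟩ := key K
  linarith

end IsMinimalEmbedding

end MinimalEmbedding

/-! ### Actions of a left-ordered group on the line. -/

section LeftOrderedGroup

variable {G : Type*} [Group G] [LinearOrder G] [MulLeftStrictMono G]

theorem exists_one_lt_of_nontrivial [Nontrivial G] : ∃ g : G, 1 < g := by
  obtain ⟨g, hg⟩ := exists_ne (1 : G)
  rcases lt_or_gt_of_ne hg with h | h
  · exact ⟨g⁻¹, by simpa using mul_lt_mul_right h g⁻¹⟩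
  · exact ⟨g, h⟩

theorem noMaxOrder_of_nontrivial [Nontrivial G] : NoMaxOrder G := by
  obtain ⟨g, hg⟩ := exists_one_lt_of_nontrivial (G := G)
  exact ⟨fun h => ⟨h * g, by simpa using mul_lt_mul_right hg h⟩⟩

theorem noMinOrder_of_nontrivial [Nontrivial G] : NoMinOrder G := by
  obtain ⟨g, hg⟩ := exists_one_lt_of_nontrivial (G := G)
  have hg' : g⁻¹ < 1 := by simpa using mul_lt_mul_right hg g⁻¹
  exact ⟨fun h => ⟨h * g⁻¹, by simpa using mul_lt_mul_right hg' h⟩⟩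

/-- `u` is the least element greater than `1`, or `1` if the order has no such element. -/
structure IsStep (u : G) : Prop where
  one_le : 1 ≤ u
  eq_one_or : u = 1 ∨ ∀ g, g ≤ 1 ∨ u ≤ g
  consecutive : ∀ l r, l < r → (∀ h, h ≤ l ∨ r ≤ h) → r = l * u

/-- A consecutive pair `l < r` makes `l⁻¹ * r` the least element above `1`, by left invariance.
Hence if there is no such element there are no consecutive pairs, and `u = 1` works vacuously. -/
theorem exists_isStep : ∃ u : G, IsStep u := by
  by_cases h : ∃ u : G, 1 < u ∧ ∀ g, g ≤ 1 ∨ u ≤ g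
  · obtain ⟨u, hu, hmin⟩ := h
    refine ⟨u, hu.le, Or.inr hmin, fun l r hlr hc => ?_⟩
    have h1 : l * u ≤ r := by
      have : u ≤ l⁻¹ * r := (hmin _).resolve_left (not_le.2 (by
        simpa using mul_lt_mul_right hlr l⁻¹))
      rcases this.lt_or_eq with h | h
      · simpa using (mul_lt_mul_right h l).le
      · simp [h]
    have h2 : r ≤ l * u := (hc _).resolve_left (not_le.2 (by
      simpa using mul_lt_mul_right hu l))
    exact le_antisymm h2 h1
  · refine ⟨1, le_rfl, Or.inl rfl, fun l r hlr hc => (h ⟨l⁻¹ * r, ?_, fun g => ?_⟩).elim⟩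
    · simpa using mul_lt_mul_right hlr l⁻¹
    · rcases hc (l * g) with h | h
      · left
        by_contra! hg
        exact h.not_gt (by simpa using mul_lt_mul_right hg l)
      · right
        by_contra! hg
        exact h.not_gt (by simpa using mul_lt_mul_right hg l)

/-- `α` parametrizes the half-open intervals `[i h, i (h * u))`, or just the points `i h` in case
`u = 1`. -/
structure IsStepParam (u : G) (i : G → ℝ) (α : G × Ico (0 : ℝ) 1 → ℝ) : Prop where
  le : ∀ h τ, i h ≤ α (h, τ)
  eq : u = 1 → ∀ h τ, α (h, τ) = i h
  lt : u ≠ 1 → ∀ h τ, α (h, τ) < i (h * u)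
  strictMono : u ≠ 1 → ∀ h, StrictMono fun τ => α (h, τ)

/-- The right-hand side mentions neither `i` nor `α`. Therefore any two parametrizations are
order-isomorphic, and left multiplication on the first factor preserves the order. -/
theorem IsStepParam.le_iff {u : G} (hu : IsStep u) {i : G → ℝ} (hi : StrictMono i)
    {α : G × Ico (0 : ℝ) 1 → ℝ} (hα : IsStepParam u i α) (x y : G × Ico (0 : ℝ) 1) :
    α x ≤ α y ↔ x.1 < y.1 ∨ x.1 = y.1 ∧ (u = 1 ∨ x.2 ≤ y.2) := by
  have key : ∀ x y : G × Ico (0 : ℝ) 1, x.1 < y.1 → α x < α y := by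
    rintro ⟨g, σ⟩ ⟨h, τ⟩ (hgh : g < h)
    rcases eq_or_ne u 1 with h1 | h1
    · rw [hα.eq h1, hα.eq h1]; exact hi hgh
    · have : g * u ≤ h := by
        have h2 : u ≤ g⁻¹ * h := ((hu.eq_one_or.resolve_left h1) _).resolve_left (not_le.2 (by
          simpa using mul_lt_mul_right hgh g⁻¹))
        rcases h2.lt_or_eq with h | h
        · simpa using (mul_lt_mul_right h g).le
        · simp [h]
      exact ((hα.lt h1 g σ).trans_le (hi.monotone this)).trans_le (hα.le h τ)
  rcases lt_trichotomy x.1 y.1 with h | h | h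
  · simp [h, (key x y h).le]
  · obtain ⟨g, σ⟩ := x
    obtain ⟨g', τ⟩ := y
    obtain rfl : g = g' := h
    rcases eq_or_ne u 1 with h1 | h1
    · simp [h1, hα.eq h1]
    · simp only [h1, (hα.strictMono h1 g).le_iff_le, lt_irrefl, false_or, true_and]
  · simp [h.not_gt, h.ne', key y x h]

/-- An interval without values of `i` lies between consecutive elements `l` and `l * u`, where the
parameters with first entry `l` fill everything. If `u = 1` there is no such interval. -/
theorem IsStepParam.denseRange [Nontrivial G] {s : ℕ ≃ G} {u : G} (hu : IsStep u) {i : G → ℝ}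
    (hmin : IsMinimalEmbedding s i) (hi : StrictMono i)
    {α : G × Ico (0 : ℝ) 1 → ℝ} (hα : IsStepParam u i α)
    (hsurj : u ≠ 1 → ∀ h, ∀ t ∈ Ico (i h) (i (h * u)), ∃ τ, α (h, τ) = t) : DenseRange α := by
  have := noMaxOrder_of_nontrivial (G := G)
  have := noMinOrder_of_nontrivial (G := G)
  refine dense_of_exists_between fun a b hab => ?_
  by_cases hd : Disjoint (Ioo a b) (range i)
  · obtain ⟨l, r, hlr, hc, hl, hr⟩ := hmin.exists_consecutive hi hab hd
    have e := hu.consecutive l r hlr hc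
    have h1 : u ≠ 1 := by rintro rfl; simp [e] at hlr
    obtain ⟨τ, hτ⟩ := hsurj h1 l ((a + b) / 2) ⟨by linarith, by rw [← e]; linarith⟩
    exact ⟨_, ⟨(l, τ), rfl⟩, by rw [hτ]; linarith, by rw [hτ]; linarith⟩
  · obtain ⟨_, ht, h, rfl⟩ := not_disjoint_iff.1 hd
    rcases eq_or_ne u 1 with h1 | h1
    · exact ⟨_, ⟨(h, ⟨0, by simp⟩), rfl⟩, by rw [hα.eq h1]; exact ht⟩
    · obtain ⟨τ, hτ⟩ := hsurj h1 h (i h) ⟨le_rfl, hi (by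
        simpa using mul_lt_mul_right (hu.one_le.lt_of_ne' h1) h)⟩
      exact ⟨_, ⟨(h, τ), rfl⟩, by rw [hτ]; exact ht⟩

theorem isStepParam_affine {u : G} (hu : IsStep u) {i : G → ℝ} (hi : StrictMono i) :
    IsStepParam u i fun x => i x.1 + x.2 * (i (x.1 * u) - i x.1) := by
  have hpos : u ≠ 1 → ∀ h, 0 < i (h * u) - i h := fun h1 h => sub_pos.2 (hi (by
    simpa using mul_lt_mul_right (hu.one_le.lt_of_ne' h1) h))
  refine ⟨fun h τ => ?_, fun h1 h τ => by simp [h1], fun h1 h τ => ?_, fun h1 h σ τ hστ => ?_⟩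
  · rcases eq_or_ne u 1 with h1 | h1
    · simp [h1]
    · have := mul_nonneg τ.2.1 (hpos h1 h).le
      simp only
      linarith
  · have := mul_lt_mul_of_pos_right τ.2.2 (hpos h1 h)
    simp only
    linarith
  · have := mul_lt_mul_of_pos_right (show (σ : ℝ) < τ from hστ) (hpos h1 h)
    simp only
    linarith

/-- Left multiplication on the first factor of `G × [0, 1)` extends to the line by density. It is
affine on gaps because the parametrization is affine on each interval from `i l` to `i (l * u)`. -/
theorem exists_isActionOfEmbedding [Nontrivial G] {s : ℕ ≃ G} {i : G → ℝ}
    (hmin : IsMinimalEmbedding s i) (hi : StrictMono i) :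
    ∃ ρ : G →* (ℝ ≃o ℝ), IsActionOfEmbedding i ρ := by
  have := noMaxOrder_of_nontrivial (G := G)
  have := noMinOrder_of_nontrivial (G := G)
  obtain ⟨u, hu⟩ := exists_isStep (G := G)
  have hα := isStepParam_affine hu hi
  have hd := hα.denseRange hu hmin hi (fun h1 h t ht => by
    have hpos : 0 < i (h * u) - i h := by linarith [ht.1, ht.2]
    refine ⟨⟨(t - i h) / (i (h * u) - i h), div_nonneg (by linarith [ht.1]) hpos.le,
      (div_lt_one hpos).2 (by linarith [ht.2])⟩, ?_⟩
    simp only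
    field_simp
    ring)
  obtain ⟨ρ, hρ⟩ := exists_action_extension
    (fun (g : G) (x : G × Ico (0 : ℝ) 1) => (g * x.1, x.2)) (fun x => by simp)
    (fun g k x => by simp [mul_assoc]) hd (fun g x y => by
      rw [hα.le_iff hu hi, hα.le_iff hu hi]
      simp)
  have hmap : ∀ g h, ρ g (i h) = i (g * h) := fun g h => by
    simpa using hρ g (h, ⟨0, by simp⟩)
  refine ⟨ρ, hmap, fun g a b hab hgap => ?_⟩
  obtain ⟨l, r, hlr, hc, hl, hr⟩ := hmin.exists_consecutive hi hab hgap
  obtain rfl := hu.consecutive l r hlr hc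
  have hpos : 0 < i (l * u) - i l := sub_pos.2 (hi hlr)
  set c := (i (g * l * u) - i (g * l)) / (i (l * u) - i l)
  refine ⟨c, i (g * l) - c * i l, fun t ht => ?_⟩
  -- The right end point is not parametrized over `l`, since `τ < 1`; there the affine formula is
  -- checked on `i (l * u)` itself.
  rcases (ht.2.trans hr).lt_or_eq with h | rfl
  · have e := hρ g (l, ⟨(t - i l) / (i (l * u) - i l), div_nonneg (by linarith [ht.1]) hpos.le,
      (div_lt_one hpos).2 (by linarith)⟩)
    simp only at e
    rw [div_mul_cancel₀ _ hpos.ne', add_sub_cancel] at e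
    rw [e]
    simp only [c]
    field_simp
    ring
  · rw [hmap]
    simp only [c]
    rw [← mul_assoc]
    field_simp
    ring

/-- Any action realizing the order is semiconjugate to the one given by a minimal embedding. -/
theorem exists_semiconj [Nontrivial G] {ρ ρ₀ : G →* (ℝ ≃o ℝ)} {s : ℕ ≃ G}
    (hρ : StrictMono fun g => ρ g 0) (hρ₀ : StrictMono fun g => ρ₀ g 0)
    (hmin : IsMinimalEmbedding s fun g => ρ₀ g 0) :
    ∃ f : ℝ → ℝ, (∀ g, f (ρ g 0) = ρ₀ g 0) ∧ MonotoneOn f (strictHull fun g => ρ g 0) ∧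
      ContinuousOn f (strictHull fun g => ρ g 0) ∧
      ∀ g, ∀ t ∈ strictHull (fun g => ρ g 0), f (ρ g t) = ρ₀ g (f t) := by
  obtain ⟨u, hu⟩ := exists_isStep (G := G)
  -- The interval above `ρ h 0` is parametrized by transporting the affine parametrization of `[0, ρ
  -- u 0)` by `ρ h`, which makes the parametrization equivariant.
  have param : ∀ ρ : G →* (ℝ ≃o ℝ), StrictMono (fun g => ρ g 0) →
      IsStepParam u (fun g => ρ g 0) fun x => ρ x.1 (x.2 * ρ u 0) := by
    intro ρ hρ
    have hpos : u ≠ 1 → 0 < ρ u 0 := fun h1 => by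
      simpa using hρ (hu.one_le.lt_of_ne' h1)
    refine ⟨fun h τ => ?_, fun h1 h τ => by simp [h1], fun h1 h τ => ?_,
      fun h1 h σ τ hστ => ?_⟩
    · refine (ρ h).monotone (mul_nonneg τ.2.1 ?_)
      simpa using hρ.monotone hu.one_le
    · simp only [map_mul, RelIso.mul_apply, OrderIso.lt_iff_lt]
      exact mul_lt_of_lt_one_left (hpos h1) τ.2.2
    · simp only [OrderIso.lt_iff_lt]
      exact mul_lt_mul_of_pos_right (show (σ : ℝ) < τ from hστ) (hpos h1)
  have hα := param ρ hρ
  have hβ := param ρ₀ hρ₀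
  set α : G × Ico (0 : ℝ) 1 → ℝ := fun x => ρ x.1 (x.2 * ρ u 0) with hαdef
  set β : G × Ico (0 : ℝ) 1 → ℝ := fun x => ρ₀ x.1 (x.2 * ρ₀ u 0) with hβdef
  have hle : ∀ x y, α x ≤ α y ↔ β x ≤ β y := fun x y => by
    rw [hα.le_iff hu hρ, hβ.le_iff hu hρ₀]
  -- Density is available for the minimal action only. The values of `α` may omit intervals, and on
  -- these the semiconjugacy is constant: they are the strips to be collapsed.
  have hd : DenseRange β := hβ.denseRange hu hmin hρ₀ (fun h1 h t ht => by
    have hpos : 0 < ρ₀ u 0 := by simpa using hρ₀ (hu.one_le.lt_of_ne' h1)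
    refine ⟨⟨(ρ₀ h).symm t / ρ₀ u 0, div_nonneg ((ρ₀ h).le_symm_apply.2 ht.1) hpos.le,
      (div_lt_one hpos).2 ((ρ₀ h).symm_apply_lt.2 (by simpa using ht.2))⟩, ?_⟩
    simp only [hβdef, div_mul_cancel₀ _ hpos.ne', OrderIso.apply_symm_apply])
  have hzero : ∀ g, α (g, ⟨0, by simp⟩) = ρ g 0 := fun g => by simp [hαdef]
  have hull : strictHull (fun g => ρ g 0) = strictHull α := by
    ext t
    constructor
    · rintro ⟨⟨x, hx⟩, y, hy⟩
      exact ⟨⟨_, (hzero x).trans_lt hx⟩, _, hy.trans_eq (hzero y).symm⟩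
    · rintro ⟨⟨x, hx⟩, y, hy⟩
      refine ⟨⟨x.1, (hα.le x.1 x.2).trans_lt hx⟩, ?_⟩
      rcases eq_or_ne u 1 with h1 | h1
      · exact ⟨y.1, hy.trans_eq (hα.eq h1 y.1 y.2)⟩
      · exact ⟨_, hy.trans (hα.lt h1 y.1 y.2)⟩
  rw [hull]
  refine ⟨monotoneExtension α β, fun g => ?_, monotoneOn_monotoneExtension hle,
    continuousOn_monotoneExtension hle hd, fun g t ht => ?_⟩
  · rw [← hzero, monotoneExtension_apply hle]
    simp [hβdef]
  -- The set whose supremum defines the extension moves equivariantly, and an order isomorphism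
  -- commutes with suprema.
  · have hset : β '' {x | α x ≤ ρ g t} = ρ₀ g '' (β '' {x | α x ≤ t}) := by
      ext z
      constructor
      · rintro ⟨x, hx, rfl⟩
        refine ⟨_, ⟨(g⁻¹ * x.1, x.2), ?_, rfl⟩, ?_⟩
        · have := (ρ g⁻¹).monotone hx
          simpa only [hαdef, mem_ofPred_eq, ← RelIso.mul_apply, ← map_mul, inv_mul_cancel, map_one,
            RelIso.one_apply] using this
        · simp [hβdef, ← RelIso.mul_apply, ← map_mul]
      · rintro ⟨_, ⟨x, hx, rfl⟩, rfl⟩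
        refine ⟨(g * x.1, x.2), ?_, ?_⟩
        · simpa [hαdef] using hx
        · simp [hβdef]
    rw [monotoneExtension, monotoneExtension, hset]
    obtain ⟨x, hx⟩ := ht.1
    have hne : (β '' {x | α x ≤ t}).Nonempty := ⟨β x, x, hx.le, rfl⟩
    exact ((ρ₀ g).map_csSup' hne (bddAbove_image_of_mem_strictHull hle ht)).symm

end LeftOrderedGroup

/-! ### Hyperplane sections of a simplex. -/

section Simplex

variable {k : ℕ}

/-- A hyperplane section of a simplex is spanned by its points on the edges. -/
theorem hyperplaneSection_eq_convexHull (c : Fin (k + 1) → ℝ) :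
    {y | y ∈ stdSimplex ℝ (Fin (k + 1)) ∧ ∑ i, c i * y i = 0} =
      convexHull ℝ {y | y ∈ oneSkeleton k ∧ ∑ i, c i * y i = 0} := by
  classical
  apply Subset.antisymm
  · rintro y ⟨hy, hcy⟩
    -- `Ap` and `Am` are the total positive and negative contributions to the form; they agree
    -- because it vanishes at `y`.
    set Ap := ∑ j, if 0 < c j then c j * y j else 0 with hAp
    set Am := ∑ i, if c i < 0 then -c i * y i else 0 with hAm
    have hA : Ap = Am := by
      have : Ap - Am = ∑ i, c i * y i := by
        rw [hAp, hAm, ← Finset.sum_sub_distrib]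
        refine Finset.sum_congr rfl fun i _ => ?_
        rcases lt_trichotomy (c i) 0 with h | h | h
        · simp [h, h.not_gt]
        · simp [h]
        · simp [h, h.not_gt]
      linarith
    have hAp0 : 0 ≤ Ap := Finset.sum_nonneg fun j _ => by
      split_ifs with h
      · exact mul_nonneg h.le (hy.1 j)
      · exact le_rfl
    -- Product coupling of negative and positive contributions: for `c i < 0 < c j` the point `P (i,
    -- j)` is the zero of the form on the edge, and `W (i, j)` is its weight. Vertices where `c`
    -- vanishes keep their mass on the diagonal.
    let W : Fin (k + 1) × Fin (k + 1) → ℝ := fun p =>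
      if c p.1 < 0 ∧ 0 < c p.2 then y p.1 * y p.2 * (c p.2 - c p.1) / Ap
      else if p.1 = p.2 ∧ c p.1 = 0 then y p.1 else 0
    let P : Fin (k + 1) × Fin (k + 1) → Fin (k + 1) → ℝ := fun p =>
      if c p.1 < 0 ∧ 0 < c p.2 then
        (c p.2 / (c p.2 - c p.1)) • Pi.single p.1 1 + (-c p.1 / (c p.2 - c p.1)) • Pi.single p.2 1
      else Pi.single p.1 1
    have hW : ∀ p, 0 ≤ W p := fun p => by
      simp only [W]
      split_ifs with h1 h2
      · exact div_nonneg (mul_nonneg (mul_nonneg (hy.1 _) (hy.1 _)) (by linarith [h1.1, h1.2])) hAp0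
      · exact hy.1 _
      · exact le_rfl
    have hPsum : ∀ p, ∑ l, P p l = 1 := fun p => by
      simp only [P]
      split_ifs with h1
      · have : c p.2 - c p.1 ≠ 0 := by linarith [h1.1, h1.2]
        simp only [Pi.add_apply, Pi.smul_apply, smul_eq_mul, Finset.sum_add_distrib,
          ← Finset.mul_sum, Finset.mem_univ, if_true, Pi.single_apply,
          Finset.sum_ite_eq']
        field_simp
        ring
      · simp
    have hPmem : ∀ p, W p ≠ 0 → P p ∈ {y | y ∈ oneSkeleton k ∧ ∑ i, c i * y i = 0} := by
      intro p hp
      simp only [W] at hp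
      refine ⟨⟨⟨fun l => ?_, hPsum p⟩, ?_⟩, ?_⟩
      · simp only [P]
        split_ifs with h1
        · have : 0 < c p.2 - c p.1 := by linarith [h1.1, h1.2]
          simp only [Pi.add_apply, Pi.smul_apply, smul_eq_mul, Pi.single_apply]
          have h2 : 0 ≤ c p.2 / (c p.2 - c p.1) := div_nonneg h1.2.le this.le
          have h3 : 0 ≤ -c p.1 / (c p.2 - c p.1) := div_nonneg (by linarith [h1.1]) this.le
          split_ifs <;> simp [h2, h3, add_nonneg]
        · simp only [Pi.single_apply]
          split_ifs <;> simp
      · have hsub : Function.support (P p) ⊆ {p.1, p.2} := by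
          intro l hl
          simp only [P, Function.mem_support] at hl
          by_contra hc
          simp only [mem_insert_iff, mem_singleton_iff, not_or] at hc
          split_ifs at hl <;> simp [hc.1, hc.2] at hl
        exact (ncard_le_ncard hsub (toFinite _)).trans ((ncard_insert_le _ _).trans (by simp))
      · simp only [P]
        split_ifs at hp ⊢ with h1 h2
        · have : c p.2 - c p.1 ≠ 0 := by linarith [h1.1, h1.2]
          simp only [Pi.add_apply, Pi.smul_apply, smul_eq_mul, Pi.single_apply, mul_add,
            Finset.sum_add_distrib, mul_ite, mul_one, mul_zero, Finset.sum_ite_eq', Finset.mem_univ,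
            if_true]
          field_simp
          ring
        · simp [Pi.single_apply, h2.2]
        · exact absurd rfl hp
    have hcoord : ∀ l, ∑ p, W p * P p l = y l := by
      intro l
      have e : ∀ p : Fin (k + 1) × Fin (k + 1), W p * P p l =
          (if p.1 = l then (if c l < 0 then y l / Ap * (if 0 < c p.2 then c p.2 * y p.2 else 0)
            else 0) else 0) +
          (if p.2 = l then (if 0 < c l then y l / Ap * (if c p.1 < 0 then -c p.1 * y p.1 else 0)
            else 0) else 0) +
          (if p.1 = l then (if p.2 = l then (if c l = 0 then y l else 0) else 0) else 0) := by
        rintro ⟨i, j⟩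
        simp only [W, P]
        by_cases h1 : c i < 0 ∧ 0 < c j
        · have : c j - c i ≠ 0 := by linarith [h1.1, h1.2]
          have hij : i ≠ j := by rintro rfl; linarith [h1.1, h1.2]
          by_cases hi : i = l
          · subst hi
            simp [h1, hij.symm]
            field_simp
          · by_cases hj : j = l
            · subst hj
              simp [h1, hij]
              field_simp
            · simp [h1, hi, hj, Ne.symm hi, Ne.symm hj]
        · rw [if_neg h1, if_neg h1]
          by_cases hi : i = l
          · subst hi
            by_cases hj : j = i
            · subst hj
              rcases lt_trichotomy (c j) 0 with h | h | h
              · simp [h, h.ne, h.not_gt]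
              · simp [h]
              · simp [h, h.ne', h.not_gt]
            · rcases lt_or_ge (c i) 0 with h | h
              · have : ¬ 0 < c j := fun h' => h1 ⟨h, h'⟩
                simp [hj, Ne.symm hj, this]
              · simp [hj, Ne.symm hj, h.not_gt]
          · by_cases hj : j = l
            · subst hj
              rcases lt_or_ge 0 (c j) with h | h
              · have : ¬ c i < 0 := fun h' => h1 ⟨h', h⟩
                simp [hi, this]
              · simp [hi, h.not_gt]
            · simp [hi, hj]
      simp only [e, Finset.sum_add_distrib, Fintype.sum_prod_type]
      have e1 : (∑ i : Fin (k + 1), ∑ j, if i = l then (if c l < 0 then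
          y l / Ap * (if 0 < c j then c j * y j else 0) else 0) else 0) =
          if c l < 0 then y l / Ap * Ap else 0 := by
        rw [Finset.sum_comm]
        simp only [Finset.sum_ite_eq', Finset.mem_univ, if_true]
        split_ifs
        · rw [← Finset.mul_sum]
        · simp
      have e2 : (∑ i : Fin (k + 1), ∑ j, if j = l then (if 0 < c l then
          y l / Ap * (if c i < 0 then -c i * y i else 0) else 0) else 0) =
          if 0 < c l then y l / Ap * Ap else 0 := by
        simp only [Finset.sum_ite_eq', Finset.mem_univ, if_true]
        split_ifs
        · rw [← Finset.mul_sum, hA]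
        · simp
      rw [e1, e2]
      simp only [Finset.sum_ite_irrel, Finset.sum_ite_eq', Finset.mem_univ, if_true,
        Finset.sum_const_zero]
      -- If `Ap = 0`, no mass sits at vertices with `c l ≠ 0`, so division by zero does no harm.
      have hzero : Ap = 0 → c l ≠ 0 → y l = 0 := by
        intro h0 hl
        rcases lt_or_gt_of_ne hl with h | h
        · rw [hA, hAm, Finset.sum_eq_zero_iff_of_nonneg] at h0
          · have := h0 l (Finset.mem_univ _)
            simpa [h, h.ne] using this
          · intro i _
            split_ifs with h
            · exact mul_nonneg (by linarith) (hy.1 i)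
            · exact le_rfl
        · rw [hAp, Finset.sum_eq_zero_iff_of_nonneg] at h0
          · have := h0 l (Finset.mem_univ _)
            simpa [h, h.ne'] using this
          · intro i _
            split_ifs with h
            · exact mul_nonneg h.le (hy.1 i)
            · exact le_rfl
      have hdiv : c l ≠ 0 → y l / Ap * Ap = y l := by
        intro hl
        rcases eq_or_ne Ap 0 with h | h
        · simp [h, hzero h hl]
        · exact div_mul_cancel₀ _ h
      rcases lt_trichotomy (c l) 0 with h | h | h
      · simp [h, h.ne, h.not_gt, hdiv h.ne]
      · simp [h]
      · simp [h, h.ne', h.not_gt, hdiv h.ne']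
    have hWsum : ∑ p, W p = 1 := by
      calc ∑ p, W p = ∑ p, W p * ∑ l, P p l := by simp [hPsum]
        _ = ∑ l, ∑ p, W p * P p l := by simp_rw [Finset.mul_sum]; rw [Finset.sum_comm]
        _ = 1 := by simp_rw [hcoord]; exact hy.2
    have hfin := (convex_convexHull ℝ {y | y ∈ oneSkeleton k ∧ ∑ i, c i * y i = 0}).finsum_mem
      hW (by rw [finsum_eq_sum_of_fintype, hWsum])
      (fun p hp => subset_convexHull ℝ _ (hPmem p hp))
    rw [finsum_eq_sum_of_fintype] at hfin
    convert hfin using 1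
    funext l
    simp [hcoord]
  · refine convexHull_min (fun y hy => ⟨hy.1.1, hy.2⟩) ?_
    intro x hx y hy a b ha hb hab
    refine ⟨convex_stdSimplex ℝ _ hx.1 hy.1 ha hb hab, ?_⟩
    calc ∑ i, c i * (a • x + b • y) i = a * ∑ i, c i * x i + b * ∑ i, c i * y i := by
          rw [Finset.mul_sum, Finset.mul_sum, ← Finset.sum_add_distrib]
          refine Finset.sum_congr rfl fun i _ => ?_
          simp only [Pi.add_apply, Pi.smul_apply, smul_eq_mul]
          ring
      _ = 0 := by rw [hx.2, hy.2]; ring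

end Simplex

/-! ### Levels spanned by edge points are hyperplane sections. -/

section LevelForm

variable {k : ℕ}

/-- The level `t` of `φ` is the hyperplane section of the simplex given by `c`. -/
def IsLevelForm (φ : (Fin (k + 1) → ℝ) → ℝ) (t : ℝ) (c : Fin (k + 1) → ℝ) : Prop :=
  ∀ y ∈ stdSimplex ℝ (Fin (k + 1)),
    (0 < ∑ i, c i * y i ↔ t < φ y) ∧ (∑ i, c i * y i < 0 ↔ φ y < t)

theorem IsLevelForm.eq_zero_iff {φ : (Fin (k + 1) → ℝ) → ℝ} {t : ℝ} {c : Fin (k + 1) → ℝ}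
    (h : IsLevelForm φ t c) {y : Fin (k + 1) → ℝ} (hy : y ∈ stdSimplex ℝ (Fin (k + 1))) :
    ∑ i, c i * y i = 0 ↔ φ y = t := by
  obtain ⟨h1, h2⟩ := h y hy
  constructor
  · intro h0
    exact le_antisymm (not_lt.1 fun h => (h1.2 h).ne' h0) (not_lt.1 fun h => (h2.2 h).ne h0)
  · intro h0
    exact le_antisymm (not_lt.1 fun h => (h1.1 h).ne' h0) (not_lt.1 fun h => (h2.1 h).ne h0)

theorem sum_mul_single (c : Fin (k + 1) → ℝ) (l : Fin (k + 1)) :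
    ∑ i, c i * (Pi.single l 1 : Fin (k + 1) → ℝ) i = c l := by
  simp [Pi.single_apply]

theorem IsLevelForm.pos_iff {φ : (Fin (k + 1) → ℝ) → ℝ} {t : ℝ} {c : Fin (k + 1) → ℝ}
    (h : IsLevelForm φ t c) (l : Fin (k + 1)) : 0 < c l ↔ t < φ (Pi.single l 1) := by
  have := (h _ (single_mem_stdSimplex ℝ l)).1
  rwa [sum_mul_single] at this

theorem IsLevelForm.neg_iff {φ : (Fin (k + 1) → ℝ) → ℝ} {t : ℝ} {c : Fin (k + 1) → ℝ}
    (h : IsLevelForm φ t c) (l : Fin (k + 1)) : c l < 0 ↔ φ (Pi.single l 1) < t := by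
  have := (h _ (single_mem_stdSimplex ℝ l)).2
  rwa [sum_mul_single] at this

/-- The point of the edge from the vertex `i` to the vertex `j` with coordinate `s` at `j`. -/
noncomputable def edgePoint (i j : Fin (k + 1)) (s : ℝ) : Fin (k + 1) → ℝ :=
  (1 - s) • Pi.single i 1 + s • Pi.single j 1

theorem continuous_edgePoint (i j : Fin (k + 1)) : Continuous (edgePoint i j) := by
  unfold edgePoint; fun_prop

theorem edgePoint_zero (i j : Fin (k + 1)) : edgePoint i j 0 = Pi.single i 1 := by
  simp [edgePoint]

theorem edgePoint_one (i j : Fin (k + 1)) : edgePoint i j 1 = Pi.single j 1 := by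
  simp [edgePoint]

theorem edgePoint_mem_segment (i j : Fin (k + 1)) {s : ℝ} (hs : s ∈ Icc (0 : ℝ) 1) :
    edgePoint i j s ∈ segment ℝ (Pi.single i 1 : Fin (k + 1) → ℝ) (Pi.single j 1) :=
  ⟨1 - s, s, by linarith [hs.2], hs.1, by ring, rfl⟩

theorem edgePoint_mem_stdSimplex (i j : Fin (k + 1)) {s : ℝ} (hs : s ∈ Icc (0 : ℝ) 1) :
    edgePoint i j s ∈ stdSimplex ℝ (Fin (k + 1)) :=
  (convex_stdSimplex ℝ _).segment_subset (single_mem_stdSimplex ℝ i) (single_mem_stdSimplex ℝ j)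
    (edgePoint_mem_segment i j hs)

theorem sum_mul_edgePoint (c : Fin (k + 1) → ℝ) (i j : Fin (k + 1)) (s : ℝ) :
    ∑ l, c l * edgePoint i j s l = (1 - s) * c i + s * c j := by
  simp [edgePoint, mul_add, Finset.sum_add_distrib, Pi.single_apply]
  ring

theorem edgePoint_injective {i j : Fin (k + 1)} (hij : i ≠ j) :
    Function.Injective (edgePoint i j) := by
  intro s t h
  have := congr_fun h j
  simpa [edgePoint, hij.symm] using this

theorem edgePoint_mem_oneSkeleton (i j : Fin (k + 1)) {s : ℝ} (hs : s ∈ Icc (0 : ℝ) 1) :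
    edgePoint i j s ∈ oneSkeleton k := by
  refine ⟨edgePoint_mem_stdSimplex i j hs, ?_⟩
  have hsub : Function.support (edgePoint i j s) ⊆ {i, j} := by
    intro l hl
    by_contra hc
    simp only [mem_insert_iff, mem_singleton_iff, not_or] at hc
    simp [edgePoint, hc.1, hc.2] at hl
  exact (ncard_le_ncard hsub (toFinite _)).trans ((ncard_insert_le _ _).trans (by simp))

theorem exists_edgePoint {y : Fin (k + 1) → ℝ} (hy : y ∈ oneSkeleton k) :
    ∃ i j, ∃ s ∈ Icc (0 : ℝ) 1, y = edgePoint i j s := by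
  obtain ⟨⟨h0, h1⟩, h2⟩ := hy
  have hne : (Function.support y).Nonempty := by
    by_contra hc
    rw [not_nonempty_iff_eq_empty, Function.support_eq_empty_iff] at hc
    simp [hc] at h1
  obtain ⟨i, hi⟩ := hne
  have hex : ∃ j, Function.support y ⊆ {i, j} := by
    by_cases hs : ∃ j ∈ Function.support y, j ≠ i
    · obtain ⟨j, hj, hji⟩ := hs
      have h3 : ({i, j} : Set (Fin (k + 1))) ⊆ Function.support y := by
        rintro l (rfl | rfl) <;> assumption
      refine ⟨j, (eq_of_subset_of_ncard_le h3 ?_ (toFinite _)).ge⟩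
      rwa [ncard_pair hji.symm]
    · push Not at hs
      exact ⟨i, fun l hl => by simp [hs l hl]⟩
  obtain ⟨j, hj⟩ := hex
  have hz : ∀ l, l ≠ i → l ≠ j → y l = 0 := fun l hli hlj => by
    by_contra hc
    rcases hj hc with rfl | h
    · exact hli rfl
    · exact hlj h
  rcases eq_or_ne i j with rfl | hij
  · refine ⟨i, i, 0, by simp, ?_⟩
    have hyi : y i = 1 := by
      rw [← h1, Finset.sum_eq_single i (fun l _ hl => hz l hl hl) (by simp)]
    funext l
    rcases eq_or_ne l i with rfl | hl
    · simp [edgePoint, hyi]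
    · simp [edgePoint, hl, hz l hl hl]
  · have hsum : y i + y j = 1 := by
      rw [← h1, ← Finset.sum_subset (Finset.subset_univ {i, j}) (fun l _ hl => by
        simp only [Finset.mem_insert, Finset.mem_singleton, not_or] at hl
        exact hz l hl.1 hl.2), Finset.sum_pair hij]
    refine ⟨i, j, y j, ⟨h0 j, by linarith [h0 i]⟩, ?_⟩
    funext l
    rcases eq_or_ne l i with rfl | hl
    · simp [edgePoint, hij]; linarith
    · rcases eq_or_ne l j with rfl | hl'
      · simp [edgePoint, hl]
      · simp [edgePoint, hl, hl', hz l hl hl']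

variable {φ : (Fin (k + 1) → ℝ) → ℝ}

theorem continuousOn_edge (hc : ContinuousOn φ (stdSimplex ℝ (Fin (k + 1)))) (i j : Fin (k + 1)) :
    ContinuousOn (fun s => φ (edgePoint i j s)) (Icc 0 1) :=
  hc.comp (continuous_edgePoint i j).continuousOn fun _ hs => edgePoint_mem_stdSimplex i j hs

theorem strictMonoOn_edge (hc : ContinuousOn φ (stdSimplex ℝ (Fin (k + 1))))
    (hinj : ∀ i j, i ≠ j → InjOn φ (segment ℝ (Pi.single i 1) (Pi.single j 1)))
    {i j : Fin (k + 1)} (hij : φ (Pi.single i 1) < φ (Pi.single j 1)) :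
    StrictMonoOn (fun s => φ (edgePoint i j s)) (Icc 0 1) := by
  have hne : i ≠ j := by rintro rfl; exact lt_irrefl _ hij
  refine ContinuousOn.strictMonoOn_of_injOn_Icc zero_le_one ?_ (continuousOn_edge hc i j) ?_
  · simp only [edgePoint_zero, edgePoint_one]; exact hij.le
  · intro s hs t ht hst
    exact edgePoint_injective hne (hinj i j hne (edgePoint_mem_segment i j hs)
      (edgePoint_mem_segment i j ht) hst)

/-- A linear form with the right zeros on the edges is a level form. -/
theorem isLevelForm_of_edges (hc : ContinuousOn φ (stdSimplex ℝ (Fin (k + 1))))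
    (hinj : ∀ i j, i ≠ j → InjOn φ (segment ℝ (Pi.single i 1) (Pi.single j 1)))
    {t : ℝ} (hlev : {y | y ∈ stdSimplex ℝ (Fin (k + 1)) ∧ φ y = t} =
      convexHull ℝ {y | y ∈ oneSkeleton k ∧ φ y = t})
    {c : Fin (k + 1) → ℝ} (hpos : ∀ l, 0 < c l ↔ t < φ (Pi.single l 1))
    (hneg : ∀ l, c l < 0 ↔ φ (Pi.single l 1) < t)
    (hedge : ∀ i j, φ (Pi.single i 1) < t → t < φ (Pi.single j 1) → ∀ s ∈ Icc (0 : ℝ) 1,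
      φ (edgePoint i j s) = t → (1 - s) * c i + s * c j = 0) :
    IsLevelForm φ t c := by
  have key : ∀ i j, φ (Pi.single i 1) < φ (Pi.single j 1) → ∀ s ∈ Icc (0 : ℝ) 1,
      ((1 - s) * c i + s * c j = 0 ↔ φ (edgePoint i j s) = t) := by
    intro i j hij s hs
    have hmono := strictMonoOn_edge hc hinj hij
    have h0 : (0 : ℝ) ∈ Icc (0 : ℝ) 1 := by simp
    have h1 : (1 : ℝ) ∈ Icc (0 : ℝ) 1 := by simp
    by_cases hit : φ (Pi.single i 1) < t
    · have hi := (hneg i).2 hit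
      by_cases htj : t < φ (Pi.single j 1)
      · refine ⟨fun h => ?_, hedge i j hit htj s hs⟩
        have hj := (hpos j).2 htj
        obtain ⟨r, hr, hrt⟩ := intermediate_value_Icc zero_le_one (continuousOn_edge hc i j)
          (show t ∈ Icc _ _ by simp only [edgePoint_zero, edgePoint_one]; exact ⟨hit.le, htj.le⟩)
        have hr' := hedge i j hit htj r hr hrt
        have : (s - r) * (c j - c i) = 0 := by linarith
        have hsr : s = r := by
          rcases mul_eq_zero.1 this with h | h <;> linarith
        rw [hsr]; exact hrt
      · have hj : c j ≤ 0 := not_lt.1 fun h => htj ((hpos j).1 h)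
        rcases hs.2.lt_or_eq with hs1 | rfl
        · have e1 : φ (edgePoint i j s) < t := by
            have := hmono hs h1 hs1
            simp only [edgePoint_one] at this
            exact this.trans_le (not_lt.1 htj)
          have e2 : (1 - s) * c i < 0 := mul_neg_of_pos_of_neg (by linarith) hi
          have e3 : s * c j ≤ 0 := mul_nonpos_of_nonneg_of_nonpos hs.1 hj
          constructor <;> intro h <;> linarith
        · rw [edgePoint_one, sub_self, zero_mul, zero_add, one_mul]
          constructor
          · intro h
            exact le_antisymm (not_lt.1 htj) (not_lt.1 fun h' => by
              linarith [(hneg j).2 h'])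
          · intro h
            exact le_antisymm hj (not_lt.1 fun h' => by linarith [(hneg j).1 h'])
    · have hj : 0 < c j := (hpos j).2 ((not_lt.1 hit).trans_lt hij)
      have hi : 0 ≤ c i := not_lt.1 fun h => hit ((hneg i).1 h)
      rcases hs.1.lt_or_eq with hs1 | rfl
      · have e1 : t < φ (edgePoint i j s) := by
          have := hmono h0 hs hs1
          simp only [edgePoint_zero] at this
          exact (not_lt.1 hit).trans_lt this
        have e2 : 0 < s * c j := mul_pos hs1 hj
        have e3 : 0 ≤ (1 - s) * c i := mul_nonneg (by linarith [hs.2]) hi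
        constructor <;> intro h <;> linarith
      · rw [edgePoint_zero, sub_zero, one_mul, zero_mul, add_zero]
        constructor
        · intro h
          exact le_antisymm (not_lt.1 fun h' => by linarith [(hpos i).2 h']) (not_lt.1 hit)
        · intro h
          exact le_antisymm (not_lt.1 fun h' => by linarith [(hpos i).1 h']) hi
  have skel : ∀ y ∈ oneSkeleton k, (∑ l, c l * y l = 0 ↔ φ y = t) := by
    intro y hy
    obtain ⟨i, j, s, hs, rfl⟩ := exists_edgePoint hy
    rw [sum_mul_edgePoint]
    rcases lt_trichotomy (φ (Pi.single i 1)) (φ (Pi.single j 1)) with h | h | h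
    · exact key i j h s hs
    · have hij : i = j := by
        by_contra hij
        have := hinj i j hij (left_mem_segment ℝ _ _) (right_mem_segment ℝ _ _) h
        have := congr_fun this i
        simp [hij] at this
      subst hij
      have e : edgePoint i i s = Pi.single i 1 := by
        rw [edgePoint, ← add_smul]; simp
      rw [e, ← add_mul, sub_add_cancel, one_mul]
      constructor
      · intro h
        exact le_antisymm (not_lt.1 fun h' => by linarith [(hpos i).2 h'])
          (not_lt.1 fun h' => by linarith [(hneg i).2 h'])
      · intro h
        exact le_antisymm (not_lt.1 fun h' => by linarith [(hpos i).1 h'])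
          (not_lt.1 fun h' => by linarith [(hneg i).1 h'])
    · have e : edgePoint i j s = edgePoint j i (1 - s) := by
        simp only [edgePoint, sub_sub_cancel]
        exact add_comm _ _
      have := key j i h (1 - s) ⟨by linarith [hs.2], by linarith [hs.1]⟩
      rw [← e, sub_sub_cancel, add_comm] at this
      exact this
  -- The hyperplane section and the level are convex hulls of the same points of the 1-skeleton.
  have hzero : ∀ y ∈ stdSimplex ℝ (Fin (k + 1)), (∑ l, c l * y l = 0 ↔ φ y = t) := by
    have h1 : {y | y ∈ oneSkeleton k ∧ ∑ i, c i * y i = 0} = {y | y ∈ oneSkeleton k ∧ φ y = t} := by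
      ext y
      exact and_congr_right (skel y)
    have h2 := hyperplaneSection_eq_convexHull c
    rw [h1, ← hlev] at h2
    intro y hy
    have := Set.ext_iff.1 h2 y
    simpa [hy] using this
  -- Each open side of the hyperplane is convex, hence connected, and misses the level. So `φ` stays
  -- on one side of `t` there, and a vertex on that side tells which.
  have conv : ∀ P : ℝ → Prop, Convex ℝ {z : ℝ | P z} →
      IsPreconnected {y | y ∈ stdSimplex ℝ (Fin (k + 1)) ∧ P (∑ i, c i * y i)} := by
    intro P hP
    refine Convex.isPreconnected fun x hx y hy a b ha hb hab =>
      ⟨convex_stdSimplex ℝ _ hx.1 hy.1 ha hb hab, ?_⟩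
    have : ∑ i, c i * (a • x + b • y) i = a • ∑ i, c i * x i + b • ∑ i, c i * y i := by
      rw [smul_eq_mul, smul_eq_mul, Finset.mul_sum, Finset.mul_sum, ← Finset.sum_add_distrib]
      refine Finset.sum_congr rfl fun i _ => ?_
      simp only [Pi.add_apply, Pi.smul_apply, smul_eq_mul]
      ring
    rw [this]
    exact hP hx.2 hy.2 ha hb hab
  have hgt : ∀ y ∈ stdSimplex ℝ (Fin (k + 1)), 0 < ∑ i, c i * y i → t < φ y := by
    intro y hy hcy
    by_contra! hyt
    obtain ⟨l, -, hl⟩ := Finset.exists_lt_of_sum_lt (f := fun _ => (0 : ℝ)) (by simpa using hcy)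
    have hcl : 0 < c l := pos_of_mul_pos_left hl (hy.1 l)
    have hlm := single_mem_stdSimplex ℝ l
    obtain ⟨z, ⟨hz, hz'⟩, hzt⟩ := (conv (fun z => 0 < z) (convex_Ioi 0)).intermediate_value
      (a := y) (b := Pi.single l 1) ⟨hy, hcy⟩ ⟨hlm, by rw [sum_mul_single]; exact hcl⟩
      (hc.mono fun z hz => hz.1) ⟨hyt, ((hpos l).1 hcl).le⟩
    exact hz'.ne' ((hzero z hz).2 hzt)
  have hlt : ∀ y ∈ stdSimplex ℝ (Fin (k + 1)), ∑ i, c i * y i < 0 → φ y < t := by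
    intro y hy hcy
    by_contra! hyt
    obtain ⟨l, -, hl⟩ := Finset.exists_lt_of_sum_lt (g := fun _ => (0 : ℝ)) (by simpa using hcy)
    have hcl : c l < 0 := by
      by_contra! h
      exact (mul_nonneg h (hy.1 l)).not_gt hl
    have hlm := single_mem_stdSimplex ℝ l
    obtain ⟨z, ⟨hz, hz'⟩, hzt⟩ := (conv (fun z => z < 0) (convex_Iio 0)).intermediate_value
      (a := Pi.single l 1) (b := y) ⟨hlm, by rw [sum_mul_single]; exact hcl⟩ ⟨hy, hcy⟩
      (hc.mono fun z hz => hz.1) ⟨((hneg l).1 hcl).le, hyt⟩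
    exact hz'.ne ((hzero z hz).2 hzt)
  intro y hy
  refine ⟨⟨hgt y hy, fun h => ?_⟩, hlt y hy, fun h => ?_⟩
  · rcases lt_trichotomy (∑ i, c i * y i) 0 with h' | h' | h'
    · exact absurd (hlt y hy h') h.not_gt
    · exact absurd ((hzero y hy).1 h') h.ne'
    · exact h'
  · rcases lt_trichotomy (∑ i, c i * y i) 0 with h' | h' | h'
    · exact h'
    · exact absurd ((hzero y hy).1 h') h.ne
    · exact absurd (hgt y hy h') h.not_gt

end LevelForm

section LevelForm

variable {k : ℕ} {φ : (Fin (k + 1) → ℝ) → ℝ}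

/-- The point of level `r` on an edge depends continuously on `r` from the left. -/
theorem eventually_exists_edgePoint (hc : ContinuousOn φ (stdSimplex ℝ (Fin (k + 1))))
    (hinj : ∀ i j, i ≠ j → InjOn φ (segment ℝ (Pi.single i 1) (Pi.single j 1)))
    {i j : Fin (k + 1)} {t s : ℝ} (hit : φ (Pi.single i 1) < t) (htj : t ≤ φ (Pi.single j 1))
    (hs : s ∈ Icc (0 : ℝ) 1) (hst : φ (edgePoint i j s) = t) {U : Set (Fin (k + 1) → ℝ)}
    (hU : U ∈ 𝓝 (edgePoint i j s)) :
    ∀ᶠ r in 𝓝[<] t, ∃ z ∈ stdSimplex ℝ (Fin (k + 1)), z ∈ U ∧ z ∈ oneSkeleton k ∧ φ z = r := by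
  have hmono := strictMonoOn_edge hc hinj (hit.trans_le htj)
  have hs0 : 0 < s := by
    rcases hs.1.lt_or_eq with h | rfl
    · exact h
    · rw [edgePoint_zero] at hst; exact absurd hst hit.ne
  have hU' : (edgePoint i j) ⁻¹' U ∈ 𝓝 s := (continuous_edgePoint i j).continuousAt hU
  obtain ⟨r₀, hr₀, h2⟩ := exists_Ioc_subset_of_mem_nhds hU' ⟨s - 1, sub_one_lt s⟩
  have hr₁ : max ((r₀ + s) / 2) (s / 2) < s := max_lt (by linarith) (by linarith)
  have hr₁' : max ((r₀ + s) / 2) (s / 2) ∈ Icc (0 : ℝ) 1 := ⟨le_max_of_le_right (by linarith), hr₁.le.trans hs.2⟩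
  have hlt := hmono hr₁' hs hr₁
  simp only [hst] at hlt
  filter_upwards [Ioo_mem_nhdsLT hlt] with r hr
  obtain ⟨z, hz, hzr⟩ := intermediate_value_Icc hr₁.le
    ((continuousOn_edge hc i j).mono (Icc_subset_Icc hr₁'.1 hs.2))
    (show r ∈ Icc _ _ from ⟨hr.1.le, by simp only [hst]; exact hr.2.le⟩)
  have hz' : z ∈ Icc (0 : ℝ) 1 := Icc_subset_Icc hr₁'.1 hs.2 hz
  exact ⟨_, edgePoint_mem_stdSimplex i j hz', h2 ⟨lt_of_lt_of_le (by linarith) ((le_max_left _ _).trans hz.1), hz.2⟩,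
    edgePoint_mem_oneSkeleton i j hz', hzr⟩

/-- The edge points of a level do not span: otherwise the level would have interior points, and
would meet the levels nearby. -/
theorem span_edgePoints_ne_top (hc : ContinuousOn φ (stdSimplex ℝ (Fin (k + 1))))
    (hinj : ∀ i j, i ≠ j → InjOn φ (segment ℝ (Pi.single i 1) (Pi.single j 1)))
    (hlev : ∀ t, {y | y ∈ stdSimplex ℝ (Fin (k + 1)) ∧ φ y = t} =
      convexHull ℝ {y | y ∈ oneSkeleton k ∧ φ y = t}) {t : ℝ}
    (s : {p : Fin (k + 1) × Fin (k + 1) // φ (Pi.single p.1 1) < t ∧ t ≤ φ (Pi.single p.2 1)} → ℝ)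
    (hs : ∀ p, s p ∈ Icc (0 : ℝ) 1) (hst : ∀ p, φ (edgePoint p.1.1 p.1.2 (s p)) = t) :
    Submodule.span ℝ (range fun p => edgePoint p.1.1 p.1.2 (s p)) ≠ ⊤ := by
  classical
  intro htop
  let ι := {p : Fin (k + 1) × Fin (k + 1) // φ (Pi.single p.1 1) < t ∧ t ≤ φ (Pi.single p.2 1)}
  let q : ι → Fin (k + 1) → ℝ := fun p => edgePoint p.1.1 p.1.2 (s p)
  have hq : ∀ p, q p ∈ stdSimplex ℝ (Fin (k + 1)) := fun p => edgePoint_mem_stdSimplex _ _ (hs p)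
  -- If the edge points span, `Λ` is an open map, and their strictly positive combinations form an
  -- open set.
  let Λ : (ι → ℝ) →ₗ[ℝ] (Fin (k + 1) → ℝ) := Fintype.linearCombination ℝ q
  have hΛ : Function.Surjective Λ := by
    rw [← LinearMap.range_eq_top, Fintype.range_linearCombination]; exact htop
  have hO : IsOpen (Λ '' {w | ∀ p, 0 < w p}) := by
    refine LinearMap.isOpenMap_of_finiteDimensional Λ hΛ _ ?_
    have : {w : ι → ℝ | ∀ p, 0 < w p} = ⋂ p, {w | 0 < w p} := by ext; simp
    rw [this]
    exact isOpen_iInter_of_finite fun p => isOpen_lt continuous_const (continuous_apply p)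
  have hmem : ∑ p, q p ∈ Λ '' {w | ∀ p, 0 < w p} :=
    ⟨fun _ => 1, fun _ => one_pos, by simp [Λ, Fintype.linearCombination_apply]⟩
  have hcont : Continuous fun z : ι → Fin (k + 1) → ℝ => ∑ p, z p := by fun_prop
  have hnh := hcont.continuousAt.preimage_mem_nhds (hO.mem_nhds hmem)
  rw [nhds_pi, Filter.mem_pi] at hnh
  obtain ⟨I, -, V, hV, hVsub⟩ := hnh
  -- Edge points of a slightly lower level `r` are close to those of level `t`, so their sum is
  -- still a positive combination of the latter.
  have hev : ∀ᶠ r in 𝓝[<] t, ∀ p : ι, ∃ z ∈ stdSimplex ℝ (Fin (k + 1)),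
      z ∈ V p ∧ z ∈ oneSkeleton k ∧ φ z = r :=
    Filter.eventually_all.2 fun p =>
      eventually_exists_edgePoint hc hinj p.2.1 p.2.2 (hs p) (hst p) (hV p)
  obtain ⟨r, hr, hrt⟩ := (hev.and self_mem_nhdsWithin).exists
  choose z hzΔ hzV hz1 hzr using hr
  obtain ⟨w, hw, hwz⟩ := hVsub (show z ∈ I.pi V from fun p _ => hzV p)
  simp only [Λ, Fintype.linearCombination_apply] at hwz
  have hne : Nonempty ι := by
    by_contra hcon
    rw [not_nonempty_iff] at hcon
    rw [range_eq_empty, Submodule.span_empty] at htop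
    have h1 : (Pi.single 0 1 : Fin (k + 1) → ℝ) ∈ (⊥ : Submodule ℝ (Fin (k + 1) → ℝ)) := by
      rw [htop]; trivial
    have := congr_fun ((Submodule.mem_bot ℝ).1 h1) 0
    simp at this
  set N : ℝ := (Fintype.card ι : ℝ)
  have hN : 0 < N := by simp only [N]; exact_mod_cast Fintype.card_pos
  -- The average of the points of level `r` lies in level `r`. Comparing coordinate sums shows that
  -- it is also a convex combination of points of level `t`, hence lies in level `t`.
  have hz' : N⁻¹ • ∑ p, z p ∈ {y | y ∈ stdSimplex ℝ (Fin (k + 1)) ∧ φ y = r} := by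
    rw [hlev r, Finset.smul_sum]
    refine (convex_convexHull ℝ _).sum_mem (fun _ _ => by positivity) ?_
      fun p _ => subset_convexHull ℝ _ ⟨hz1 p, hzr p⟩
    simp only [Finset.sum_const, Finset.card_univ, nsmul_eq_mul]
    exact mul_inv_cancel₀ hN.ne'
  have hwN : ∑ p, w p = N := by
    have e := congr_arg (fun y : Fin (k + 1) → ℝ => ∑ l, y l) hwz
    simp only [Finset.sum_apply, Pi.smul_apply, smul_eq_mul] at e
    rw [Finset.sum_comm] at e
    conv_rhs at e => rw [Finset.sum_comm]
    simp_rw [← Finset.mul_sum, (hq _).2, (hzΔ _).2] at e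
    simpa [N] using e
  have hz'' : N⁻¹ • ∑ p, z p ∈ {y | y ∈ stdSimplex ℝ (Fin (k + 1)) ∧ φ y = t} := by
    rw [hlev t, ← hwz, Finset.smul_sum]
    simp_rw [smul_smul]
    refine (convex_convexHull ℝ _).sum_mem (fun p _ => mul_nonneg (by positivity) (hw p).le) ?_
      fun p _ => subset_convexHull ℝ _ ⟨edgePoint_mem_oneSkeleton _ _ (hs p), hst p⟩
    rw [← Finset.mul_sum, hwN]
    exact inv_mul_cancel₀ hN.ne'
  exact (show r < t from hrt).ne (hz'.2.symm.trans hz''.2)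

/-- If the levels of a function on a simplex are spanned by their points on the edges, they are
hyperplane sections. -/
theorem exists_isLevelForm (hc : ContinuousOn φ (stdSimplex ℝ (Fin (k + 1))))
    (hinj : ∀ i j, i ≠ j → InjOn φ (segment ℝ (Pi.single i 1) (Pi.single j 1)))
    (hlev : ∀ t, {y | y ∈ stdSimplex ℝ (Fin (k + 1)) ∧ φ y = t} =
      convexHull ℝ {y | y ∈ oneSkeleton k ∧ φ y = t}) (t : ℝ) :
    ∃ c, IsLevelForm φ t c := by
  classical
  by_cases hLU : (∃ i, φ (Pi.single i 1) < t) ∧ ∃ j, t < φ (Pi.single j 1)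
  · obtain ⟨⟨i₀, hi₀⟩, j₀, hj₀⟩ := hLU
    have hex : ∀ p : {p : Fin (k + 1) × Fin (k + 1) //
        φ (Pi.single p.1 1) < t ∧ t ≤ φ (Pi.single p.2 1)},
        ∃ s ∈ Icc (0 : ℝ) 1, φ (edgePoint p.1.1 p.1.2 s) = t := fun p => by
      have := intermediate_value_Icc zero_le_one (continuousOn_edge hc p.1.1 p.1.2)
        (show t ∈ Icc _ _ by simp only [edgePoint_zero, edgePoint_one]; exact ⟨p.2.1.le, p.2.2⟩)
      exact this
    choose s hs hst using hex
    have hspan := span_edgePoints_ne_top hc hinj hlev s hs hst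
    -- A nonzero functional vanishing on all edge points of the level; only its sign is left to be
    -- fixed.
    obtain ⟨f, hf0, hf⟩ := Submodule.exists_le_ker_of_lt_top _ (lt_top_iff_ne_top.2 hspan)
    have hfsum : ∀ y, f y = ∑ l, f (Pi.single l 1) * y l := fun y => by
      rw [LinearMap.pi_apply_eq_sum_univ f y]
      refine Finset.sum_congr rfl fun l _ => ?_
      rw [smul_eq_mul, mul_comm]
      congr 2
      funext m
      simp [Pi.single_apply, eq_comm]
    have hfs : ∀ i j, φ (Pi.single i 1) < t → t ≤ φ (Pi.single j 1) → ∀ r ∈ Icc (0 : ℝ) 1,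
        φ (edgePoint i j r) = t → (1 - r) * f (Pi.single i 1) + r * f (Pi.single j 1) = 0 := by
      intro i j hi hj r hr hrt
      have hrs : r = s ⟨(i, j), hi, hj⟩ := (strictMonoOn_edge hc hinj (hi.trans_le hj)).injOn hr
        (hs _) (hrt.trans (hst ⟨(i, j), hi, hj⟩).symm)
      have := hf (Submodule.subset_span ⟨⟨(i, j), hi, hj⟩, rfl⟩)
      rw [LinearMap.mem_ker, hfsum, sum_mul_edgePoint] at this
      rw [hrs]; exact this
    have hzero : ∀ e, φ (Pi.single e 1) = t → f (Pi.single e 1) = 0 := fun e he => by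
      simpa using hfs i₀ e hi₀ he.ge 1 (by simp) (by rw [edgePoint_one, he])
    have hopp : ∀ i j, φ (Pi.single i 1) < t → t < φ (Pi.single j 1) →
        ∃ r ∈ Ioo (0 : ℝ) 1, (1 - r) * f (Pi.single i 1) + r * f (Pi.single j 1) = 0 := by
      intro i j hi hj
      have h1 := hs ⟨(i, j), hi, hj.le⟩
      have h2 := hst ⟨(i, j), hi, hj.le⟩
      refine ⟨_, ⟨h1.1.lt_of_ne fun h => ?_, h1.2.lt_of_ne fun h => ?_⟩,
        hfs i j hi hj.le _ h1 h2⟩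
      · rw [← h, edgePoint_zero] at h2; exact hi.ne h2
      · rw [h, edgePoint_one] at h2; exact hj.ne' h2
    -- Across each edge that crosses the level the values of `f` at the ends have opposite signs or
    -- both vanish, so a zero at `i₀` would spread to all vertices.
    have hi₀ne : f (Pi.single i₀ 1) ≠ 0 := by
      intro h0
      have hU : ∀ j, t < φ (Pi.single j 1) → f (Pi.single j 1) = 0 := fun j hj => by
        obtain ⟨r, hr, h⟩ := hopp i₀ j hi₀ hj
        rw [h0, mul_zero, zero_add] at h
        exact (mul_eq_zero.1 h).resolve_left hr.1.ne'
      have hL : ∀ i, φ (Pi.single i 1) < t → f (Pi.single i 1) = 0 := fun i hi => by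
        obtain ⟨r, hr, h⟩ := hopp i j₀ hi hj₀
        rw [hU j₀ hj₀, mul_zero, add_zero] at h
        exact (mul_eq_zero.1 h).resolve_left (by linarith [hr.2])
      refine hf0 (LinearMap.ext fun y => ?_)
      rw [hfsum]
      refine Finset.sum_eq_zero fun l _ => ?_
      rcases lt_trichotomy (φ (Pi.single l 1)) t with h | h | h
      · simp [hL l h]
      · simp [hzero l h]
      · simp [hU l h]
    obtain ⟨ε, hε0, hε⟩ : ∃ ε : ℝ, ε ≠ 0 ∧ ε * f (Pi.single i₀ 1) < 0 := by
      rcases lt_or_gt_of_ne hi₀ne with h | h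
      · exact ⟨1, one_ne_zero, by linarith⟩
      · exact ⟨-1, by norm_num, by linarith⟩
    have hopp' : ∀ i j, φ (Pi.single i 1) < t → t < φ (Pi.single j 1) →
        ∃ r ∈ Ioo (0 : ℝ) 1,
          (1 - r) * (ε * f (Pi.single i 1)) + r * (ε * f (Pi.single j 1)) = 0 := by
      intro i j hi hj
      obtain ⟨r, hr, h⟩ := hopp i j hi hj
      exact ⟨r, hr, by linear_combination ε * h⟩
    have hU : ∀ j, t < φ (Pi.single j 1) → 0 < ε * f (Pi.single j 1) := fun j hj => by
      obtain ⟨r, hr, h⟩ := hopp' i₀ j hi₀ hj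
      have h1 := mul_neg_of_pos_of_neg (sub_pos.2 hr.2) hε
      exact pos_of_mul_pos_right (a := r) (by linarith) hr.1.le
    have hL : ∀ i, φ (Pi.single i 1) < t → ε * f (Pi.single i 1) < 0 := fun i hi => by
      obtain ⟨r, hr, h⟩ := hopp' i j₀ hi hj₀
      have h1 := mul_pos hr.1 (hU j₀ hj₀)
      by_contra! hcon
      have := mul_nonneg (sub_pos.2 hr.2).le hcon
      linarith
    refine ⟨fun l => ε * f (Pi.single l 1), isLevelForm_of_edges hc hinj (hlev t) (fun l => ?_)
      (fun l => ?_) fun i j hi hj r hr hrt => ?_⟩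
    · refine ⟨fun h => ?_, hU l⟩
      by_contra! hcon
      rcases hcon.lt_or_eq with h' | h'
      · exact (hL l h').not_gt h
      · simp [hzero l h'] at h
    · refine ⟨fun h => ?_, hL l⟩
      by_contra! hcon
      rcases hcon.lt_or_eq with h' | h'
      · exact (hU l h').not_gt h
      · simp [hzero l h'.symm] at h
    · linear_combination ε * hfs i j hi hj.le r hr hrt
  -- With no vertices strictly below or none strictly above the level, no edge condition remains and
  -- the signs suffice.
  · refine ⟨fun l => if φ (Pi.single l 1) < t then -1 else if t < φ (Pi.single l 1) then 1 else 0,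
      isLevelForm_of_edges hc hinj (hlev t) (fun l => ?_) (fun l => ?_)
      fun i j hi hj => absurd ⟨⟨i, hi⟩, j, hj⟩ hLU⟩
    · split_ifs with h1 h2
      · exact iff_of_false (by norm_num) h1.not_gt
      · exact iff_of_true one_pos h2
      · exact iff_of_false (lt_irrefl _) h2
    · split_ifs with h1 h2
      · exact iff_of_true (by norm_num) h1
      · exact iff_of_false (by norm_num) h1
      · exact iff_of_false (lt_irrefl _) h1

end LevelForm

/-! ### The projective flow on a simplex with ordered vertices. -/

section Flow

variable {G : Type*} [LinearOrder G] {ι : Type*} [Fintype ι]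

/-- The cumulative distribution function of the weights `y` at the labels `lab`. -/
noncomputable def cumulative (lab : ι → G) (y : ι → ℝ) (h : G) : ℝ :=
  ∑ j, if lab j ≤ h then y j else 0

/-- The left limits of the cumulative distribution function. -/
noncomputable def cumulativeLT (lab : ι → G) (y : ι → ℝ) (h : G) : ℝ :=
  ∑ j, if lab j < h then y j else 0

variable {lab : ι → G}

theorem continuous_cumulative (lab : ι → G) (h : G) :
    Continuous fun y : ι → ℝ => cumulative lab y h := by
  unfold cumulative
  refine continuous_finsetSum _ fun j _ => ?_
  split_ifs
  · exact continuous_apply j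
  · exact continuous_const

theorem cumulative_nonneg {y : ι → ℝ} (hy : y ∈ stdSimplex ℝ ι) (h : G) :
    0 ≤ cumulative lab y h :=
  Finset.sum_nonneg fun j _ => by split_ifs; exacts [hy.1 j, le_rfl]

theorem cumulative_le_one {y : ι → ℝ} (hy : y ∈ stdSimplex ℝ ι) (h : G) :
    cumulative lab y h ≤ 1 := by
  rw [← hy.2]
  exact Finset.sum_le_sum fun j _ => by split_ifs; exacts [le_rfl, hy.1 j]

theorem cumulativeLT_nonneg {y : ι → ℝ} (hy : y ∈ stdSimplex ℝ ι) (h : G) :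
    0 ≤ cumulativeLT lab y h :=
  Finset.sum_nonneg fun j _ => by split_ifs; exacts [hy.1 j, le_rfl]

theorem cumulativeLT_le_one {y : ι → ℝ} (hy : y ∈ stdSimplex ℝ ι) (h : G) :
    cumulativeLT lab y h ≤ 1 := by
  rw [← hy.2]
  exact Finset.sum_le_sum fun j _ => by split_ifs; exacts [le_rfl, hy.1 j]

theorem cumulative_eq_add (hlab : Function.Injective lab) (y : ι → ℝ) (i : ι) :
    cumulative lab y (lab i) = cumulativeLT lab y (lab i) + y i := by
  classical
  have : y i = ∑ j, if j = i then y j else 0 := by simp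
  rw [this, cumulative, cumulativeLT, ← Finset.sum_add_distrib]
  refine Finset.sum_congr rfl fun j _ => ?_
  by_cases hji : j = i
  · subst hji; simp
  · have : lab j ≠ lab i := fun h => hji (hlab h)
    simp [hji, le_iff_lt_or_eq, this]

/-- The left limit is the value at the preceding label, if there is one. Thus statements about the
distribution function transfer to its left limits. -/
theorem cumulativeLT_eq (lab : ι → G) (h : G) :
    (∀ y : ι → ℝ, cumulativeLT lab y h = 0) ∨
      ∃ h', ∀ y : ι → ℝ, cumulativeLT lab y h = cumulative lab y h' := by
  classical
  by_cases hne : ∃ j, lab j < h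
  · right
    obtain ⟨j₀, hj₀⟩ := hne
    obtain ⟨m, hm, hmax⟩ := (Finset.univ.filter fun j => lab j < h).exists_max_image lab
      ⟨j₀, by simpa using hj₀⟩
    simp only [Finset.mem_filter, Finset.mem_univ, true_and] at hm hmax
    refine ⟨lab m, fun y => Finset.sum_congr rfl fun j _ => ?_⟩
    have : lab j < h ↔ lab j ≤ lab m := ⟨hmax j, fun hj => hj.trans_lt hm⟩
    simp [this]
  · left
    push Not at hne
    intro y
    exact Finset.sum_eq_zero fun j _ => by simp [(hne j).not_gt]

theorem eq_of_cumulative_eq (hlab : Function.Injective lab) {y z : ι → ℝ}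
    (h : ∀ g, cumulative lab y g = cumulative lab z g) : y = z := by
  funext i
  have h1 := h (lab i)
  rw [cumulative_eq_add hlab, cumulative_eq_add hlab] at h1
  rcases cumulativeLT_eq lab (lab i) with h2 | ⟨h', h2⟩
  · rw [h2, h2] at h1; linarith
  · rw [h2, h2, h h'] at h1; linarith

theorem cumulative_eq_zero_iff {y : ι → ℝ} (hy : y ∈ stdSimplex ℝ ι) (h : G) :
    cumulative lab y h = 0 ↔ ∀ j, lab j ≤ h → y j = 0 := by
  rw [cumulative, Finset.sum_eq_zero_iff_of_nonneg]
  · simp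
  · intro j _; split_ifs; exacts [hy.1 j, le_rfl]

theorem cumulative_eq_one_iff {y : ι → ℝ} (hy : y ∈ stdSimplex ℝ ι) (h : G) :
    cumulative lab y h = 1 ↔ ∀ j, h < lab j → y j = 0 := by
  have : (1 : ℝ) - cumulative lab y h = ∑ j, if h < lab j then y j else 0 := by
    rw [← hy.2, cumulative, ← Finset.sum_sub_distrib]
    refine Finset.sum_congr rfl fun j _ => ?_
    by_cases hj : lab j ≤ h
    · simp [hj, hj.not_gt]
    · simp [hj, not_le.1 hj]
  rw [eq_comm, ← sub_eq_zero, this, Finset.sum_eq_zero_iff_of_nonneg]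
  · simp
  · intro j _; split_ifs; exacts [hy.1 j, le_rfl]

/-- The odds of the distribution function of `z` are `p / (1 - p)` times those of `y`. -/
def OddsRel (lab : ι → G) (p : ℝ) (y z : ι → ℝ) : Prop :=
  ∀ h, cumulative lab z h * (1 - p) * (1 - cumulative lab y h) =
    p * cumulative lab y h * (1 - cumulative lab z h)

theorem OddsRel.symm {p : ℝ} {y z : ι → ℝ} (h : OddsRel lab p y z) : OddsRel lab (1 - p) z y :=
  fun g => by linear_combination -h g

/-- The odds factors divide: `q / (1 - q)` is the quotient of `p / (1 - p)` by `p' / (1 - p')`.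
Where the distribution function of `y` is `0` or `1`, those of `z` and `z'` take the same value,
which needs a separate argument since nothing can be cancelled. -/
theorem OddsRel.comp {p p' : ℝ} {y z z' : ι → ℝ} (h : OddsRel lab p y z)
    (h' : OddsRel lab p' y z') (hp : p ∈ Ioo (0 : ℝ) 1) (hp' : p' ∈ Ioo (0 : ℝ) 1) :
    ∃ q ∈ Ioo (0 : ℝ) 1, OddsRel lab q z' z := by
  have h1 : 0 < p * (1 - p') := mul_pos hp.1 (by linarith [hp'.2])
  have h2 : 0 < p' * (1 - p) := mul_pos hp'.1 (by linarith [hp.2])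
  have h3 : 0 < p * (1 - p') + p' * (1 - p) := by linarith
  refine ⟨p * (1 - p') / (p * (1 - p') + p' * (1 - p)), ⟨div_pos h1 h3,
    (div_lt_one h3).2 (by linarith)⟩, fun g => ?_⟩
  have key : cumulative lab z g * (p' * (1 - p)) * (1 - cumulative lab z' g) =
      p * (1 - p') * cumulative lab z' g * (1 - cumulative lab z g) := by
    have e := h g
    have e' := h' g
    rcases eq_or_ne (cumulative lab y g) 0 with h0 | h0
    · rw [h0] at e e'
      have a0 : cumulative lab z g = 0 := by
        have : cumulative lab z g * (1 - p) = 0 := by linarith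
        exact (mul_eq_zero.1 this).resolve_right (by linarith [hp.2])
      have b0 : cumulative lab z' g = 0 := by
        have : cumulative lab z' g * (1 - p') = 0 := by linarith
        exact (mul_eq_zero.1 this).resolve_right (by linarith [hp'.2])
      simp [a0, b0]
    · rcases eq_or_ne (cumulative lab y g) 1 with h1 | h1
      · rw [h1] at e e'
        have a0 : 1 - cumulative lab z g = 0 := by
          have : p * (1 - cumulative lab z g) = 0 := by linarith
          exact (mul_eq_zero.1 this).resolve_left hp.1.ne'
        have b0 : 1 - cumulative lab z' g = 0 := by
          have : p' * (1 - cumulative lab z' g) = 0 := by linarith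
          exact (mul_eq_zero.1 this).resolve_left hp'.1.ne'
        rw [a0, b0]; ring
      · have hS : cumulative lab y g * (1 - cumulative lab y g) ≠ 0 :=
          mul_ne_zero h0 (sub_ne_zero.2 h1.symm)
        refine mul_left_cancel₀ hS ?_
        linear_combination (p' * cumulative lab y g * (1 - cumulative lab z' g)) * e -
          (p * cumulative lab y g * (1 - cumulative lab z g)) * e'
  field_simp
  linear_combination key

theorem OddsRel.eq_zero_of_lt {p : ℝ} {y z : ι → ℝ} (h : OddsRel lab p y z)
    (hy : y ∈ stdSimplex ℝ ι) (hz : z ∈ stdSimplex ℝ ι) (hp : p < 1) {g : G}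
    (hg : ∀ j, lab j < g → y j = 0) : ∀ j, lab j < g → z j = 0 := by
  intro j hj
  have h0 : cumulative lab y (lab j) = 0 :=
    (cumulative_eq_zero_iff hy _).2 fun i hi => hg i (hi.trans_lt hj)
  have e := h (lab j)
  rw [h0] at e
  have : cumulative lab z (lab j) * (1 - p) = 0 := by linarith
  exact (cumulative_eq_zero_iff hz _).1 ((mul_eq_zero.1 this).resolve_right (by linarith)) j le_rfl

theorem OddsRel.eq_zero_of_gt {p : ℝ} {y z : ι → ℝ} (h : OddsRel lab p y z)
    (hy : y ∈ stdSimplex ℝ ι) (hz : z ∈ stdSimplex ℝ ι) (hp : 0 < p) {g : G}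
    (hg : ∀ j, g < lab j → y j = 0) : ∀ j, g < lab j → z j = 0 := by
  intro j hj
  have h0 : cumulative lab y g = 1 := (cumulative_eq_one_iff hy _).2 hg
  have e := h g
  rw [h0] at e
  have : p * (1 - cumulative lab z g) = 0 := by linarith
  have h1 := (mul_eq_zero.1 this).resolve_left hp.ne'
  exact (cumulative_eq_one_iff hz _).1 (by linarith) j hj

/-- The value at `S` of a projective transformation of the unit interval. -/
noncomputable def moveCdf (p S : ℝ) : ℝ := if S = 1 then 1 else p * S / (p * S + (1 - p) * (1 - S))

/-- The value at `S = 1` is set apart because the fraction is `0 / 0` for `p = 0`. This keeps the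
total mass equal to `1` at the end of the flow. -/
theorem moveCdf_one (p : ℝ) : moveCdf p 1 = 1 := by simp [moveCdf]

theorem moveCdf_zero (p : ℝ) : moveCdf p 0 = 0 := by simp [moveCdf]

/-- Continuity holds in `p` for fixed `S`, including both ends, but not jointly at `(0, 1)` and `(1,
0)`. For this reason continuity of orbit points in the starting point is later derived by
compactness. -/
theorem continuousOn_moveCdf {S : ℝ} (hS : S ∈ Icc (0 : ℝ) 1) :
    ContinuousOn (fun p => moveCdf p S) (Icc 0 1) := by
  rcases eq_or_ne S 1 with rfl | h1
  · simp only [moveCdf_one]; exact continuousOn_const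
  rcases eq_or_ne S 0 with rfl | h0
  · simp only [moveCdf_zero]; exact continuousOn_const
  simp only [moveCdf, if_neg h1]
  refine ContinuousOn.div (by fun_prop) (by fun_prop) fun p hp => ?_
  have hS0 : 0 < S := hS.1.lt_of_ne' h0
  have hS1 : S < 1 := hS.2.lt_of_ne h1
  rcases hp.1.lt_or_eq with h | rfl
  · have := mul_pos h hS0
    have := mul_nonneg (sub_nonneg.2 hp.2) (sub_nonneg.2 hS.2)
    linarith
  · simp; linarith

theorem moveCdf_mono {p S S' : ℝ} (hp : p ∈ Icc (0 : ℝ) 1) (hS : 0 ≤ S) (hSS' : S ≤ S')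
    (hS' : S' ≤ 1) : moveCdf p S ≤ moveCdf p S' := by
  have hle : ∀ T, 0 ≤ T → T ≤ 1 → moveCdf p T ≤ 1 := by
    intro T h0 h1
    unfold moveCdf
    split_ifs
    · exact le_rfl
    · have e1 := mul_nonneg hp.1 h0
      have e2 := mul_nonneg (sub_nonneg.2 hp.2) (sub_nonneg.2 h1)
      exact div_le_one_of_le₀ (by linarith) (by linarith)
  rcases eq_or_ne S' 1 with rfl | h1
  · rw [moveCdf_one]; exact hle S hS hSS'
  have h1' : S' < 1 := hS'.lt_of_ne h1
  rw [moveCdf, moveCdf, if_neg h1, if_neg (hSS'.trans_lt h1').ne]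
  rcases hp.2.lt_or_eq with hp1 | rfl
  · have e1 := mul_nonneg hp.1 hS
    have e2 := mul_nonneg hp.1 (hS.trans hSS')
    have e3 := mul_pos (sub_pos.2 hp1) (sub_pos.2 h1')
    have e4 := mul_pos (sub_pos.2 hp1) (sub_pos.2 (hSS'.trans_lt h1'))
    rw [div_le_div_iff₀ (by linarith) (by linarith)]
    have := mul_nonneg (mul_nonneg hp.1 (sub_pos.2 hp1).le) (sub_nonneg.2 hSS')
    linarith
  · rcases hS.lt_or_eq with h | rfl
    · have : 0 < S' := h.trans_le hSS'
      simp [h.ne', this.ne']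
    · simp
      exact div_nonneg hSS' hSS'

theorem moveCdf_cross {p S : ℝ} (hp : p ∈ Icc (0 : ℝ) 1) (hS : S ∈ Icc (0 : ℝ) 1) :
    moveCdf p S * (1 - p) * (1 - S) = p * S * (1 - moveCdf p S) := by
  unfold moveCdf
  split_ifs with h1
  · simp [h1]
  · rcases eq_or_ne (p * S + (1 - p) * (1 - S)) 0 with h0 | h0
    · have e1 := mul_nonneg hp.1 hS.1
      have e2 := mul_nonneg (sub_nonneg.2 hp.2) (sub_nonneg.2 hS.2)
      have : p * S = 0 := by linarith
      rw [this]; simp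
    · field_simp
      ring

/-- The projective flow on the simplex. -/
noncomputable def simplexFlow (lab : ι → G) (y : ι → ℝ) (p : ℝ) : ι → ℝ := fun i =>
  moveCdf p (cumulative lab y (lab i)) - moveCdf p (cumulativeLT lab y (lab i))

/-- The coordinates of the flow are increments of the transformed distribution function, so sums
over down-closed sets telescope; the induction removes the vertex of greatest label. -/
theorem sum_simplexFlow (hlab : Function.Injective lab) (y : ι → ℝ) (p : ℝ) (D : Finset ι) :
    (∀ i ∈ D, ∀ j, lab j ≤ lab i → j ∈ D) →
      ∑ i ∈ D, simplexFlow lab y p i = moveCdf p (∑ i ∈ D, y i) := by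
  classical
  induction hn : D.card generalizing D with
  | zero =>
    intro _
    rw [Finset.card_eq_zero] at hn
    simp [hn, moveCdf_zero]
  | succ n ih =>
    intro hD
    obtain ⟨m, hm, hmax⟩ := D.exists_max_image lab (Finset.card_pos.1 (by omega))
    have hDm : ∀ j, j ∈ D ↔ lab j ≤ lab m := fun j => ⟨hmax j, hD m hm j⟩
    have h1 : ∑ i ∈ D, y i = cumulative lab y (lab m) := by
      rw [cumulative, ← Finset.sum_filter]
      refine Finset.sum_congr ?_ fun _ _ => rfl
      ext j; simp [hDm]
    have h2 : ∑ i ∈ D.erase m, y i = cumulativeLT lab y (lab m) := by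
      rw [cumulativeLT, ← Finset.sum_filter]
      refine Finset.sum_congr ?_ fun _ _ => rfl
      ext j
      simp [hDm, lt_iff_le_and_ne, hlab.ne_iff, and_comm]
    have h3 := ih (D.erase m) (by rw [Finset.card_erase_of_mem hm, hn]; rfl) (fun i hi j hj => by
      simp only [Finset.mem_erase] at hi ⊢
      refine ⟨?_, hD i hi.2 j hj⟩
      rintro rfl
      exact hi.1 (hlab (le_antisymm (hmax i hi.2) hj)))
    rw [← Finset.add_sum_erase _ _ hm, h3, h2, h1, simplexFlow]
    ring

theorem cumulative_simplexFlow (hlab : Function.Injective lab) (y : ι → ℝ) (p : ℝ) (h : G) :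
    cumulative lab (simplexFlow lab y p) h = moveCdf p (cumulative lab y h) := by
  classical
  rw [cumulative, ← Finset.sum_filter, sum_simplexFlow hlab, cumulative, ← Finset.sum_filter]
  intro i hi j hj
  simp only [Finset.mem_filter, Finset.mem_univ, true_and] at hi ⊢
  exact hj.trans hi

theorem simplexFlow_mem (hlab : Function.Injective lab) {y : ι → ℝ} (hy : y ∈ stdSimplex ℝ ι)
    {p : ℝ} (hp : p ∈ Icc (0 : ℝ) 1) : simplexFlow lab y p ∈ stdSimplex ℝ ι := by
  refine ⟨fun i => sub_nonneg.2 (moveCdf_mono hp (cumulativeLT_nonneg hy _) ?_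
    (cumulative_le_one hy _)), ?_⟩
  · rw [cumulative_eq_add hlab]; linarith [hy.1 i]
  · rw [sum_simplexFlow hlab y p Finset.univ (by simp), hy.2, moveCdf_one]

theorem simplexFlow_eq_zero (hlab : Function.Injective lab) {y : ι → ℝ} {i : ι} (hi : y i = 0)
    (p : ℝ) : simplexFlow lab y p i = 0 := by
  rw [simplexFlow, cumulative_eq_add hlab, hi, add_zero, sub_self]

theorem oddsRel_simplexFlow (hlab : Function.Injective lab) {y : ι → ℝ}
    (hy : y ∈ stdSimplex ℝ ι) {p : ℝ} (hp : p ∈ Icc (0 : ℝ) 1) :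
    OddsRel lab p y (simplexFlow lab y p) := fun h => by
  rw [cumulative_simplexFlow hlab]
  exact moveCdf_cross hp ⟨cumulative_nonneg hy h, cumulative_le_one hy h⟩

theorem continuousOn_simplexFlow {y : ι → ℝ} (hy : y ∈ stdSimplex ℝ ι) :
    ContinuousOn (simplexFlow lab y) (Icc 0 1) := by
  refine continuousOn_pi.2 fun i => ContinuousOn.sub ?_ ?_
  · exact continuousOn_moveCdf ⟨cumulative_nonneg hy _, cumulative_le_one hy _⟩
  · exact continuousOn_moveCdf ⟨cumulativeLT_nonneg hy _, cumulativeLT_le_one hy _⟩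

end Flow

/-! ### Transverse functions and orbits in one simplex. -/

section Transverse

variable {G : Type*} [LinearOrder G] {k : ℕ}

/-- A function on a simplex whose levels are hyperplane sections, and whose values at the vertices
are ordered as the labels. -/
structure IsTransverse (lab : Fin (k + 1) → G) (φ : (Fin (k + 1) → ℝ) → ℝ) : Prop where
  continuousOn : ContinuousOn φ (stdSimplex ℝ (Fin (k + 1)))
  exists_form : ∀ t, ∃ c, IsLevelForm φ t c
  lt_iff : ∀ i j, φ (Pi.single i 1) < φ (Pi.single j 1) ↔ lab i < lab j

theorem eq_single_of_forall_ne {y : Fin (k + 1) → ℝ} (hy : y ∈ stdSimplex ℝ (Fin (k + 1)))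
    {e : Fin (k + 1)} (h : ∀ j, j ≠ e → y j = 0) : y = Pi.single e 1 := by
  have h1 : y e = 1 := by
    rw [← hy.2, Finset.sum_eq_single e (fun j _ hj => h j hj) (by simp)]
  funext j
  rcases eq_or_ne j e with rfl | hj
  · simp [h1]
  · simp [hj, h j hj]

namespace IsTransverse

variable {lab : Fin (k + 1) → G} {φ : (Fin (k + 1) → ℝ) → ℝ}

theorem le_iff (h : IsTransverse lab φ) (i j : Fin (k + 1)) :
    φ (Pi.single i 1) ≤ φ (Pi.single j 1) ↔ lab i ≤ lab j := by
  rw [← not_lt, h.lt_iff, not_lt]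

/-- The form of the level through the vertex `e` is nonnegative at all vertices with labels at least
`lab e`. -/
theorem le_of_support (h : IsTransverse lab φ) {y : Fin (k + 1) → ℝ}
    (hy : y ∈ stdSimplex ℝ (Fin (k + 1))) {e : Fin (k + 1)} (hs : ∀ j, lab j < lab e → y j = 0) :
    φ (Pi.single e 1) ≤ φ y := by
  obtain ⟨c, hc⟩ := h.exists_form (φ (Pi.single e 1))
  by_contra! hlt
  refine ((hc y hy).2.2 hlt).not_ge (Finset.sum_nonneg fun j _ => ?_)
  rcases lt_or_ge (lab j) (lab e) with hj | hj
  · simp [hs j hj]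
  · refine mul_nonneg (not_lt.1 fun hcj => ?_) (hy.1 j)
    exact ((hc.neg_iff j).1 hcj).not_ge ((h.le_iff e j).2 hj)

theorem ge_of_support (h : IsTransverse lab φ) {y : Fin (k + 1) → ℝ}
    (hy : y ∈ stdSimplex ℝ (Fin (k + 1))) {e : Fin (k + 1)} (hs : ∀ j, lab e < lab j → y j = 0) :
    φ y ≤ φ (Pi.single e 1) := by
  obtain ⟨c, hc⟩ := h.exists_form (φ (Pi.single e 1))
  by_contra! hlt
  refine ((hc y hy).1.2 hlt).not_ge (Finset.sum_nonpos fun j _ => ?_)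
  rcases lt_or_ge (lab e) (lab j) with hj | hj
  · simp [hs j hj]
  · refine mul_nonpos_of_nonpos_of_nonneg (not_lt.1 fun hcj => ?_) (hy.1 j)
    exact ((hc.pos_iff j).1 hcj).not_ge ((h.le_iff j e).2 hj)

theorem eq_single_of_le (hlab : Function.Injective lab) (h : IsTransverse lab φ)
    {y : Fin (k + 1) → ℝ} (hy : y ∈ stdSimplex ℝ (Fin (k + 1))) {e : Fin (k + 1)}
    (hs : ∀ j, lab j < lab e → y j = 0) (hle : φ y ≤ φ (Pi.single e 1)) : y = Pi.single e 1 := by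
  obtain ⟨c, hc⟩ := h.exists_form (φ (Pi.single e 1))
  have hnn : ∀ j ∈ Finset.univ, 0 ≤ c j * y j := by
    intro j _
    rcases lt_or_ge (lab j) (lab e) with hj | hj
    · simp [hs j hj]
    · refine mul_nonneg (not_lt.1 fun hcj => ?_) (hy.1 j)
      exact ((hc.neg_iff j).1 hcj).not_ge ((h.le_iff e j).2 hj)
  have h0 : ∑ j, c j * y j = 0 :=
    le_antisymm (not_lt.1 fun h' => hle.not_gt ((hc y hy).1.1 h')) (Finset.sum_nonneg hnn)
  rw [Finset.sum_eq_zero_iff_of_nonneg hnn] at h0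
  refine eq_single_of_forall_ne hy fun j hj => ?_
  rcases lt_or_gt_of_ne (fun h' => hj (hlab h') : lab j ≠ lab e) with h' | h'
  · exact hs j h'
  · exact (mul_eq_zero.1 (h0 j (Finset.mem_univ j))).resolve_left
      ((hc.pos_iff j).2 ((h.lt_iff e j).2 h')).ne'

theorem eq_single_of_ge (hlab : Function.Injective lab) (h : IsTransverse lab φ)
    {y : Fin (k + 1) → ℝ} (hy : y ∈ stdSimplex ℝ (Fin (k + 1))) {e : Fin (k + 1)}
    (hs : ∀ j, lab e < lab j → y j = 0) (hle : φ (Pi.single e 1) ≤ φ y) : y = Pi.single e 1 := by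
  obtain ⟨c, hc⟩ := h.exists_form (φ (Pi.single e 1))
  have hnn : ∀ j ∈ Finset.univ, c j * y j ≤ 0 := by
    intro j _
    rcases lt_or_ge (lab e) (lab j) with hj | hj
    · simp [hs j hj]
    · refine mul_nonpos_of_nonpos_of_nonneg (not_lt.1 fun hcj => ?_) (hy.1 j)
      exact ((hc.pos_iff j).1 hcj).not_ge ((h.le_iff j e).2 hj)
  have h0 : ∑ j, c j * y j = 0 :=
    le_antisymm (Finset.sum_nonpos hnn) (not_lt.1 fun h' => hle.not_gt ((hc y hy).2.1 h'))
  rw [Finset.sum_eq_zero_iff_of_nonpos hnn] at h0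
  refine eq_single_of_forall_ne hy fun j hj => ?_
  rcases lt_or_gt_of_ne (fun h' => hj (hlab h') : lab j ≠ lab e) with h' | h'
  · exact (mul_eq_zero.1 (h0 j (Finset.mem_univ j))).resolve_left
      ((hc.neg_iff j).2 ((h.lt_iff j e).2 h')).ne
  · exact hs j h'

/-- The function increases along the projective flow. -/
theorem lt_of_oddsRel (hlab : Function.Injective lab) (h : IsTransverse lab φ)
    {y z : Fin (k + 1) → ℝ} (hy : y ∈ stdSimplex ℝ (Fin (k + 1)))
    (hz : z ∈ stdSimplex ℝ (Fin (k + 1))) (hyv : ∀ i, y ≠ Pi.single i 1) {q : ℝ} (hq0 : 0 < q)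
    (hq : q < 1 / 2) (hyz : OddsRel lab q y z) : φ y < φ z := by
  classical
  obtain ⟨c, hc⟩ := h.exists_form (φ y)
  have hcy : ∑ i, c i * y i = 0 := (hc.eq_zero_iff hy).2 rfl
  refine (hc z hz).1.1 ?_
  -- The distribution function `S` of `y` becomes `q * S / D S` for `z`; the denominator decreases
  -- in `S` because `q < 1 / 2`.
  let D : ℝ → ℝ := fun S => (1 - q) - (1 - 2 * q) * S
  have hDpos : ∀ S ≤ 1, 0 < D S := fun S hS => by
    have := mul_le_mul_of_nonneg_left hS (show 0 ≤ 1 - 2 * q by linarith)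
    simp only [D]; linarith
  have hDanti : ∀ S S', S ≤ S' → D S' ≤ D S := fun S S' hS => by
    have := mul_le_mul_of_nonneg_left hS (show 0 ≤ 1 - 2 * q by linarith)
    simp only [D]; linarith
  have hcum : ∀ g, cumulative lab z g = q * cumulative lab y g / D (cumulative lab y g) := by
    intro g
    rw [eq_div_iff (hDpos _ (cumulative_le_one (lab := lab) hy g)).ne']
    simp only [D]
    linear_combination hyz g
  have hcumLT : ∀ g, cumulativeLT lab z g = q * cumulativeLT lab y g / D (cumulativeLT lab y g) := by
    intro g
    rcases cumulativeLT_eq lab g with h0 | ⟨g', h'⟩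
    · simp [h0]
    · rw [h', h', hcum]
  -- The increment of the projective transformation, with determinant `q * (1 - q)`, over the jump
  -- of size `y i`.
  have hzi : ∀ i, z i = q * (1 - q) * y i /
      (D (cumulative lab y (lab i)) * D (cumulativeLT lab y (lab i))) := by
    intro i
    have e := cumulative_eq_add hlab z i
    rw [hcum, hcumLT] at e
    have e' := cumulative_eq_add hlab y i
    have d1 := (hDpos _ (cumulative_le_one (lab := lab) hy (lab i))).ne'
    have d2 := (hDpos _ (cumulativeLT_le_one (lab := lab) hy (lab i))).ne'
    rw [eq_div_iff (mul_ne_zero d1 d2)]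
    have : z i = q * cumulative lab y (lab i) / D (cumulative lab y (lab i)) -
      q * cumulativeLT lab y (lab i) / D (cumulativeLT lab y (lab i)) := by linarith
    rw [this, sub_mul]
    have : y i = cumulative lab y (lab i) - cumulativeLT lab y (lab i) := by linarith
    rw [this]
    field_simp
    simp only [D]
    ring
  -- `S₀` is the mass of `y` at vertices below the level. Since `D` decreases, the factor `z i / y
  -- i` is at most `q * (1 - q) / (B * B)` below the level and at least that above, where `B = D
  -- S₀`. So the form, which vanishes at `y`, can only grow.
  let S₀ := ∑ j, if φ (Pi.single j 1) < φ y then y j else 0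
  have hS₀ : S₀ ≤ 1 := by
    rw [← hy.2]
    exact Finset.sum_le_sum fun j _ => by split_ifs; exacts [le_rfl, hy.1 j]
  have hlow : ∀ i, φ (Pi.single i 1) < φ y → cumulative lab y (lab i) ≤ S₀ := by
    intro i hi
    refine Finset.sum_le_sum fun j _ => ?_
    by_cases hj : lab j ≤ lab i
    · rw [if_pos hj, if_pos (((h.le_iff j i).2 hj).trans_lt hi)]
    · rw [if_neg hj]; split_ifs; exacts [hy.1 j, le_rfl]
  have hhigh : ∀ i, φ y < φ (Pi.single i 1) → S₀ ≤ cumulativeLT lab y (lab i) := by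
    intro i hi
    refine Finset.sum_le_sum fun j _ => ?_
    by_cases hj : φ (Pi.single j 1) < φ y
    · rw [if_pos hj, if_pos ((h.lt_iff j i).1 (hj.trans hi))]
    · rw [if_neg hj]; split_ifs; exacts [hy.1 j, le_rfl]
  have hLT : ∀ i, cumulativeLT lab y (lab i) ≤ cumulative lab y (lab i) := fun i => by
    rw [cumulative_eq_add hlab]; linarith [hy.1 i]
  set B := D S₀
  have hB : 0 < B := hDpos _ hS₀
  have hqq : 0 < q * (1 - q) := mul_pos hq0 (by linarith)
  have hterm : ∀ i, c i * y i * (q * (1 - q) / (B * B)) ≤ c i * z i := by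
    intro i
    have d1 := hDpos _ (cumulative_le_one (lab := lab) hy (lab i))
    have d2 := hDpos _ (cumulativeLT_le_one (lab := lab) hy (lab i))
    rw [hzi]
    rcases lt_trichotomy (c i) 0 with hci | hci | hci
    · have hi := (hc.neg_iff i).1 hci
      have b1 : B ≤ D (cumulative lab y (lab i)) := hDanti _ _ (hlow i hi)
      have b2 : B ≤ D (cumulativeLT lab y (lab i)) := hDanti _ _ ((hLT i).trans (hlow i hi))
      have : q * (1 - q) / (D (cumulative lab y (lab i)) * D (cumulativeLT lab y (lab i))) ≤
          q * (1 - q) / (B * B) := by gcongr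
      calc _ ≤ c i * y i * (q * (1 - q) /
            (D (cumulative lab y (lab i)) * D (cumulativeLT lab y (lab i)))) :=
            mul_le_mul_of_nonpos_left this (mul_nonpos_of_nonpos_of_nonneg hci.le (hy.1 i))
        _ = _ := by ring
    · simp [hci]
    · have hi := (hc.pos_iff i).1 hci
      have b1 : D (cumulative lab y (lab i)) ≤ B := hDanti _ _ ((hhigh i hi).trans (hLT i))
      have b2 : D (cumulativeLT lab y (lab i)) ≤ B := hDanti _ _ (hhigh i hi)
      have : q * (1 - q) / (B * B) ≤
          q * (1 - q) / (D (cumulative lab y (lab i)) * D (cumulativeLT lab y (lab i))) := by gcongr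
      calc _ ≤ c i * y i * (q * (1 - q) /
            (D (cumulative lab y (lab i)) * D (cumulativeLT lab y (lab i)))) :=
            mul_le_mul_of_nonneg_left this (mul_nonneg hci.le (hy.1 i))
        _ = _ := by ring
  -- Otherwise `y` would be supported on vertices of its own level. Distinct labels leave only one,
  -- and `y` is not a vertex.
  have hex : ∃ i, 0 < c i * y i := by
    by_contra! hcon
    have h0 := (Finset.sum_eq_zero_iff_of_nonpos fun i _ => hcon i).1 hcy
    have hsupp : ∀ i, y i ≠ 0 → φ (Pi.single i 1) = φ y := fun i hi => by
      have h1 := (mul_eq_zero.1 (h0 i (Finset.mem_univ i))).resolve_right hi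
      rw [← sum_mul_single c i] at h1
      exact (hc.eq_zero_iff (single_mem_stdSimplex ℝ i)).1 h1
    have hne : ∃ e, y e ≠ 0 := by
      by_contra! hall
      have := hy.2
      simp [hall] at this
    obtain ⟨e, he⟩ := hne
    refine hyv e (eq_single_of_forall_ne hy fun j hj => ?_)
    by_contra hyj
    have h1 := (hsupp j hyj).trans (hsupp e he).symm
    exact hj (hlab (le_antisymm ((h.le_iff _ _).1 h1.le) ((h.le_iff _ _).1 h1.ge)))
  obtain ⟨i, hi⟩ := hex
  have hyi : 0 < y i := (hy.1 i).lt_of_ne fun h' => by simp [← h'] at hi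
  have hci : 0 < c i := pos_of_mul_pos_left hi (hy.1 i)
  suffices c i * y i * (q * (1 - q) / (B * B)) < c i * z i by
    calc 0 = ∑ i, c i * y i * (q * (1 - q) / (B * B)) := by rw [← Finset.sum_mul, hcy, zero_mul]
      _ < ∑ i, c i * z i := Finset.sum_lt_sum (fun i _ => hterm i) ⟨i, Finset.mem_univ i, this⟩
  have d1 := hDpos _ (cumulative_le_one (lab := lab) hy (lab i))
  have d2 := hDpos _ (cumulativeLT_le_one (lab := lab) hy (lab i))
  rw [hzi]
  have hi' := (hc.pos_iff i).1 hci
  have b1 : D (cumulative lab y (lab i)) < B := by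
    have h1 := hhigh i hi'
    have h2 := cumulative_eq_add hlab y i
    have := mul_lt_mul_of_pos_left (show S₀ < cumulative lab y (lab i) by linarith)
      (show 0 < 1 - 2 * q by linarith)
    simp only [B, D]; linarith
  have b2 : D (cumulativeLT lab y (lab i)) ≤ B := hDanti _ _ (hhigh i hi')
  have : q * (1 - q) / (B * B) <
      q * (1 - q) / (D (cumulative lab y (lab i)) * D (cumulativeLT lab y (lab i))) := by
    have : D (cumulative lab y (lab i)) * D (cumulativeLT lab y (lab i)) < B * B :=
      mul_lt_mul b1 b2 d2 hB.le
    gcongr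
  calc _ < c i * y i * (q * (1 - q) /
        (D (cumulative lab y (lab i)) * D (cumulativeLT lab y (lab i)))) :=
        mul_lt_mul_of_pos_left this hi
    _ = _ := by ring

/-- Two points on one orbit and one level are equal. -/
theorem eq_of_oddsRel (hlab : Function.Injective lab) (h : IsTransverse lab φ)
    {y z : Fin (k + 1) → ℝ} (hy : y ∈ stdSimplex ℝ (Fin (k + 1)))
    (hz : z ∈ stdSimplex ℝ (Fin (k + 1))) {q : ℝ} (hq : q ∈ Ioo (0 : ℝ) 1)
    (hyz : OddsRel lab q y z) (hφ : φ y = φ z) : y = z := by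
  by_cases hyv : ∃ i, y = Pi.single i 1
  · obtain ⟨i, rfl⟩ := hyv
    symm
    refine eq_single_of_forall_ne hz fun j hj => ?_
    rcases lt_or_gt_of_ne (fun h' => hj (hlab h') : lab j ≠ lab i) with h' | h'
    · exact hyz.eq_zero_of_lt hy hz hq.2 (fun l hl => by
        rw [Pi.single_apply, if_neg]; rintro rfl; exact lt_irrefl _ hl) j h'
    · exact hyz.eq_zero_of_gt hy hz hq.1 (fun l hl => by
        rw [Pi.single_apply, if_neg]; rintro rfl; exact lt_irrefl _ hl) j h'
  by_cases hzv : ∃ i, z = Pi.single i 1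
  · obtain ⟨i, rfl⟩ := hzv
    have hzy := hyz.symm
    refine eq_single_of_forall_ne hy fun j hj => ?_
    rcases lt_or_gt_of_ne (fun h' => hj (hlab h') : lab j ≠ lab i) with h' | h'
    · exact hzy.eq_zero_of_lt hz hy (by linarith [hq.1]) (fun l hl => by
        rw [Pi.single_apply, if_neg]; rintro rfl; exact lt_irrefl _ hl) j h'
    · exact hzy.eq_zero_of_gt hz hy (by linarith [hq.2]) (fun l hl => by
        rw [Pi.single_apply, if_neg]; rintro rfl; exact lt_irrefl _ hl) j h'
  push Not at hyv hzv
  rcases lt_trichotomy q (1 / 2) with h' | rfl | h'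
  · exact absurd hφ (h.lt_of_oddsRel hlab hy hz hyv hq.1 h' hyz).ne
  · exact eq_of_cumulative_eq hlab fun g => by linear_combination -2 * hyz g
  · exact absurd hφ (h.lt_of_oddsRel hlab hz hy hzv (by linarith [hq.2]) (by linarith)
      hyz.symm).ne'

/-- `z` is the point of level `t` on the closure of the orbit of `y`. -/
def _root_.IsOrbitPoint (lab : Fin (k + 1) → G) (φ : (Fin (k + 1) → ℝ) → ℝ)
    (y : Fin (k + 1) → ℝ) (t : ℝ) (z : Fin (k + 1) → ℝ) : Prop :=
  z ∈ stdSimplex ℝ (Fin (k + 1)) ∧ (∃ p ∈ Icc (0 : ℝ) 1, OddsRel lab p y z) ∧ φ z = t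

/-- `t` lies between the values of `φ` at the least and the greatest vertex of the support. -/
def _root_.IsBetween (φ : (Fin (k + 1) → ℝ) → ℝ) (y : Fin (k + 1) → ℝ) (t : ℝ) : Prop :=
  (∃ i, y i ≠ 0 ∧ φ (Pi.single i 1) ≤ t) ∧ ∃ j, y j ≠ 0 ∧ t ≤ φ (Pi.single j 1)

theorem exists_support_min (lab : Fin (k + 1) → G) {y : Fin (k + 1) → ℝ}
    (hy : y ∈ stdSimplex ℝ (Fin (k + 1))) : ∃ e, y e ≠ 0 ∧ ∀ j, lab j < lab e → y j = 0 := by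
  classical
  have hne : ∃ e, y e ≠ 0 := by
    by_contra! hall
    have := hy.2
    simp [hall] at this
  obtain ⟨i, hi⟩ := hne
  obtain ⟨e, he, hmin⟩ := (Finset.univ.filter fun j => y j ≠ 0).exists_min_image lab
    ⟨i, by simpa using hi⟩
  simp only [Finset.mem_filter, Finset.mem_univ, true_and] at he hmin
  exact ⟨e, he, fun j hj => by_contra fun h => (hmin j h).not_gt hj⟩

theorem exists_support_max (lab : Fin (k + 1) → G) {y : Fin (k + 1) → ℝ}
    (hy : y ∈ stdSimplex ℝ (Fin (k + 1))) : ∃ e, y e ≠ 0 ∧ ∀ j, lab e < lab j → y j = 0 :=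
  exists_support_min (G := Gᵒᵈ) lab hy

theorem isBetween_self (h : IsTransverse lab φ) {y : Fin (k + 1) → ℝ}
    (hy : y ∈ stdSimplex ℝ (Fin (k + 1))) : IsBetween φ y (φ y) := by
  obtain ⟨e, he, hmin⟩ := exists_support_min lab hy
  obtain ⟨e', he', hmax⟩ := exists_support_max lab hy
  exact ⟨⟨e, he, h.le_of_support hy hmin⟩, e', he', h.ge_of_support hy hmax⟩

/-- An orbit point that is not a vertex lies on the open orbit. -/
theorem orbit_cases (hlab : Function.Injective lab) (h : IsTransverse lab φ)
    {y z : Fin (k + 1) → ℝ} {t : ℝ} (hy : y ∈ stdSimplex ℝ (Fin (k + 1))) (ht : IsBetween φ y t)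
    (hz : IsOrbitPoint lab φ y t z) :
    (∃ e, y e ≠ 0 ∧ z = Pi.single e 1 ∧ t = φ (Pi.single e 1) ∧
      ((∀ j, lab j < lab e → y j = 0) ∨ ∀ j, lab e < lab j → y j = 0)) ∨
    ∃ p ∈ Ioo (0 : ℝ) 1, OddsRel lab p y z ∧ ∀ e, y e ≠ 0 →
      ((∀ j, lab j < lab e → y j = 0) → φ (Pi.single e 1) < t) ∧
      ((∀ j, lab e < lab j → y j = 0) → t < φ (Pi.single e 1)) := by
  obtain ⟨hzΔ, ⟨p, hp, hrel⟩, hzt⟩ := hz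
  obtain ⟨e, he, hmin⟩ := exists_support_min lab hy
  obtain ⟨e', he', hmax⟩ := exists_support_max lab hy
  obtain ⟨⟨i, hi, hit⟩, j, hj, htj⟩ := ht
  have h1 : φ (Pi.single e 1) ≤ t :=
    le_trans ((h.le_iff e i).2 (not_lt.1 fun h' => hi (hmin i h'))) hit
  have h2 : t ≤ φ (Pi.single e' 1) :=
    htj.trans ((h.le_iff j e').2 (not_lt.1 fun h' => hj (hmax j h')))
  have hzmin : p < 1 → ∀ j, lab j < lab e → z j = 0 := fun hp1 =>
    hrel.eq_zero_of_lt hy hzΔ hp1 hmin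
  have hzmax : 0 < p → ∀ j, lab e' < lab j → z j = 0 := fun hp0 =>
    hrel.eq_zero_of_gt hy hzΔ hp0 hmax
  -- For `p = 0` the odds relation only says that `z` has no mass below the greatest vertex `e'` of
  -- the support, so `φ z` is at least the value there. The bound on `t` from `IsBetween` then
  -- forces `z` to be `e'`. The case `p = 1` is symmetric.
  have hzmin' : p = 0 → ∀ j, lab j < lab e' → z j = 0 := by
    rintro rfl j hj
    have e1 := hrel (lab j)
    have h3 : cumulative lab y (lab j) ≠ 1 := fun h' =>
      he' ((cumulative_eq_one_iff hy _).1 h' e' hj)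
    have : cumulative lab z (lab j) * (1 - cumulative lab y (lab j)) = 0 := by linarith
    exact (cumulative_eq_zero_iff hzΔ _).1
      ((mul_eq_zero.1 this).resolve_right (sub_ne_zero.2 h3.symm)) j le_rfl
  have hzmax' : p = 1 → ∀ j, lab e < lab j → z j = 0 := by
    rintro rfl
    have e1 := hrel (lab e)
    have h3 : cumulative lab y (lab e) ≠ 0 := fun h' =>
      he ((cumulative_eq_zero_iff hy _).1 h' e le_rfl)
    have : cumulative lab y (lab e) * (1 - cumulative lab z (lab e)) = 0 := by linarith
    have := (mul_eq_zero.1 this).resolve_left h3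
    exact (cumulative_eq_one_iff hzΔ _).1 (by linarith)
  have hmin_unique : ∀ l, y l ≠ 0 → (∀ j, lab j < lab l → y j = 0) → l = e := fun l hl hl' =>
    hlab (le_antisymm (not_lt.1 fun h' => he (hl' e h')) (not_lt.1 fun h' => hl (hmin l h')))
  have hmax_unique : ∀ l, y l ≠ 0 → (∀ j, lab l < lab j → y j = 0) → l = e' := fun l hl hl' =>
    hlab (le_antisymm (not_lt.1 fun h' => hl (hmax l h')) (not_lt.1 fun h' => he' (hl' e' h')))
  by_cases hte : t = φ (Pi.single e 1)
  · left
    refine ⟨e, he, ?_, hte, Or.inl hmin⟩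
    rcases hp.2.lt_or_eq with hp1 | hp1
    · exact h.eq_single_of_le hlab hzΔ (hzmin hp1) (by rw [hzt, hte])
    · exact h.eq_single_of_ge hlab hzΔ (hzmax' hp1) (by rw [hzt, hte])
  by_cases hte' : t = φ (Pi.single e' 1)
  · left
    refine ⟨e', he', ?_, hte', Or.inr hmax⟩
    rcases hp.1.lt_or_eq with hp1 | hp1
    · exact h.eq_single_of_ge hlab hzΔ (hzmax hp1) (by rw [hzt, hte'])
    · exact h.eq_single_of_le hlab hzΔ (hzmin' hp1.symm) (by rw [hzt, hte'])
  right
  refine ⟨p, ⟨hp.1.lt_of_ne fun hp0 => hte' ?_, hp.2.lt_of_ne fun hp1 => hte ?_⟩, hrel,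
    fun l hl => ⟨fun hl' => ?_, fun hl' => ?_⟩⟩
  · exact le_antisymm h2 (hzt ▸ h.le_of_support hzΔ (hzmin' hp0.symm))
  · exact le_antisymm (hzt ▸ h.ge_of_support hzΔ (hzmax' hp1)) h1
  · rw [hmin_unique l hl hl']; exact h1.lt_of_ne (Ne.symm hte)
  · rw [hmax_unique l hl hl']; exact h2.lt_of_ne hte'

theorem orbitPoint_unique (hlab : Function.Injective lab) (h : IsTransverse lab φ)
    {y z z' : Fin (k + 1) → ℝ} {t : ℝ} (hy : y ∈ stdSimplex ℝ (Fin (k + 1)))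
    (ht : IsBetween φ y t) (hz : IsOrbitPoint lab φ y t z) (hz' : IsOrbitPoint lab φ y t z') :
    z = z' := by
  rcases h.orbit_cases hlab hy ht hz with ⟨e, he, rfl, hte, hs⟩ | ⟨p, hp, hr, hlt⟩
  · rcases h.orbit_cases hlab hy ht hz' with ⟨e', he', rfl, hte', hs'⟩ | ⟨p, hp, hr, hlt⟩
    · have := hte.symm.trans hte'
      rw [hlab (le_antisymm ((h.le_iff e e').1 this.le) ((h.le_iff e' e).1 this.ge))]
    · rcases hs with hs | hs
      · exact absurd hte ((hlt e he).1 hs).ne'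
      · exact absurd hte ((hlt e he).2 hs).ne
  · rcases h.orbit_cases hlab hy ht hz' with ⟨e', he', rfl, hte', hs'⟩ | ⟨p', hp', hr', hlt'⟩
    · rcases hs' with hs | hs
      · exact absurd hte' ((hlt e' he').1 hs).ne'
      · exact absurd hte' ((hlt e' he').2 hs).ne
    · obtain ⟨q, hq, hrel⟩ := hr.comp hr' hp hp'
      exact (h.eq_of_oddsRel hlab hz'.1 hz.1 hq hrel (hz'.2.2.trans hz.2.2.symm)).symm

/-- The flow runs from the greatest vertex of the support at `p = 0` to the least at `p = 1`; the
intermediate value theorem gives every level between. -/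
theorem exists_orbitPoint (hlab : Function.Injective lab) (h : IsTransverse lab φ)
    {y : Fin (k + 1) → ℝ} {t : ℝ} (hy : y ∈ stdSimplex ℝ (Fin (k + 1)))
    (ht : IsBetween φ y t) : ∃ z, IsOrbitPoint lab φ y t z ∧ ∀ j, y j = 0 → z j = 0 := by
  obtain ⟨e, he, hmin⟩ := exists_support_min lab hy
  obtain ⟨e', he', hmax⟩ := exists_support_max lab hy
  obtain ⟨⟨i, hi, hit⟩, j, hj, htj⟩ := ht
  have h1 : φ (Pi.single e 1) ≤ t :=
    le_trans ((h.le_iff e i).2 (not_lt.1 fun h' => hi (hmin i h'))) hit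
  have h2 : t ≤ φ (Pi.single e' 1) :=
    htj.trans ((h.le_iff j e').2 (not_lt.1 fun h' => hj (hmax j h')))
  have e0 : simplexFlow lab y 0 = Pi.single e' 1 := by
    refine eq_single_of_forall_ne (simplexFlow_mem hlab hy (by simp)) fun j hj => ?_
    rcases lt_or_gt_of_ne (fun h' => hj (hlab h') : lab j ≠ lab e') with h' | h'
    · have h3 : cumulative lab y (lab j) ≠ 1 := fun h'' =>
        he' ((cumulative_eq_one_iff hy _).1 h'' e' h')
      have h4 : cumulativeLT lab y (lab j) ≠ 1 := fun h'' => h3 (le_antisymm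
        (cumulative_le_one hy _) (by rw [cumulative_eq_add hlab, h'']; linarith [hy.1 j]))
      simp [simplexFlow, moveCdf, h3, h4]
    · exact simplexFlow_eq_zero hlab (hmax j h') 0
  have e1 : simplexFlow lab y 1 = Pi.single e 1 := by
    refine eq_single_of_forall_ne (simplexFlow_mem hlab hy (by simp)) fun j hj => ?_
    rcases lt_or_gt_of_ne (fun h' => hj (hlab h') : lab j ≠ lab e) with h' | h'
    · exact simplexFlow_eq_zero hlab (hmin j h') 1
    · have h3 : cumulativeLT lab y (lab j) ≠ 0 := by
        intro h''
        rw [cumulativeLT, Finset.sum_eq_zero_iff_of_nonneg] at h''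
        · have := h'' e (Finset.mem_univ e)
          rw [if_pos h'] at this
          exact he this
        · intro l _; split_ifs; exacts [hy.1 l, le_rfl]
      have h4 : cumulative lab y (lab j) ≠ 0 := by
        have := (cumulativeLT_nonneg (lab := lab) hy (lab j)).lt_of_ne' h3
        rw [cumulative_eq_add hlab]
        linarith [hy.1 j]
      simp [simplexFlow, moveCdf, h3, h4]
  have hcont : ContinuousOn (fun p => φ (simplexFlow lab y p)) (Icc 0 1) :=
    h.continuousOn.comp (continuousOn_simplexFlow hy) fun p hp => simplexFlow_mem hlab hy hp
  obtain ⟨p, hp, hpt⟩ := intermediate_value_Icc' zero_le_one hcont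
    (show t ∈ Icc _ _ by simp only [e0, e1]; exact ⟨h1, h2⟩)
  exact ⟨_, ⟨simplexFlow_mem hlab hy hp, ⟨p, hp, oddsRel_simplexFlow hlab hy hp⟩, hpt⟩,
    fun j hj => simplexFlow_eq_zero hlab hj p⟩

end IsTransverse

end Transverse

/-! ### Faces, and compatibility of orbits with them. -/

section FaceMap

variable {d k : ℕ} (f : Fin (d + 1) ↪ Fin (k + 1))

theorem faceMap_apply (y : Fin (d + 1) → ℝ) (l : Fin (d + 1)) : faceMap f y (f l) = y l :=
  f.injective.extend_apply y 0 l

theorem faceMap_apply_of_notMem (y : Fin (d + 1) → ℝ) {i : Fin (k + 1)} (hi : i ∉ range f) :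
    faceMap f y i = 0 :=
  Function.extend_apply' _ _ _ hi

theorem sum_faceMap {g : Fin (k + 1) → ℝ}
    (h : ∀ i, i ∉ range f → g i = 0) : ∑ i, g i = ∑ l, g (f l) := by
  classical
  rw [← Finset.sum_map Finset.univ f g]
  symm
  refine Finset.sum_subset (Finset.subset_univ _) fun i _ hi => h i ?_
  simpa using hi

theorem sum_mul_faceMap (c : Fin (k + 1) → ℝ) (y : Fin (d + 1) → ℝ) :
    ∑ i, c i * faceMap f y i = ∑ l, c (f l) * y l := by
  rw [sum_faceMap f fun i hi => by rw [faceMap_apply_of_notMem f y hi, mul_zero]]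
  simp [faceMap_apply]

theorem faceMap_mem {y : Fin (d + 1) → ℝ} (hy : y ∈ stdSimplex ℝ (Fin (d + 1))) :
    faceMap f y ∈ stdSimplex ℝ (Fin (k + 1)) := by
  constructor
  · intro i
    by_cases hi : i ∈ range f
    · obtain ⟨l, rfl⟩ := hi
      rw [faceMap_apply]; exact hy.1 l
    · rw [faceMap_apply_of_notMem f y hi]
  · have := sum_mul_faceMap f (fun _ => 1) y
    simp only [one_mul] at this
    rw [this, hy.2]

theorem faceMap_single (l : Fin (d + 1)) : faceMap f (Pi.single l 1) = Pi.single (f l) 1 := by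
  funext i
  by_cases hi : i ∈ range f
  · obtain ⟨j, rfl⟩ := hi
    rw [faceMap_apply]
    simp [Pi.single_apply]
  · rw [faceMap_apply_of_notMem f _ hi, Pi.single_apply, if_neg]
    rintro rfl
    exact hi ⟨l, rfl⟩

theorem continuous_faceMap : Continuous (faceMap f) := by
  refine continuous_pi fun i => ?_
  by_cases hi : i ∈ range f
  · obtain ⟨l, rfl⟩ := hi
    simp only [faceMap_apply]
    fun_prop
  · simp only [faceMap_apply_of_notMem f _ hi]
    fun_prop

theorem faceMap_comp_self {y : Fin (k + 1) → ℝ} (h : ∀ i, i ∉ range f → y i = 0) :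
    faceMap f (y ∘ f) = y := by
  funext i
  by_cases hi : i ∈ range f
  · obtain ⟨l, rfl⟩ := hi
    rw [faceMap_apply]; rfl
  · rw [faceMap_apply_of_notMem f _ hi, h i hi]

theorem comp_mem_stdSimplex {y : Fin (k + 1) → ℝ} (hy : y ∈ stdSimplex ℝ (Fin (k + 1)))
    (h : ∀ i, i ∉ range f → y i = 0) : y ∘ f ∈ stdSimplex ℝ (Fin (d + 1)) :=
  ⟨fun l => hy.1 (f l), by rw [← hy.2, sum_faceMap f h]; rfl⟩

/-- Every point of a simplex lies in the interior of a face. -/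
theorem exists_faceMap_eq {y : Fin (k + 1) → ℝ} (hy : y ∈ stdSimplex ℝ (Fin (k + 1))) :
    ∃ (d : ℕ) (f : Fin (d + 1) ↪ Fin (k + 1)), ∃ w ∈ openSimplex d, faceMap f w = y := by
  classical
  let S : Finset (Fin (k + 1)) := Finset.univ.filter fun i => y i ≠ 0
  have hS : S.Nonempty := by
    by_contra hcon
    rw [Finset.not_nonempty_iff_eq_empty, Finset.filter_eq_empty_iff] at hcon
    have := hy.2
    rw [Finset.sum_eq_zero fun i hi => by simpa using hcon hi] at this
    exact zero_ne_one this
  have hcard : S.card = (S.card - 1) + 1 := by have := hS.card_pos; omega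
  let f := (S.orderEmbOfFin hcard).toEmbedding
  have hf : ∀ i, i ∉ range f → y i = 0 := fun i hi => by
    by_contra hyi
    refine hi ?_
    have := Finset.range_orderEmbOfFin S hcard
    change i ∈ range (S.orderEmbOfFin hcard)
    rw [this]
    simpa [S] using hyi
  refine ⟨S.card - 1, f, y ∘ f, ⟨comp_mem_stdSimplex f hy hf, fun l => ?_⟩, faceMap_comp_self f hf⟩
  have : f l ∈ S := Finset.orderEmbOfFin_mem S hcard l
  simp only [S, Finset.mem_filter, Finset.mem_univ, true_and] at this
  exact (hy.1 (f l)).lt_of_ne' this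

variable {G : Type*} [LinearOrder G] {lab : Fin (k + 1) → G}

theorem cumulative_faceMap (lab : Fin (k + 1) → G) (y : Fin (d + 1) → ℝ) (h : G) :
    cumulative lab (faceMap f y) h = cumulative (lab ∘ f) y h := by
  unfold cumulative
  rw [sum_faceMap f fun i hi => by rw [faceMap_apply_of_notMem f y hi, ite_self]]
  simp [faceMap_apply]

/-- Vertices without mass do not affect distribution functions. Hence orbits of a face are orbits of
the simplex, and the flow makes sense on a whole complex. -/
theorem oddsRel_faceMap {p : ℝ} {y z : Fin (d + 1) → ℝ} :
    OddsRel lab p (faceMap f y) (faceMap f z) ↔ OddsRel (lab ∘ f) p y z := by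
  simp only [OddsRel, cumulative_faceMap]

theorem isOrbitPoint_faceMap {φ : (Fin (k + 1) → ℝ) → ℝ} {φ₀ : (Fin (d + 1) → ℝ) → ℝ}
    (hφ : ∀ w ∈ stdSimplex ℝ (Fin (d + 1)), φ (faceMap f w) = φ₀ w) {y z : Fin (d + 1) → ℝ} {t : ℝ}
    (hz : IsOrbitPoint (lab ∘ f) φ₀ y t z) :
    IsOrbitPoint lab φ (faceMap f y) t (faceMap f z) := by
  obtain ⟨hzΔ, ⟨p, hp, hr⟩, ht⟩ := hz
  exact ⟨faceMap_mem f hzΔ, ⟨p, hp, (oddsRel_faceMap f).2 hr⟩, by rw [hφ z hzΔ, ht]⟩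

theorem isBetween_faceMap {φ : (Fin (k + 1) → ℝ) → ℝ} {φ₀ : (Fin (d + 1) → ℝ) → ℝ}
    (hφ : ∀ w ∈ stdSimplex ℝ (Fin (d + 1)), φ (faceMap f w) = φ₀ w) {y : Fin (d + 1) → ℝ} {t : ℝ} :
    IsBetween φ (faceMap f y) t ↔ IsBetween φ₀ y t := by
  have hex : ∀ P : ℝ → Prop, (∃ i, faceMap f y i ≠ 0 ∧ P (φ (Pi.single i 1))) ↔
      ∃ l, y l ≠ 0 ∧ P (φ₀ (Pi.single l 1)) := by
    intro P
    constructor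
    · rintro ⟨i, hi, hP⟩
      have hr : i ∈ range f := by
        by_contra hr
        exact hi (faceMap_apply_of_notMem f y hr)
      obtain ⟨l, rfl⟩ := hr
      rw [faceMap_apply] at hi
      rw [← faceMap_single, hφ _ (single_mem_stdSimplex ℝ l)] at hP
      exact ⟨l, hi, hP⟩
    · rintro ⟨l, hl, hP⟩
      refine ⟨f l, by rwa [faceMap_apply], ?_⟩
      rwa [← faceMap_single, hφ _ (single_mem_stdSimplex ℝ l)]
  exact and_congr (hex fun r => r ≤ t) (hex fun r => t ≤ r)

end FaceMap

section Orbit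

variable {G : Type*} [LinearOrder G] {k : ℕ} {lab : Fin (k + 1) → G}

/-- For `p` strictly between `0` and `1` the odds relation determines the distribution function of
`z`, so `z` is the flow of `y`, which preserves faces. -/
theorem OddsRel.eq_zero {ι : Type*} [Fintype ι] {lab : ι → G} (hlab : Function.Injective lab)
    {p : ℝ} (hp : p ∈ Ioo (0 : ℝ) 1) {y z : ι → ℝ} (hy : y ∈ stdSimplex ℝ ι) (h : OddsRel lab p y z)
    {i : ι} (hi : y i = 0) : z i = 0 := by
  have : z = simplexFlow lab y p := by
    refine eq_of_cumulative_eq hlab fun g => ?_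
    have e1 := h g
    have e2 := oddsRel_simplexFlow hlab hy ⟨hp.1.le, hp.2.le⟩ g
    have h0 := cumulative_nonneg (lab := lab) hy g
    have h1 := cumulative_le_one (lab := lab) hy g
    have hne : (1 - p) * (1 - cumulative lab y g) + p * cumulative lab y g ≠ 0 := by
      rcases h0.lt_or_eq with h0 | h0
      · have := mul_pos hp.1 h0
        have := mul_nonneg (sub_nonneg.2 hp.2.le) (sub_nonneg.2 h1)
        linarith
      · rw [← h0]; linarith [hp.2]
    refine mul_right_cancel₀ hne ?_
    linear_combination e1 - e2
  rw [this, simplexFlow_eq_zero hlab hi]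

/-- Points of one open orbit have the same orbit points. The parameters `0` and `1` stay fixed when
the starting point moves, whereas interior ones change by `OddsRel.comp`. -/
theorem IsOrbitPoint.of_oddsRel {φ : (Fin (k + 1) → ℝ) → ℝ} {a b z : Fin (k + 1) → ℝ} {t q : ℝ}
    (hz : IsOrbitPoint lab φ a t z) (hq : q ∈ Ioo (0 : ℝ) 1) (hab : OddsRel lab q a b) :
    IsOrbitPoint lab φ b t z := by
  obtain ⟨hzΔ, ⟨p, hp, hr⟩, ht⟩ := hz
  refine ⟨hzΔ, ?_, ht⟩
  rcases hp.1.lt_or_eq with hp0 | rfl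
  · rcases hp.2.lt_or_eq with hp1 | rfl
    · obtain ⟨r, hr', hrel⟩ := hr.comp hab ⟨hp0, hp1⟩ hq
      exact ⟨r, ⟨hr'.1.le, hr'.2.le⟩, hrel⟩
    · refine ⟨1, by simp, fun g => ?_⟩
      have e1 := hr g
      have e2 := hab g
      simp only [sub_self, mul_zero, zero_mul, one_mul] at e1 ⊢
      rcases mul_eq_zero.1 e1.symm with h0 | h0
      · rw [h0] at e2
        have : cumulative lab b g * (1 - q) = 0 := by linarith
        rw [(mul_eq_zero.1 this).resolve_right (by linarith [hq.2]), zero_mul]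
      · rw [h0, mul_zero]
  · refine ⟨0, by simp, fun g => ?_⟩
    have e1 := hr g
    have e2 := hab g
    simp only [sub_zero, mul_one, zero_mul] at e1 ⊢
    rcases mul_eq_zero.1 e1 with h0 | h0
    · rw [h0, zero_mul]
    · rw [h0, mul_zero, show cumulative lab a g = 1 by linarith, mul_one] at e2
      rw [(mul_eq_zero.1 e2.symm).resolve_left hq.1.ne', mul_zero]

theorem IsBetween.of_support {φ : (Fin (k + 1) → ℝ) → ℝ} {a b : Fin (k + 1) → ℝ} {t : ℝ}
    (h : IsBetween φ a t) (hab : ∀ i, b i = 0 → a i = 0) : IsBetween φ b t := by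
  obtain ⟨⟨i, hi, hit⟩, j, hj, hjt⟩ := h
  exact ⟨⟨i, fun h => hi (hab i h), hit⟩, j, fun h => hj (hab j h), hjt⟩

variable [Group G] [MulLeftStrictMono G]

/-- The relation depends on the order of the labels only, and left multiplication preserves it. -/
theorem oddsRel_mul_left (g : G) {p : ℝ} {y z : Fin (k + 1) → ℝ} (h : OddsRel lab p y z) :
    OddsRel (fun i => g * lab i) p y z := by
  have hc : ∀ (y : Fin (k + 1) → ℝ) (a : G),
      cumulative (fun i => g * lab i) y a = cumulative lab y (g⁻¹ * a) := fun y a => by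
    unfold cumulative
    refine Finset.sum_congr rfl fun j _ => ?_
    have : g * lab j ≤ a ↔ lab j ≤ g⁻¹ * a := by
      conv_lhs => rw [← mul_inv_cancel_left g a, ← not_lt, mul_lt_mul_iff_left, not_lt]
    simp only [this]
  intro a
  rw [hc, hc]
  exact h _

end Orbit

/-! ### Orbits in a labelled complex. -/

/-- A simplicial structure on a space, given by the characteristic maps of its simplices, whose
vertices are labelled so that the labels of the vertices of each simplex are distinct. -/
structure LabelledComplex (X G : Type*) [TopologicalSpace X] where
  simplex : ∀ k : ℕ, Set ((Fin (k + 1) → ℝ) → X)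
  label : X → G
  continuousOn : ∀ {k : ℕ}, ∀ s ∈ simplex k, ContinuousOn s (stdSimplex ℝ (Fin (k + 1)))
  carrier : ∀ x, ∃ d, ∃ s₀ ∈ simplex d, ∃ w₀ ∈ openSimplex d, s₀ w₀ = x ∧
    ∀ k, ∀ s ∈ simplex k, ∀ y ∈ stdSimplex ℝ (Fin (k + 1)), s y = x →
      ∃ f : Fin (d + 1) ↪ Fin (k + 1), faceMap f w₀ = y ∧
        ∀ w ∈ stdSimplex ℝ (Fin (d + 1)), s (faceMap f w) = s₀ w
  mem_ultrafilter : ∀ (x : X) (U : Ultrafilter X), ↑U ≤ 𝓝 x →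
    ∃ k, ∃ s ∈ simplex k, s '' stdSimplex ℝ (Fin (k + 1)) ∈ U
  label_injective : ∀ {k : ℕ}, ∀ s ∈ simplex k,
    Function.Injective fun i => label (s (Pi.single i 1))

namespace LabelledComplex

variable {X G : Type*} [TopologicalSpace X] (K : LabelledComplex X G)

/-- The labels of the vertices of a simplex. -/
def verts {k : ℕ} (s : (Fin (k + 1) → ℝ) → X) (i : Fin (k + 1)) : G := K.label (s (Pi.single i 1))

/-- A continuous function that is transverse to all simplices. -/
structure IsTransverseMap [LinearOrder G] (F : X → ℝ) : Prop where
  continuous : Continuous F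
  transverse : ∀ {k : ℕ}, ∀ s ∈ K.simplex k, IsTransverse (K.verts s) fun y => F (s y)

/-- `z` is a point of level `t` on the closure of the orbit of `x`. -/
def Orbit [LinearOrder G] (F : X → ℝ) (x : X) (t : ℝ) (z : X) : Prop :=
  ∃ k, ∃ s ∈ K.simplex k, ∃ y ∈ stdSimplex ℝ (Fin (k + 1)), ∃ w, s y = x ∧ s w = z ∧
    IsOrbitPoint (K.verts s) (fun y => F (s y)) y t w

/-- The orbit closure of `x` meets the level `t`. -/
def Between (F : X → ℝ) (x : X) (t : ℝ) : Prop :=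
  ∃ k, ∃ s ∈ K.simplex k, ∃ y ∈ stdSimplex ℝ (Fin (k + 1)), s y = x ∧
    IsBetween (fun y => F (s y)) y t

variable {K}

theorem Between.isBetween {F : X → ℝ} {x : X} {t : ℝ} (h : K.Between F x t) {k : ℕ}
    {s : (Fin (k + 1) → ℝ) → X} (hs : s ∈ K.simplex k) {y : Fin (k + 1) → ℝ}
    (hy : y ∈ stdSimplex ℝ (Fin (k + 1))) (hx : s y = x) : IsBetween (fun y => F (s y)) y t := by
  obtain ⟨k', s', hs', y', hy', hx', hb⟩ := h
  obtain ⟨d, s₀, hs₀, w₀, hw₀, -, hcar⟩ := K.carrier x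
  obtain ⟨f, rfl, hf⟩ := hcar k s hs y hy hx
  obtain ⟨f', rfl, hf'⟩ := hcar k' s' hs' y' hy' hx'
  refine (isBetween_faceMap f (φ₀ := fun y => F (s₀ y)) fun w hw => by rw [hf w hw]).2 ?_
  exact (isBetween_faceMap f' (φ₀ := fun y => F (s₀ y)) fun w hw => by rw [hf' w hw]).1 hb

theorem verts_comp {k d : ℕ} {s : (Fin (k + 1) → ℝ) → X} {s₀ : (Fin (d + 1) → ℝ) → X}
    {f : Fin (d + 1) ↪ Fin (k + 1)}
    (hf : ∀ w ∈ stdSimplex ℝ (Fin (d + 1)), s (faceMap f w) = s₀ w) :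
    K.verts s ∘ f = K.verts s₀ := by
  funext l
  simp only [verts, Function.comp, ← hf _ (single_mem_stdSimplex ℝ l), faceMap_single]

variable [LinearOrder G] {F : X → ℝ} (hF : K.IsTransverseMap F)
include hF

namespace IsTransverseMap

theorem exists_orbit {x : X} {t : ℝ} (h : K.Between F x t) : ∃ z, K.Orbit F x t z := by
  obtain ⟨k, s, hs, y, hy, hx, hb⟩ := h
  obtain ⟨w, hw, -⟩ := (hF.transverse s hs).exists_orbitPoint (K.label_injective s hs) hy hb
  exact ⟨s w, k, s, hs, y, hy, w, hx, rfl, hw⟩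

/-- An orbit point can be seen in any simplex containing `x`: construct it in the carrier of `x`,
push it into both simplices, and use uniqueness in the one where `z` was given. -/
theorem exists_isOrbitPoint {x z : X} {t : ℝ} (h : K.Between F x t) (hz : K.Orbit F x t z) {k : ℕ}
    {s : (Fin (k + 1) → ℝ) → X} (hs : s ∈ K.simplex k) {y : Fin (k + 1) → ℝ}
    (hy : y ∈ stdSimplex ℝ (Fin (k + 1))) (hx : s y = x) :
    ∃ w, s w = z ∧ IsOrbitPoint (K.verts s) (fun y => F (s y)) y t w := by
  obtain ⟨d, s₀, hs₀, w₀, hw₀, hx₀, hcar⟩ := K.carrier x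
  obtain ⟨w, hw, -⟩ := (hF.transverse s₀ hs₀).exists_orbitPoint (K.label_injective s₀ hs₀) hw₀.1
    (h.isBetween hs₀ hw₀.1 hx₀)
  have key : ∀ (k : ℕ) (s : (Fin (k + 1) → ℝ) → X), s ∈ K.simplex k →
      ∀ f : Fin (d + 1) ↪ Fin (k + 1),
      (∀ w ∈ stdSimplex ℝ (Fin (d + 1)), s (faceMap f w) = s₀ w) →
      IsOrbitPoint (K.verts s) (fun y => F (s y)) (faceMap f w₀) t (faceMap f w) := by
    intro k s hs f hf
    refine isOrbitPoint_faceMap f (φ₀ := fun y => F (s₀ y)) (fun w hw => by rw [hf w hw]) ?_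
    rwa [verts_comp hf]
  obtain ⟨k', s', hs', y', hy', w', hx', hz', ho⟩ := hz
  obtain ⟨f', rfl, hf'⟩ := hcar k' s' hs' y' hy' hx'
  obtain ⟨f, rfl, hf⟩ := hcar k s hs y hy hx
  have := (hF.transverse s' hs').orbitPoint_unique (K.label_injective s' hs') hy'
    (h.isBetween hs' hy' hx') ho (key k' s' hs' f' hf')
  refine ⟨faceMap f w, ?_, key k s hs f hf⟩
  rw [hf w hw.1, ← hz', this, hf' w hw.1]

theorem orbit_unique {x z z' : X} {t : ℝ} (h : K.Between F x t) (hz : K.Orbit F x t z)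
    (hz' : K.Orbit F x t z') : z = z' := by
  obtain ⟨k, s, hs, y, hy, w, hx, rfl, ho⟩ := hz
  obtain ⟨w', rfl, ho'⟩ := hF.exists_isOrbitPoint h hz' hs hy hx
  rw [(hF.transverse s hs).orbitPoint_unique (K.label_injective s hs) hy
    (h.isBetween hs hy hx) ho ho']

open Classical in
omit hF in
/-- The point of level `t` on the closure of the orbit of `x`. -/
noncomputable def _root_.LabelledComplex.orb (K : LabelledComplex X G) (F : X → ℝ) (x : X) (t : ℝ) :
    X :=
  if h : ∃ z, K.Orbit F x t z then h.choose else x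

theorem orbit_orb {x : X} {t : ℝ} (h : K.Between F x t) : K.Orbit F x t (K.orb F x t) := by
  have hex := hF.exists_orbit h
  rw [orb, dif_pos hex]
  exact hex.choose_spec

theorem map_orb {x : X} {t : ℝ} (h : K.Between F x t) : F (K.orb F x t) = t := by
  obtain ⟨k, s, hs, y, hy, w, hx, hz, ho⟩ := hF.orbit_orb h
  rw [← hz, ← ho.2.2]

theorem orb_eq {x z : X} {t : ℝ} (h : K.Between F x t) (hz : K.Orbit F x t z) :
    K.orb F x t = z :=
  hF.orbit_unique h (hF.orbit_orb h) hz

theorem between_self (x : X) : K.Between F x (F x) := by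
  obtain ⟨d, s₀, hs₀, w₀, hw₀, rfl, -⟩ := K.carrier x
  exact ⟨d, s₀, hs₀, w₀, hw₀.1, rfl, (hF.transverse s₀ hs₀).isBetween_self hw₀.1⟩

omit hF in
theorem _root_.LabelledComplex.orbit_self (F : X → ℝ) (x : X) : K.Orbit F x (F x) x := by
  obtain ⟨d, s₀, hs₀, w₀, hw₀, rfl, -⟩ := K.carrier x
  exact ⟨d, s₀, hs₀, w₀, hw₀.1, w₀, rfl, rfl, hw₀.1, ⟨1 / 2, by norm_num, fun g => by ring⟩, rfl⟩

/-- A closed-graph argument. Starting point, parameter and orbit point range over a compact set, the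
conditions relating them are closed, and the orbit point is unique. The parameter need not vary
continuously; it only has to have a limit. -/
theorem continuousOn_orb [T2Space X] :
    ContinuousOn (fun q : X × ℝ => K.orb F q.1 q.2) {q | K.Between F q.1 q.2} := by
  rintro ⟨x, t⟩ hxt
  rw [ContinuousWithinAt, Filter.tendsto_iff_ultrafilter]
  intro U hU
  have hUx : Filter.Tendsto Prod.fst (U : Filter (X × ℝ)) (𝓝 x) :=
    (continuous_fst.tendsto (x, t)).mono_left (hU.trans nhdsWithin_le_nhds)
  have hUt : Filter.Tendsto Prod.snd (U : Filter (X × ℝ)) (𝓝 t) :=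
    (continuous_snd.tendsto (x, t)).mono_left (hU.trans nhdsWithin_le_nhds)
  -- Local finiteness: the starting points are concentrated on a single simplex.
  obtain ⟨k, s, hs, hsU⟩ := K.mem_ultrafilter x (U.map Prod.fst) hUx
  have hev : ∀ᶠ q : X × ℝ in U, ∃ r : (Fin (k + 1) → ℝ) × ℝ × (Fin (k + 1) → ℝ),
      r ∈ stdSimplex ℝ (Fin (k + 1)) ×ˢ Icc (0 : ℝ) 1 ×ˢ stdSimplex ℝ (Fin (k + 1)) ∧
      s r.1 = q.1 ∧ s r.2.2 = K.orb F q.1 q.2 ∧ OddsRel (K.verts s) r.2.1 r.1 r.2.2 ∧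
      F (s r.2.2) = q.2 := by
    have h1 : ∀ᶠ q : X × ℝ in U, q.1 ∈ s '' stdSimplex ℝ (Fin (k + 1)) := hsU
    have h2 : ∀ᶠ q : X × ℝ in U, K.Between F q.1 q.2 := hU self_mem_nhdsWithin
    filter_upwards [h1, h2] with q ⟨y, hy, hyq⟩ hq
    obtain ⟨w, hw, hwΔ, ⟨p, hp, hr⟩, hwt⟩ :=
      hF.exists_isOrbitPoint hq (hF.orbit_orb hq) hs hy hyq
    exact ⟨(y, p, w), ⟨hy, hp, hwΔ⟩, hyq, hw, hr, hwt⟩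
  obtain ⟨r, hr⟩ := hev.choice
  have hcomp : IsCompact (stdSimplex ℝ (Fin (k + 1)) ×ˢ Icc (0 : ℝ) 1 ×ˢ
      stdSimplex ℝ (Fin (k + 1))) :=
    (isCompact_stdSimplex ℝ _).prod (isCompact_Icc.prod (isCompact_stdSimplex ℝ _))
  obtain ⟨⟨y, p, w⟩, ⟨hy, hp, hw⟩, hlim⟩ := isCompact_iff_ultrafilter_le_nhds.1 hcomp (U.map r)
    (by rw [Filter.le_principal_iff]; exact hr.mono fun q hq => hq.1)
  have hlim' : Filter.Tendsto r (U : Filter (X × ℝ)) (𝓝 (y, p, w)) := hlim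
  have l1 : Filter.Tendsto (fun q => (r q).1) (U : Filter (X × ℝ)) (𝓝 y) :=
    (continuous_fst.tendsto _).comp hlim'
  have l2 : Filter.Tendsto (fun q => (r q).2.1) (U : Filter (X × ℝ)) (𝓝 p) :=
    ((continuous_fst.comp continuous_snd).tendsto _).comp hlim'
  have l3 : Filter.Tendsto (fun q => (r q).2.2) (U : Filter (X × ℝ)) (𝓝 w) :=
    ((continuous_snd.comp continuous_snd).tendsto _).comp hlim'
  have m1 : Filter.Tendsto (fun q => s (r q).1) (U : Filter (X × ℝ)) (𝓝 (s y)) :=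
    ((K.continuousOn s hs) y hy).tendsto.comp (tendsto_nhdsWithin_iff.2
      ⟨l1, hr.mono fun q hq => hq.1.1⟩)
  have m3 : Filter.Tendsto (fun q => s (r q).2.2) (U : Filter (X × ℝ)) (𝓝 (s w)) :=
    ((K.continuousOn s hs) w hw).tendsto.comp (tendsto_nhdsWithin_iff.2
      ⟨l3, hr.mono fun q hq => hq.1.2.2⟩)
  have hxy : s y = x :=
    tendsto_nhds_unique (m1.congr' (hr.mono fun q hq => hq.2.1)) hUx
  have hFw : F (s w) = t :=
    tendsto_nhds_unique (((hF.continuous.tendsto _).comp m3).congr'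
      (hr.mono fun q hq => hq.2.2.2.2)) hUt
  have hrel : OddsRel (K.verts s) p y w := by
    intro g
    have c1 := ((continuous_cumulative (K.verts s) g).tendsto y).comp l1
    have c3 := ((continuous_cumulative (K.verts s) g).tendsto w).comp l3
    refine tendsto_nhds_unique ((c3.mul (tendsto_const_nhds.sub l2)).mul
      (tendsto_const_nhds.sub c1)) ?_
    refine Filter.Tendsto.congr' ?_ ((l2.mul c1).mul (tendsto_const_nhds.sub c3))
    exact hr.mono fun q hq => (hq.2.2.2.1 g).symm
  have horb : K.orb F x t = s w :=
    hF.orb_eq hxt ⟨k, s, hs, y, hy, w, hxy, rfl, hw, ⟨p, hp, hrel⟩, hFw⟩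
  simp only [horb]
  exact m3.congr' (hr.mono fun q hq => hq.2.2.1)

end IsTransverseMap

end LabelledComplex

/-! ### Strips, and the collapse along orbits. -/

namespace LabelledComplex

variable {X G : Type*} [TopologicalSpace X] {K : LabelledComplex X G} [LinearOrder G] {F : X → ℝ}

/-- A vertex of a simplex of the complex. -/
def IsVertex (K : LabelledComplex X G) (x : X) : Prop :=
  ∃ k, ∃ s ∈ K.simplex k, ∃ i, x = s (Pi.single i 1)

omit [LinearOrder G] in
theorem exists_single_of_eq (K : LabelledComplex X G) {k k' : ℕ} {s : (Fin (k + 1) → ℝ) → X}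
    {s' : (Fin (k' + 1) → ℝ) → X} (hs : s ∈ K.simplex k) (hs' : s' ∈ K.simplex k')
    {w' : Fin (k' + 1) → ℝ} (hw' : w' ∈ stdSimplex ℝ (Fin (k' + 1))) {i : Fin (k + 1)}
    (h : s (Pi.single i 1) = s' w') : ∃ j, w' = Pi.single j 1 := by
  obtain ⟨d, s₀, hs₀, w₀, hw₀, -, hcar⟩ := K.carrier (s' w')
  obtain ⟨f, hf, -⟩ := hcar k s hs _ (single_mem_stdSimplex ℝ i) h
  obtain ⟨f', rfl, -⟩ := hcar k' s' hs' w' hw' rfl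
  have hfi : ∀ l, f l = i := fun l => by
    by_contra hne
    have := hw₀.2 l
    rw [← faceMap_apply f w₀, hf] at this
    simp [hne] at this
  have : w₀ = Pi.single 0 1 := eq_single_of_forall_ne hw₀.1 fun j hj =>
    absurd (f.injective ((hfi j).trans (hfi 0).symm)) hj
  exact ⟨f' 0, by rw [this, faceMap_single]⟩

namespace IsTransverseMap

theorem orb_cases (hF : K.IsTransverseMap F) {x : X} {t : ℝ} (h : K.Between F x t) {k : ℕ}
    {s : (Fin (k + 1) → ℝ) → X} (hs : s ∈ K.simplex k) {y : Fin (k + 1) → ℝ}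
    (hy : y ∈ stdSimplex ℝ (Fin (k + 1))) (hx : s y = x) :
    (∃ e, K.orb F x t = s (Pi.single e 1) ∧ t = F (s (Pi.single e 1)) ∧
      ((∀ j, K.verts s j < K.verts s e → y j = 0) ∨ ∀ j, K.verts s e < K.verts s j → y j = 0)) ∨
    ∃ w ∈ stdSimplex ℝ (Fin (k + 1)), K.orb F x t = s w ∧
      ∃ p ∈ Ioo (0 : ℝ) 1, OddsRel (K.verts s) p y w := by
  obtain ⟨w, hw, ho⟩ := hF.exists_isOrbitPoint h (hF.orbit_orb h) hs hy hx
  rcases (hF.transverse s hs).orbit_cases (K.label_injective s hs) hy (h.isBetween hs hy hx) ho with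
    ⟨e, -, rfl, hte, hext⟩ | ⟨p, hp, hrel, -⟩
  · exact Or.inl ⟨e, hw.symm, hte, hext⟩
  · exact Or.inr ⟨w, ho.1, hw.symm, p, hp, hrel⟩

theorem orb_eq_of_oddsRel (hF : K.IsTransverseMap F) {k : ℕ} {s : (Fin (k + 1) → ℝ) → X}
    (hs : s ∈ K.simplex k) {a b : Fin (k + 1) → ℝ} (ha : a ∈ stdSimplex ℝ (Fin (k + 1)))
    (hb : b ∈ stdSimplex ℝ (Fin (k + 1))) {q : ℝ} (hq : q ∈ Ioo (0 : ℝ) 1)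
    (hab : OddsRel (K.verts s) q a b) {t : ℝ} (h : K.Between F (s a) t) :
    K.orb F (s b) t = K.orb F (s a) t := by
  obtain ⟨w, hw, ho⟩ := hF.exists_isOrbitPoint h (hF.orbit_orb h) hs ha rfl
  refine hF.orb_eq ⟨k, s, hs, b, hb, rfl, (h.isBetween hs ha rfl).of_support fun i hi =>
    OddsRel.eq_zero (K.label_injective s hs) ⟨by linarith [hq.2], by linarith [hq.1]⟩ hb
      hab.symm hi⟩ ?_
  exact ⟨k, s, hs, b, hb, w, rfl, hw, ho.of_oddsRel hq hab⟩

section Strip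

variable (hF : K.IsTransverseMap F) {a b : ℝ}
  (hv : ∀ k, ∀ s ∈ K.simplex k, ∀ i, F (s (Pi.single i 1)) ∉ Ioo a b)
include hF hv

/-- The vertex values bracketing `F x` avoid the interval, so they bracket the whole interval. -/
theorem between_of_mem_Ioo {x : X} {t : ℝ} (hx : F x ∈ Ioo a b) (ht : t ∈ Ioo a b) :
    K.Between F x t := by
  obtain ⟨k, s, hs, y, hy, rfl, ⟨i, hi, hit⟩, j, hj, htj⟩ := hF.between_self x
  refine ⟨k, s, hs, y, hy, rfl, ⟨i, hi, ?_⟩, j, hj, ?_⟩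
  · have : F (s (Pi.single i 1)) ≤ a :=
      not_lt.1 fun h => hv k s hs i ⟨h, lt_of_le_of_lt hit hx.2⟩
    exact this.trans ht.1.le
  · have : b ≤ F (s (Pi.single j 1)) :=
      not_lt.1 fun h => hv k s hs j ⟨lt_of_lt_of_le hx.1 htj, h⟩
    exact ht.2.le.trans this

theorem exists_oddsRel_orb {x : X} {t : ℝ} (hx : F x ∈ Ioo a b) (ht : t ∈ Ioo a b) :
    ∃ k, ∃ s ∈ K.simplex k, ∃ y ∈ stdSimplex ℝ (Fin (k + 1)), ∃ w ∈ stdSimplex ℝ (Fin (k + 1)),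
      s y = x ∧ K.orb F x t = s w ∧ ∃ p ∈ Ioo (0 : ℝ) 1, OddsRel (K.verts s) p y w := by
  obtain ⟨d, s, hs, y, hy, hxy, -⟩ := K.carrier x
  rcases hF.orb_cases (hF.between_of_mem_Ioo hv hx ht) hs hy.1 hxy with
    ⟨e, -, hte, -⟩ | ⟨w, hw, hxw, hrel⟩
  · exact absurd (hte ▸ ht) (hv d s hs e)
  · exact ⟨d, s, hs, y, hy.1, w, hw, hxy, hxw, hrel⟩

theorem orb_orb {x : X} {t r : ℝ} (hx : F x ∈ Ioo a b) (ht : t ∈ Ioo a b) (hr : r ∈ Ioo a b) :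
    K.orb F (K.orb F x t) r = K.orb F x r := by
  obtain ⟨k, s, hs, y, hy, w, hw, rfl, hz, p, hp, hrel⟩ := hF.exists_oddsRel_orb hv hx ht
  rw [hz]
  exact hF.orb_eq_of_oddsRel hs hy hw hp hrel (hF.between_of_mem_Ioo hv hx hr)

/-- The orbits are the vertical lines of the product: project along them to level `c` and keep the
value of `F`. The inverse follows the orbit from level `c` to level `t`. -/
theorem exists_strip_homeomorph [T2Space X] {c : ℝ} (hc : c ∈ Ioo a b) :
    ∃ Φ : (F ⁻¹' Ioo a b) ≃ₜ (F ⁻¹' {c}) × (Ioo a b),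
      ∀ x, ((Φ x).2 : ℝ) = F x ∧ ((Φ x).1 : X) = K.orb F x c := by
  have hself : ∀ x, K.orb F x (F x) = x := fun x =>
    hF.orb_eq (hF.between_self x) (K.orbit_self F x)
  refine ⟨{
    toFun := fun x => (⟨K.orb F x c, hF.map_orb (hF.between_of_mem_Ioo hv x.2 hc)⟩, ⟨F x, x.2⟩)
    invFun := fun q => ⟨K.orb F q.1 q.2, by
      have h1 : F q.1 ∈ Ioo a b := by rw [q.1.2]; exact hc
      rw [mem_preimage, hF.map_orb (hF.between_of_mem_Ioo hv h1 q.2.2)]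
      exact q.2.2⟩
    left_inv := ?_
    right_inv := ?_
    continuous_toFun := ?_
    continuous_invFun := ?_ }, fun x => ⟨rfl, rfl⟩⟩
  · rintro ⟨x, hx⟩
    apply Subtype.ext
    simp only
    rw [hF.orb_orb hv hx hc hx, hself]
  · rintro ⟨⟨z, hz⟩, t, ht⟩
    have hz' : F z = c := hz
    have h1 : F z ∈ Ioo a b := by rw [hz']; exact hc
    refine Prod.ext (Subtype.ext ?_) (Subtype.ext ?_)
    · simp only
      rw [hF.orb_orb hv h1 ht hc, ← hz', hself]
    · simp only
      rw [hF.map_orb (hF.between_of_mem_Ioo hv h1 ht)]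
  · refine Continuous.prodMk ?_ ?_
    · refine Continuous.subtype_mk ?_ _
      exact hF.continuousOn_orb.comp_continuous (f := fun x : F ⁻¹' Ioo a b => ((x : X), c))
        (by fun_prop) fun x => hF.between_of_mem_Ioo hv x.2 hc
    · exact (hF.continuous.comp continuous_subtype_val).subtype_mk _
  · refine Continuous.subtype_mk ?_ _
    refine hF.continuousOn_orb.comp_continuous
      (f := fun q : (F ⁻¹' {c}) × (Ioo a b) => ((q.1 : X), (q.2 : ℝ))) (by fun_prop) fun q => ?_
    refine hF.between_of_mem_Ioo hv ?_ q.2.2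
    rw [q.1.2]; exact hc

end Strip

end IsTransverseMap

section Collapse

variable {F₀ : X → ℝ} {f : ℝ → ℝ}

/-- The map along orbits that sends the `t`-level of `F` to the `f t`-level of `F₀`. -/
noncomputable def collapse (K : LabelledComplex X G) (F F₀ : X → ℝ) (f : ℝ → ℝ) (x : X) : X :=
  K.orb F₀ x (f (F x))

variable (hF : K.IsTransverseMap F) (hF₀ : K.IsTransverseMap F₀) {H : Set ℝ} (hH : ∀ x, F x ∈ H)
  (hmono : MonotoneOn f H)
  (hv : ∀ k, ∀ s ∈ K.simplex k, ∀ i, f (F (s (Pi.single i 1))) = F₀ (s (Pi.single i 1)))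
include hF hH hmono hv

/-- Monotonicity of `f` turns vertex values of `F` bracketing `F x` into vertex values of `F₀`
bracketing `f (F x)`. -/
theorem between_collapse (x : X) : K.Between F₀ x (f (F x)) := by
  obtain ⟨k, s, hs, y, hy, rfl, ⟨i, hi, hit⟩, j, hj, htj⟩ := hF.between_self x
  refine ⟨k, s, hs, y, hy, rfl, ⟨i, hi, ?_⟩, j, hj, ?_⟩
  · simp only [← hv k s hs]; exact hmono (hH _) (hH _) hit
  · simp only [← hv k s hs]; exact hmono (hH _) (hH _) htj

include hF₀

theorem map_collapse (x : X) : F₀ (K.collapse F F₀ f x) = f (F x) :=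
  hF₀.map_orb (between_collapse hF hH hmono hv x)

theorem continuous_collapse [T2Space X] (hf : ContinuousOn f H) :
    Continuous (K.collapse F F₀ f) :=
  hF₀.continuousOn_orb.comp_continuous (f := fun x => (x, f (F x)))
    (continuous_id.prodMk (hf.comp_continuous hF.continuous hH))
    (between_collapse hF hH hmono hv)

/-- For surjectivity, a preimage of `s w` is sought on the orbit of `w` itself: by the intermediate
value theorem some level `t` satisfies `f t = F₀ (s w)`, and the orbit point of `F`-level `t` is
mapped to `s w`. -/
theorem collapse_image (hf : ContinuousOn f H) {k : ℕ} {s : (Fin (k + 1) → ℝ) → X}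
    (hs : s ∈ K.simplex k) : K.collapse F F₀ f '' (s '' stdSimplex ℝ (Fin (k + 1))) =
      s '' stdSimplex ℝ (Fin (k + 1)) := by
  have hb := between_collapse hF hH hmono hv
  apply Subset.antisymm
  · rintro _ ⟨_, ⟨y, hy, rfl⟩, rfl⟩
    obtain ⟨w, hw, ho⟩ := hF₀.exists_isOrbitPoint (hb _) (hF₀.orbit_orb (hb _)) hs hy rfl
    exact ⟨w, ho.1, hw⟩
  · rintro _ ⟨w, hw, rfl⟩
    have hT := hF₀.transverse s hs
    have hinj := K.label_injective s hs
    obtain ⟨e, he, hmin⟩ := IsTransverse.exists_support_min (K.verts s) hw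
    obtain ⟨e', he', hmax⟩ := IsTransverse.exists_support_max (K.verts s) hw
    have hb0 : ∀ t, F (s (Pi.single e 1)) ≤ t → t ≤ F (s (Pi.single e' 1)) →
        IsBetween (fun y => F (s y)) w t ∧
          ∃ y, IsOrbitPoint (K.verts s) (fun y => F (s y)) w t y := by
      intro t h1 h2
      have hbt : IsBetween (fun y => F (s y)) w t := ⟨⟨e, he, h1⟩, e', he', h2⟩
      obtain ⟨z, hz, -⟩ := (hF.transverse s hs).exists_orbitPoint hinj hw hbt
      exact ⟨hbt, z, hz⟩
    have hle : F (s (Pi.single e 1)) ≤ F (s (Pi.single e' 1)) :=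
      ((hF.transverse s hs).le_of_support hw hmin).trans
        ((hF.transverse s hs).ge_of_support hw hmax)
    have hsub : Icc (F (s (Pi.single e 1))) (F (s (Pi.single e' 1))) ⊆ H := by
      intro t ht
      obtain ⟨-, y, -, -, rfl⟩ := hb0 t ht.1 ht.2
      exact hH _
    obtain ⟨t, ht, hft⟩ := intermediate_value_Icc hle (hf.mono hsub)
      (show F₀ (s w) ∈ Icc _ _ by
        rw [hv k s hs, hv k s hs]
        exact ⟨hT.le_of_support hw hmin, hT.ge_of_support hw hmax⟩)
    obtain ⟨hbt, y, hy⟩ := hb0 t ht.1 ht.2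
    have hyt : F (s y) = t := hy.2.2
    refine ⟨s y, ⟨y, hy.1, rfl⟩, hF₀.orb_eq (hb _) ?_⟩
    rw [hyt, hft]
    refine ⟨k, s, hs, y, hy.1, w, rfl, rfl, hw, ?_, rfl⟩
    rcases (hF.transverse s hs).orbit_cases hinj hw hbt hy with
      ⟨e, -, rfl, -, hext⟩ | ⟨p, hp, hrel, -⟩
    -- If the orbit point found is an extreme vertex of the support, then `w` has the same
    -- `F₀`-value as this vertex and must equal it.
    · have heq : F₀ (s (Pi.single e 1)) = F₀ (s w) := by rw [← hv k s hs, ← hft, ← hyt]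
      have : w = Pi.single e 1 := by
        rcases hext with h | h
        · exact hT.eq_single_of_le hinj hw h heq.ge
        · exact hT.eq_single_of_ge hinj hw h heq.le
      rw [this]
      exact ⟨1 / 2, by norm_num, fun g => by ring⟩
    · exact ⟨1 - p, ⟨by linarith [hp.2], by linarith [hp.1]⟩, hrel.symm⟩

/-- If the common image is not a vertex, both points lie on its open orbit, where `F` is injective.
If it is a vertex with the `F`-value of `x`, then `x` and `y` are this vertex. Otherwise the vertex
has another `F`-value with the same image under `f`, which is the exceptional case. -/
theorem collapse_injective {x y : X} (hxy : F x = F y)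
    (hκ : K.collapse F F₀ f x = K.collapse F F₀ f y) :
    x = y ∨ ∃ k, ∃ s ∈ K.simplex k, ∃ i, K.collapse F F₀ f x = s (Pi.single i 1) ∧
      F (s (Pi.single i 1)) ≠ F x ∧ f (F (s (Pi.single i 1))) = f (F x) := by
  have hb := between_collapse hF hH hmono hv
  have hvert : ∀ x : X, (∃ k, ∃ s ∈ K.simplex k, ∃ i, K.collapse F F₀ f x = s (Pi.single i 1) ∧
      f (F (s (Pi.single i 1))) = f (F x) ∧ (F (s (Pi.single i 1)) = F x →
        x = K.collapse F F₀ f x)) ∨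
      (¬ K.IsVertex (K.collapse F F₀ f x)) ∧
      ∃ k, ∃ s ∈ K.simplex k, ∃ a ∈ stdSimplex ℝ (Fin (k + 1)), ∃ w ∈ stdSimplex ℝ (Fin (k + 1)),
        s a = x ∧ K.collapse F F₀ f x = s w ∧ ∃ p ∈ Ioo (0 : ℝ) 1, OddsRel (K.verts s) p a w := by
    intro x
    obtain ⟨d, s, hs, a, ha, hxa, -⟩ := K.carrier x
    rcases hF₀.orb_cases (hb x) hs ha.1 hxa with ⟨e, he, hte, hext⟩ | ⟨w, hw, hz, hrel⟩
    · refine Or.inl ⟨d, s, hs, e, he, by rw [hv d s hs, hte], fun heq => ?_⟩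
      rw [collapse, he, ← hxa]
      congr 1
      rw [← hxa] at heq
      rcases hext with h | h
      · exact (hF.transverse s hs).eq_single_of_le (K.label_injective s hs) ha.1 h heq.ge
      · exact (hF.transverse s hs).eq_single_of_ge (K.label_injective s hs) ha.1 h heq.le
    · by_cases hver : K.IsVertex (K.collapse F F₀ f x)
      · obtain ⟨k', s', hs', i', hi'⟩ := hver
        obtain ⟨i, rfl⟩ := K.exists_single_of_eq hs' hs hw (hi'.symm.trans hz)
        obtain ⟨p, hp, hrel⟩ := hrel
        have hai : a = Pi.single i 1 := eq_single_of_forall_ne ha.1 fun j hj =>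
          OddsRel.eq_zero (K.label_injective s hs) ⟨by linarith [hp.2], by linarith [hp.1]⟩
            hw hrel.symm (by simp [hj])
        refine Or.inl ⟨d, s, hs, i, hz, by rw [← hxa, hai], fun _ => ?_⟩
        rw [collapse, hz, ← hxa, hai]
      · exact Or.inr ⟨hver, d, s, hs, a, ha.1, w, hw, hxa, hz, hrel⟩
  rcases hvert x with ⟨k, s, hs, i, hi, hfi, hF1⟩ | ⟨hnx, k, s, hs, a, ha, w, hw, hxa, hz, p, hp, hr⟩
  · by_cases hne : F (s (Pi.single i 1)) = F x
    · rcases hvert y with ⟨k', s', hs', i', hi', hfi', hF1'⟩ | ⟨hny, -⟩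
      · have : s' (Pi.single i' 1) = s (Pi.single i 1) := by rw [← hi, hκ, hi']
        left
        rw [hF1 hne, hF1' (by rw [this, hne, hxy]), hκ]
      · exact absurd ⟨k, s, hs, i, by rw [← hκ, hi]⟩ hny
    · exact Or.inr ⟨k, s, hs, i, hi, hne, hfi⟩
  · rcases hvert y with ⟨k', s', hs', i', hi', -⟩ |
      ⟨-, k', s', hs', b, hb', w', hw', hyb, hz', p', hp', hr'⟩
    · exact absurd ⟨k', s', hs', i', by rw [hκ, hi']⟩ hnx
    left
    obtain ⟨d, s₀, hs₀, w₀, hw₀, -, hcar⟩ := K.carrier (K.collapse F F₀ f x)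
    have key : ∀ (k : ℕ) (s : (Fin (k + 1) → ℝ) → X), s ∈ K.simplex k →
        ∀ a ∈ stdSimplex ℝ (Fin (k + 1)), ∀ w ∈ stdSimplex ℝ (Fin (k + 1)),
        K.collapse F F₀ f x = s w → ∀ p ∈ Ioo (0 : ℝ) 1, OddsRel (K.verts s) p a w →
        ∃ a₀ ∈ stdSimplex ℝ (Fin (d + 1)), s₀ a₀ = s a ∧ OddsRel (K.verts s₀) p a₀ w₀ := by
      intro k s hs a ha w hw hz p hp hr
      obtain ⟨g, rfl, hg⟩ := hcar k s hs w hw hz.symm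
      have hag : ∀ i, i ∉ range g → a i = 0 := fun i hi =>
        OddsRel.eq_zero (K.label_injective s hs) ⟨by linarith [hp.2], by linarith [hp.1]⟩
          hw hr.symm (faceMap_apply_of_notMem g w₀ hi)
      refine ⟨a ∘ g, comp_mem_stdSimplex g ha hag, ?_, ?_⟩
      · rw [← hg _ (comp_mem_stdSimplex g ha hag), faceMap_comp_self g hag]
      · rw [← verts_comp hg, ← oddsRel_faceMap, faceMap_comp_self g hag]
        exact hr
    obtain ⟨a₀, ha₀, hea, hra⟩ := key k s hs a ha w hw hz p hp hr
    obtain ⟨b₀, hb₀, heb, hrb⟩ := key k' s' hs' b hb' w' hw' (hκ.trans hz') p' hp' hr'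
    obtain ⟨q, hq, hab⟩ := hra.symm.comp hrb.symm ⟨by linarith [hp.2], by linarith [hp.1]⟩
      ⟨by linarith [hp'.2], by linarith [hp'.1]⟩
    have := (hF.transverse s₀ hs₀).eq_of_oddsRel (K.label_injective s₀ hs₀) hb₀ ha₀ hq hab
      (by rw [hea, heb, hxa, hyb, hxy])
    rw [← hxa, ← hyb, ← hea, ← heb, this]

end Collapse

end LabelledComplex

/-! ### Gluing over simplices, and automorphisms. -/

namespace LabelledComplex

variable {X G : Type*} [TopologicalSpace X] {K : LabelledComplex X G}

/-- A convergent ultrafilter lives on one simplex, and by compactness it lifts to a convergent one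
in the standard simplex. -/
theorem continuous_of_simplex [T2Space X] {Z : Type*} [TopologicalSpace Z] {F : X → Z}
    (h : ∀ k, ∀ s ∈ K.simplex k, ContinuousOn (fun y => F (s y)) (stdSimplex ℝ (Fin (k + 1)))) :
    Continuous F := by
  refine continuous_iff_continuousAt.2 fun x => ?_
  rw [ContinuousAt, Filter.tendsto_iff_ultrafilter]
  intro U hU
  obtain ⟨k, s, hs, hsU⟩ := K.mem_ultrafilter x U hU
  have hev : ∀ᶠ q in U, ∃ y, y ∈ stdSimplex ℝ (Fin (k + 1)) ∧ s y = q := hsU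
  obtain ⟨r, hr⟩ := hev.choice
  obtain ⟨y, hy, hlim⟩ := isCompact_iff_ultrafilter_le_nhds.1 (isCompact_stdSimplex ℝ _) (U.map r)
    (by rw [Filter.le_principal_iff]; exact hr.mono fun q hq => hq.1)
  have l1 : Filter.Tendsto r (U : Filter X) (𝓝[stdSimplex ℝ (Fin (k + 1))] y) :=
    tendsto_nhdsWithin_iff.2 ⟨hlim, hr.mono fun q hq => hq.1⟩
  have hxy : s y = x := tendsto_nhds_unique
    ((((K.continuousOn s hs) y hy).tendsto.comp l1).congr' (hr.mono fun q hq => hq.2)) hU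
  have := ((h k s hs) y hy).tendsto.comp l1
  simp only [hxy] at this
  exact this.congr' (hr.mono fun q hq => by simp only [Function.comp, hq.2])

/-- `τ` is an automorphism of the complex that multiplies the labels by `g`. -/
structure IsAutomorphism [Group G] (K : LabelledComplex X G) (g : G) (τ : X → X) : Prop where
  simplex : ∀ k, ∀ s ∈ K.simplex k, (fun y => τ (s y)) ∈ K.simplex k
  label : ∀ k, ∀ s ∈ K.simplex k, ∀ i, K.label (τ (s (Pi.single i 1))) =
    g * K.label (s (Pi.single i 1))

/-- An automorphism carries orbits to orbits, because left multiplication preserves the order of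
labels, and `hfr` matches the levels. Uniqueness of the orbit point does the rest. -/
theorem IsAutomorphism.collapse [LinearOrder G] [Group G] [MulLeftStrictMono G]
    {F F₀ : X → ℝ} {f : ℝ → ℝ} (hF : K.IsTransverseMap F) (hF₀ : K.IsTransverseMap F₀) {H : Set ℝ}
    (hH : ∀ x, F x ∈ H) (hmono : MonotoneOn f H)
    (hv : ∀ k, ∀ s ∈ K.simplex k, ∀ i, f (F (s (Pi.single i 1))) = F₀ (s (Pi.single i 1)))
    {g : G} {τ : X → X} (hτ : K.IsAutomorphism g τ) {r r₀ : ℝ → ℝ} (hr : ∀ x, F (τ x) = r (F x))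
    (hr₀ : ∀ x, F₀ (τ x) = r₀ (F₀ x)) (hfr : ∀ t ∈ H, f (r t) = r₀ (f t)) (x : X) :
    K.collapse F F₀ f (τ x) = τ (K.collapse F F₀ f x) := by
  have hb := between_collapse hF hH hmono hv
  refine hF₀.orb_eq (hb (τ x)) ?_
  obtain ⟨k, s, hs, y, hy, w, rfl, hw, hwΔ, ⟨p, hp, hrel⟩, ht⟩ := hF₀.orbit_orb (hb x)
  refine ⟨k, _, hτ.simplex k s hs, y, hy, w, rfl, ?_, hwΔ, ⟨p, hp, ?_⟩, ?_⟩
  · simp only [hw]; rfl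
  · have : K.verts (fun y => τ (s y)) = fun i => g * K.verts s i :=
      funext fun i => hτ.label k s hs i
    rw [this]
    exact oddsRel_mul_left g hrel
  · simp only at ht ⊢
    rw [hr, hfr _ (hH _), hr₀, ht]

end LabelledComplex

/-! ### Transverse functions from families of linear forms. -/

section FormFamily

variable {G : Type*}

/-- A coherent family of linear forms, one for each labelled simplex and each level, such that the
zero sets of the forms on each labelled simplex decompose the simplex. -/
structure IsFormFamily (P : ℕ → Prop) (a : G → ℝ)
    (Form : ∀ {k : ℕ}, (Fin (k + 1) → G) → ℝ → (Fin (k + 1) → ℝ) → Prop) : Prop where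
  restrict : ∀ {k d : ℕ} (f : Fin (d + 1) ↪ Fin (k + 1)) {lab : Fin (k + 1) → G} {t : ℝ}
    {c : Fin (k + 1) → ℝ}, Form lab t c → Form (lab ∘ f) t (c ∘ f)
  exists_form : ∀ {k : ℕ}, P k → ∀ {lab : Fin (k + 1) → G}, Function.Injective lab →
    ∀ t, ∃ c, Form lab t c
  neg : ∀ {k : ℕ} {lab : Fin (k + 1) → G} {t t' : ℝ} {c c' : Fin (k + 1) → ℝ}, t < t' →
    Form lab t c → Form lab t' c' → ∀ y ∈ stdSimplex ℝ (Fin (k + 1)), ∑ i, c i * y i ≤ 0 →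
    ∑ i, c' i * y i < 0
  unique : ∀ {k : ℕ} {lab : Fin (k + 1) → G} {t : ℝ} {c c' : Fin (k + 1) → ℝ},
    Form lab t c → Form lab t c' → ∀ y ∈ stdSimplex ℝ (Fin (k + 1)), ∑ i, c i * y i = 0 →
    ∑ i, c' i * y i = 0
  solve : ∀ {k : ℕ}, P k → ∀ {lab : Fin (k + 1) → G}, Function.Injective lab →
    ∀ y ∈ stdSimplex ℝ (Fin (k + 1)), ∃ t c, Form lab t c ∧ ∑ i, c i * y i = 0
  vertex : ∀ {k : ℕ} {lab : Fin (k + 1) → G} {c : Fin (k + 1) → ℝ} (i), Form lab (a (lab i)) c →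
    c i = 0

open Classical in
/-- The level on which a point of a labelled simplex lies. -/
noncomputable def levelOf (Form : ∀ {k : ℕ}, (Fin (k + 1) → G) → ℝ → (Fin (k + 1) → ℝ) → Prop)
    {k : ℕ} (lab : Fin (k + 1) → G) (y : Fin (k + 1) → ℝ) : ℝ :=
  if h : ∃ t c, Form lab t c ∧ ∑ i, c i * y i = 0 then h.choose else 0

namespace IsFormFamily

variable {P : ℕ → Prop} {a : G → ℝ}
  {Form : ∀ {k : ℕ}, (Fin (k + 1) → G) → ℝ → (Fin (k + 1) → ℝ) → Prop}
  (h : IsFormFamily P a Form)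
include h

theorem levelOf_eq {k : ℕ} {lab : Fin (k + 1) → G} {y : Fin (k + 1) → ℝ}
    (hy : y ∈ stdSimplex ℝ (Fin (k + 1))) {t : ℝ} {c : Fin (k + 1) → ℝ} (hc : Form lab t c)
    (hcy : ∑ i, c i * y i = 0) : levelOf Form lab y = t := by
  have hex : ∃ t c, Form lab t c ∧ ∑ i, c i * y i = 0 := ⟨t, c, hc, hcy⟩
  rw [levelOf, dif_pos hex]
  obtain ⟨c', hc', hcy'⟩ := hex.choose_spec
  rcases lt_trichotomy hex.choose t with hlt | heq | hlt
  · exact absurd hcy (h.neg hlt hc' hc y hy hcy'.le).ne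
  · exact heq
  · exact absurd hcy' (h.neg hlt hc hc' y hy hcy.le).ne

theorem isLevelForm {k : ℕ} (hk : P k) {lab : Fin (k + 1) → G} (hlab : Function.Injective lab)
    {t : ℝ} {c : Fin (k + 1) → ℝ} (hc : Form lab t c) : IsLevelForm (levelOf Form lab) t c := by
  intro y hy
  obtain ⟨T, c', hc', hcy'⟩ := h.solve hk hlab y hy
  rw [h.levelOf_eq hy hc' hcy']
  rcases lt_trichotomy t T with hlt | rfl | hlt
  · have : 0 < ∑ i, c i * y i := by
      by_contra! hcon
      exact (h.neg hlt hc hc' y hy hcon).ne hcy'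
    exact ⟨iff_of_true this hlt, iff_of_false this.not_gt hlt.not_gt⟩
  · rw [h.unique hc' hc y hy hcy']
    simp
  · have := h.neg hlt hc' hc y hy hcy'.le
    exact ⟨iff_of_false this.not_gt hlt.not_gt, iff_of_true this hlt⟩

theorem levelOf_single {k : ℕ} (hk : P k) {lab : Fin (k + 1) → G} (hlab : Function.Injective lab)
    (i : Fin (k + 1)) : levelOf Form lab (Pi.single i 1) = a (lab i) := by
  obtain ⟨c, hc⟩ := h.exists_form hk hlab (a (lab i))
  refine h.levelOf_eq (single_mem_stdSimplex ℝ i) hc ?_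
  rw [sum_mul_single, h.vertex i hc]

/-- The sub- and superlevel sets are cut out by strict linear inequalities, so they are relatively
open; this is continuity. -/
theorem isTransverse [LinearOrder G] (ha : StrictMono a) {k : ℕ} (hk : P k) {lab : Fin (k + 1) → G}
    (hlab : Function.Injective lab) : IsTransverse lab (levelOf Form lab) := by
  have hform : ∀ t, ∃ c, IsLevelForm (levelOf Form lab) t c := fun t => by
    obtain ⟨c, hc⟩ := h.exists_form hk hlab t
    exact ⟨c, h.isLevelForm hk hlab hc⟩
  refine ⟨?_, hform, fun i j => ?_⟩
  · have hopen : ∀ c : Fin (k + 1) → ℝ, Continuous fun y : Fin (k + 1) → ℝ => ∑ i, c i * y i :=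
      fun c => by fun_prop
    intro y hy
    rw [ContinuousWithinAt, tendsto_order]
    refine ⟨fun t ht => ?_, fun t ht => ?_⟩
    · obtain ⟨c, hc⟩ := hform t
      filter_upwards [self_mem_nhdsWithin, nhdsWithin_le_nhds
        ((isOpen_lt continuous_const (hopen c)).mem_nhds ((hc y hy).1.2 ht))] with z hz hcz
      exact (hc z hz).1.1 hcz
    · obtain ⟨c, hc⟩ := hform t
      filter_upwards [self_mem_nhdsWithin, nhdsWithin_le_nhds
        ((isOpen_lt (hopen c) continuous_const).mem_nhds ((hc y hy).2.2 ht))] with z hz hcz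
      exact (hc z hz).2.1 hcz
  · rw [h.levelOf_single hk hlab, h.levelOf_single hk hlab, ha.lt_iff_lt]

/-- A form on the simplex restricts to a form of the same level on the face; hence the local
functions agree and glue. -/
theorem levelOf_faceMap {k d : ℕ} (hk : P k) (f : Fin (d + 1) ↪ Fin (k + 1)) {lab : Fin (k + 1) → G}
    (hlab : Function.Injective lab) {w : Fin (d + 1) → ℝ} (hw : w ∈ stdSimplex ℝ (Fin (d + 1))) :
    levelOf Form (lab ∘ f) w = levelOf Form lab (faceMap f w) := by
  obtain ⟨t, c, hc, hcw⟩ := h.solve hk hlab _ (faceMap_mem f hw)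
  rw [h.levelOf_eq (faceMap_mem f hw) hc hcw]
  rw [sum_mul_faceMap] at hcw
  exact h.levelOf_eq hw (h.restrict f hc) hcw

theorem exists_transverseMap [LinearOrder G] {X : Type*} [TopologicalSpace X] [T2Space X] (K : LabelledComplex X G)
    (hP : ∀ k, (K.simplex k).Nonempty → P k) (ha : StrictMono a) :
    ∃ F : X → ℝ, K.IsTransverseMap F ∧ ∀ k, ∀ s ∈ K.simplex k,
      ∀ y ∈ stdSimplex ℝ (Fin (k + 1)), F (s y) = levelOf Form (K.verts s) y := by
  have hex : ∀ x, ∃ T, ∀ k, ∀ s ∈ K.simplex k, ∀ y ∈ stdSimplex ℝ (Fin (k + 1)), s y = x →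
      T = levelOf Form (K.verts s) y := by
    intro x
    obtain ⟨d, s₀, hs₀, w₀, hw₀, -, hcar⟩ := K.carrier x
    refine ⟨levelOf Form (K.verts s₀) w₀, fun k s hs y hy hx => ?_⟩
    obtain ⟨f, rfl, hf⟩ := hcar k s hs y hy hx
    rw [← LabelledComplex.verts_comp hf]
    exact h.levelOf_faceMap (hP k ⟨s, hs⟩) f (K.label_injective s hs) hw₀.1
  choose F hF using hex
  have hF' : ∀ k, ∀ s ∈ K.simplex k, ∀ y ∈ stdSimplex ℝ (Fin (k + 1)),
      F (s y) = levelOf Form (K.verts s) y := fun k s hs y hy => hF _ k s hs y hy rfl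
  have htr : ∀ {k : ℕ}, ∀ s ∈ K.simplex k, IsTransverse (K.verts s) fun y => F (s y) := by
    intro k s hs
    have h0 := h.isTransverse ha (hP k ⟨s, hs⟩) (K.label_injective s hs)
    refine ⟨h0.continuousOn.congr fun y hy => hF' k s hs y hy, fun t => ?_, fun i j => ?_⟩
    · obtain ⟨c, hc⟩ := h0.exists_form t
      refine ⟨c, fun y hy => ?_⟩
      simp only [hF' k s hs y hy]
      exact hc y hy
    · simp only [hF' k s hs _ (single_mem_stdSimplex ℝ i), hF' k s hs _ (single_mem_stdSimplex ℝ j)]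
      exact h0.lt_iff i j
  exact ⟨F, ⟨LabelledComplex.continuous_of_simplex fun k s hs => (htr s hs).continuousOn, htr⟩, hF'⟩

/-- Equivariance of the level function, if the forms are invariant. -/
theorem levelOf_mul [Group G] (g : G) (r : ℝ → ℝ)
    (hinv : ∀ {k : ℕ} {lab : Fin (k + 1) → G} {t : ℝ} {c : Fin (k + 1) → ℝ}, Form lab t c →
      Form (fun i => g * lab i) (r t) c) {k : ℕ} (hk : P k) {lab : Fin (k + 1) → G}
    (hlab : Function.Injective lab) {y : Fin (k + 1) → ℝ} (hy : y ∈ stdSimplex ℝ (Fin (k + 1))) :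
    levelOf Form (fun i => g * lab i) y = r (levelOf Form lab y) := by
  obtain ⟨t, c, hc, hcy⟩ := h.solve hk hlab y hy
  rw [h.levelOf_eq hy hc hcy, h.levelOf_eq hy (hinv hc) hcy]

end IsFormFamily

end FormFamily

section VertexForms

variable {G : Type*} {a : G → ℝ} {γ : G → ℝ → ℝ}

/-- For a fixed point the value of the form is a positive combination of strictly decreasing
functions of the level. It is nonnegative at the least vertex value and nonpositive at the greatest,
so it vanishes for exactly one level. -/
theorem isFormFamily_vertex (hcont : ∀ g, Continuous (γ g)) (hanti : ∀ g, StrictAnti (γ g))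
    (hzero : ∀ g, γ g (a g) = 0) :
    IsFormFamily (fun _ => True) a fun lab t c => ∀ i, c i = γ (lab i) t where
  restrict := fun f _ _ _ h l => h (f l)
  exists_form := fun _ _ _ t => ⟨_, fun _ => rfl⟩
  neg := by
    intro k lab t t' c c' htt hc hc' y hy hle
    refine lt_of_lt_of_le ?_ hle
    obtain ⟨i, hi⟩ : ∃ i, y i ≠ 0 := by
      by_contra! hall
      have := hy.2
      simp [hall] at this
    refine Finset.sum_lt_sum (fun j _ => ?_) ⟨i, Finset.mem_univ i, ?_⟩
    · rw [hc, hc']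
      exact mul_le_mul_of_nonneg_right (hanti _ htt).le (hy.1 j)
    · rw [hc, hc']
      exact mul_lt_mul_of_pos_right (hanti _ htt) ((hy.1 i).lt_of_ne' hi)
  unique := by
    intro k lab t c c' hc hc' y _ h
    rwa [show c' = c from funext fun i => by rw [hc, hc']]
  solve := by
    intro k _ lab _ y hy
    obtain ⟨i, -, hi⟩ := Finset.univ.exists_min_image (fun j => a (lab j)) ⟨0, Finset.mem_univ 0⟩
    obtain ⟨j, -, hj⟩ := Finset.univ.exists_max_image (fun j => a (lab j)) ⟨0, Finset.mem_univ 0⟩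
    have hc : Continuous fun t => ∑ l, γ (lab l) t * y l := by fun_prop
    have h1 : ∑ l, γ (lab l) (a (lab j)) * y l ≤ 0 :=
      Finset.sum_nonpos fun l _ => mul_nonpos_of_nonpos_of_nonneg
        (by rw [← hzero (lab l)]; exact (hanti _).antitone (hj l (Finset.mem_univ l))) (hy.1 l)
    have h2 : 0 ≤ ∑ l, γ (lab l) (a (lab i)) * y l :=
      Finset.sum_nonneg fun l _ => mul_nonneg
        (by rw [← hzero (lab l)]; exact (hanti _).antitone (hi l (Finset.mem_univ l))) (hy.1 l)
    obtain ⟨t, -, ht⟩ := intermediate_value_Icc' (hi j (Finset.mem_univ j)) hc.continuousOn ⟨h1, h2⟩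
    exact ⟨t, _, fun _ => rfl, ht⟩
  vertex := fun i h => by rw [h, hzero]

end VertexForms

/-! ### Forms with prescribed crossing points on the edges. -/

section EdgeForms

variable {G : Type*} [LinearOrder G] {a : G → ℝ} {v : G → G → ℝ → ℝ}

/-- The linear form `c` vanishes on the points of level `t` on the edges, where `v g h t` is the
coordinate at `g` of the point of level `t` on an edge from `g` to `h`. -/
structure IsEdgeForm (a : G → ℝ) (v : G → G → ℝ → ℝ) {k : ℕ} (lab : Fin (k + 1) → G) (t : ℝ)
    (c : Fin (k + 1) → ℝ) : Prop where
  pos_iff : ∀ i, 0 < c i ↔ t < a (lab i)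
  neg_iff : ∀ i, c i < 0 ↔ a (lab i) < t
  edge : ∀ i j, a (lab i) < t → t < a (lab j) →
    c i * v (lab i) (lab j) t + c j * (1 - v (lab i) (lab j) t) = 0

/-- Coordinates of points on edges, as functions of the level. -/
structure IsEdgeCoordinate (a : G → ℝ) (v : G → G → ℝ → ℝ) : Prop where
  continuous : ∀ g h, g < h → Continuous (v g h)
  anti : ∀ g h, g < h → StrictAnti (v g h)
  left : ∀ g h, g < h → v g h (a g) = 1
  right : ∀ g h, g < h → v g h (a h) = 0

omit [LinearOrder G] in
theorem IsEdgeForm.eq_zero {k : ℕ} {lab : Fin (k + 1) → G} {t : ℝ} {c : Fin (k + 1) → ℝ}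
    (h : IsEdgeForm a v lab t c) {i : Fin (k + 1)} (hi : a (lab i) = t) : c i = 0 := by
  have h1 := h.pos_iff i
  have h2 := h.neg_iff i
  rw [hi] at h1 h2
  exact le_antisymm (not_lt.1 fun h' => lt_irrefl _ (h1.1 h'))
    (not_lt.1 fun h' => lt_irrefl _ (h2.1 h'))

omit [LinearOrder G] in
theorem isEdgeForm_of_ge_or_le {k : ℕ} {lab : Fin (k + 1) → G} {t : ℝ}
    (h : (∀ i, t ≤ a (lab i)) ∨ ∀ i, a (lab i) ≤ t) : IsEdgeForm a v lab t fun i => a (lab i) - t :=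
  ⟨fun i => sub_pos, fun i => sub_neg, fun i j hi hj => by
    rcases h with h | h
    · exact absurd hi (h i).not_gt
    · exact absurd hj (h j).not_gt⟩

section Compare

variable (ha : StrictMono a) (hv : IsEdgeCoordinate a v) {k : ℕ} {lab : Fin (k + 1) → G}
  {t t' : ℝ} {c c' : Fin (k + 1) → ℝ} (hc : IsEdgeForm a v lab t c)
  (hc' : IsEdgeForm a v lab t' c')
include ha hv hc hc'

/-- On an edge crossing the level, `c j / (-c i)` equals `v / (1 - v)`, and `v` decreases as the
level rises. The inequality is this comparison, cleared of denominators. -/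
theorem IsEdgeForm.ratio_le (htt : t ≤ t') {i j : Fin (k + 1)} (hi : a (lab i) < t)
    (hj : t' < a (lab j)) : c' j * c i ≥ c' i * c j ∧ (t < t' → c' j * c i > c' i * c j) := by
  have hij : lab i < lab j := ha.lt_iff_lt.1 (hi.trans_le (htt.trans hj.le))
  have e1 := hc.edge i j hi (htt.trans_lt hj)
  have e2 := hc'.edge i j (hi.trans_le htt) hj
  have hv1 : v (lab i) (lab j) t < 1 := by
    rw [← hv.left _ _ hij]; exact hv.anti _ _ hij hi
  have hv2 : 0 < v (lab i) (lab j) t' := by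
    rw [← hv.right _ _ hij]; exact hv.anti _ _ hij hj
  have hvv : v (lab i) (lab j) t' ≤ v (lab i) (lab j) t := (hv.anti _ _ hij).antitone htt
  have hvs : t < t' → v (lab i) (lab j) t' < v (lab i) (lab j) t := fun h => hv.anti _ _ hij h
  have c1 := (hc.neg_iff i).2 hi
  have c2 := (hc'.neg_iff i).2 (hi.trans_le htt)
  have c3 := (hc.pos_iff j).2 (htt.trans_lt hj)
  have c4 := (hc'.pos_iff j).2 hj
  generalize v (lab i) (lab j) t = α at *
  generalize v (lab i) (lab j) t' = β at *
  have f1 : c j = -c i * α / (1 - α) := by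
    rw [eq_div_iff (by linarith)]; linarith
  have f2 : c' j = -c' i * β / (1 - β) := by
    rw [eq_div_iff (by linarith)]; linarith
  have hmul : 0 < c' i * c i := mul_pos_of_neg_of_neg c2 c1
  have key : c' j * c i - c' i * c j = c' i * c i * ((α - β) / ((1 - α) * (1 - β))) := by
    rw [f1, f2]
    have h1 : 1 - α ≠ 0 := by linarith
    have h2 : 1 - β ≠ 0 := by linarith
    field_simp
    ring
  have hden : 0 < (1 - α) * (1 - β) := mul_pos (by linarith) (by linarith)
  refine ⟨?_, fun h => ?_⟩
  · have := mul_nonneg hmul.le (div_nonneg (sub_nonneg.2 hvv) hden.le)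
    linarith
  · have := mul_pos hmul (div_pos (sub_pos.2 (hvs h)) hden)
    linarith

/-- Forms are comparable only after rescaling. The factor `r` is the least ratio `c' i / c i` over
the vertices below `t`; this choice settles these vertices, and `ratio_le` for a minimizing vertex
settles those above `t'`. At the remaining vertices `c'` is at most `0`. -/
theorem IsEdgeForm.exists_scale (htt : t ≤ t') (hL : ∃ i, a (lab i) < t)
    : ∃ r > 0, (∀ l, c' l ≤ r * c l) ∧
      (t < t' → ∀ l, t ≤ a (lab l) → c' l < r * c l) := by
  classical
  obtain ⟨i₀, hi₀⟩ := hL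
  obtain ⟨i, hi, hmin⟩ := (Finset.univ.filter fun i => a (lab i) < t).exists_min_image
    (fun i => c' i / c i) ⟨i₀, by simpa using hi₀⟩
  simp only [Finset.mem_filter, Finset.mem_univ, true_and] at hi hmin
  have hci := (hc.neg_iff i).2 hi
  have hci' := (hc'.neg_iff i).2 (hi.trans_le htt)
  have hr : 0 < c' i / c i := div_pos_of_neg_of_neg hci' hci
  have hU : ∀ l, t ≤ a (lab l) → c' l ≤ c' i / c i * c l ∧ (t < t' → c' l < c' i / c i * c l) := by
    intro l hl
    have hcl : 0 ≤ c l := not_lt.1 fun h => hl.not_gt ((hc.neg_iff l).1 h)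
    rcases lt_trichotomy (a (lab l)) t' with h | h | h
    · have h1 := (hc'.neg_iff l).2 h
      have h2 := mul_nonneg hr.le hcl
      exact ⟨by linarith, fun _ => by linarith⟩
    · rw [hc'.eq_zero h]
      exact ⟨mul_nonneg hr.le hcl, fun h' => mul_pos hr ((hc.pos_iff l).2 (h ▸ h'))⟩
    · obtain ⟨h1, h2⟩ := IsEdgeForm.ratio_le ha hv hc hc' htt hi h
      constructor
      · rw [div_mul_eq_mul_div, le_div_iff_of_neg hci]
        exact h1
      · intro h'
        rw [div_mul_eq_mul_div, lt_div_iff_of_neg hci]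
        exact h2 h'
  refine ⟨c' i / c i, hr, fun l => ?_, fun h l hl => (hU l hl).2 h⟩
  rcases lt_or_ge (a (lab l)) t with hl | hl
  · have h1 := (hc.neg_iff l).2 hl
    have h2 := hmin l hl
    calc c' l = c' l / c l * c l := (div_mul_cancel₀ _ h1.ne).symm
      _ ≤ _ := mul_le_mul_of_nonpos_right h2 h1.le
  · exact (hU l hl).1

/-- If some vertex is below `t`, compare with the rescaled form, strictly at any vertex of the
support not below `t`. If none is, `c` is nonnegative and the hypothesis puts the support of `y` on
the zeros of `c`. -/
theorem IsEdgeForm.neg_of_lt (htt : t < t') {y : Fin (k + 1) → ℝ}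
    (hy : y ∈ stdSimplex ℝ (Fin (k + 1))) (h : ∑ i, c i * y i ≤ 0) : ∑ i, c' i * y i < 0 := by
  obtain ⟨e, he⟩ : ∃ i, y i ≠ 0 := by
    by_contra! hall
    have := hy.2
    simp [hall] at this
  have hye := (hy.1 e).lt_of_ne' he
  by_cases hL : ∃ i, a (lab i) < t
  · obtain ⟨r, hr, h1, h2⟩ := IsEdgeForm.exists_scale ha hv hc hc' htt.le hL
    by_cases hsupp : ∃ l, y l ≠ 0 ∧ t ≤ a (lab l)
    · obtain ⟨l, hl, htl⟩ := hsupp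
      calc ∑ i, c' i * y i < ∑ i, r * c i * y i := by
            refine Finset.sum_lt_sum (fun j _ => mul_le_mul_of_nonneg_right (h1 j) (hy.1 j))
              ⟨l, Finset.mem_univ l, mul_lt_mul_of_pos_right (h2 htt l htl)
                ((hy.1 l).lt_of_ne' hl)⟩
        _ = r * ∑ i, c i * y i := by rw [Finset.mul_sum]; simp only [mul_assoc]
        _ ≤ 0 := mul_nonpos_of_nonneg_of_nonpos hr.le h
    · push Not at hsupp
      refine Finset.sum_neg' (fun j _ => ?_) ⟨e, Finset.mem_univ e, mul_neg_of_neg_of_pos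
        ((hc'.neg_iff e).2 ((hsupp e he).trans htt)) hye⟩
      by_cases hj : y j = 0
      · simp [hj]
      · exact mul_nonpos_of_nonpos_of_nonneg ((hc'.neg_iff j).2 ((hsupp j hj).trans htt)).le (hy.1 j)
  · push Not at hL
    have hnn : ∀ i ∈ Finset.univ, 0 ≤ c i * y i := fun i _ =>
      mul_nonneg (not_lt.1 fun h' => (hL i).not_gt ((hc.neg_iff i).1 h')) (hy.1 i)
    have h0 := (Finset.sum_eq_zero_iff_of_nonneg hnn).1 (le_antisymm h (Finset.sum_nonneg hnn))
    have hneg : ∀ j, y j ≠ 0 → c' j < 0 := fun j hj => by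
      have h1 := (mul_eq_zero.1 (h0 j (Finset.mem_univ j))).resolve_right hj
      refine (hc'.neg_iff j).2 (lt_of_le_of_lt ?_ htt)
      by_contra! hlt
      exact ((hc.pos_iff j).2 hlt).ne' h1
    refine Finset.sum_neg' (fun j _ => ?_) ⟨e, Finset.mem_univ e, mul_neg_of_neg_of_pos
        (hneg e he) hye⟩
    by_cases hj : y j = 0
    · simp [hj]
    · exact mul_nonpos_of_nonpos_of_nonneg (hneg j hj).le (hy.1 j)

end Compare

/-- With a vertex below the level, rescaling in both directions bounds each form by a positive
multiple of the other. With none, both forms are nonnegative with the same zeros. -/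
theorem IsEdgeForm.eq_zero_of_eq_zero (ha : StrictMono a) (hv : IsEdgeCoordinate a v) {k : ℕ}
    {lab : Fin (k + 1) → G} {t : ℝ} {c c' : Fin (k + 1) → ℝ} (hc : IsEdgeForm a v lab t c)
    (hc' : IsEdgeForm a v lab t c') {y : Fin (k + 1) → ℝ} (hy : y ∈ stdSimplex ℝ (Fin (k + 1)))
    (h : ∑ i, c i * y i = 0) : ∑ i, c' i * y i = 0 := by
  by_cases hL : ∃ i, a (lab i) < t
  · obtain ⟨r, hr, h1, -⟩ := IsEdgeForm.exists_scale ha hv hc hc' le_rfl hL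
    obtain ⟨r', hr', h1', -⟩ := IsEdgeForm.exists_scale ha hv hc' hc le_rfl hL
    have key : ∀ {c c' : Fin (k + 1) → ℝ} {r : ℝ}, (∀ l, c' l ≤ r * c l) →
        ∑ i, c' i * y i ≤ r * ∑ i, c i * y i := fun h => by
      rw [Finset.mul_sum]
      exact Finset.sum_le_sum fun i _ => by
        rw [← mul_assoc]; exact mul_le_mul_of_nonneg_right (h i) (hy.1 i)
    have k1 := key h1
    have k2 := key h1'
    rw [h, mul_zero] at k1
    rw [h] at k2
    exact le_antisymm k1 (not_lt.1 fun h' => (mul_neg_of_pos_of_neg hr' h').not_ge k2)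
  · push Not at hL
    have hnn : ∀ i ∈ Finset.univ, 0 ≤ c i * y i := fun i _ =>
      mul_nonneg (not_lt.1 fun h' => (hL i).not_gt ((hc.neg_iff i).1 h')) (hy.1 i)
    have h0 := (Finset.sum_eq_zero_iff_of_nonneg hnn).1 h
    refine Finset.sum_eq_zero fun j hj => ?_
    rcases mul_eq_zero.1 (h0 j hj) with h1 | h1
    · rw [hc'.eq_zero (le_antisymm (not_lt.1 fun h' => ((hc.pos_iff j).2 h').ne' h1) (hL j)),
        zero_mul]
    · rw [h1, mul_zero]

section Triangle

variable (ha : StrictMono a) (hv : IsEdgeCoordinate a v) {lab : Fin 3 → G} (hlab : StrictMono lab)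
include ha hv hlab

/-- Below the middle vertex the level crosses just the two edges at the lowest vertex, so any two
crossing points lie on a line and no compatibility is needed; this is special to dimension two. Here
`α` and `β` are the coordinates of the crossing points at the upper ends, and the form has been
multiplied by `α * β` to clear denominators. -/
theorem isEdgeForm_lower {t : ℝ} (h0 : a (lab 0) < t) (h1 : t ≤ a (lab 1)) {α β : ℝ}
    (hα : α = 1 - v (lab 0) (lab 1) t) (hβ : β = 1 - v (lab 0) (lab 2) t) :
    IsEdgeForm a v (k := 2) lab t ![-(α * β), (1 - α) * β, (1 - β) * α] := by
  have l01 : lab 0 < lab 1 := hlab (by decide)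
  have l02 : lab 0 < lab 2 := hlab (by decide)
  have l12 : a (lab 1) < a (lab 2) := ha (hlab (by decide))
  have α0 : 0 < α := by
    have := hv.anti _ _ l01 h0
    rw [hv.left _ _ l01] at this
    linarith
  have β0 : 0 < β := by
    have := hv.anti _ _ l02 h0
    rw [hv.left _ _ l02] at this
    linarith
  have β1 : 0 < 1 - β := by
    have := hv.anti _ _ l02 (h1.trans_lt l12)
    rw [hv.right _ _ l02] at this
    linarith
  have α1 : 0 < 1 - α ↔ t < a (lab 1) := by
    rw [hα, sub_sub_cancel, ← hv.right _ _ l01]; exact (hv.anti _ _ l01).lt_iff_gt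
  have α1' : 0 ≤ 1 - α := by
    have := (hv.anti _ _ l01).antitone h1
    rw [hv.right _ _ l01] at this
    linarith
  have n0 : -(α * β) < 0 := by have := mul_pos α0 β0; linarith
  have p2 : 0 < (1 - β) * α := mul_pos β1 α0
  have p1 : 0 < (1 - α) * β ↔ t < a (lab 1) := by rw [← α1]; exact mul_pos_iff_of_pos_right β0
  refine ⟨fun i => ?_, fun i => ?_, fun i j hi hj => ?_⟩
  · fin_cases i
    · exact iff_of_false n0.not_gt h0.not_gt
    · exact p1
    · exact iff_of_true p2 (h1.trans_lt l12)
  · fin_cases i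
    · exact iff_of_true n0 h0
    · exact iff_of_false (mul_nonneg α1' β0.le).not_gt h1.not_gt
    · exact iff_of_false p2.not_gt (h1.trans_lt l12).not_gt
  · have hi0 : i = 0 := by
      fin_cases i
      · rfl
      · exact absurd hi h1.not_gt
      · exact absurd hi (h1.trans_lt l12).not_gt
    subst hi0
    fin_cases j
    · exact absurd hj h0.not_gt
    · simp [hα, hβ]; ring
    · simp [hα, hβ]; ring

theorem isEdgeForm_upper {t : ℝ} (h1 : a (lab 1) ≤ t) (h2 : t < a (lab 2)) {α β : ℝ}
    (hα : α = v (lab 1) (lab 2) t) (hβ : β = v (lab 0) (lab 2) t) :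
    IsEdgeForm a v (k := 2) lab t ![-((1 - β) * α), -((1 - α) * β), α * β] := by
  have l12 : lab 1 < lab 2 := hlab (by decide)
  have l02 : lab 0 < lab 2 := hlab (by decide)
  have l01 : a (lab 0) < a (lab 1) := ha (hlab (by decide))
  have α0 : 0 < α := by
    have := hv.anti _ _ l12 h2
    rw [hv.right _ _ l12] at this
    linarith
  have β0 : 0 < β := by
    have := hv.anti _ _ l02 h2
    rw [hv.right _ _ l02] at this
    linarith
  have β1 : 0 < 1 - β := by
    have := hv.anti _ _ l02 (l01.trans_le h1)
    rw [hv.left _ _ l02] at this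
    linarith
  have α1 : 0 < 1 - α ↔ a (lab 1) < t := by
    rw [hα, sub_pos, ← hv.left _ _ l12]; exact (hv.anti _ _ l12).lt_iff_gt
  have α1' : 0 ≤ 1 - α := by
    have := (hv.anti _ _ l12).antitone h1
    rw [hv.left _ _ l12] at this
    linarith
  have p2 : 0 < α * β := mul_pos α0 β0
  have n0 : -((1 - β) * α) < 0 := by have := mul_pos β1 α0; linarith
  have n1 : -((1 - α) * β) < 0 ↔ a (lab 1) < t := by
    rw [← α1, neg_lt_zero]; exact mul_pos_iff_of_pos_right β0
  have n1' : -((1 - α) * β) ≤ 0 := by have := mul_nonneg α1' β0.le; linarith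
  refine ⟨fun i => ?_, fun i => ?_, fun i j hi hj => ?_⟩
  · fin_cases i
    · exact iff_of_false n0.not_gt (l01.trans_le h1).not_gt
    · exact iff_of_false n1'.not_gt h1.not_gt
    · exact iff_of_true p2 h2
  · fin_cases i
    · exact iff_of_true n0 (l01.trans_le h1)
    · exact n1
    · exact iff_of_false p2.not_gt h2.not_gt
  · have hj2 : j = 2 := by
      fin_cases j
      · exact absurd hj (l01.trans_le h1).not_gt
      · exact absurd hj h1.not_gt
      · rfl
    subst hj2
    fin_cases i
    · simp [hα, hβ]; ring
    · simp [hα, hβ]; ring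
    · exact absurd hi h2.not_gt

theorem exists_isEdgeForm_triangle (t : ℝ) : ∃ c, IsEdgeForm a v (k := 2) lab t c := by
  have h01 : a (lab 0) < a (lab 1) := ha (hlab (by decide))
  have h12 : a (lab 1) < a (lab 2) := ha (hlab (by decide))
  rcases le_or_gt t (a (lab 0)) with h | h
  · refine ⟨_, isEdgeForm_of_ge_or_le (Or.inl fun i => ?_)⟩
    fin_cases i
    exacts [h, h.trans h01.le, h.trans (h01.trans h12).le]
  rcases le_or_gt t (a (lab 1)) with h' | h'
  · exact ⟨_, isEdgeForm_lower ha hv hlab h h' rfl rfl⟩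
  rcases lt_or_ge t (a (lab 2)) with h'' | h''
  · exact ⟨_, isEdgeForm_upper ha hv hlab h'.le h'' rfl rfl⟩
  · refine ⟨_, isEdgeForm_of_ge_or_le (Or.inr fun i => ?_)⟩
    fin_cases i
    exacts [h.le, h'.le, h'']

theorem exists_level_triangle {y : Fin 3 → ℝ} (hy : y ∈ stdSimplex ℝ (Fin 3)) :
    ∃ t c, IsEdgeForm a v (k := 2) lab t c ∧ ∑ i, c i * y i = 0 := by
  have l01 : lab 0 < lab 1 := hlab (by decide)
  have l12 : lab 1 < lab 2 := hlab (by decide)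
  have l02 : lab 0 < lab 2 := l01.trans l12
  have hsum : y 0 + y 1 + y 2 = 1 := by rw [← hy.2, Fin.sum_univ_three]
  by_cases hvert : ∃ i, y = Pi.single i 1
  · obtain ⟨i, rfl⟩ := hvert
    obtain ⟨c, hc⟩ := exists_isEdgeForm_triangle ha hv hlab (a (lab i))
    exact ⟨_, c, hc, by rw [sum_mul_single, hc.eq_zero rfl]⟩
  have c01 := hv.continuous _ _ l01
  have c02 := hv.continuous _ _ l02
  have c12 := hv.continuous _ _ l12
  -- the two halves are symmetric
  have near : ∀ {α β : ℝ → ℝ} {l : Filter ℝ} {p q : ℝ}, l.NeBot → Filter.Tendsto α l (𝓝 0) →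
      Filter.Tendsto β l (𝓝 0) → (∀ᶠ t in l, 0 < α t ∧ 0 < β t) → 0 ≤ p → 0 ≤ q → 0 < p + q →
      ∀ᶠ t in l, 0 < p * β t + q * α t - α t * β t := by
    intro α β l p q hl hα hβ hpos hp hq hpq
    rcases hp.lt_or_eq with hp' | rfl
    · filter_upwards [hα.eventually_lt_const hp', hpos] with t h1 h2
      have := mul_pos (sub_pos.2 h1) h2.2
      have := mul_nonneg hq h2.1.le
      linarith
    · rw [zero_add] at hpq
      filter_upwards [hβ.eventually_lt_const hpq, hpos] with t h1 h2
      have := mul_pos (sub_pos.2 h1) h2.1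
      linarith
  have hne : ∀ i, y i ≠ 1 := fun i hi => hvert ⟨i, eq_single_of_forall_ne hy fun j hj => by
    have h1 : ∑ l ∈ Finset.univ.erase i, y l = 0 := by
      have := Finset.add_sum_erase Finset.univ y (Finset.mem_univ i)
      rw [hy.2, hi] at this
      linarith
    exact (Finset.sum_eq_zero_iff_of_nonneg fun l _ => hy.1 l).1 h1 j
      (Finset.mem_erase.2 ⟨hj, Finset.mem_univ j⟩)⟩
  have hlt : ∀ i, y i < 1 := fun i => ((mem_Icc_of_mem_stdSimplex hy i).2).lt_of_ne (hne i)
  -- The level through the middle vertex divides the triangle; the inequality tells in which half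
  -- `y` lies.
  rcases le_or_gt (y 2 * v (lab 0) (lab 2) (a (lab 1)))
    (y 0 * (1 - v (lab 0) (lab 2) (a (lab 1)))) with hD | hD
  · let α := fun t => 1 - v (lab 0) (lab 1) t
    let β := fun t => 1 - v (lab 0) (lab 2) t
    have hα : Continuous α := by fun_prop
    have hβ : Continuous β := by fun_prop
    have tα : Filter.Tendsto α (𝓝[>] a (lab 0)) (𝓝 0) := by
      have := hα.tendsto (a (lab 0))
      simp only [α, hv.left _ _ l01, sub_self] at this
      exact this.mono_left nhdsWithin_le_nhds
    have tβ : Filter.Tendsto β (𝓝[>] a (lab 0)) (𝓝 0) := by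
      have := hβ.tendsto (a (lab 0))
      simp only [β, hv.left _ _ l02, sub_self] at this
      exact this.mono_left nhdsWithin_le_nhds
    have hpos : ∀ᶠ t in 𝓝[>] a (lab 0), 0 < α t ∧ 0 < β t := by
      filter_upwards [self_mem_nhdsWithin] with t ht
      have h1 := hv.anti _ _ l01 ht
      have h2 := hv.anti _ _ l02 ht
      rw [hv.left _ _ l01] at h1
      rw [hv.left _ _ l02] at h2
      exact ⟨sub_pos.2 h1, sub_pos.2 h2⟩
    -- With denominators cleared the form vanishes identically at the level of the lowest vertex.
    -- The intermediate value theorem therefore starts slightly above it, where the value is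
    -- positive.
    obtain ⟨t₁, ht₁, ht₁0, ht₁1⟩ := ((near inferInstance tα tβ hpos (hy.1 1) (hy.1 2)
      (by linarith [hlt 0])).and (Ioo_mem_nhdsGT (ha l01))).exists
    have hcont : Continuous fun t => y 1 * β t + y 2 * α t - α t * β t := by fun_prop
    obtain ⟨t, ⟨h1, h2⟩, ht⟩ := intermediate_value_Icc' ht₁1.le hcont.continuousOn
      (show (0 : ℝ) ∈ Icc _ _ from ⟨by
        simp only [α, β, hv.right _ _ l01]
        linear_combination hD + (1 - v (lab 0) (lab 2) (a (lab 1))) * hsum, ht₁.le⟩)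
    refine ⟨t, _, isEdgeForm_lower ha hv hlab (ht₁0.trans_le h1) h2 rfl rfl, ?_⟩
    rw [Fin.sum_univ_three]
    simp only [α, β] at ht
    simp
    linear_combination ht - (1 - v (lab 0) (lab 1) t) * (1 - v (lab 0) (lab 2) t) * hsum
  · let α := fun t => v (lab 1) (lab 2) t
    let β := fun t => v (lab 0) (lab 2) t
    have hα : Continuous α := by fun_prop
    have hβ : Continuous β := by fun_prop
    have tα : Filter.Tendsto α (𝓝[<] a (lab 2)) (𝓝 0) := by
      have := hα.tendsto (a (lab 2))
      simp only [α, hv.right _ _ l12] at this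
      exact this.mono_left nhdsWithin_le_nhds
    have tβ : Filter.Tendsto β (𝓝[<] a (lab 2)) (𝓝 0) := by
      have := hβ.tendsto (a (lab 2))
      simp only [β, hv.right _ _ l02] at this
      exact this.mono_left nhdsWithin_le_nhds
    have hpos : ∀ᶠ t in 𝓝[<] a (lab 2), 0 < α t ∧ 0 < β t := by
      filter_upwards [self_mem_nhdsWithin] with t ht
      have h1 := hv.anti _ _ l12 ht
      have h2 := hv.anti _ _ l02 ht
      rw [hv.right _ _ l12] at h1
      rw [hv.right _ _ l02] at h2
      exact ⟨h1, h2⟩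
    obtain ⟨t₁, ht₁, ht₁0, ht₁1⟩ := ((near inferInstance tα tβ hpos (hy.1 1) (hy.1 0)
      (by linarith [hlt 2])).and (Ioo_mem_nhdsLT (ha l12))).exists
    have hcont : Continuous fun t => y 1 * β t + y 0 * α t - α t * β t := by fun_prop
    obtain ⟨t, ⟨h1, h2⟩, ht⟩ := intermediate_value_Icc ht₁0.le hcont.continuousOn
      (show (0 : ℝ) ∈ Icc _ _ from ⟨by
        simp only [α, β, hv.left _ _ l12]
        linear_combination hD + v (lab 0) (lab 2) (a (lab 1)) * hsum, ht₁.le⟩)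
    refine ⟨t, _, isEdgeForm_upper ha hv hlab h1 (h2.trans_lt ht₁1) rfl rfl, ?_⟩
    rw [Fin.sum_univ_three]
    simp only [α, β] at ht
    simp
    linear_combination -ht + v (lab 1) (lab 2) t * v (lab 0) (lab 2) t * hsum

end Triangle

omit [LinearOrder G] in
theorem IsEdgeForm.restrict {k d : ℕ} {lab : Fin (k + 1) → G} {t : ℝ} {c : Fin (k + 1) → ℝ}
    (h : IsEdgeForm a v lab t c) (f : Fin (d + 1) ↪ Fin (k + 1)) :
    IsEdgeForm a v (lab ∘ f) t (c ∘ f) :=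
  ⟨fun i => h.pos_iff (f i), fun i => h.neg_iff (f i), fun i j => h.edge (f i) (f j)⟩

/-- Reduces everything to triangles with increasing labels: an infinite group supplies the missing
labels of an edge or a vertex. -/
theorem exists_strictMono_extension [Infinite G] {k : ℕ} (hk : k ≤ 2) {lab : Fin (k + 1) → G}
    (hlab : Function.Injective lab) :
    ∃ (lab' : Fin 3 → G) (f : Fin (k + 1) ↪ Fin (2 + 1)), StrictMono lab' ∧ lab = lab' ∘ f := by
  classical
  obtain ⟨S, hS, hcard⟩ := Infinite.exists_superset_card_eq (Finset.univ.image lab) 3 (by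
    rw [Finset.card_image_of_injective _ hlab, Finset.card_univ, Fintype.card_fin]; omega)
  have hmem : ∀ i, ∃ j, S.orderEmbOfFin hcard j = lab i := fun i => by
    have : lab i ∈ range (S.orderEmbOfFin hcard) := by
      rw [Finset.range_orderEmbOfFin]
      exact hS (Finset.mem_image_of_mem lab (Finset.mem_univ i))
    exact this
  choose f hf using hmem
  refine ⟨S.orderEmbOfFin hcard, ⟨f, fun i j hij => hlab ?_⟩,
    (S.orderEmbOfFin hcard).strictMono, ?_⟩
  · rw [← hf, ← hf, hij]
  · funext i
    exact (hf i).symm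

theorem isFormFamily_edge [Infinite G] (ha : StrictMono a) (hv : IsEdgeCoordinate a v) :
    IsFormFamily (fun k => k ≤ 2) a fun lab t c => IsEdgeForm a v lab t c where
  restrict := fun f _ _ _ h => h.restrict f
  exists_form := by
    intro k hk lab hlab t
    obtain ⟨lab', f, hlab', rfl⟩ := exists_strictMono_extension hk hlab
    obtain ⟨c, hc⟩ := exists_isEdgeForm_triangle ha hv hlab' t
    exact ⟨_, hc.restrict f⟩
  neg := fun htt hc hc' y hy h => IsEdgeForm.neg_of_lt ha hv hc hc' htt hy h
  unique := fun hc hc' y hy h => hc.eq_zero_of_eq_zero ha hv hc' hy h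
  solve := by
    intro k hk lab hlab y hy
    obtain ⟨lab', f, hlab', rfl⟩ := exists_strictMono_extension hk hlab
    obtain ⟨t, c, hc, hcy⟩ := exists_level_triangle ha hv hlab' (faceMap_mem f hy)
    refine ⟨t, _, hc.restrict f, ?_⟩
    rw [sum_mul_faceMap] at hcy
    exact hcy
  vertex := fun i h => h.eq_zero rfl

end EdgeForms

/-! ### Deck transformations and the labelling of the fibre. -/

section Deck

variable {M X : Type*} [TopologicalSpace M] [TopologicalSpace X] {p : X → M}

theorem IsCoveringMap.locallyPathConnectedSpace [LocallyPathConnectedSpace M]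
    (cov : IsCoveringMap p) : LocallyPathConnectedSpace X := by
  choose e he hpe using cov.isLocalHomeomorph
  let _ : ChartedSpace M X :=
    { atlas := range e
      chartAt := e
      mem_chart_source := he
      chart_mem_atlas := fun x => mem_range_self x }
  exact ChartedSpace.locallyPathConnectedSpace M X

theorem IsCoveringMap.t2Space [T2Space M] (cov : IsCoveringMap p) : T2Space X := by
  refine ⟨fun x y hxy => ?_⟩
  by_cases h : p x = p y
  · exact cov.isSeparatedMap x y h hxy
  · obtain ⟨U, V, hU, hV, hx, hy, hUV⟩ := t2_separation h
    exact ⟨p ⁻¹' U, p ⁻¹' V, hU.preimage cov.continuous, hV.preimage cov.continuous, hx, hy,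
      hUV.preimage p⟩

theorem IsCoveringMap.exists_deck [SimplyConnectedSpace X] [LocallyPathConnectedSpace X]
    (cov : IsCoveringMap p) {a b : X} (hab : p a = p b) :
    ∃ τ : X ≃ₜ X, (∀ x, p (τ x) = p x) ∧ τ a = b := by
  have key : ∀ a b : X, p a = p b → ∃ F : C(X, X), (∀ x, p (F x) = p x) ∧ F a = b := by
    intro a b h
    obtain ⟨F, ⟨h1, h2⟩, -⟩ := cov.existsUnique_continuousMap_lifts ⟨p, cov.continuous⟩ a b h.symm
    exact ⟨F, fun x => congr_fun h2 x, h1⟩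
  have hid : ∀ {F : X → X}, Continuous F → (∀ x, p (F x) = p x) → ∀ a, F a = a → F = id :=
    fun hF hp a ha => cov.eq_of_comp_eq hF continuous_id (funext hp) a ha
  obtain ⟨F, hF, hFa⟩ := key a b hab
  obtain ⟨F', hF', hFb⟩ := key b a hab.symm
  refine ⟨⟨⟨F, F', fun x => ?_, fun x => ?_⟩, F.continuous, F'.continuous⟩, hF, hFa⟩
  · exact congr_fun (hid (F := F' ∘ F) (F'.continuous.comp F.continuous)
      (fun x => by rw [Function.comp, hF', hF]) a (by rw [Function.comp, hFa, hFb])) x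
  · exact congr_fun (hid (F := F ∘ F') (F.continuous.comp F'.continuous)
      (fun x => by rw [Function.comp, hF, hF']) b (by rw [Function.comp, hFb, hFa])) x

theorem IsCoveringMap.monodromy_mk (cov : IsCoveringMap p) {x y : M} (γ : Path x y)
    (e : p ⁻¹' {x}) (Γ : C(unitInterval, X)) (h0 : Γ 0 = e) (hΓ : p ∘ Γ = γ) :
    (cov.monodromy (Path.Homotopic.Quotient.mk γ) e : X) = Γ 1 :=
  congr_arg (fun f : C(unitInterval, X) => f 1)
    ((cov.eq_liftPath_iff' (γ_0 := γ.source.trans e.2.symm)).2 ⟨hΓ, h0⟩).symm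

theorem IsCoveringMap.exists_lift_path (cov : IsCoveringMap p) {x y : M} (γ : Path x y)
    (e : p ⁻¹' {x}) : ∃ Γ : C(unitInterval, X), Γ 0 = e ∧ p ∘ Γ = γ :=
  ⟨cov.liftPath γ e (γ.source.trans e.2.symm), cov.liftPath_zero .., cov.liftPath_lifts ..⟩

theorem IsCoveringMap.monodromy_deck (cov : IsCoveringMap p) {x y : M}
    (γ : Path.Homotopic.Quotient x y) {τ : X ≃ₜ X} (hτ : ∀ x, p (τ x) = p x)
    (e e' : p ⁻¹' {x}) (h : (e' : X) = τ e) :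
    (cov.monodromy γ e' : X) = τ (cov.monodromy γ e) := by
  obtain ⟨γ⟩ := γ
  obtain ⟨Γ, h0, hΓ⟩ := cov.exists_lift_path γ e
  rw [show (Quot.mk _ γ : Path.Homotopic.Quotient x y) = Path.Homotopic.Quotient.mk γ from rfl,
    cov.monodromy_mk γ e Γ h0 hΓ,
    cov.monodromy_mk γ e' ((⟨τ, τ.continuous⟩ : C(X, X)).comp Γ) (by simp [h0, h])
      (by rw [← hΓ]; funext t; exact hτ _)]
  rfl

theorem IsCoveringMap.monodromy_injective [SimplyConnectedSpace X] (cov : IsCoveringMap p) {x y : M}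
    (e : p ⁻¹' {x}) : Function.Injective fun γ : Path.Homotopic.Quotient x y =>
      cov.monodromy γ e := by
  rintro ⟨γ⟩ ⟨γ'⟩ h
  obtain ⟨Γ, h0, hΓ⟩ := cov.exists_lift_path γ e
  obtain ⟨Γ', h0', hΓ'⟩ := cov.exists_lift_path γ' e
  have h1 : Γ 1 = Γ' 1 := by
    rw [← cov.monodromy_mk γ e Γ h0 hΓ, ← cov.monodromy_mk γ' e Γ' h0' hΓ']
    exact congr_arg Subtype.val h
  let P : Path (e : X) (Γ 1) := ⟨Γ, h0, rfl⟩
  let P' : Path (e : X) (Γ 1) := ⟨Γ', h0', h1.symm⟩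
  have hP : P.Homotopic P' := SimplyConnectedSpace.paths_homotopic P P'
  have hmap := hP.map ⟨p, cov.continuous⟩
  have hx : p e = x := e.2
  have hy : p (Γ 1) = y := (congr_fun hΓ 1).trans γ.target
  refine Path.Homotopic.Quotient.eq.2 ?_
  obtain ⟨H⟩ := hmap
  have e1 : γ = (P.map cov.continuous).cast hx.symm hy.symm := by
    ext t; exact (congr_fun hΓ t).symm
  have e2 : γ' = (P'.map cov.continuous).cast hx.symm hy.symm := by
    ext t; exact (congr_fun hΓ' t).symm
  rw [e1, e2]
  exact ⟨H.cast rfl rfl⟩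

theorem IsCoveringMap.monodromy_surjective [PathConnectedSpace X] (cov : IsCoveringMap p) {x y : M}
    (e : p ⁻¹' {x}) (e' : p ⁻¹' {y}) : ∃ γ : Path.Homotopic.Quotient x y,
      cov.monodromy γ e = e' := by
  let Γ : Path (e : X) e' := PathConnectedSpace.somePath _ _
  refine ⟨Path.Homotopic.Quotient.mk ((Γ.map cov.continuous).cast e.2.symm e'.2.symm),
    Subtype.ext ?_⟩
  rw [cov.monodromy_mk _ e (Γ : C(unitInterval, X)) Γ.source rfl]
  exact Γ.target

variable {v : M} (cov : IsCoveringMap p) (x₀ : p ⁻¹' {v})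

/-- The point of the fibre that corresponds to an element of the fundamental group. -/
noncomputable def fibrePoint (g : FundamentalGroup M v) : X :=
  cov.monodromy (FundamentalGroup.toPath g⁻¹) x₀

theorem map_fibrePoint (g : FundamentalGroup M v) : p (fibrePoint cov x₀ g) = v :=
  (cov.monodromy (FundamentalGroup.toPath g⁻¹) x₀).2

theorem fibrePoint_one : fibrePoint cov x₀ 1 = x₀ := by
  rw [fibrePoint, inv_one]
  exact congr_arg Subtype.val (congr_fun cov.monodromy_refl x₀)

variable [SimplyConnectedSpace X]

theorem fibrePoint_injective : Function.Injective (fibrePoint cov x₀) := fun _ _ h =>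
  inv_injective (cov.monodromy_injective x₀ (Subtype.ext h))

theorem exists_fibrePoint_eq {x : X} (hx : p x = v) : ∃ g, fibrePoint cov x₀ g = x := by
  obtain ⟨γ, hγ⟩ := cov.monodromy_surjective x₀ (⟨x, hx⟩ : p ⁻¹' {v})
  refine ⟨(FundamentalGroup.fromPath γ)⁻¹, ?_⟩
  rw [fibrePoint, inv_inv]
  exact congr_arg Subtype.val hγ

theorem exists_isDeck_of_deck {τ : X ≃ₜ X} (hτ : ∀ x, p (τ x) = p x) :
    ∃ g, IsDeck cov x₀ g τ := by
  obtain ⟨g, hg⟩ := exists_fibrePoint_eq cov x₀ (x := τ x₀) ((hτ _).trans x₀.2)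
  exact ⟨g, hτ, hg⟩

theorem exists_isDeck [LocallyPathConnectedSpace X] (g : FundamentalGroup M v) :
    ∃ τ : X ≃ₜ X, IsDeck cov x₀ g τ := by
  obtain ⟨τ, hτ, h⟩ := cov.exists_deck (a := (x₀ : X)) (b := fibrePoint cov x₀ g)
    (x₀.2.trans (map_fibrePoint cov x₀ g).symm)
  exact ⟨τ, hτ, h.symm⟩

-- Monodromy commutes with deck transformations. The inverse in `fibrePoint` compensates for the
-- order of composition of loops and turns this into left multiplication.
omit [SimplyConnectedSpace X] in
theorem IsDeck.map_fibrePoint {g : FundamentalGroup M v} {τ : X ≃ₜ X} (hτ : IsDeck cov x₀ g τ)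
    (h : FundamentalGroup M v) : τ (fibrePoint cov x₀ h) = fibrePoint cov x₀ (g * h) := by
  have hg : fibrePoint cov x₀ g = τ x₀ := hτ.2
  have := cov.monodromy_deck (FundamentalGroup.toPath h⁻¹) hτ.1 x₀
    (cov.monodromy (FundamentalGroup.toPath g⁻¹) x₀) hg
  rw [fibrePoint, ← this, ← cov.monodromy_trans_apply, fibrePoint, mul_inv_rev]
  rfl

open Classical in
/-- The element of the fundamental group that corresponds to a point of the fibre. -/
noncomputable def fibreLabel (x : X) : FundamentalGroup M v :=
  if h : ∃ g, fibrePoint cov x₀ g = x then h.choose else 1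

theorem fibrePoint_fibreLabel {x : X} (hx : p x = v) :
    fibrePoint cov x₀ (fibreLabel cov x₀ x) = x := by
  have h := exists_fibrePoint_eq cov x₀ hx
  rw [fibreLabel, dif_pos h]
  exact h.choose_spec

theorem fibreLabel_fibrePoint (g : FundamentalGroup M v) :
    fibreLabel cov x₀ (fibrePoint cov x₀ g) = g :=
  fibrePoint_injective cov x₀ (fibrePoint_fibreLabel cov x₀ (map_fibrePoint cov x₀ g))

theorem IsDeck.fibreLabel {g : FundamentalGroup M v} {τ : X ≃ₜ X} (hτ : IsDeck cov x₀ g τ) {x : X}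
    (hx : p x = v) : fibreLabel cov x₀ (τ x) = g * fibreLabel cov x₀ x := by
  conv_lhs => rw [← fibrePoint_fibreLabel cov x₀ hx, hτ.map_fibrePoint, fibreLabel_fibrePoint]

end Deck

/-! ### The lifted triangulation. -/

section LiftSimplex

variable {M X : Type*} [TopologicalSpace M] [TopologicalSpace X] {p : X → M}

namespace Triangulation

variable (T : Triangulation M) (cov : IsCoveringMap p)
include cov

/-- The simplex contracts linearly to `w`; the contraction lifts, starting from the constant map at
`x`, and its end is the required lift. -/
theorem exists_isLift {k : ℕ} (σ : T.Cell k) {w : Fin (k + 1) → ℝ}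
    (hw : w ∈ stdSimplex ℝ (Fin (k + 1))) {x : X} (hx : p x = T.char σ w) :
    ∃ s, T.IsLift p σ s ∧ s w = x := by
  classical
  let Δ := stdSimplex ℝ (Fin (k + 1))
  have hmem : ∀ q : unitInterval × Δ, (1 - (q.1 : ℝ)) • w + (q.1 : ℝ) • q.2.1 ∈ Δ :=
    fun q => convex_stdSimplex ℝ _ hw q.2.2 (by linarith [q.1.2.2]) q.1.2.1 (by ring)
  let H : C(unitInterval × Δ, M) :=
    ⟨fun q => T.char σ ((1 - (q.1 : ℝ)) • w + (q.1 : ℝ) • q.2.1),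
      (T.continuousOn_char σ).comp_continuous (by fun_prop) hmem⟩
  have H0 : ∀ a, H (0, a) = p ((ContinuousMap.const Δ x) a) := fun a => by simp [H, hx]
  let L := cov.liftHomotopy H (ContinuousMap.const Δ x) H0
  have hL : ∀ q, p (L q) = H q := fun q => congr_fun (cov.liftHomotopy_lifts H _ H0) q
  have hL0 : ∀ a, L (0, a) = x := fun a => cov.liftHomotopy_zero H _ H0 a
  refine ⟨fun y => if hy : y ∈ Δ then L (1, ⟨y, hy⟩) else x, ⟨?_, fun y hy => ?_⟩, ?_⟩
  · rw [continuousOn_iff_continuous_domRestrict]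
    have : (stdSimplex ℝ (Fin (k + 1))).domRestrict (fun y => if hy : y ∈ Δ then L (1, ⟨y, hy⟩) else x) = fun y => L (1, y) := by
      funext y
      simp only [Set.domRestrict, Δ, y.2, dif_pos]
    rw [this]
    fun_prop
  · simp only [show y ∈ Δ from hy, dif_pos, hL, H]
    simp
  · simp only [show w ∈ Δ from hw, dif_pos]
    rw [← hL0 ⟨w, hw⟩]
    -- The contraction fixes `w`, so the lifted path over `w` is constant.
    refine cov.const_of_comp (A := unitInterval) (g := fun t => L (t, ⟨w, hw⟩)) (by fun_prop)
      (fun a a' => ?_) 1 0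
    simp only [hL]
    simp only [H, ContinuousMap.coe_mk, ← add_smul, sub_add_cancel, one_smul]

theorem IsLift.eqOn {k : ℕ} {σ : T.Cell k} {s s' : (Fin (k + 1) → ℝ) → X} (hs : T.IsLift p σ s)
    (hs' : T.IsLift p σ s') {w : Fin (k + 1) → ℝ} (hw : w ∈ stdSimplex ℝ (Fin (k + 1)))
    (h : s w = s' w) : EqOn s s' (stdSimplex ℝ (Fin (k + 1))) :=
  cov.eqOn_of_comp_eqOn (convex_stdSimplex ℝ _).isPreconnected hs.1 hs'.1
    (fun y hy => (hs.2 y hy).trans (hs'.2 y hy).symm) hw h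

end Triangulation

end LiftSimplex

namespace Triangulation

variable {M X : Type*} [TopologicalSpace M] [TopologicalSpace X] {p : X → M}
  (T : Triangulation M)

theorem comp_perm_mem_stdSimplex {ι : Type*} [Fintype ι] {y : ι → ℝ} (hy : y ∈ stdSimplex ℝ ι)
    (π : Equiv.Perm ι) : y ∘ π ∈ stdSimplex ℝ ι :=
  ⟨fun i => hy.1 (π i), by rw [← hy.2]; exact Equiv.sum_comp π y⟩

theorem char_single {v : M} (hvertex : T.HasUniqueVertex v) {k : ℕ} (σ : T.Cell k)
    (i : Fin (k + 1)) : T.char σ (Pi.single i 1) = v := by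
  obtain ⟨τ, π, h⟩ := T.char_face σ (d := 0) ⟨fun _ => i, fun a b _ => Fin.ext (by omega)⟩
  have h1 := h _ (single_mem_stdSimplex ℝ 0)
  rw [faceMap_single] at h1
  refine h1.trans (hvertex τ _ ?_)
  exact comp_perm_mem_stdSimplex (single_mem_stdSimplex ℝ 0) π

theorem IsLift.face {T : Triangulation M} {k d : ℕ} {σ : T.Cell k} {s : (Fin (k + 1) → ℝ) → X}
    (hs : T.IsLift p σ s) {f : Fin (d + 1) ↪ Fin (k + 1)} {τ : T.Cell d}
    {π : Equiv.Perm (Fin (d + 1))}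
    (h : ∀ y ∈ stdSimplex ℝ (Fin (d + 1)), T.char σ (faceMap f y) = T.char τ (y ∘ π)) :
    T.IsLift p τ fun y => s (faceMap f (y ∘ π.symm)) := by
  constructor
  · refine hs.1.comp ((continuous_faceMap f).comp (by fun_prop)).continuousOn fun y hy =>
      faceMap_mem f (comp_perm_mem_stdSimplex hy π.symm)
  · intro y hy
    have hy' := comp_perm_mem_stdSimplex hy π.symm
    rw [hs.2 _ (faceMap_mem f hy'), h _ hy']
    congr 1
    funext i
    simp

/-- A point of the interior of a face, seen in the face. -/
theorem exists_face_perm {k d d' : ℕ} (σ : T.Cell k) (j : Fin (d + 1) ↪ Fin (k + 1))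
    {w : Fin (d + 1) → ℝ} (hw : w ∈ openSimplex d) (σ₀ : T.Cell d') {w₀ : Fin (d' + 1) → ℝ}
    (hw₀ : w₀ ∈ openSimplex d') (h : T.char σ (faceMap j w) = T.char σ₀ w₀) :
    ∃ f : Fin (d' + 1) ↪ Fin (k + 1), faceMap f w₀ = faceMap j w ∧
      ∀ y ∈ stdSimplex ℝ (Fin (d' + 1)), T.char σ (faceMap f y) = T.char σ₀ y := by
  obtain ⟨τ, π, hτ⟩ := T.char_face σ j
  have hwπ : w ∘ π ∈ openSimplex d :=
    ⟨comp_perm_mem_stdSimplex hw.1 π, fun i => hw.2 (π i)⟩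
  have h1 : T.char τ (w ∘ π) = T.char σ₀ w₀ := by rw [← hτ w hw.1, h]
  have h2 : (⟨d, τ⟩ : Σ k, T.Cell k) = ⟨d', σ₀⟩ :=
    (T.existsUnique_cell (T.char σ₀ w₀)).unique ⟨w ∘ π, hwπ, h1⟩ ⟨w₀, hw₀, rfl⟩
  obtain ⟨rfl, h3⟩ := Sigma.mk.inj_iff.1 h2
  obtain rfl := eq_of_heq h3
  have h4 : w ∘ π = w₀ := T.injOn_char τ hwπ hw₀ h1
  have hface : ∀ y : Fin (d + 1) → ℝ,
      faceMap (π.toEmbedding.trans j) y = faceMap j (y ∘ π.symm) := by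
    intro y
    funext i
    by_cases hi : i ∈ range j
    · obtain ⟨l, rfl⟩ := hi
      rw [faceMap_apply]
      have := faceMap_apply (π.toEmbedding.trans j) y (π.symm l)
      simpa using this
    · rw [faceMap_apply_of_notMem j _ hi, faceMap_apply_of_notMem]
      rintro ⟨l, rfl⟩
      exact hi ⟨π l, rfl⟩
  refine ⟨π.toEmbedding.trans j, ?_, fun y hy => ?_⟩
  · rw [hface, ← h4]
    congr 1
    funext i
    simp
  · rw [hface, hτ _ (comp_perm_mem_stdSimplex hy π.symm)]
    congr 1
    funext i
    simp

variable (cov : IsCoveringMap p)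
include cov

/-- The unique open cell containing `p x` is lifted through `x`. In any other lifted simplex through
`x` the corresponding face is a lift of the same cell through `x`, hence equal to it. -/
theorem lift_carrier (x : X) : ∃ d, ∃ σ₀ : T.Cell d, ∃ s₀, T.IsLift p σ₀ s₀ ∧
    ∃ w₀ ∈ openSimplex d, s₀ w₀ = x ∧
      ∀ k, ∀ σ : T.Cell k, ∀ s, T.IsLift p σ s → ∀ y ∈ stdSimplex ℝ (Fin (k + 1)), s y = x →
        ∃ f : Fin (d + 1) ↪ Fin (k + 1), faceMap f w₀ = y ∧
          (∀ w ∈ stdSimplex ℝ (Fin (d + 1)), T.char σ (faceMap f w) = T.char σ₀ w) ∧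
          ∀ w ∈ stdSimplex ℝ (Fin (d + 1)), s (faceMap f w) = s₀ w := by
  obtain ⟨⟨d, σ₀⟩, ⟨w₀, hw₀, hx⟩, -⟩ := T.existsUnique_cell (p x)
  obtain ⟨s₀, hs₀, hs₀x⟩ := T.exists_isLift cov σ₀ hw₀.1 hx.symm
  refine ⟨d, σ₀, s₀, hs₀, w₀, hw₀, hs₀x, fun k σ s hs y hy hsy => ?_⟩
  obtain ⟨d', j, w, hw, rfl⟩ := exists_faceMap_eq hy
  obtain ⟨f, hfw, hf⟩ := T.exists_face_perm σ j hw σ₀ hw₀ (by rw [← hs.2 _ hy, hsy, hx])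
  refine ⟨f, hfw, hf, ?_⟩
  have hlift : T.IsLift p σ₀ fun w => s (faceMap f w) :=
    ⟨hs.1.comp (continuous_faceMap f).continuousOn fun y hy => faceMap_mem f hy,
      fun y hy => by rw [hs.2 _ (faceMap_mem f hy), hf y hy]⟩
  exact IsLift.eqOn T cov hlift hs₀ hw₀.1 (by rw [hfw, hsy, hs₀x])

/-- As there are finitely many cells, one of them contains the images of ultrafilter-many points.
Their coordinates converge to some `w`; the lift with `w` over `x` contains the points themselves,
since `p` is injective near `x`. -/
theorem lift_mem_ultrafilter [T2Space M] (x : X) (U : Ultrafilter X) (hU : ↑U ≤ 𝓝 x) :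
    ∃ k, ∃ σ : T.Cell k, ∃ s, T.IsLift p σ s ∧ s '' stdSimplex ℝ (Fin (k + 1)) ∈ U := by
  have := T.finite_cells
  have hcover : ∀ᶠ z in U, ∃ σ : Σ k, T.Cell k, p z ∈ T.char σ.2 '' stdSimplex ℝ (Fin (σ.1 + 1)) :=
    Filter.Eventually.of_forall fun z => by
      obtain ⟨σ, ⟨w, hw, hz⟩, -⟩ := T.existsUnique_cell (p z)
      exact ⟨σ, w, hw.1, hz⟩
  obtain ⟨⟨k, σ⟩, hσ⟩ := Ultrafilter.eventually_exists_iff.1 hcover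
  obtain ⟨r, hr⟩ := Filter.Eventually.choice hσ
  obtain ⟨w, hw, hlim⟩ := isCompact_iff_ultrafilter_le_nhds.1 (isCompact_stdSimplex ℝ _) (U.map r)
    (by rw [Filter.le_principal_iff]; exact hr.mono fun q hq => hq.1)
  have l1 : Filter.Tendsto r (U : Filter X) (𝓝[stdSimplex ℝ (Fin (k + 1))] w) :=
    tendsto_nhdsWithin_iff.2 ⟨hlim, hr.mono fun q hq => hq.1⟩
  have hpx : T.char σ w = p x := tendsto_nhds_unique
    ((((T.continuousOn_char σ) w hw).tendsto.comp l1).congr' (hr.mono fun q hq => hq.2))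
    ((cov.continuous.tendsto x).mono_left hU)
  obtain ⟨s, hs, hsx⟩ := T.exists_isLift cov σ hw hpx.symm
  refine ⟨k, σ, s, hs, ?_⟩
  obtain ⟨e, hxe, rfl⟩ := cov.isLocalHomeomorph x
  have hO : e.source ∈ 𝓝 x := e.open_source.mem_nhds hxe
  have h1 : ∀ᶠ q in U, s (r q) ∈ e.source := by
    have := ((hs.1 w hw).tendsto.comp l1)
    rw [hsx] at this
    exact this hO
  filter_upwards [h1, hU hO, hr] with q hq1 hq2 hq3
  refine ⟨r q, hq3.1, e.injOn hq1 hq2 ?_⟩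
  rw [hs.2 _ hq3.1, hq3.2]

/-- If two vertices coincided, the edge between them would be a closed path in a simply connected
space, and its image in `M` a null-homotopic edge. -/
theorem lift_vertex_injective [SimplyConnectedSpace X] {v : M} (hvertex : T.HasUniqueVertex v)
    (hess : T.IsEssential v) {k : ℕ} {σ : T.Cell k} {s : (Fin (k + 1) → ℝ) → X}
    (hs : T.IsLift p σ s) : Function.Injective fun i => s (Pi.single i 1) := by
  intro i j hij
  by_contra hne
  let f : Fin (1 + 1) ↪ Fin (k + 1) := ⟨![i, j], by
    intro a b hab
    fin_cases a <;> fin_cases b <;> simp_all [eq_comm]⟩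
  obtain ⟨τ, π, h⟩ := T.char_face σ f
  have hs' := hs.face h
  have hmem : ∀ t : unitInterval, ![1 - (t : ℝ), (t : ℝ)] ∈ stdSimplex ℝ (Fin 2) := fun t => by
    refine ⟨fun l => ?_, by simp⟩
    fin_cases l
    · simpa using t.2.2
    · simpa using t.2.1
  have hcont : Continuous fun t : unitInterval => ![1 - (t : ℝ), (t : ℝ)] := by
    refine continuous_pi fun l => ?_
    fin_cases l <;> simp <;> fun_prop
  let Γ : C(unitInterval, X) :=
    ⟨fun t => s (faceMap f (![1 - (t : ℝ), (t : ℝ)] ∘ π.symm)), hs'.1.comp_continuous hcont hmem⟩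
  have hΓ : ∀ l : Fin 2, s (faceMap f (Pi.single l 1 ∘ π.symm)) = s (Pi.single i 1) := by
    intro l
    have : (Pi.single l 1 : Fin 2 → ℝ) ∘ π.symm = Pi.single (π l) 1 := by
      funext a
      simp only [Function.comp, Pi.single_apply, Equiv.symm_apply_eq]
    rw [this, faceMap_single]
    generalize π l = b
    fin_cases b
    · rfl
    · exact hij.symm
  have e0 : ![1 - ((0 : unitInterval) : ℝ), ((0 : unitInterval) : ℝ)] = Pi.single 0 1 := by
    funext a; fin_cases a <;> simp
  have e1 : ![1 - ((1 : unitInterval) : ℝ), ((1 : unitInterval) : ℝ)] = Pi.single 1 1 := by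
    funext a; fin_cases a <;> simp
  have hΓ0 : Γ 0 = s (Pi.single i 1) := by
    change s (faceMap f (![1 - ((0 : unitInterval) : ℝ), ((0 : unitInterval) : ℝ)] ∘ π.symm)) = _
    rw [e0]; exact hΓ 0
  have hΓ1 : Γ 1 = s (Pi.single i 1) := by
    change s (faceMap f (![1 - ((1 : unitInterval) : ℝ), ((1 : unitInterval) : ℝ)] ∘ π.symm)) = _
    rw [e1]; exact hΓ 1
  have hpΓ : ∀ t : unitInterval, p (Γ t) = T.char τ ![1 - (t : ℝ), (t : ℝ)] := fun t =>
    hs'.2 _ (hmem t)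
  have hpi : p (s (Pi.single i 1)) = v := by
    rw [hs.2 _ (single_mem_stdSimplex ℝ i), T.char_single hvertex]
  let γ : Path v v := ⟨⟨fun t => p (Γ t), cov.continuous.comp Γ.continuous⟩,
    by simp only [hΓ0, hpi], by simp only [hΓ1, hpi]⟩
  refine hess τ γ hpΓ ?_
  have := cov.monodromy_injective (⟨_, hpi⟩ : p ⁻¹' {v})
    (a₁ := Path.Homotopic.Quotient.mk γ) (a₂ := Path.Homotopic.Quotient.refl v) (Subtype.ext ?_)
  · exact Path.Homotopic.Quotient.eq.1 this
  · simp only [cov.monodromy_refl]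
    rw [cov.monodromy_mk γ _ Γ hΓ0 rfl, hΓ1]
    rfl

variable {v : M} (x₀ : p ⁻¹' {v}) [SimplyConnectedSpace X] [T2Space M]

/-- The lifted triangulation of the universal covering, with the vertices labelled by the elements
of the fundamental group. -/
noncomputable def liftComplex (hvertex : T.HasUniqueVertex v) (hess : T.IsEssential v) :
    LabelledComplex X (FundamentalGroup M v) where
  simplex k := {s | ∃ σ : T.Cell k, T.IsLift p σ s}
  label := fibreLabel cov x₀
  continuousOn := fun s ⟨_, hs⟩ => hs.1
  carrier x := by
    obtain ⟨d, σ₀, s₀, hs₀, w₀, hw₀, hx, h⟩ := T.lift_carrier cov x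
    refine ⟨d, s₀, ⟨σ₀, hs₀⟩, w₀, hw₀, hx, fun k s ⟨σ, hs⟩ y hy hsy => ?_⟩
    obtain ⟨f, hf, -, hf'⟩ := h k σ s hs y hy hsy
    exact ⟨f, hf, hf'⟩
  mem_ultrafilter x U hU := by
    obtain ⟨k, σ, s, hs, h⟩ := T.lift_mem_ultrafilter cov x U hU
    exact ⟨k, s, ⟨σ, hs⟩, h⟩
  label_injective := by
    rintro k s ⟨σ, hs⟩ i j hij
    have hp : ∀ i, p (s (Pi.single i 1)) = v := fun i => by
      rw [hs.2 _ (single_mem_stdSimplex ℝ i), T.char_single hvertex]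
    refine T.lift_vertex_injective cov hvertex hess hs ?_
    simp only at hij ⊢
    rw [← fibrePoint_fibreLabel cov x₀ (hp i), hij, fibrePoint_fibreLabel cov x₀ (hp j)]

end Triangulation

/-- The coset of the vertex labels is constant on each simplex, hence continuous as a map to a
discrete space, hence constant on a connected space. -/
theorem LabelledComplex.label_inv_mul_label_mem {X G : Type*} [TopologicalSpace X] [T2Space X]
    [PreconnectedSpace X] [Group G] (K : LabelledComplex X G) (H : Subgroup G)
    (hH : ∀ k, ∀ s ∈ K.simplex k, ∀ i j,
      (K.label (s (Pi.single i 1)))⁻¹ * K.label (s (Pi.single j 1)) ∈ H) {k k' : ℕ}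
    {s : (Fin (k + 1) → ℝ) → X} (hs : s ∈ K.simplex k) (i : Fin (k + 1))
    {s' : (Fin (k' + 1) → ℝ) → X} (hs' : s' ∈ K.simplex k') (i' : Fin (k' + 1)) :
    (K.label (s (Pi.single i 1)))⁻¹ * K.label (s' (Pi.single i' 1)) ∈ H := by
  let _ : TopologicalSpace (G ⧸ H) := ⊥
  have : DiscreteTopology (G ⧸ H) := ⟨rfl⟩
  choose d s₀ hs₀ w₀ hw₀ hx hcar using K.carrier
  let χ : X → G ⧸ H := fun x => QuotientGroup.mk (K.label (s₀ x (Pi.single 0 1)))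
  have hχ : ∀ k, ∀ s ∈ K.simplex k, ∀ y ∈ stdSimplex ℝ (Fin (k + 1)), ∀ i,
      χ (s y) = QuotientGroup.mk (K.label (s (Pi.single i 1))) := by
    intro k s hs y hy i
    obtain ⟨f, -, hf⟩ := hcar (s y) k s hs y hy rfl
    simp only [χ]
    rw [QuotientGroup.eq, ← hf _ (single_mem_stdSimplex ℝ 0), faceMap_single]
    exact hH k s hs _ _
  have hcont : Continuous χ := LabelledComplex.continuous_of_simplex (K := K) fun k s hs =>
    continuousOn_const.congr fun y hy => hχ k s hs y hy 0
  have := PreconnectedSpace.constant ‹_› hcont (x := s (Pi.single i 1)) (y := s' (Pi.single i' 1))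
  rw [hχ k s hs _ (single_mem_stdSimplex ℝ i) i,
    hχ k' s' hs' _ (single_mem_stdSimplex ℝ i') i'] at this
  exact QuotientGroup.eq.1 this

/-! ### The fundamental group is countable and nontrivial. -/

namespace Triangulation

variable {M X : Type*} [TopologicalSpace M] [TopologicalSpace X] {p : X → M}
  (T : Triangulation M) {v : M} (hvertex : T.HasUniqueVertex v) (hess : T.IsEssential v)
  [SimplyConnectedSpace X] [T2Space M] (cov : IsCoveringMap p) (x₀ : p ⁻¹' {v})

section

variable {T}

omit [SimplyConnectedSpace X] [T2Space M] in
include hvertex in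
theorem IsLift.map_single {k : ℕ} {σ : T.Cell k} {s : (Fin (k + 1) → ℝ) → X}
    (hs : T.IsLift p σ s) (i : Fin (k + 1)) : p (s (Pi.single i 1)) = v := by
  rw [hs.2 _ (single_mem_stdSimplex ℝ i), T.char_single hvertex]

omit [SimplyConnectedSpace X] [T2Space M] in
theorem IsLift.deck {k : ℕ} {σ : T.Cell k} {s : (Fin (k + 1) → ℝ) → X}
    (hs : T.IsLift p σ s) {τ : X ≃ₜ X} (hτ : ∀ x, p (τ x) = p x) :
    T.IsLift p σ fun y => τ (s y) :=
  ⟨τ.continuous.comp_continuousOn hs.1, fun y hy => (hτ _).trans (hs.2 y hy)⟩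

end

theorem isAutomorphism_deck {g : FundamentalGroup M v} {τ : X ≃ₜ X} (hτ : IsDeck cov x₀ g τ) :
    (T.liftComplex cov x₀ hvertex hess).IsAutomorphism g τ where
  simplex := fun _ _ ⟨σ, hs⟩ => ⟨σ, hs.deck hτ.1⟩
  label := fun _ _ ⟨_, hs⟩ i => hτ.fibreLabel cov x₀ (hs.map_single hvertex i)

include hvertex in
omit [SimplyConnectedSpace X] [T2Space M] in
theorem exists_isLift_vertex {x : X} (hx : p x = v) :
    ∃ (σ : T.Cell 0) (s : (Fin (0 + 1) → ℝ) → X), T.IsLift p σ s ∧ s (Pi.single 0 1) = x := by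
  obtain ⟨⟨k, σ⟩, -⟩ := (T.existsUnique_cell v).exists
  obtain ⟨τ, -⟩ := T.char_face σ (d := 0) ⟨fun _ => 0, fun a b _ => Fin.ext (by omega)⟩
  refine ⟨τ, fun _ => x, ⟨continuousOn_const, fun y hy => ?_⟩, rfl⟩
  rw [hvertex τ y hy, hx]

-- Choose one lift of each cell. All lifts are translates of these, so the finitely many label
-- differences within them generate the group, by `label_inv_mul_label_mem`.
include hvertex cov x₀ in
theorem countable_fundamentalGroup [LocallyPathConnectedSpace X] (hess : T.IsEssential v) :
    Countable (FundamentalGroup M v) := by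
  have := cov.t2Space
  have := T.finite_cells
  let K := T.liftComplex cov x₀ hvertex hess
  have hex : ∀ σ : (Σ k, T.Cell k), ∃ s, T.IsLift p σ.2 s := fun ⟨k, σ⟩ => by
    obtain ⟨s, hs, -⟩ := T.exists_isLift cov σ (single_mem_stdSimplex ℝ 0) (x := (x₀ : X))
      (by rw [T.char_single hvertex]; exact x₀.2)
    exact ⟨s, hs⟩
  choose s hs using hex
  let E : Set (FundamentalGroup M v) := range fun q : (Σ σ : (Σ k, T.Cell k), Fin (σ.1 + 1) ×
    Fin (σ.1 + 1)) => (K.label (s q.1 (Pi.single q.2.1 1)))⁻¹ * K.label (s q.1 (Pi.single q.2.2 1))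
  have hE : E.Countable := countable_range _
  have hH : ∀ k, ∀ s ∈ K.simplex k, ∀ i j,
      (K.label (s (Pi.single i 1)))⁻¹ * K.label (s (Pi.single j 1)) ∈ Subgroup.closure E := by
    rintro k s' ⟨σ, hs'⟩ i j
    obtain ⟨τ, hτ, hτ0⟩ := cov.exists_deck (a := s ⟨k, σ⟩ (Pi.single 0 1))
      (b := s' (Pi.single 0 1)) (((hs ⟨k, σ⟩).map_single hvertex 0).trans
        (hs'.map_single hvertex 0).symm)
    obtain ⟨g, hg⟩ := exists_isDeck_of_deck cov x₀ hτ
    have heq := IsLift.eqOn T cov ((hs ⟨k, σ⟩).deck hτ) hs' (single_mem_stdSimplex ℝ 0) hτ0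
    have hl : ∀ i, K.label (s' (Pi.single i 1)) = g * K.label (s ⟨k, σ⟩ (Pi.single i 1)) := by
      intro i
      rw [← heq (single_mem_stdSimplex ℝ i)]
      exact hg.fibreLabel cov x₀ ((hs ⟨k, σ⟩).map_single hvertex i)
    rw [hl, hl, mul_inv_rev, mul_assoc, inv_mul_cancel_left]
    exact Subgroup.subset_closure ⟨⟨⟨k, σ⟩, i, j⟩, rfl⟩
  have htop : Subgroup.closure E = ⊤ := by
    refine eq_top_iff.2 fun g _ => ?_
    obtain ⟨σ, s₁, h1, hx1⟩ := T.exists_isLift_vertex hvertex (map_fibrePoint cov x₀ 1)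
    obtain ⟨σ', s₂, h2, hx2⟩ := T.exists_isLift_vertex hvertex (map_fibrePoint cov x₀ g)
    have := K.label_inv_mul_label_mem (Subgroup.closure E) hH (s := s₁) ⟨σ, h1⟩ 0 (s' := s₂)
      ⟨σ', h2⟩ 0
    rw [hx1, hx2] at this
    have hlab : ∀ g, K.label (fibrePoint cov x₀ g) = g := fibreLabel_fibrePoint cov x₀
    rwa [hlab, hlab, inv_one, one_mul] at this
  have := hE.to_subtype
  have hcov : ∀ g : FundamentalGroup M v, ∃ l : List (E × Bool),
      (l.map fun q => if q.2 then (q.1 : FundamentalGroup M v) else (q.1 : FundamentalGroup M v)⁻¹).prod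
        = g := by
    intro g
    have hg : g ∈ Subgroup.closure E := htop ▸ Subgroup.mem_top g
    induction hg using Subgroup.closure_induction with
    | mem x hx => exact ⟨[(⟨x, hx⟩, true)], by simp only [List.map_cons, List.map_nil,
        List.prod_cons, List.prod_nil, if_true, mul_one]⟩
    | one => exact ⟨[], rfl⟩
    | mul x y _ _ hx hy =>
      obtain ⟨l, rfl⟩ := hx
      obtain ⟨l', rfl⟩ := hy
      exact ⟨l ++ l', by rw [List.map_append, List.prod_append]⟩
    | inv x _ hx =>
      obtain ⟨l, rfl⟩ := hx
      refine ⟨(l.map fun q => (q.1, !q.2)).reverse, ?_⟩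
      rw [List.prod_inv_reverse, List.map_reverse, List.map_map, List.map_map]
      congr 2
      refine List.map_congr_left fun q _ => ?_
      cases h : q.2 <;> simp [h]
  choose l hl using hcov
  exact Function.Injective.countable (f := l) fun g g' h => by rw [← hl g, h, hl]

-- The link of the vertex is a nonempty sphere, so there is a simplex of positive dimension, and its
-- lift has vertices with different labels.
include hvertex hess cov x₀ in
theorem nontrivial_fundamentalGroup {m : ℕ} (hlinks : T.HasSphericalLinks (m + 1)) :
    Nontrivial (FundamentalGroup M v) := by
  obtain ⟨σ₀, -⟩ := T.exists_isLift_vertex hvertex (p := p) x₀.2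
  obtain ⟨j, hj, ⟨e⟩⟩ := hlinks 0 σ₀
  have hj' : j = m + 1 := by omega
  subst hj'
  have hne : (Metric.sphere (0 : EuclideanSpace ℝ (Fin (m + 1))) 1).Nonempty :=
    NormedSpace.sphere_nonempty.2 zero_le_one
  obtain ⟨z, hz⟩ := hne
  obtain ⟨-, l, σ, f, -, y, hy, hyf, -⟩ := e.symm ⟨z, hz⟩
  -- A link point has coordinate `2 / 3` at the vertex, whereas the only point of a 0-simplex has
  -- coordinate `1`.
  have hl : l ≠ 0 := by
    rintro rfl
    have h1 := hy.2
    have h2 := hyf 0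
    have h3 : f 0 = 0 := Fin.ext (by omega)
    rw [h3] at h2
    simp at h1
    rw [h1] at h2
    norm_num at h2
  obtain ⟨s, hs, -⟩ := T.exists_isLift cov σ (single_mem_stdSimplex ℝ 0) (x := (x₀ : X))
    (by rw [T.char_single hvertex]; exact x₀.2)
  refine ⟨_, _, ((T.liftComplex cov x₀ hvertex hess).label_injective s ⟨σ, hs⟩).ne
    (a₁ := 0) (a₂ := Fin.last l) fun h => hl ?_⟩
  have := congr_arg Fin.val h
  simpa using this.symm

end Triangulation

/-! ### Developing maps: equivariance and existence. -/

namespace Triangulation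

variable {M X : Type*} [TopologicalSpace M] [TopologicalSpace X] {p : X → M}
  {T : Triangulation M} {v : M} (hvertex : T.HasUniqueVertex v) (hess : T.IsEssential v)
  [SimplyConnectedSpace X] [LocallyPathConnectedSpace X] [T2Space M] (cov : IsCoveringMap p)
  (x₀ : p ⁻¹' {v}) {ρ : FundamentalGroup M v →* (ℝ ≃o ℝ)} {F : X → ℝ}

omit [T2Space M] in
theorem _root_.IsDevelopingMap.map_fibrePoint (hF : IsDevelopingMap T cov x₀ ρ F)
    (g : FundamentalGroup M v) : F (fibrePoint cov x₀ g) = ρ g 0 := by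
  obtain ⟨τ, hτ⟩ := exists_isDeck cov x₀ g
  have : fibrePoint cov x₀ g = τ x₀ := hτ.2
  rw [this, hF.vertex g τ hτ]

omit [T2Space M] in
include hvertex in
theorem _root_.IsDevelopingMap.map_single (hF : IsDevelopingMap T cov x₀ ρ F) {k : ℕ} {σ : T.Cell k}
    {s : (Fin (k + 1) → ℝ) → X} (hs : T.IsLift p σ s) (i : Fin (k + 1)) :
    F (s (Pi.single i 1)) = ρ (fibreLabel cov x₀ (s (Pi.single i 1))) 0 := by
  rw [← hF.map_fibrePoint cov x₀, fibrePoint_fibreLabel cov x₀ (hs.map_single hvertex i)]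

omit [TopologicalSpace M] [TopologicalSpace X] [SimplyConnectedSpace X]
  [LocallyPathConnectedSpace X] [T2Space M] in
theorem exists_face_of_ne {M : Type*} [TopologicalSpace M] (T : Triangulation M) {k : ℕ}
    (σ : T.Cell k) {i j : Fin (k + 1)} (hij : i ≠ j) :
    ∃ (f : Fin (1 + 1) ↪ Fin (k + 1)) (τ : T.Cell 1) (π : Equiv.Perm (Fin (1 + 1))),
      (∀ y ∈ stdSimplex ℝ (Fin (1 + 1)), T.char σ (faceMap f y) = T.char τ (y ∘ π)) ∧
      ∀ y ∈ segment ℝ (Pi.single i 1 : Fin (k + 1) → ℝ) (Pi.single j 1),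
        ∃ w ∈ stdSimplex ℝ (Fin (1 + 1)), faceMap f (w ∘ π.symm) = y := by
  let f : Fin (1 + 1) ↪ Fin (k + 1) := ⟨![i, j], by
    intro a b hab
    fin_cases a <;> fin_cases b <;> simp_all [eq_comm]⟩
  obtain ⟨τ, π, h⟩ := T.char_face σ f
  refine ⟨f, τ, π, h, ?_⟩
  rintro y ⟨a, b, ha, hb, hab, rfl⟩
  have hw : ![a, b] ∈ stdSimplex ℝ (Fin (1 + 1)) := by
    refine ⟨fun l => ?_, by simpa using hab⟩
    fin_cases l
    exacts [ha, hb]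
  refine ⟨![a, b] ∘ π, comp_perm_mem_stdSimplex hw π, ?_⟩
  have h1 : (![a, b] ∘ π) ∘ π.symm = a • Pi.single 0 1 + b • Pi.single 1 1 := by
    funext l
    simp only [Function.comp, Equiv.apply_symm_apply]
    fin_cases l <;> simp
  have h2 : ∀ l, f l ∈ range f := fun l => ⟨l, rfl⟩
  rw [h1]
  funext l
  by_cases hl : l ∈ range f
  · obtain ⟨l, rfl⟩ := hl
    rw [faceMap_apply]
    have e0 : (Pi.single (f 0) 1 : Fin (k + 1) → ℝ) (f l) = (Pi.single 0 1 : Fin 2 → ℝ) l := by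
      rw [← faceMap_single, faceMap_apply]
    have e1 : (Pi.single (f 1) 1 : Fin (k + 1) → ℝ) (f l) = (Pi.single 1 1 : Fin 2 → ℝ) l := by
      rw [← faceMap_single, faceMap_apply]
    change _ = a * (Pi.single (f 0) 1 : Fin (k + 1) → ℝ) (f l) +
      b * (Pi.single (f 1) 1 : Fin (k + 1) → ℝ) (f l)
    rw [e0, e1]
    rfl
  · rw [faceMap_apply_of_notMem f _ hl]
    have hi : l ≠ i := fun h => hl ⟨0, h.symm⟩
    have hj : l ≠ j := fun h => hl ⟨1, h.symm⟩
    simp [hi, hj]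

variable [LinearOrder (FundamentalGroup M v)]

omit [SimplyConnectedSpace X] [LocallyPathConnectedSpace X] [T2Space M]
  [LinearOrder (FundamentalGroup M v)] in
theorem _root_.IsDevelopingMap.injOn_segment (hF : IsDevelopingMap T cov x₀ ρ F) {k : ℕ}
    {σ : T.Cell k} {s : (Fin (k + 1) → ℝ) → X} (hs : T.IsLift p σ s) (i j : Fin (k + 1))
    (hij : i ≠ j) : InjOn (fun y => F (s y)) (segment ℝ (Pi.single i 1) (Pi.single j 1)) := by
  obtain ⟨f, τ, π, h, hseg⟩ := T.exists_face_of_ne σ hij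
  intro y hy z hz hyz
  obtain ⟨a, ha, rfl⟩ := hseg y hy
  obtain ⟨b, hb, rfl⟩ := hseg z hz
  rw [hF.edge_injOn τ _ (hs.face h) ha hb hyz]

theorem _root_.IsDevelopingMap.isTransverseMap (hρ : StrictMono fun g => ρ g 0)
    (hF : IsDevelopingMap T cov x₀ ρ F) :
    (T.liftComplex cov x₀ hvertex hess).IsTransverseMap F where
  continuous := hF.continuous
  transverse := by
    rintro k s ⟨σ, hs⟩
    have hc : ContinuousOn (fun y => F (s y)) (stdSimplex ℝ (Fin (k + 1))) :=
      hF.continuous.comp_continuousOn hs.1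
    refine ⟨hc, fun t => exists_isLevelForm hc (hF.injOn_segment cov x₀ hs)
      (hF.level_polytope k σ s hs) t, fun i j => ?_⟩
    simp only [hF.map_single hvertex cov x₀ hs]
    exact hρ.lt_iff_lt

-- Equivariance is given on the edges. Each level in a simplex is the hull of its edge points, and
-- the deck transformation sends the edge points of level `t` to edge points of level `ρ g t`.
omit [T2Space M] [LinearOrder (FundamentalGroup M v)] in
include hvertex in
theorem _root_.IsDevelopingMap.equivariant (hF : IsDevelopingMap T cov x₀ ρ F)
    {g : FundamentalGroup M v} {τ : X ≃ₜ X} (hτ : IsDeck cov x₀ g τ) (x : X) :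
    F (τ x) = ρ g (F x) := by
  obtain ⟨k, σ, s, hs, y, hy, rfl, -⟩ := T.lift_carrier cov x
  have hvert : ∀ i, F (τ (s (Pi.single i 1))) = ρ g (F (s (Pi.single i 1))) := fun i => by
    rw [hF.map_single hvertex cov x₀ (hs.deck hτ.1), hF.map_single hvertex cov x₀ hs,
      hτ.fibreLabel cov x₀ (hs.map_single hvertex i), map_mul]
    rfl
  have hskel : ∀ y ∈ oneSkeleton k, F (τ (s y)) = ρ g (F (s y)) := by
    intro y hy
    obtain ⟨i, j, r, hr, rfl⟩ := exists_edgePoint hy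
    rcases eq_or_ne i j with rfl | hij
    · have : edgePoint i i r = Pi.single i 1 := by rw [edgePoint, ← add_smul]; simp
      rw [this, hvert]
    · obtain ⟨f, τ', π, h, hseg⟩ := T.exists_face_of_ne σ hij
      obtain ⟨w, hw, hwe⟩ := hseg _ (edgePoint_mem_segment i j hr)
      have := hF.edge_equivariant g τ hτ τ' _ (hs.face h) w hw
      rwa [hwe] at this
  have h1 : y ∈ convexHull ℝ {z | z ∈ oneSkeleton k ∧ F (s z) = F (s y)} := by
    rw [← hF.level_polytope k σ s hs (F (s y))]
    exact ⟨hy.1, rfl⟩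
  have h2 : {z | z ∈ oneSkeleton k ∧ F (s z) = F (s y)} ⊆
      {z | z ∈ oneSkeleton k ∧ F (τ (s z)) = ρ g (F (s y))} := fun z hz =>
    ⟨hz.1, by rw [hskel z hz.1, hz.2]⟩
  have h3 := convexHull_mono h2 h1
  rw [← hF.level_polytope k σ _ (hs.deck hτ.1) (ρ g (F (s y)))] at h3
  exact h3.2

omit [LocallyPathConnectedSpace X] in
theorem isDevelopingMap_of_isTransverseMap
    (hF : (T.liftComplex cov x₀ hvertex hess).IsTransverseMap F) (hbase : F x₀ = 0)
    (heq : ∀ g τ, IsDeck cov x₀ g τ → ∀ x, F (τ x) = ρ g (F x)) :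
    IsDevelopingMap T cov x₀ ρ F where
  continuous := hF.continuous
  vertex := fun g τ hτ => by rw [heq g τ hτ, hbase]
  edge_injOn := by
    intro σ s hs y hy z hz hyz
    have hT := hF.transverse s ⟨σ, hs⟩
    have hinj := (T.liftComplex cov x₀ hvertex hess).label_injective s ⟨σ, hs⟩
    obtain ⟨c, hc⟩ := hT.exists_form (F (s y))
    have h1 := (hc.eq_zero_iff hy).2 rfl
    have h2 := (hc.eq_zero_iff hz).2 hyz.symm
    have hy1 := hy.2
    have hz1 := hz.2
    simp only [Nat.reduceAdd, Fin.sum_univ_two] at h1 h2 hy1 hz1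
    have hne : c 0 ≠ c 1 := by
      intro h
      have h0 : c 0 = 0 := by
        rw [← h] at h1
        linear_combination h1 - c 0 * hy1
      have hv : ∀ l : Fin 2, c l = 0 → F (s (Pi.single l 1)) = F (s y) := fun l hl =>
        (hc.eq_zero_iff (single_mem_stdSimplex ℝ l)).1 (by rw [sum_mul_single, hl])
      have h3 := (hv 0 h0).trans (hv 1 (h ▸ h0)).symm
      have h4 := hinj (le_antisymm ((hT.le_iff 0 1).1 h3.le) ((hT.le_iff 1 0).1 h3.ge))
      exact absurd h4 (by decide)
    have h5 : y 1 = z 1 := by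
      have : (c 1 - c 0) * (y 1 - z 1) = 0 := by
        linear_combination h1 - h2 - c 0 * hy1 + c 0 * hz1
      exact sub_eq_zero.1 ((mul_eq_zero.1 this).resolve_left (sub_ne_zero.2 hne.symm))
    funext l
    fin_cases l
    · change y 0 = z 0
      linarith
    · exact h5
  edge_equivariant := fun g τ hτ _ _ _ _ _ => heq g τ hτ _
  level_polytope := by
    intro k σ s hs t
    obtain ⟨c, hc⟩ := (hF.transverse s ⟨σ, hs⟩).exists_form t
    have h1 : {y | y ∈ stdSimplex ℝ (Fin (k + 1)) ∧ F (s y) = t} =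
        {y | y ∈ stdSimplex ℝ (Fin (k + 1)) ∧ ∑ i, c i * y i = 0} := by
      ext y
      exact and_congr_right fun hy => (hc.eq_zero_iff hy).symm
    have h2 : {y | y ∈ oneSkeleton k ∧ F (s y) = t} =
        {y | y ∈ oneSkeleton k ∧ ∑ i, c i * y i = 0} := by
      ext y
      exact and_congr_right fun hy => (hc.eq_zero_iff hy.1).symm
    rw [h1, h2, hyperplaneSection_eq_convexHull]

section Existence

variable (hρ : StrictMono fun g => ρ g 0)
  {P : ℕ → Prop} {Form : ∀ {k : ℕ}, (Fin (k + 1) → FundamentalGroup M v) → ℝ →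
    (Fin (k + 1) → ℝ) → Prop} (h : IsFormFamily P (fun g => ρ g 0) Form)
  (hP : ∀ k, T.Cell k → P k)
  (hinv : ∀ g, ∀ {k : ℕ} {lab : Fin (k + 1) → FundamentalGroup M v} {t : ℝ} {c : Fin (k + 1) → ℝ},
    Form lab t c → Form (fun i => g * lab i) (ρ g t) c)
include hvertex hess hρ h hP hinv

omit [LocallyPathConnectedSpace X] in
theorem exists_isDevelopingMap_of_isFormFamily : ∃ F : X → ℝ, IsDevelopingMap T cov x₀ ρ F ∧
    ∀ (k : ℕ) (σ : T.Cell k) (s : (Fin (k + 1) → ℝ) → X), T.IsLift p σ s →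
      ∀ y ∈ stdSimplex ℝ (Fin (k + 1)),
        F (s y) = levelOf Form (fun i => fibreLabel cov x₀ (s (Pi.single i 1))) y := by
  have := cov.t2Space
  let K := T.liftComplex cov x₀ hvertex hess
  obtain ⟨F, hF, hlev⟩ := h.exists_transverseMap K (fun k ⟨s, σ, hs⟩ => hP k σ) hρ
  refine ⟨F, isDevelopingMap_of_isTransverseMap hvertex hess cov x₀ hF ?_ fun g τ hτ x => ?_,
    fun k σ s hs y hy => hlev k s ⟨σ, hs⟩ y hy⟩
  · obtain ⟨σ, s, hs, hsx⟩ := T.exists_isLift_vertex hvertex (x := (x₀ : X)) x₀.2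
    rw [← hsx, hlev 0 s ⟨σ, hs⟩ _ (single_mem_stdSimplex ℝ 0),
      h.levelOf_single (lab := K.verts s) (hP 0 σ) (K.label_injective s ⟨σ, hs⟩)]
    have : K.verts s 0 = 1 := by
      change fibreLabel cov x₀ (s (Pi.single 0 1)) = 1
      rw [hsx, ← fibrePoint_one cov x₀, fibreLabel_fibrePoint]
    rw [this, map_one]
    rfl
  · obtain ⟨k, σ, s, hs, y, hy, rfl, -⟩ := T.lift_carrier cov x
    have := hlev k _ ⟨σ, hs.deck hτ.1⟩ y hy.1
    rw [this, hlev k s ⟨σ, hs⟩ y hy.1,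
      ← h.levelOf_mul (lab := K.verts s) g (ρ g) (hinv g) (hP k σ) (K.label_injective s ⟨σ, hs⟩) hy.1]
    congr 1
    funext i
    exact hτ.fibreLabel cov x₀ (hs.map_single hvertex i)

end Existence

-- The vertex labelled `g` gets the coefficient `-ρ(g⁻¹)(t)`, which decreases strictly and vanishes
-- at `t = ρ(g)(0)`. Replacing `g` by `h * g` and `t` by `ρ(h)(t)` does not change it.
omit [LocallyPathConnectedSpace X] in
include hvertex hess in
theorem exists_isDevelopingMap (hρ : StrictMono fun g => ρ g 0) :
    ∃ F : X → ℝ, IsDevelopingMap T cov x₀ ρ F := by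
  have hfam := isFormFamily_vertex (a := fun g => ρ g 0) (γ := fun g t => -(ρ g⁻¹ t))
    (fun g => (ρ g⁻¹).continuous.neg) (fun g a b hab => neg_lt_neg ((ρ g⁻¹).strictMono hab))
    (fun g => by
      rw [neg_eq_zero, ← RelIso.mul_apply, ← map_mul, inv_mul_cancel, map_one]; rfl)
  obtain ⟨F, hF, -⟩ := exists_isDevelopingMap_of_isFormFamily hvertex hess cov x₀ hρ hfam
    (fun _ _ => trivial) fun g k lab t c hc i => by
      rw [hc i, ← RelIso.mul_apply, ← map_mul, mul_inv_rev, inv_mul_cancel_right]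
  exact ⟨F, hF⟩

end Triangulation

theorem Fin.sum_univ_of_ne {i j : Fin 2} (hij : i ≠ j) (g : Fin 2 → ℝ) : ∑ l, g l = g i + g j := by
  fin_cases i <;> fin_cases j <;> simp_all [add_comm]

theorem IsFormFamily.levelOf_edge {G : Type*} {P : ℕ → Prop} {a : G → ℝ} {v : G → G → ℝ → ℝ}
    (h : IsFormFamily P a fun lab t c => IsEdgeForm a v lab t c) {lab : Fin (1 + 1) → G}
    {i j : Fin (1 + 1)} (hij : i ≠ j) (hj : a (lab j) = 0) (hi : a (lab i) < 0)
    (hv : ∀ t, v (lab i) (lab j) t = t / a (lab i)) {y : Fin (1 + 1) → ℝ}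
    (hy : y ∈ stdSimplex ℝ (Fin (1 + 1))) :
    levelOf (fun lab t c => IsEdgeForm a v lab t c) lab y = y i * a (lab i) := by
  have hl : ∀ l, l = i ∨ l = j := by omega
  have hsum := Fin.sum_univ_of_ne hij
  have hy1 : y i + y j = 1 := by rw [← hsum]; exact hy.2
  have hi0 := hy.1 i
  have hj0 := hy.1 j
  let c : Fin (1 + 1) → ℝ := fun l => if l = j then y i else -y j
  have hcj : c j = y i := if_pos rfl
  have hci : c i = -y j := if_neg hij
  have hTi : a (lab i) ≤ y i * a (lab i) := by nlinarith
  have hT0 : y i * a (lab i) ≤ 0 := by nlinarith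
  refine h.levelOf_eq (c := c) hy ⟨fun l => ?_, fun l => ?_, fun l l' => ?_⟩ ?_
  · rcases hl l with rfl | rfl
    · rw [hci]
      constructor <;> intro <;> linarith
    · rw [hcj, hj]
      constructor
      · intro h0; exact mul_neg_of_pos_of_neg h0 hi
      · intro h0; by_contra hn; nlinarith
  · rcases hl l with rfl | rfl
    · rw [hci]
      constructor
      · intro h0; nlinarith
      · intro h0; by_contra hn
        have : y j = 0 := by linarith
        rw [show y l = 1 by linarith] at h0
        linarith
    · rw [hcj, hj]
      constructor <;> intro <;> linarith
  · intro h1 h2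
    rcases hl l with rfl | rfl
    · rcases hl l' with rfl | rfl
      · linarith
      · rw [hci, hcj, hv, mul_div_cancel_right₀ _ hi.ne]
        linear_combination -y l * hy1
    · rw [hj] at h1
      linarith
  · rw [hsum, hci, hcj]
    ring

namespace Triangulation

variable {M X : Type*} [TopologicalSpace M] [TopologicalSpace X] {p : X → M}
  {T : Triangulation M} {v : M} (hvertex : T.HasUniqueVertex v) (hess : T.IsEssential v)
  [SimplyConnectedSpace X] [LocallyPathConnectedSpace X] [T2Space M] (cov : IsCoveringMap p)
  (x₀ : p ⁻¹' {v}) {ρ : FundamentalGroup M v →* (ℝ ≃o ℝ)}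

section Affine

variable [LinearOrder (FundamentalGroup M v)]

-- For `h = 1` the coordinate is `t / ρ(g)(0)`, the affine one on edges ending at the base point.
-- Other edges are obtained by translating their upper end to `1`.
omit [SimplyConnectedSpace X] [LocallyPathConnectedSpace X] [T2Space M] in
theorem isEdgeCoordinate_div (hρ : StrictMono fun g => ρ g 0) :
    IsEdgeCoordinate (fun g => ρ g 0) fun g h t => ρ h⁻¹ t / ρ h⁻¹ (ρ g 0) := by
  have hinv : ∀ h t, ρ h⁻¹ (ρ h t) = t := fun h t => by
    rw [← RelIso.mul_apply, ← map_mul, inv_mul_cancel, map_one]; rfl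
  have hneg : ∀ g h, g < h → ρ h⁻¹ (ρ g 0) < 0 := fun g h hgh => by
    have := (ρ h⁻¹).strictMono (hρ hgh)
    simp only [hinv] at this
    exact this
  exact {
    continuous := fun g h _ => (ρ h⁻¹).continuous.div_const _
    anti := fun g h hgh t t' htt =>
      div_lt_div_of_neg_of_lt (hneg g h hgh) ((ρ h⁻¹).strictMono htt)
    left := fun g h hgh => div_self (hneg g h hgh).ne
    right := fun g h _ => by simp only [hinv, zero_div] }

include hvertex hess in
theorem exists_isDevelopingMap_isAffineOnBaseEdges [Infinite (FundamentalGroup M v)]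
    (hdim : ∀ k, T.Cell k → k ≤ 2) (hρ : StrictMono fun g => ρ g 0) :
    ∃ F : X → ℝ, IsDevelopingMap T cov x₀ ρ F ∧ IsAffineOnBaseEdges T p x₀ F := by
  have hmul : ∀ g h t, ρ g (ρ h t) = ρ (g * h) t := fun g h t => by rw [map_mul]; rfl
  have hfam := isFormFamily_edge hρ (isEdgeCoordinate_div hρ)
  obtain ⟨F, hF, hlev⟩ := exists_isDevelopingMap_of_isFormFamily hvertex hess cov x₀ hρ hfam
    hdim fun g k lab t c hc => by
      -- The edge forms are invariant because the coordinates depend only on the edge after its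
      -- upper end has been translated to `1`.
      refine ⟨fun i => ?_, fun i => ?_, fun i j h1 h2 => ?_⟩
      · rw [hc.pos_iff, ← hmul, (ρ g).lt_iff_lt]
      · rw [hc.neg_iff, ← hmul, (ρ g).lt_iff_lt]
      · rw [← hmul, (ρ g).lt_iff_lt] at h1 h2
        have := hc.edge i j h1 h2
        simpa only [hmul, mul_inv_rev, mul_assoc, inv_mul_cancel_left, inv_mul_cancel, mul_one]
          using this
  refine ⟨F, hF, fun σ s hs ⟨j, hj⟩ hle y hy => ?_⟩
  obtain ⟨i, hij⟩ := exists_ne j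
  have hl : ∀ l, l = i ∨ l = j := by omega
  have hsum := Fin.sum_univ_of_ne hij
  have hlabj : fibreLabel cov x₀ (s (Pi.single j 1)) = 1 := by
    rw [hj, ← fibrePoint_one cov x₀, fibreLabel_fibrePoint]
  have hFj : F (s (Pi.single j 1)) = 0 := by
    rw [hF.map_single hvertex cov x₀ (k := 1) hs, hlabj, map_one]; rfl
  have hFi : F (s (Pi.single i 1)) < 0 := by
    have h1 := hle _ (single_mem_stdSimplex ℝ i)
    rw [← hj, hFj] at h1
    refine lt_of_le_of_ne h1 fun h0 => hij ?_
    have := hF.edge_injOn σ s hs (single_mem_stdSimplex ℝ i) (single_mem_stdSimplex ℝ j)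
      (h0.trans hFj.symm)
    by_contra hne
    have := congr_fun this i
    simp [hij] at this
  have hFi' := hF.map_single hvertex cov x₀ (k := 1) hs i
  rw [hsum, hFj, mul_zero, add_zero, hlev 1 σ s hs y hy,
    hfam.levelOf_edge (lab := fun i => fibreLabel cov x₀ (s (Pi.single i 1))) hij _ _ _ hy, hFi']
  · rw [← hF.map_single hvertex cov x₀ (k := 1) hs, hFj]
  · rw [← hFi']
    exact hFi
  · intro t
    simp only [hlabj, inv_one, map_one]
    rfl

end Affine

omit [TopologicalSpace X] [SimplyConnectedSpace X] [LocallyPathConnectedSpace X] [T2Space M] in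
theorem HasSphericalLinks.le {M : Type*} [TopologicalSpace M] {T : Triangulation M} {n : ℕ}
    (h : T.HasSphericalLinks n) {k : ℕ} (σ : T.Cell k) : k ≤ n := by
  obtain ⟨j, hj, -⟩ := h k σ
  omega

section Collapse

variable [LinearOrder (FundamentalGroup M v)] [MulLeftStrictMono (FundamentalGroup M v)]
  [Nontrivial (FundamentalGroup M v)]
include hvertex hess

theorem exists_isStripCollapse {ρ₀ : FundamentalGroup M v →* (ℝ ≃o ℝ)}
    {s : ℕ ≃ FundamentalGroup M v} {F F₀ : X → ℝ} (hρ : StrictMono fun g => ρ g 0)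
    (hρ₀ : StrictMono fun g => ρ₀ g 0) (hmin : IsMinimalEmbedding s fun g => ρ₀ g 0)
    (hF : IsDevelopingMap T cov x₀ ρ F) (hF₀ : IsDevelopingMap T cov x₀ ρ₀ F₀) :
    ∃ (f : ℝ → ℝ) (κ : X → X), IsStripCollapse T p v F F₀ f κ := by
  have := cov.t2Space
  have := noMaxOrder_of_nontrivial (G := FundamentalGroup M v)
  have := noMinOrder_of_nontrivial (G := FundamentalGroup M v)
  obtain ⟨f, hf, hmono, hcont, hequi⟩ := exists_semiconj hρ hρ₀ hmin
  let K := T.liftComplex cov x₀ hvertex hess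
  have hK := hF.isTransverseMap hvertex hess cov x₀ hρ
  have hK₀ := hF₀.isTransverseMap hvertex hess cov x₀ hρ₀
  -- Vertex values bracket `F x`, and the order on `G` has no extreme elements.
  have hH : ∀ x, F x ∈ strictHull fun g => ρ g 0 := by
    intro x
    obtain ⟨k, s, ⟨σ, hs⟩, y, hy, rfl, ⟨i, -, hi⟩, j, -, hj⟩ := hK.between_self x
    obtain ⟨g, hg⟩ := exists_lt (fibreLabel cov x₀ (s (Pi.single i 1)))
    obtain ⟨h, hh⟩ := exists_gt (fibreLabel cov x₀ (s (Pi.single j 1)))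
    simp only [hF.map_single hvertex cov x₀ hs] at hi hj
    exact ⟨⟨g, (hρ hg).trans_le hi⟩, h, hj.trans_lt (hρ hh)⟩
  have hv : ∀ k, ∀ s ∈ K.simplex k, ∀ i, f (F (s (Pi.single i 1))) = F₀ (s (Pi.single i 1)) := by
    rintro k s ⟨σ, hs⟩ i
    rw [hF.map_single hvertex cov x₀ hs, hF₀.map_single hvertex cov x₀ hs, hf]
  have hb := K.between_collapse hK hH hmono hv
  refine ⟨f, K.collapse F F₀ f, ?_, ?_, ?_, ?_, ?_, ?_, ?_⟩
  · exact LabelledComplex.continuous_collapse hK hK₀ hH hmono hv hcont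
  · intro τ hτ x
    obtain ⟨g, hg⟩ := exists_isDeck_of_deck cov x₀ hτ
    exact (T.isAutomorphism_deck hvertex hess cov x₀ hg).collapse hK hK₀ hH hmono hv
      (hF.equivariant hvertex cov x₀ hg) (hF₀.equivariant hvertex cov x₀ hg) (hequi g) x
  · exact fun k σ s hs => LabelledComplex.collapse_image hK hK₀ hH hmono hv hcont ⟨σ, hs⟩
  · exact hmono.mono (range_subset_iff.2 hH)
  · exact LabelledComplex.map_collapse hK hK₀ hH hmono hv
  · intro a b c hc hfc hab
    have hv' : ∀ k, ∀ s ∈ K.simplex k, ∀ i, F (s (Pi.single i 1)) ∉ Ioo a b :=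
      fun k s ⟨σ, hs⟩ i hi => hab _ hi (hs.map_single hvertex i)
    obtain ⟨Φ, hΦ⟩ := hK.exists_strip_homeomorph hv' hc
    refine ⟨Φ, fun x => ⟨(hΦ x).1, ?_⟩⟩
    obtain ⟨k, s, hs, y, hy, w, hw, hx, hz, q, hq, hrel⟩ := hK.exists_oddsRel_orb hv' x.2 hc
    rw [(hΦ x).2, LabelledComplex.collapse, hK.map_orb (hK.between_of_mem_Ioo hv' x.2 hc),
      LabelledComplex.collapse, hz, ← hx]
    -- Inside the strip, `x` and its projection share an open orbit, and `f` takes the same value on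
    -- their levels. So they have the same image under the collapse.
    have hfx : f c = f (F (s y)) := by rw [hx]; exact (hfc _ x.2).symm
    rw [hfx]
    exact hK₀.orb_eq_of_oddsRel hs hy hw hq hrel (hb _)
  · intro x y hxy hκ
    rcases LabelledComplex.collapse_injective hK hK₀ hH hmono hv hxy hκ with h | ⟨k, s, ⟨σ, hs⟩, i, h⟩
    · exact Or.inl h
    · exact Or.inr ⟨h.1 ▸ hs.map_single hvertex i, _, ⟨_, rfl⟩, h.2⟩

end Collapse

end Triangulation

theorem exists_equiv_nat_zero {G : Type*} [Countable G] [Infinite G] (g : G) :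
    ∃ s : ℕ ≃ G, s 0 = g := by
  classical
  obtain ⟨e⟩ := nonempty_denumerable G
  let s := (Denumerable.eqv G).symm
  exact ⟨s.trans (Equiv.swap (s 0) g), by simp⟩

/-! ### Radial rescaling relative to a face. -/

section Rescale

variable {k l : ℕ} (f : Fin (k + 1) ↪ Fin (l + 1))

/-- Change the barycentric coordinates on a face to `u`, and multiply the remaining ones by a
common factor. -/
noncomputable def rescale (u : Fin (k + 1) → ℝ) (y : Fin (l + 1) → ℝ) : Fin (l + 1) → ℝ :=
  faceMap f u + ((1 - ∑ i, u i) / (1 - ∑ i, y (f i))) • (y - faceMap f (y ∘ f))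

theorem rescale_apply (u : Fin (k + 1) → ℝ) (y : Fin (l + 1) → ℝ) (i : Fin (k + 1)) :
    rescale f u y (f i) = u i := by
  simp [rescale, faceMap_apply]

theorem rescale_apply_of_notMem (u : Fin (k + 1) → ℝ) (y : Fin (l + 1) → ℝ) {j : Fin (l + 1)}
    (hj : j ∉ range f) :
    rescale f u y j = (1 - ∑ i, u i) / (1 - ∑ i, y (f i)) * y j := by
  simp [rescale, faceMap_apply_of_notMem f _ hj]

theorem sum_comp_le_one {y : Fin (l + 1) → ℝ} (hy : y ∈ stdSimplex ℝ (Fin (l + 1))) :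
    ∑ i, y (f i) ≤ 1 := by
  rw [← hy.2, ← Finset.sum_map Finset.univ f y]
  exact Finset.sum_le_sum_of_subset_of_nonneg (Finset.subset_univ _) fun i _ _ => hy.1 i

theorem eq_faceMap_of_sum_comp_eq_one {y : Fin (l + 1) → ℝ} (hy : y ∈ stdSimplex ℝ (Fin (l + 1)))
    (h : ∑ i, y (f i) = 1) : faceMap f (y ∘ f) = y := by
  refine faceMap_comp_self f fun j hj => ?_
  have h1 : ∑ i, (y - faceMap f (y ∘ f)) i = 0 := by
    have h2 := sum_mul_faceMap f (fun _ => 1) (y ∘ f)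
    simp only [one_mul, Function.comp] at h2
    simp only [Pi.sub_apply, Finset.sum_sub_distrib, hy.2]
    change 1 - ∑ i, faceMap f (y ∘ f) i = 0
    rw [show ∑ i, faceMap f (y ∘ f) i = ∑ i, y (f i) from h2, h, sub_self]
  have h3 : ∀ i, 0 ≤ (y - faceMap f (y ∘ f)) i := fun i => by
    by_cases hi : i ∈ range f
    · obtain ⟨i, rfl⟩ := hi
      simp [faceMap_apply]
    · simp [faceMap_apply_of_notMem f _ hi, hy.1 i]
  have h4 := (Finset.sum_eq_zero_iff_of_nonneg fun i _ => h3 i).1 h1 j (Finset.mem_univ _)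
  simpa [faceMap_apply_of_notMem f _ hj] using h4

theorem rescale_mem {u : Fin (k + 1) → ℝ} (hu : ∀ i, 0 ≤ u i) (hu1 : ∑ i, u i ≤ 1)
    {y : Fin (l + 1) → ℝ} (hy : y ∈ stdSimplex ℝ (Fin (l + 1))) (hr : ∑ i, y (f i) < 1) :
    rescale f u y ∈ stdSimplex ℝ (Fin (l + 1)) := by
  refine ⟨fun j => ?_, ?_⟩
  · by_cases hj : j ∈ range f
    · obtain ⟨i, rfl⟩ := hj
      rw [rescale_apply]
      exact hu i
    · rw [rescale_apply_of_notMem f u y hj]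
      exact mul_nonneg (div_nonneg (by linarith) (by linarith)) (hy.1 j)
  · have h2 : ∀ w : Fin (k + 1) → ℝ, ∑ j, faceMap f w j = ∑ i, w i := fun w => by
      simpa using sum_mul_faceMap f (fun _ => 1) w
    simp only [rescale, Pi.add_apply, Pi.smul_apply, Pi.sub_apply, smul_eq_mul,
      Finset.sum_add_distrib, ← Finset.mul_sum, Finset.sum_sub_distrib, h2, hy.2, Function.comp]
    rw [div_mul_cancel₀ _ (by linarith)]
    ring

theorem rescale_rescale {u : Fin (k + 1) → ℝ} (hu : ∑ i, u i < 1) {y : Fin (l + 1) → ℝ}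
    (hr : ∑ i, y (f i) < 1) (u' : Fin (k + 1) → ℝ) :
    rescale f u' (rescale f u y) = rescale f u' y := by
  funext j
  by_cases hj : j ∈ range f
  · obtain ⟨i, rfl⟩ := hj
    rw [rescale_apply, rescale_apply]
  · simp only [rescale_apply_of_notMem f _ _ hj, rescale_apply]
    have : 1 - ∑ i, u i ≠ 0 := by linarith
    have : 1 - ∑ i, y (f i) ≠ 0 := by linarith
    field_simp

theorem rescale_self {y : Fin (l + 1) → ℝ} (hr : ∑ i, y (f i) < 1) : rescale f (y ∘ f) y = y := by
  funext j
  by_cases hj : j ∈ range f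
  · obtain ⟨i, rfl⟩ := hj
    rw [rescale_apply]; rfl
  · rw [rescale_apply_of_notMem f _ _ hj]
    have : 1 - ∑ i, y (f i) ≠ 0 := by linarith
    simp only [Function.comp]
    rw [div_self this, one_mul]

theorem rescale_faceMap {d : ℕ} (g : Fin (d + 1) ↪ Fin (l + 1)) (f' : Fin (k + 1) ↪ Fin (d + 1))
    (h : ∀ i, f i = g (f' i)) (u : Fin (k + 1) → ℝ) (w : Fin (d + 1) → ℝ) :
    rescale f u (faceMap g w) = faceMap g (rescale f' u w) := by
  funext j
  by_cases hj : j ∈ range g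
  · obtain ⟨j, rfl⟩ := hj
    rw [faceMap_apply]
    by_cases hj : j ∈ range f'
    · obtain ⟨i, rfl⟩ := hj
      rw [rescale_apply, ← h, rescale_apply]
    · have : g j ∉ range f := by
        rintro ⟨i, hi⟩
        rw [h] at hi
        exact hj ⟨i, g.injective hi⟩
      rw [rescale_apply_of_notMem f _ _ this, rescale_apply_of_notMem f' _ _ hj]
      simp [h, faceMap_apply]
  · have : j ∉ range f := by
      rintro ⟨i, rfl⟩
      exact hj ⟨f' i, (h i).symm⟩
    rw [rescale_apply_of_notMem f _ _ this, faceMap_apply_of_notMem g _ hj,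
      faceMap_apply_of_notMem g _ hj, mul_zero]

theorem continuousOn_rescale (u : Fin (k + 1) → ℝ) :
    ContinuousOn (rescale f u) {y | ∑ i, y (f i) < 1} := by
  refine continuousOn_const.add (ContinuousOn.fun_smul ?_ ?_)
  · refine continuousOn_const.div (by fun_prop) fun y hy => ?_
    exact (sub_pos.2 hy).ne'
  · exact (continuous_id.sub ((continuous_faceMap f).comp (by fun_prop))).continuousOn

end Rescale

/-! ### Barycentric coordinates and cofaces. -/

namespace LabelledComplex

variable {X G : Type*} [TopologicalSpace X] (K : LabelledComplex X G)

theorem exists_simplex_tendsto [T2Space X] {x : X} {U : Ultrafilter X} (hU : ↑U ≤ 𝓝 x) :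
    ∃ k, ∃ s ∈ K.simplex k, ∃ y ∈ stdSimplex ℝ (Fin (k + 1)), s y = x ∧
      ∃ r : X → (Fin (k + 1) → ℝ), (∀ᶠ q in U, r q ∈ stdSimplex ℝ (Fin (k + 1)) ∧ s (r q) = q) ∧
        Filter.Tendsto r U (𝓝[stdSimplex ℝ (Fin (k + 1))] y) := by
  obtain ⟨k, s, hs, hsU⟩ := K.mem_ultrafilter x U hU
  have hev : ∀ᶠ q in U, ∃ y, y ∈ stdSimplex ℝ (Fin (k + 1)) ∧ s y = q := hsU
  obtain ⟨r, hr⟩ := hev.choice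
  obtain ⟨y, hy, hlim⟩ := isCompact_iff_ultrafilter_le_nhds.1 (isCompact_stdSimplex ℝ _) (U.map r)
    (by rw [Filter.le_principal_iff]; exact hr.mono fun q hq => hq.1)
  have l1 : Filter.Tendsto r (U : Filter X) (𝓝[stdSimplex ℝ (Fin (k + 1))] y) :=
    tendsto_nhdsWithin_iff.2 ⟨hlim, hr.mono fun q hq => hq.1⟩
  exact ⟨k, s, hs, y, hy, tendsto_nhds_unique
    ((((K.continuousOn s hs) y hy).tendsto.comp l1).congr' (hr.mono fun q hq => hq.2)) hU, r, hr, l1⟩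

section Bary

open Classical in
/-- The barycentric coordinate of a point at the vertex of its carrier that has label `g`. -/
noncomputable def bary (g : G) (x : X) : ℝ :=
  ∑ i, if K.verts (K.carrier x).choose_spec.choose i = g then
    (K.carrier x).choose_spec.choose_spec.2.choose i else 0

open Classical in
theorem bary_apply {k : ℕ} {s : (Fin (k + 1) → ℝ) → X} (hs : s ∈ K.simplex k)
    {y : Fin (k + 1) → ℝ} (hy : y ∈ stdSimplex ℝ (Fin (k + 1))) (g : G) :
    K.bary g (s y) = ∑ i, if K.verts s i = g then y i else 0 := by
  obtain ⟨-, -, hcar⟩ := (K.carrier (s y)).choose_spec.choose_spec.2.choose_spec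
  obtain ⟨f, hf, hsf⟩ := hcar k s hs y hy rfl
  have h := sum_mul_faceMap f (fun i => if K.verts s i = g then 1 else 0)
    (K.carrier (s y)).choose_spec.choose_spec.2.choose
  rw [hf] at h
  simp only [ite_mul, one_mul, zero_mul] at h
  rw [h, bary, ← verts_comp hsf]
  rfl

theorem bary_verts {k : ℕ} {s : (Fin (k + 1) → ℝ) → X} (hs : s ∈ K.simplex k)
    {y : Fin (k + 1) → ℝ} (hy : y ∈ stdSimplex ℝ (Fin (k + 1))) (i : Fin (k + 1)) :
    K.bary (K.verts s i) (s y) = y i := by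
  classical
  rw [K.bary_apply hs hy, Finset.sum_eq_single i, if_pos rfl]
  · intro j _ hj
    exact if_neg fun h => hj (K.label_injective s hs h)
  · simp

theorem continuous_bary [T2Space X] (g : G) : Continuous (K.bary g) := by
  classical
  refine continuous_of_simplex (K := K) fun k s hs => ?_
  refine ContinuousOn.congr (f := fun y => ∑ i, if K.verts s i = g then y i else 0) ?_
    fun y hy => K.bary_apply hs hy g
  refine Continuous.continuousOn (continuous_finsetSum _ fun i _ => ?_)
  split_ifs <;> fun_prop

end Bary

/-- `s` is a simplex of which `s₀` is the face given by `f`. -/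
structure IsCoface {k l : ℕ} (s₀ : (Fin (k + 1) → ℝ) → X) (s : (Fin (l + 1) → ℝ) → X)
    (f : Fin (k + 1) ↪ Fin (l + 1)) : Prop where
  mem : s ∈ K.simplex l
  face : ∀ w ∈ stdSimplex ℝ (Fin (k + 1)), s (faceMap f w) = s₀ w

variable {K} {k : ℕ} {s₀ : (Fin (k + 1) → ℝ) → X}

theorem IsCoface.verts {l : ℕ} {s : (Fin (l + 1) → ℝ) → X} {f : Fin (k + 1) ↪ Fin (l + 1)}
    (h : K.IsCoface s₀ s f) (i : Fin (k + 1)) : K.verts s (f i) = K.verts s₀ i :=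
  congr_fun (verts_comp h.face) i

theorem IsCoface.bary {l : ℕ} {s : (Fin (l + 1) → ℝ) → X} {f : Fin (k + 1) ↪ Fin (l + 1)}
    (h : K.IsCoface s₀ s f) {y : Fin (l + 1) → ℝ} (hy : y ∈ stdSimplex ℝ (Fin (l + 1)))
    (i : Fin (k + 1)) : K.bary (K.verts s₀ i) (s y) = y (f i) := by
  rw [← h.verts, K.bary_verts h.mem hy]

/-- If the carrier of a point of a coface is not disjoint from any vertex of `s₀`, then `s₀` is a
face of the carrier. -/
theorem IsCoface.exists_factor {l d : ℕ} {s : (Fin (l + 1) → ℝ) → X}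
    {f : Fin (k + 1) ↪ Fin (l + 1)} (h : K.IsCoface s₀ s f) {s₁ : (Fin (d + 1) → ℝ) → X}
    (hs₁ : s₁ ∈ K.simplex d) {g : Fin (d + 1) ↪ Fin (l + 1)} {w : Fin (d + 1) → ℝ}
    (hg : ∀ w ∈ stdSimplex ℝ (Fin (d + 1)), s (faceMap g w) = s₁ w)
    (hpos : ∀ i, 0 < faceMap g w (f i)) :
    ∃ f' : Fin (k + 1) ↪ Fin (d + 1), (∀ i, f i = g (f' i)) ∧ K.IsCoface s₀ s₁ f' := by
  have hex : ∀ i, ∃ j, g j = f i := fun i => by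
    by_contra hne
    have := hpos i
    rw [faceMap_apply_of_notMem g w hne] at this
    exact lt_irrefl _ this
  choose f' hf' using hex
  let f'' : Fin (k + 1) ↪ Fin (d + 1) := ⟨f', fun i j hij => f.injective (by rw [← hf', hij, hf'])⟩
  refine ⟨f'', fun i => (hf' i).symm, hs₁, fun w hw => ?_⟩
  rw [← h.face w hw, ← hg _ (faceMap_mem f'' hw)]
  congr 1
  funext j
  by_cases hj : j ∈ range g
  · obtain ⟨j, rfl⟩ := hj
    rw [faceMap_apply]
    by_cases hj : j ∈ range f''
    · obtain ⟨i, rfl⟩ := hj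
      rw [faceMap_apply, show g (f'' i) = f i from hf' i, faceMap_apply]
    · rw [faceMap_apply_of_notMem f'' _ hj, faceMap_apply_of_notMem]
      rintro ⟨i, hi⟩
      exact hj ⟨i, g.injective ((hf' i).trans hi)⟩
  · rw [faceMap_apply_of_notMem g _ hj, faceMap_apply_of_notMem]
    rintro ⟨i, rfl⟩
    exact hj ⟨f' i, hf' i⟩

/-- Positive coordinates at the vertices of `s₀` make `s₀` a face of the carrier of the point, and
the carrier is a face of every simplex through the point. -/
theorem IsCoface.of_mem {l : ℕ} {s : (Fin (l + 1) → ℝ) → X} {f : Fin (k + 1) ↪ Fin (l + 1)}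
    (h : K.IsCoface s₀ s f) {y : Fin (l + 1) → ℝ} (hy : y ∈ stdSimplex ℝ (Fin (l + 1)))
    (hpos : ∀ i, 0 < y (f i)) {l' : ℕ} {s' : (Fin (l' + 1) → ℝ) → X} (hs' : s' ∈ K.simplex l')
    {y' : Fin (l' + 1) → ℝ} (hy' : y' ∈ stdSimplex ℝ (Fin (l' + 1))) (heq : s' y' = s y) :
    ∃ f', K.IsCoface s₀ s' f' := by
  obtain ⟨d, s₁, hs₁, w₁, hw₁, -, hcar⟩ := K.carrier (s y)
  obtain ⟨g, rfl, hg⟩ := hcar l s h.mem y hy rfl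
  obtain ⟨g', rfl, hg'⟩ := hcar l' s' hs' y' hy' heq
  obtain ⟨f₁, -, h₁⟩ := h.exists_factor hs₁ hg hpos
  refine ⟨f₁.trans g', hs', fun w hw => ?_⟩
  rw [← h₁.face w hw, ← hg' _ (faceMap_mem f₁ hw)]
  congr 1
  funext j
  by_cases hj : j ∈ range g'
  · obtain ⟨j, rfl⟩ := hj
    rw [faceMap_apply]
    by_cases hj : j ∈ range f₁
    · obtain ⟨i, rfl⟩ := hj
      rw [faceMap_apply]
      exact faceMap_apply (f₁.trans g') w i
    · rw [faceMap_apply_of_notMem f₁ _ hj, faceMap_apply_of_notMem]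
      rintro ⟨i, hi⟩
      exact hj ⟨i, g'.injective hi⟩
  · rw [faceMap_apply_of_notMem g' _ hj, faceMap_apply_of_notMem]
    rintro ⟨i, rfl⟩
    exact hj ⟨f₁ i, rfl⟩

/-- Rescaling can be carried out in the common carrier. There the two embeddings of `s₀` coincide
because the labels are distinct. -/
theorem IsCoface.rescale_congr {l l' : ℕ} {s : (Fin (l + 1) → ℝ) → X}
    {s' : (Fin (l' + 1) → ℝ) → X} {f : Fin (k + 1) ↪ Fin (l + 1)} {f' : Fin (k + 1) ↪ Fin (l' + 1)}
    (h : K.IsCoface s₀ s f) (h' : K.IsCoface s₀ s' f') {y : Fin (l + 1) → ℝ}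
    (hy : y ∈ stdSimplex ℝ (Fin (l + 1))) (hpos : ∀ i, 0 < y (f i)) (hr : ∑ i, y (f i) < 1)
    {y' : Fin (l' + 1) → ℝ} (hy' : y' ∈ stdSimplex ℝ (Fin (l' + 1))) (heq : s y = s' y')
    {u : Fin (k + 1) → ℝ} (hu : ∀ i, 0 ≤ u i) (hu1 : ∑ i, u i ≤ 1) :
    s (rescale f u y) = s' (rescale f' u y') := by
  have hyy : ∀ i, y (f i) = y' (f' i) := fun i => by rw [← h.bary hy, heq, h'.bary hy']
  obtain ⟨d, s₁, hs₁, w₁, hw₁, -, hcar⟩ := K.carrier (s y)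
  obtain ⟨g, rfl, hg⟩ := hcar l s h.mem y hy rfl
  obtain ⟨g', rfl, hg'⟩ := hcar l' s' h'.mem y' hy' heq.symm
  obtain ⟨f₁, hf₁, h₁⟩ := h.exists_factor hs₁ hg hpos
  obtain ⟨f₂, hf₂, h₂⟩ := h'.exists_factor hs₁ hg' fun i => hyy i ▸ hpos i
  have : f₁ = f₂ := by
    ext1 i
    exact K.label_injective s₁ hs₁ ((h₁.verts i).trans (h₂.verts i).symm)
  subst this
  have hr₁ : ∑ i, w₁ (f₁ i) < 1 := by simpa only [hf₁, faceMap_apply] using hr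
  rw [rescale_faceMap f g f₁ hf₁, rescale_faceMap f' g' f₁ hf₂,
    hg _ (rescale_mem f₁ hu hu1 hw₁.1 hr₁), hg' _ (rescale_mem f₁ hu hu1 hw₁.1 hr₁)]

end LabelledComplex

/-! ### The open star as a product with the cone over the link. -/

namespace LabelledComplex

variable {X G : Type*} [TopologicalSpace X] (K : LabelledComplex X G) {k : ℕ}
  (s₀ : (Fin (k + 1) → ℝ) → X)

/-- The union of the simplices of which `s₀` is a face. -/
def closedStar : Set X :=
  {x | ∃ (l : ℕ) (s : (Fin (l + 1) → ℝ) → X) (f : Fin (k + 1) ↪ Fin (l + 1)),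
    K.IsCoface s₀ s f ∧ ∃ y ∈ stdSimplex ℝ (Fin (l + 1)), s y = x}

/-- The union of the open simplices of which `s₀` is a face. -/
def openStar : Set X :=
  {x | ∃ (l : ℕ) (s : (Fin (l + 1) → ℝ) → X) (f : Fin (k + 1) ↪ Fin (l + 1)),
    K.IsCoface s₀ s f ∧ ∃ y ∈ stdSimplex ℝ (Fin (l + 1)), (∀ i, 0 < y (f i)) ∧ s y = x}

/-- The link of `s₀`, realized close to the barycentre of `s₀`. -/
def linkSet : Set X :=
  {x | ∃ (l : ℕ) (s : (Fin (l + 1) → ℝ) → X) (f : Fin (k + 1) ↪ Fin (l + 1)),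
    K.IsCoface s₀ s f ∧ ∃ y ∈ stdSimplex ℝ (Fin (l + 1)),
      (∀ i, y (f i) = 2 / (2 * (k : ℝ) + 3)) ∧ s y = x}

/-- The barycentric coordinates at the vertices of `s₀`. -/
noncomputable def starCoord (x : X) (i : Fin (k + 1)) : ℝ := K.bary (K.verts s₀ i) x

/-- The sum of the barycentric coordinates at the vertices outside `s₀`. -/
noncomputable def starRest (x : X) : ℝ := 1 - ∑ i, K.starCoord s₀ x i

open Classical in
/-- The radial projection to the link. -/
noncomputable def linkPoint (x : X) : X :=
  if h : ∃ (z : X) (l : ℕ) (s : (Fin (l + 1) → ℝ) → X) (f : Fin (k + 1) ↪ Fin (l + 1)),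
    K.IsCoface s₀ s f ∧ ∃ y ∈ stdSimplex ℝ (Fin (l + 1)), (∀ i, 0 < y (f i)) ∧ s y = x ∧
      z = s (rescale f (fun _ => 2 / (2 * (k : ℝ) + 3)) y) then h.choose else x

theorem sum_linkWeight (k : ℕ) : ∑ _i : Fin (k + 1), 2 / (2 * (k : ℝ) + 3) < 1 := by
  have : (0 : ℝ) < 2 * k + 3 := by positivity
  simp only [Finset.sum_const, Finset.card_univ, Fintype.card_fin, nsmul_eq_mul]
  rw [← mul_div_assoc, div_lt_one this]
  push_cast
  linarith

theorem linkWeight_pos (k : ℕ) : 0 < 2 / (2 * (k : ℝ) + 3) := by positivity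

variable {K s₀}

section Coface

variable {l : ℕ} {s : (Fin (l + 1) → ℝ) → X} {f : Fin (k + 1) ↪ Fin (l + 1)}
  (h : K.IsCoface s₀ s f) {y : Fin (l + 1) → ℝ} (hy : y ∈ stdSimplex ℝ (Fin (l + 1)))
include h hy

theorem IsCoface.starCoord (i : Fin (k + 1)) : K.starCoord s₀ (s y) i = y (f i) := h.bary hy i

theorem IsCoface.starRest : K.starRest s₀ (s y) = 1 - ∑ i, y (f i) := by
  simp only [LabelledComplex.starRest, h.starCoord hy]

theorem IsCoface.linkPoint (hpos : ∀ i, 0 < y (f i)) (hr : ∑ i, y (f i) < 1) :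
    K.linkPoint s₀ (s y) = s (rescale f (fun _ => 2 / (2 * (k : ℝ) + 3)) y) := by
  have hex : ∃ (z : X) (l : ℕ) (s' : (Fin (l + 1) → ℝ) → X) (f : Fin (k + 1) ↪ Fin (l + 1)),
    K.IsCoface s₀ s' f ∧ ∃ y' ∈ stdSimplex ℝ (Fin (l + 1)), (∀ i, 0 < y' (f i)) ∧ s' y' = s y ∧
      z = s' (rescale f (fun _ => 2 / (2 * (k : ℝ) + 3)) y') :=
    ⟨_, l, s, f, h, y, hy, hpos, rfl, rfl⟩
  rw [LabelledComplex.linkPoint, dif_pos hex]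
  obtain ⟨l', s', f', h', y', hy', -, heq, hz⟩ := hex.choose_spec
  rw [hz]
  exact (h.rescale_congr h' hy hpos hr hy' heq.symm (fun _ => (linkWeight_pos k).le)
    (sum_linkWeight k).le).symm

theorem IsCoface.linkPoint_mem (hpos : ∀ i, 0 < y (f i)) (hr : ∑ i, y (f i) < 1) :
    K.linkPoint s₀ (s y) ∈ K.linkSet s₀ := by
  rw [h.linkPoint hy hpos hr]
  exact ⟨l, s, f, h, _, rescale_mem f (fun _ => (linkWeight_pos k).le) (sum_linkWeight k).le hy hr,
    fun i => rescale_apply f _ _ i, rfl⟩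

theorem IsCoface.eq_of_sum_eq_one (hr : ∑ i, y (f i) = 1) : s y = s₀ (y ∘ f) := by
  rw [← h.face, eq_faceMap_of_sum_comp_eq_one f hy hr]
  refine ⟨fun i => hy.1 (f i), hr⟩

end Coface

theorem continuous_starCoord [T2Space X] (i : Fin (k + 1)) :
    Continuous fun x => K.starCoord s₀ x i := K.continuous_bary _

theorem continuous_starRest [T2Space X] : Continuous (K.starRest s₀) :=
  continuous_const.sub (continuous_finsetSum _ fun i _ => continuous_starCoord i)

theorem openStar_eq : K.openStar s₀ = {x ∈ K.closedStar s₀ | ∀ i, 0 < K.starCoord s₀ x i} := by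
  ext x
  constructor
  · rintro ⟨l, s, f, h, y, hy, hpos, rfl⟩
    exact ⟨⟨l, s, f, h, y, hy, rfl⟩, fun i => by rw [h.starCoord hy]; exact hpos i⟩
  · rintro ⟨⟨l, s, f, h, y, hy, rfl⟩, hpos⟩
    exact ⟨l, s, f, h, y, hy, fun i => by rw [← h.starCoord hy]; exact hpos i, rfl⟩

theorem exists_coface_tendsto [T2Space X] {x : X} (hx : x ∈ K.openStar s₀) {U : Ultrafilter X}
    (hU : ↑U ≤ 𝓝 x) : ∃ (l : ℕ) (s : (Fin (l + 1) → ℝ) → X) (f : Fin (k + 1) ↪ Fin (l + 1)),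
      K.IsCoface s₀ s f ∧ ∃ y ∈ stdSimplex ℝ (Fin (l + 1)), (∀ i, 0 < y (f i)) ∧ s y = x ∧
      ∃ r : X → (Fin (l + 1) → ℝ), (∀ᶠ q in U, r q ∈ stdSimplex ℝ (Fin (l + 1)) ∧
        (∀ i, 0 < r q (f i)) ∧ s (r q) = q) ∧
        Filter.Tendsto r U (𝓝[stdSimplex ℝ (Fin (l + 1))] y) := by
  obtain ⟨l, s, hs, y, hy, rfl, r, hr, hlim⟩ := K.exists_simplex_tendsto hU
  obtain ⟨l', s', f', h', y', hy', hpos', heq⟩ := hx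
  obtain ⟨f, h⟩ := h'.of_mem hy' hpos' hs hy heq.symm
  have hpos : ∀ i, 0 < y (f i) := fun i => by rw [← h.bary hy, ← heq, h'.bary hy']; exact hpos' i
  refine ⟨l, s, f, h, y, hy, hpos, rfl, r, ?_, hlim⟩
  have : ∀ᶠ q in U, ∀ i, 0 < r q (f i) := Filter.eventually_all.2 fun i =>
    (((continuous_apply (f i)).tendsto y).comp (hlim.mono_right nhdsWithin_le_nhds)).eventually
      (lt_mem_nhds (hpos i))
  filter_upwards [hr, this] with q hq hq'
  exact ⟨hq.1, hq', hq.2⟩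

theorem isOpen_openStar [T2Space X] : IsOpen (K.openStar s₀) := by
  rw [isOpen_iff_ultrafilter]
  intro x hx U hU
  obtain ⟨l, s, f, h, y, hy, hpos, rfl, r, hr, -⟩ := exists_coface_tendsto hx hU
  exact hr.mono fun q hq => ⟨l, s, f, h, r q, hq.1, hq.2.1, hq.2.2⟩

section Direction

variable {E : Type*} [NormedAddCommGroup E] [NormedSpace ℝ E] {H : X → E}

/-- The coordinates of a point of the star in the cone over the link. -/
noncomputable def coneCoord (K : LabelledComplex X G) (s₀ : (Fin (k + 1) → ℝ) → X) (H : X → E)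
    (x : X) : E := K.starRest s₀ x • H (K.linkPoint s₀ x)

section Norm

variable (hH : MapsTo H (K.linkSet s₀) (Metric.sphere 0 1))

include hH in
theorem norm_coneCoord {x : X} (hx : x ∈ K.openStar s₀) : ‖K.coneCoord s₀ H x‖ = K.starRest s₀ x := by
  obtain ⟨l, s, f, h, y, hy, hpos, rfl⟩ := hx
  rw [coneCoord, norm_smul, h.starRest hy]
  rcases (sum_comp_le_one f hy).lt_or_eq with hr | hr
  · rw [mem_sphere_zero_iff_norm.1 (hH (h.linkPoint_mem hy hpos hr)), mul_one, Real.norm_eq_abs,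
      abs_of_pos (by linarith)]
  · simp [hr]

-- Off `s₀` the radial projection is continuous on each simplex. At points of `s₀` it has no limit
-- in general, but there the norm, which is the remaining mass, tends to `0`.
include hH in
theorem continuousOn_coneCoord [T2Space X] (hcont : ContinuousOn H (K.linkSet s₀)) :
    ContinuousOn (K.coneCoord s₀ H) (K.openStar s₀) := by
  intro x hx
  rw [ContinuousWithinAt, Filter.tendsto_iff_ultrafilter]
  intro U hU
  have hUx : ↑U ≤ 𝓝 x := hU.trans nhdsWithin_le_nhds
  have hUS : ∀ᶠ q in U, q ∈ K.openStar s₀ := hU self_mem_nhdsWithin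
  have hrest : Filter.Tendsto (K.starRest s₀) U (𝓝 (K.starRest s₀ x)) :=
    (continuous_starRest.tendsto x).mono_left hUx
  obtain ⟨l, s, f, h, y, hy, hpos, rfl, r, hr, hlim⟩ := exists_coface_tendsto hx hUx
  rcases (sum_comp_le_one f hy).lt_or_eq with hlt | heq
  · refine hrest.smul ?_
    let u : Fin (k + 1) → ℝ := fun _ => 2 / (2 * (k : ℝ) + 3)
    have hlim' := hlim.mono_right nhdsWithin_le_nhds
    have hO : IsOpen {y : Fin (l + 1) → ℝ | ∑ i, y (f i) < 1} :=
      isOpen_lt (by fun_prop) continuous_const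
    have hrlt : ∀ᶠ q in U, ∑ i, r q (f i) < 1 := hlim'.eventually (hO.mem_nhds hlt)
    have h1 : Filter.Tendsto (fun q => rescale f u (r q)) U
        (𝓝[stdSimplex ℝ (Fin (l + 1))] (rescale f u y)) := by
      refine tendsto_nhdsWithin_iff.2 ⟨?_, ?_⟩
      · exact ((continuousOn_rescale f u).continuousAt (hO.mem_nhds hlt)).tendsto.comp hlim'
      · filter_upwards [hr, hrlt] with q hq hq'
        exact rescale_mem f (fun _ => (linkWeight_pos k).le) (sum_linkWeight k).le hq.1 hq'
    have hmem := rescale_mem f (fun _ => (linkWeight_pos k).le) (sum_linkWeight k).le hy hlt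
    have h2 : Filter.Tendsto (fun q => s (rescale f u (r q))) U (𝓝 (s (rescale f u y))) :=
      (K.continuousOn s h.mem _ hmem).tendsto.comp h1
    have h3 : Filter.Tendsto (K.linkPoint s₀) U (𝓝[K.linkSet s₀] (K.linkPoint s₀ (s y))) := by
      refine tendsto_nhdsWithin_iff.2 ⟨?_, ?_⟩
      · rw [h.linkPoint hy hpos hlt]
        refine h2.congr' ?_
        filter_upwards [hr, hrlt] with q hq hq'
        rw [← h.linkPoint hq.1 hq.2.1 hq', hq.2.2]
      · filter_upwards [hr, hrlt] with q hq hq'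
        rw [← hq.2.2]
        exact h.linkPoint_mem hq.1 hq.2.1 hq'
    exact (hcont _ (h.linkPoint_mem hy hpos hlt)).tendsto.comp h3
  · have h0 : K.starRest s₀ (s y) = 0 := by rw [h.starRest hy, heq, sub_self]
    rw [h0] at hrest
    rw [coneCoord, h0, zero_smul, tendsto_zero_iff_norm_tendsto_zero]
    refine hrest.congr' ?_
    filter_upwards [hUS] with q hq
    exact (norm_coneCoord hH hq).symm

/-- Off `s₀`, rescaling the link point back to the original coordinates on `s₀` recovers the point.
On `s₀` the coordinates alone determine it. -/
theorem injOn_starCoord_coneCoord (hinj : InjOn H (K.linkSet s₀)) :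
    InjOn (fun x => (K.starCoord s₀ x, K.coneCoord s₀ H x)) (K.openStar s₀) := by
  rintro x ⟨l, s, f, h, y, hy, hpos, rfl⟩ x' ⟨l', s', f', h', y', hy', hpos', rfl⟩ heq
  obtain ⟨h1, h2⟩ := Prod.ext_iff.1 heq
  have hyy : ∀ i, y (f i) = y' (f' i) := fun i => by
    rw [← h.starCoord hy, ← h'.starCoord hy']; exact congr_fun h1 i
  have hss : ∑ i, y (f i) = ∑ i, y' (f' i) := by simp only [hyy]
  rcases (sum_comp_le_one f hy).lt_or_eq with hr | hr
  · have hr' := hss ▸ hr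
    simp only [coneCoord, h.starRest hy, h'.starRest hy', hss] at h2
    have h3 := hinj (h.linkPoint_mem hy hpos hr) (h'.linkPoint_mem hy' hpos' hr')
      (smul_right_injective E (by linarith : 1 - ∑ i, y' (f' i) ≠ 0) h2)
    rw [h.linkPoint hy hpos hr, h'.linkPoint hy' hpos' hr'] at h3
    have hlw := sum_linkWeight k
    have h4 := h.rescale_congr h' (u := y ∘ f)
      (rescale_mem f (fun _ => (linkWeight_pos k).le) hlw.le hy hr)
      (fun i => by rw [rescale_apply]; exact linkWeight_pos k)
      (by simpa only [rescale_apply] using hlw)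
      (rescale_mem f' (fun _ => (linkWeight_pos k).le) hlw.le hy' hr') h3
      (fun i => (hpos i).le) hr.le
    rwa [rescale_rescale f hlw hr, rescale_rescale f' hlw hr', rescale_self f hr,
      show y ∘ f = y' ∘ f' from funext hyy, rescale_self f' hr'] at h4
  · rw [h.eq_of_sum_eq_one hy hr, h'.eq_of_sum_eq_one hy' (hss ▸ hr),
      show y ∘ f = y' ∘ f' from funext hyy]

end Norm

theorem exists_starCoord_coneCoord_eq (hs₀ : s₀ ∈ K.simplex k)
    (hsurj : SurjOn H (K.linkSet s₀) (Metric.sphere 0 1)) {u : Fin (k + 1) → ℝ} {z : E}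
    (hu : ∀ i, 0 < u i) (huz : ∑ i, u i + ‖z‖ = 1) :
    ∃ x ∈ K.openStar s₀, K.starCoord s₀ x = u ∧ K.coneCoord s₀ H x = z := by
  rcases eq_or_ne z 0 with rfl | hz
  · have hu1 : ∑ i, u i = 1 := by simpa using huz
    have huΔ : u ∈ stdSimplex ℝ (Fin (k + 1)) := ⟨fun i => (hu i).le, hu1⟩
    have h : K.IsCoface s₀ s₀ (Function.Embedding.refl _) := ⟨hs₀, fun w _ => by
      congr 1
      exact funext fun i => faceMap_apply (Function.Embedding.refl _) w i⟩
    refine ⟨s₀ u, ⟨k, s₀, _, h, u, huΔ, hu, rfl⟩, funext fun i => h.starCoord huΔ i, ?_⟩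
    rw [coneCoord, h.starRest huΔ]
    simp [hu1]
  · have hz' : 0 < ‖z‖ := norm_pos_iff.2 hz
    obtain ⟨w, ⟨l, s, f, h, y, hy, hyf, rfl⟩, hw⟩ := hsurj (a := ‖z‖⁻¹ • z) (by
      rw [mem_sphere_zero_iff_norm, norm_smul, norm_inv, norm_norm, inv_mul_cancel₀ hz'.ne'])
    have hlw := sum_linkWeight k
    have hu1 : ∑ i, u i < 1 := by linarith
    have hr : ∑ i, y (f i) < 1 := by simpa only [hyf] using hlw
    have hmem := rescale_mem f (fun i => (hu i).le) hu1.le hy hr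
    have hpos : ∀ i, 0 < rescale f u y (f i) := fun i => by rw [rescale_apply]; exact hu i
    have hr' : ∑ i, rescale f u y (f i) < 1 := by simpa only [rescale_apply] using hu1
    refine ⟨s (rescale f u y), ⟨l, s, f, h, _, hmem, hpos, rfl⟩, funext fun i => ?_, ?_⟩
    · rw [h.starCoord hmem, rescale_apply]
    · rw [coneCoord, h.starRest hmem, h.linkPoint hmem hpos hr', rescale_rescale f hu1 hr,
        show (fun _ => 2 / (2 * (k : ℝ) + 3)) = y ∘ f from funext fun i => (hyf i).symm,
        rescale_self f hr, hw, smul_smul]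
      simp only [rescale_apply]
      rw [show 1 - ∑ i, u i = ‖z‖ by linarith, mul_inv_cancel₀ hz'.ne', one_smul]

end Direction

end LabelledComplex

/-! ### Constructing charts. -/

section Charts

theorem exists_openPartialHomeomorph_of_image_mem_nhds {X Y : Type*} [TopologicalSpace X]
    [TopologicalSpace Y] [Nonempty X] {A : X → Y} {N : Set X} (hN : IsOpen N)
    (hA : ContinuousOn A N) (hinj : InjOn A N) (h : ∀ x ∈ N, ∀ W ∈ 𝓝 x, A '' W ∈ 𝓝 (A x)) :
    ∃ e : OpenPartialHomeomorph X Y, e.source = N ∧ ⇑e = A := by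
  refine ⟨OpenPartialHomeomorph.ofContinuousOpenRestrict hinj.bijOn_image.toPartialEquiv hA ?_ hN,
    rfl, rfl⟩
  refine isOpenMap_iff_nhds_le.2 fun a V hV => ?_
  have h1 := h a a.2 _ (hN.isOpenEmbedding_subtypeVal.image_mem_nhds.2 hV)
  refine Filter.mem_of_superset h1 ?_
  rintro _ ⟨_, ⟨b, hb, rfl⟩, rfl⟩
  exact hb

/-- Preimages of points converging in `O` accumulate in the compact set `C`. By `hlim` an
accumulation point lies in `S`, and injectivity identifies it as the right preimage. -/
theorem exists_openPartialHomeomorph_of_isCompact {X Y : Type*} [TopologicalSpace X]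
    [TopologicalSpace Y] [T2Space Y] [Nonempty X] {A : X → Y} {S C : Set X} {O : Set Y}
    (hS : IsOpen S) (hO : IsOpen O) (hC : IsCompact C) (hSC : S ⊆ C) (hA : ContinuousOn A S)
    (hbij : BijOn A S O) (hlim : ∀ x ∈ C, ∀ q ∈ O, ∀ U : Ultrafilter X, S ∈ U → ↑U ≤ 𝓝 x →
      Filter.Tendsto A U (𝓝 q) → x ∈ S) :
    ∃ e : OpenPartialHomeomorph X Y, e.source = S ∧ e.target = O ∧ ⇑e = A := by
  refine ⟨{
    toPartialEquiv := hbij.toPartialEquiv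
    open_source := hS
    open_target := hO
    continuousOn_toFun := hA
    continuousOn_invFun := fun q hq => ?_ }, rfl, rfl, rfl⟩
  rw [ContinuousWithinAt, Filter.tendsto_iff_ultrafilter]
  intro V hV
  let B := Function.invFunOn A S
  have hVO : ∀ᶠ q in V, q ∈ O := hV self_mem_nhdsWithin
  have hBS : ∀ q ∈ O, B q ∈ S := hbij.surjOn.mapsTo_invFunOn
  have hAB : ∀ q ∈ O, A (B q) = q := hbij.invOn_invFunOn.2
  have hUS : S ∈ V.map B := hVO.mono hBS
  obtain ⟨x, hx, hUx⟩ := isCompact_iff_ultrafilter_le_nhds.1 hC (V.map B)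
    (by rw [Filter.le_principal_iff]; exact Filter.mem_of_superset hUS hSC)
  have hlimA : Filter.Tendsto A (V.map B) (𝓝 q) := by
    rw [Ultrafilter.coe_map, Filter.tendsto_map'_iff]
    exact (Filter.tendsto_id.mono_left (hV.trans nhdsWithin_le_nhds)).congr'
      (hVO.mono fun q hq => (hAB q hq).symm)
  have hxS := hlim x hx q hq _ hUS hUx hlimA
  have : A x = q := tendsto_nhds_unique
    (((hA.continuousAt (hS.mem_nhds hxS)).tendsto).mono_left hUx) hlimA
  have hBq : B q = x := hbij.injOn (hBS q hq) hxS ((hAB q hq).trans this.symm)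
  change Filter.Tendsto B V (𝓝 (B q))
  rw [hBq]
  exact hUx

/-- Straightening of the level sets of a function that is strictly increasing in the last
coordinate. -/
theorem exists_straightening {E : Type*} [TopologicalSpace E] {φ : E × ℝ → ℝ} {N : Set (E × ℝ)}
    (hN : IsOpen N) (hφ : ContinuousOn φ N)
    (hmono : ∀ e t t', (e, t) ∈ N → (e, t') ∈ N → t < t' → φ (e, t) < φ (e, t'))
    (hne : N.Nonempty) :
    ∃ S : OpenPartialHomeomorph (E × ℝ) (E × ℝ), S.source = N ∧ ∀ q, S q = (q.1, φ q) := by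
  have : Nonempty (E × ℝ) := ⟨hne.some⟩
  obtain ⟨S, hS, hS'⟩ : ∃ S : OpenPartialHomeomorph (E × ℝ) (E × ℝ), S.source = N ∧
      ⇑S = fun q => (q.1, φ q) := by
    refine exists_openPartialHomeomorph_of_image_mem_nhds hN (continuousOn_fst.prodMk hφ) ?_ ?_
    · rintro ⟨e, t⟩ h ⟨e', t'⟩ h' heq
      obtain ⟨rfl, h2⟩ := Prod.ext_iff.1 heq
      rcases lt_trichotomy t t' with hlt | rfl | hlt
      · exact absurd h2 (hmono _ _ _ h h' hlt).ne
      · rfl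
      · exact absurd h2 (hmono _ _ _ h' h hlt).ne'
    -- Open image: on a short vertical segment the values at the two ends enclose the central value.
    -- This persists for nearby segments, and the intermediate value theorem fills in the values
    -- between.
    · rintro ⟨e₁, t₁⟩ h W hW
      obtain ⟨V, hV, I, hI, hVI⟩ := mem_nhds_prod_iff.1 (Filter.inter_mem hW (hN.mem_nhds h))
      obtain ⟨δ, hδ, hball⟩ := Metric.nhds_basis_closedBall.mem_iff.1 hI
      rw [Real.closedBall_eq_Icc] at hball
      have he₁ : e₁ ∈ V := mem_of_mem_nhds hV
      have hbox : ∀ e ∈ V, ∀ t ∈ Icc (t₁ - δ) (t₁ + δ), (e, t) ∈ W ∩ N := fun e he t ht =>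
        hVI ⟨he, hball ht⟩
      have hl : t₁ - δ ∈ Icc (t₁ - δ) (t₁ + δ) := ⟨le_rfl, by linarith⟩
      have hr : t₁ + δ ∈ Icc (t₁ - δ) (t₁ + δ) := ⟨by linarith, le_rfl⟩
      have hlow := hmono e₁ (t₁ - δ) t₁ (hbox e₁ he₁ _ hl).2 h (by linarith)
      have hup := hmono e₁ t₁ (t₁ + δ) h (hbox e₁ he₁ _ hr).2 (by linarith)
      have hcont : ∀ t ∈ Icc (t₁ - δ) (t₁ + δ), Filter.Tendsto (fun q : E × ℝ => φ (q.1, t))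
          (𝓝 (e₁, φ (e₁, t₁))) (𝓝 (φ (e₁, t))) := fun t ht => by
        have h1 := (hφ.continuousAt (hN.mem_nhds (hbox e₁ he₁ t ht).2)).tendsto
        have h2 : Continuous fun q : E × ℝ => (q.1, t) := by fun_prop
        exact h1.comp (h2.tendsto (e₁, φ (e₁, t₁)))
      have hsnd : Filter.Tendsto (fun q : E × ℝ => q.2) (𝓝 (e₁, φ (e₁, t₁))) (𝓝 (φ (e₁, t₁))) :=
        continuous_snd.tendsto _
      filter_upwards [(hcont _ hl).eventually_lt hsnd hlow, hsnd.eventually_lt (hcont _ hr) hup,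
        (continuous_fst.tendsto (e₁, φ (e₁, t₁))) hV] with q hq1 hq2 hq3
      have hc : ContinuousOn (fun t => φ (q.1, t)) (Icc (t₁ - δ) (t₁ + δ)) :=
        hφ.comp (by fun_prop) fun t ht => (hbox _ hq3 t ht).2
      obtain ⟨t, ht, hqt⟩ := intermediate_value_Icc (by linarith) hc ⟨hq1.le, hq2.le⟩
      exact ⟨(q.1, t), (hbox _ hq3 t ht).1, Prod.ext rfl hqt⟩
  exact ⟨S, hS, fun q => by rw [hS']⟩

end Charts

theorem Fin.sum_eq_add_add_sum_subtype {k : ℕ} {i₀ j₀ : Fin (k + 1)} (hij : i₀ ≠ j₀) (u : Fin (k + 1) → ℝ) :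
    ∑ i, u i = u i₀ + u j₀ + ∑ i : {i // i ≠ i₀ ∧ i ≠ j₀}, u i := by
  rw [← Finset.sum_filter_add_sum_filter_not Finset.univ (fun i => i ≠ i₀ ∧ i ≠ j₀) u, add_comm]
  congr 1
  · rw [← Finset.sum_pair hij]
    refine Finset.sum_congr ?_ fun _ _ => rfl
    ext i
    simp only [Finset.mem_filter, Finset.mem_univ, true_and, Finset.mem_insert,
      Finset.mem_singleton]
    tauto
  · exact Finset.sum_subtype _ (by simp) u

namespace LabelledComplex

variable {X G : Type*} [TopologicalSpace X] [T2Space X] {K : LabelledComplex X G} {k : ℕ}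
  {s₀ : (Fin (k + 1) → ℝ) → X}

variable {E : Type*} [NormedAddCommGroup E] [NormedSpace ℝ E] {H : X → E}

/-- A chart on the open star of `s₀`, given by the barycentric coordinates at all vertices of `s₀`
except `i₀` and the coordinates in the cone over the link. -/
theorem exists_starChart (hs₀ : s₀ ∈ K.simplex k) (hC : IsCompact (K.closedStar s₀))
    (hH : BijOn H (K.linkSet s₀) (Metric.sphere 0 1)) (hcont : ContinuousOn H (K.linkSet s₀))
    {i₀ j₀ : Fin (k + 1)} (hij : i₀ ≠ j₀) :
    ∃ A : OpenPartialHomeomorph X ((({i // i ≠ i₀ ∧ i ≠ j₀} → ℝ) × E) × ℝ),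
      A.source = K.openStar s₀ ∧
      A.target = {q | (∀ i, 0 < q.1.1 i) ∧ 0 < q.2 ∧ ∑ i, q.1.1 i + q.2 + ‖q.1.2‖ < 1} ∧
      ∀ x, A x = ((fun i : {i // i ≠ i₀ ∧ i ≠ j₀} => K.starCoord s₀ x i, K.coneCoord s₀ H x), K.starCoord s₀ x j₀) := by
  have : Nonempty X := ⟨s₀ 0⟩
  have hnorm := fun x hx => norm_coneCoord (K := K) (s₀ := s₀) hH.mapsTo (x := x) hx
  have hsum := fun x => Fin.sum_eq_add_add_sum_subtype hij (K.starCoord s₀ x)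
  have hrest : ∀ x, K.starRest s₀ x = 1 - ∑ i, K.starCoord s₀ x i := fun x => rfl
  -- The coordinate at `i₀` is omitted, as it is `1` minus the others and the norm; the last
  -- inequality expresses its positivity.
  have hopen : IsOpen {q : (({i // i ≠ i₀ ∧ i ≠ j₀} → ℝ) × E) × ℝ |
      (∀ i, 0 < q.1.1 i) ∧ 0 < q.2 ∧ ∑ i, q.1.1 i + q.2 + ‖q.1.2‖ < 1} := by
    have h1 : IsOpen {q : (({i // i ≠ i₀ ∧ i ≠ j₀} → ℝ) × E) × ℝ | ∀ i, 0 < q.1.1 i} := by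
      rw [show {q : (({i // i ≠ i₀ ∧ i ≠ j₀} → ℝ) × E) × ℝ | ∀ i, 0 < q.1.1 i} =
        ⋂ i, {q | 0 < q.1.1 i} by ext; simp]
      exact isOpen_iInter_of_finite fun i => isOpen_lt continuous_const (by fun_prop)
    have h2 : IsOpen {q : (({i // i ≠ i₀ ∧ i ≠ j₀} → ℝ) × E) × ℝ | 0 < q.2} :=
      isOpen_lt continuous_const (by fun_prop)
    have h3 : IsOpen {q : (({i // i ≠ i₀ ∧ i ≠ j₀} → ℝ) × E) × ℝ |
        ∑ i, q.1.1 i + q.2 + ‖q.1.2‖ < 1} := isOpen_lt (by fun_prop) continuous_const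
    exact h1.inter (h2.inter h3)
  obtain ⟨A, h1, h2, h3⟩ : ∃ A : OpenPartialHomeomorph X ((({i // i ≠ i₀ ∧ i ≠ j₀} → ℝ) × E) × ℝ),
      A.source = K.openStar s₀ ∧
      A.target = {q | (∀ i, 0 < q.1.1 i) ∧ 0 < q.2 ∧ ∑ i, q.1.1 i + q.2 + ‖q.1.2‖ < 1} ∧
      ⇑A = fun x => (((fun i : {i // i ≠ i₀ ∧ i ≠ j₀} => K.starCoord s₀ x i),
        K.coneCoord s₀ H x), K.starCoord s₀ x j₀) := by
    refine exists_openPartialHomeomorph_of_isCompact (isOpen_openStar (K := K) (s₀ := s₀)) hopen hC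
      (by rw [openStar_eq]; exact fun x hx => hx.1) ?_ ⟨?_, ?_, ?_⟩ ?_
    · refine ContinuousOn.prodMk (ContinuousOn.prodMk ?_ ?_) (continuous_starCoord j₀).continuousOn
      · exact (continuous_pi fun i => continuous_starCoord _).continuousOn
      · exact continuousOn_coneCoord hH.mapsTo hcont
    · intro x hx
      have hpos : ∀ i, 0 < K.starCoord s₀ x i := by
        rw [openStar_eq] at hx; exact hx.2
      refine ⟨fun i => hpos i, hpos j₀, ?_⟩
      simp only
      rw [hnorm x hx, hrest, hsum]
      linarith [hpos i₀]
    · intro x hx x' hx' heq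
      obtain ⟨h1, h2⟩ := Prod.ext_iff.1 heq
      obtain ⟨h3, h4⟩ := Prod.ext_iff.1 h1
      simp only at h2 h3 h4
      refine injOn_starCoord_coneCoord hH.injOn hx hx' (Prod.ext ?_ h4)
      have h5 := hnorm x hx
      rw [h4, hnorm x' hx', hrest, hrest, hsum, hsum, h2] at h5
      have h6 : ∀ i : {i // i ≠ i₀ ∧ i ≠ j₀}, K.starCoord s₀ x i = K.starCoord s₀ x' i :=
        fun i => congr_fun h3 i
      simp only [h6] at h5
      funext i
      by_cases hi : i = i₀
      · rw [hi]; simp only; linarith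
      · by_cases hj : i = j₀
        · rw [hj]; exact h2
        · exact h6 ⟨i, hi, hj⟩
    · rintro ⟨⟨w, z⟩, t⟩ ⟨hw, ht, hlt⟩
      simp only at hw ht hlt
      let u : Fin (k + 1) → ℝ := fun i => if h : i ≠ i₀ ∧ i ≠ j₀ then w ⟨i, h⟩ else
        if i = j₀ then t else 1 - ∑ i, w i - t - ‖z‖
      have huw : ∀ i : {i // i ≠ i₀ ∧ i ≠ j₀}, u i = w i := fun i => dif_pos i.2
      have huj : u j₀ = t := by simp [u]
      have hui : u i₀ = 1 - ∑ i, w i - t - ‖z‖ := by simp [u, hij]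
      obtain ⟨x, hx, hxu, hxz⟩ := exists_starCoord_coneCoord_eq hs₀ hH.surjOn (u := u) (z := z)
        (fun i => by
          by_cases h : i ≠ i₀ ∧ i ≠ j₀
          · exact huw ⟨i, h⟩ ▸ hw _
          · by_cases hj : i = j₀
            · rw [hj, huj]; exact ht
            · have hi : i = i₀ := by tauto
              rw [hi, hui]; linarith)
        (by
          rw [Fin.sum_eq_add_add_sum_subtype hij, huj, hui]
          simp only [huw]
          ring)
      refine ⟨x, hx, ?_⟩
      simp only [hxu, hxz, huj, huw]
    -- All barycentric coordinates at `s₀` of the limit are read off from a point of the target,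
    -- hence positive, so the limit does not leave the open star.
    · rintro x hx ⟨⟨w, z⟩, t⟩ ⟨hw, ht, hlt⟩ U hUS hU hlim
      simp only at hw ht hlt
      have l1 := ((continuous_fst.comp continuous_fst).tendsto _).comp hlim
      have l2 := ((continuous_snd.comp continuous_fst).tendsto _).comp hlim
      have l3 := (continuous_snd.tendsto _).comp hlim
      have hc : ∀ i, Filter.Tendsto (fun x => K.starCoord s₀ x i) U (𝓝 (K.starCoord s₀ x i)) :=
        fun i => ((continuous_starCoord i).tendsto x).mono_left hU
      have e1 : ∀ i : {i // i ≠ i₀ ∧ i ≠ j₀}, K.starCoord s₀ x i = w i := fun i =>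
        tendsto_nhds_unique (hc i) (((continuous_apply i).tendsto _).comp l1)
      have e3 : K.starCoord s₀ x j₀ = t := tendsto_nhds_unique (hc j₀) l3
      have e2 : K.starRest s₀ x = ‖z‖ := by
        refine tendsto_nhds_unique ((continuous_starRest.tendsto x).mono_left hU) ?_
        refine l2.norm.congr' ?_
        filter_upwards [hUS] with y hy
        exact hnorm y hy
      rw [openStar_eq]
      refine ⟨hx, fun i => ?_⟩
      by_cases h : i ≠ i₀ ∧ i ≠ j₀
      · rw [e1 ⟨i, h⟩]; exact hw _
      · by_cases hj : i = j₀
        · rw [hj, e3]; exact ht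
        · have hi : i = i₀ := by tauto
          rw [hrest, hsum, e3] at e2
          simp only [e1] at e2
          rw [hi]; linarith
  exact ⟨A, h1, h2, fun x => by rw [h3]⟩

end LabelledComplex

/-! ### Charts whose last coordinate is the transverse function. -/

namespace LabelledComplex

variable {X G : Type*} [TopologicalSpace X] {K : LabelledComplex X G} {k : ℕ}
  {s₀ : (Fin (k + 1) → ℝ) → X}

section Move

variable {l : ℕ} {s : (Fin (l + 1) → ℝ) → X} {f : Fin (k + 1) ↪ Fin (l + 1)} {i₀ j₀ : Fin (k + 1)}

/-- Move a point parallel to an edge. -/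
noncomputable def edgeShift (i j : Fin (l + 1)) (r : ℝ) (y : Fin (l + 1) → ℝ) : Fin (l + 1) → ℝ :=
  y + r • (Pi.single j 1 - Pi.single i 1)

theorem edgeShift_of_ne {i j a : Fin (l + 1)} (hi : a ≠ i) (hj : a ≠ j) (r : ℝ)
    (y : Fin (l + 1) → ℝ) : edgeShift i j r y a = y a := by
  simp [edgeShift, hi, hj]

theorem edgeShift_left {i j : Fin (l + 1)} (hij : i ≠ j) (r : ℝ) (y : Fin (l + 1) → ℝ) :
    edgeShift i j r y i = y i - r := by
  simp [edgeShift, hij]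
  ring

theorem edgeShift_right {i j : Fin (l + 1)} (hij : i ≠ j) (r : ℝ) (y : Fin (l + 1) → ℝ) :
    edgeShift i j r y j = y j + r := by
  simp [edgeShift, hij.symm]

theorem sum_mul_edgeShift (c : Fin (l + 1) → ℝ) (i j : Fin (l + 1)) (r : ℝ) (y : Fin (l + 1) → ℝ) :
    ∑ a, c a * edgeShift i j r y a = ∑ a, c a * y a + r * (c j - c i) := by
  have h : ∀ a, c a * edgeShift i j r y a =
      c a * y a + r * (c a * (Pi.single j 1 : Fin (l + 1) → ℝ) a) -
        r * (c a * (Pi.single i 1 : Fin (l + 1) → ℝ) a) := fun a => by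
    simp only [edgeShift, Pi.add_apply, Pi.smul_apply, Pi.sub_apply, smul_eq_mul]
    ring
  simp only [h, Finset.sum_sub_distrib, Finset.sum_add_distrib, ← Finset.mul_sum, sum_mul_single]
  ring

theorem edgeShift_mem {i j : Fin (l + 1)} (hij : i ≠ j) {r : ℝ} (hr : 0 ≤ r)
    {y : Fin (l + 1) → ℝ} (hy : y ∈ stdSimplex ℝ (Fin (l + 1))) (hri : r ≤ y i) :
    edgeShift i j r y ∈ stdSimplex ℝ (Fin (l + 1)) := by
  refine ⟨fun a => ?_, ?_⟩
  · by_cases hi : a = i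
    · rw [hi, edgeShift_left hij]; linarith
    · by_cases hj : a = j
      · rw [hj, edgeShift_right hij]; linarith [hy.1 j]
      · rw [edgeShift_of_ne hi hj]; exact hy.1 a
  · have := sum_mul_edgeShift (fun _ => 1) i j r y
    simpa [hy.2] using this

theorem sum_comp_edgeShift (i j : Fin (k + 1)) (r : ℝ) (y : Fin (l + 1) → ℝ) :
    ∑ a, edgeShift (f i) (f j) r y (f a) = ∑ a, y (f a) := by
  have h : ∀ a, edgeShift (f i) (f j) r y (f a) = edgeShift i j r (y ∘ f) a := fun a => by
    simp [edgeShift, Pi.single_apply]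
  have := sum_mul_edgeShift (fun _ => 1) i j r (y ∘ f)
  simpa [h] using this

theorem rescale_edgeShift (i j : Fin (k + 1)) (r : ℝ) (u : Fin (k + 1) → ℝ) (y : Fin (l + 1) → ℝ) :
    rescale f u (edgeShift (f i) (f j) r y) = rescale f u y := by
  funext a
  by_cases ha : a ∈ range f
  · obtain ⟨a, rfl⟩ := ha
    rw [rescale_apply, rescale_apply]
  · rw [rescale_apply_of_notMem f _ _ ha, rescale_apply_of_notMem f _ _ ha, sum_comp_edgeShift,
      edgeShift_of_ne (fun h => ha ⟨i, h.symm⟩) (fun h => ha ⟨j, h.symm⟩)]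

theorem IsCoface.coneCoord_edgeShift {E : Type*} [NormedAddCommGroup E] [NormedSpace ℝ E] {H : X → E}
    (h : K.IsCoface s₀ s f) {y : Fin (l + 1) → ℝ} (hy : y ∈ stdSimplex ℝ (Fin (l + 1)))
    (hpos : ∀ i, 0 < y (f i)) {i j : Fin (k + 1)} {r : ℝ}
    (hy' : edgeShift (f i) (f j) r y ∈ stdSimplex ℝ (Fin (l + 1)))
    (hpos' : ∀ a, 0 < edgeShift (f i) (f j) r y (f a)) :
    K.coneCoord s₀ H (s (edgeShift (f i) (f j) r y)) = K.coneCoord s₀ H (s y) := by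
  rw [coneCoord, coneCoord, h.starRest hy, h.starRest hy', sum_comp_edgeShift]
  rcases (sum_comp_le_one f hy).lt_or_eq with hr | hr
  · rw [h.linkPoint hy hpos hr, h.linkPoint hy' hpos' (by rwa [sum_comp_edgeShift]),
      rescale_edgeShift]
  · simp [hr]

end Move

variable [LinearOrder G] {F : X → ℝ}

/-- The form of the current level is negative at `i` and positive at `j`; moving mass `r` from `i`
to `j` adds `r * (c j - c i)`. -/
theorem IsTransverseMap.lt_edgeShift (hF : K.IsTransverseMap F) {l : ℕ}
    {s : (Fin (l + 1) → ℝ) → X} (hs : s ∈ K.simplex l) {i j : Fin (l + 1)} {r : ℝ} (hr : 0 < r)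
    {y : Fin (l + 1) → ℝ} (hy : y ∈ stdSimplex ℝ (Fin (l + 1)))
    (hy' : edgeShift i j r y ∈ stdSimplex ℝ (Fin (l + 1)))
    (hi : F (s (Pi.single i 1)) < F (s y)) (hj : F (s y) < F (s (Pi.single j 1))) :
    F (s y) < F (s (edgeShift i j r y)) := by
  obtain ⟨c, hc⟩ := (hF.transverse s hs).exists_form (F (s y))
  have h0 := (hc.eq_zero_iff hy).2 rfl
  have hci := (hc _ (single_mem_stdSimplex ℝ i)).2.2 hi
  have hcj := (hc _ (single_mem_stdSimplex ℝ j)).1.2 hj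
  rw [sum_mul_single] at hci hcj
  refine (hc _ hy').1.1 ?_
  rw [sum_mul_edgeShift, h0, zero_add]
  exact mul_pos hr (by linarith)

/-- The form of the level vanishes at a point with all coordinates positive, and it is not zero
because the vertex values differ. So it takes both signs at the vertices. -/
theorem IsTransverseMap.exists_lt_lt (hF : K.IsTransverseMap F) (hs₀ : s₀ ∈ K.simplex k)
    (hk : 0 < k) {w : Fin (k + 1) → ℝ} (hw : w ∈ openSimplex k) :
    ∃ i j, F (s₀ (Pi.single i 1)) < F (s₀ w) ∧ F (s₀ w) < F (s₀ (Pi.single j 1)) := by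
  obtain ⟨c, hc⟩ := (hF.transverse s₀ hs₀).exists_form (F (s₀ w))
  have h0 := (hc.eq_zero_iff hw.1).2 rfl
  have hne : ∃ i, c i ≠ 0 := by
    by_contra hcon
    push Not at hcon
    have hall : ∀ i, F (s₀ (Pi.single i 1)) = F (s₀ w) := fun i =>
      (hc.eq_zero_iff (single_mem_stdSimplex ℝ i)).1 (by rw [sum_mul_single, hcon])
    have h1 : ∀ i j, ¬ K.verts s₀ i < K.verts s₀ j := fun i j h => by
      have := ((hF.transverse s₀ hs₀).lt_iff i j).2 h
      simp only [hall, lt_irrefl] at this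
    have := K.label_injective s₀ hs₀ (le_antisymm (not_lt.1 (h1 (Fin.last k) 0))
      (not_lt.1 (h1 0 (Fin.last k))))
    simp [Fin.ext_iff, hk.ne] at this
  have hex : (∃ i, c i < 0) ∧ ∃ j, 0 < c j := by
    constructor <;> by_contra hcon <;> push Not at hcon <;> obtain ⟨i, hi⟩ := hne
    · have := (Finset.sum_eq_zero_iff_of_nonneg fun i _ =>
        mul_nonneg (hcon i) (hw.2 i).le).1 h0 i (Finset.mem_univ _)
      exact (mul_ne_zero hi (hw.2 i).ne') this
    · have := (Finset.sum_eq_zero_iff_of_nonpos fun i _ =>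
        mul_nonpos_of_nonpos_of_nonneg (hcon i) (hw.2 i).le).1 h0 i (Finset.mem_univ _)
      exact (mul_ne_zero hi (hw.2 i).ne') this
  obtain ⟨⟨i, hi⟩, j, hj⟩ := hex
  refine ⟨i, j, (hc _ (single_mem_stdSimplex ℝ i)).2.1 ?_, (hc _ (single_mem_stdSimplex ℝ j)).1.1 ?_⟩
  · rwa [sum_mul_single]
  · rwa [sum_mul_single]

/-- Near the points of an open simplex of positive dimension whose link is a sphere, there are
charts in which the last coordinate is the given transverse function. -/
theorem IsTransverseMap.exists_levelChart [T2Space X] (hF : K.IsTransverseMap F)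
    (hs₀ : s₀ ∈ K.simplex k) (hk : 0 < k) (hC : IsCompact (K.closedStar s₀)) {m d : ℕ}
    (hd : k + d = m + 1) {H : X → EuclideanSpace ℝ (Fin d)}
    (hH : BijOn H (K.linkSet s₀) (Metric.sphere 0 1)) (hcont : ContinuousOn H (K.linkSet s₀))
    {w : Fin (k + 1) → ℝ} (hw : w ∈ openSimplex k) :
    ∃ ψ : OpenPartialHomeomorph X (EuclideanSpace ℝ (Fin m) × ℝ),
      s₀ w ∈ ψ.source ∧ ∀ x ∈ ψ.source, (ψ x).2 = F x := by
  obtain ⟨i₀, j₀, hi₀, hj₀⟩ := hF.exists_lt_lt hs₀ hk hw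
  have hij : i₀ ≠ j₀ := by
    rintro rfl
    exact lt_asymm hi₀ hj₀
  obtain ⟨A, hAs, hAt, hA⟩ := exists_starChart hs₀ hC hH hcont hij
  have hcoface : K.IsCoface s₀ s₀ (Function.Embedding.refl _) := ⟨hs₀, fun w _ => by
    congr 1
    exact funext fun i => faceMap_apply (Function.Embedding.refl _) w i⟩
  have hwS : s₀ w ∈ A.source := by
    rw [hAs]
    exact ⟨k, s₀, _, hcoface, w, hw.1, hw.2, rfl⟩
  let I := Ioo (F (s₀ (Pi.single i₀ 1))) (F (s₀ (Pi.single j₀ 1)))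
  -- Here `F` is strictly between its values at the vertices `i₀` and `j₀`, as needed for edge
  -- shifts to increase it.
  let N := A.target ∩ A.symm ⁻¹' (F ⁻¹' I)
  have hN : IsOpen N := A.isOpen_inter_preimage_symm (isOpen_Ioo.preimage hF.continuous)
  have hφ : ContinuousOn (fun q => F (A.symm q)) N :=
    hF.continuous.comp_continuousOn (A.symm.continuousOn.mono inter_subset_left)
  have hwN : A (s₀ w) ∈ N := ⟨A.map_source hwS, by
    rw [mem_preimage, A.left_inv hwS]; exact ⟨hi₀, hj₀⟩⟩
  -- Increasing the last coordinate with the others fixed is the edge shift from `i₀` to `j₀`.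
  have hmono : ∀ e t t', (e, t) ∈ N → (e, t') ∈ N → t < t' →
      F (A.symm (e, t)) < F (A.symm (e, t')) := by
    intro e t t' ht ht' htt
    have hxS := A.map_target ht.1
    have hx := A.right_inv ht.1
    have hFI : F (A.symm (e, t)) ∈ I := ht.2
    obtain ⟨l, s, f, h, y, hy, hpos, hxy⟩ := hAs ▸ hxS
    rw [← hxy] at hx hFI hxS ⊢
    rw [hAs] at hxS
    have hn := norm_coneCoord hH.mapsTo hxS
    have hlt := ht'.1
    rw [hAt] at hlt
    have hx' := hx
    rw [hA] at hx'
    obtain ⟨h1, h2⟩ := Prod.ext_iff.1 hx'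
    simp only at h1 h2
    have hlt2 : _ < (1 : ℝ) := hlt.2.2
    simp only [← h1] at hlt2
    have hsum := Fin.sum_eq_add_add_sum_subtype hij (K.starCoord s₀ (s y))
    rw [hn, LabelledComplex.starRest, hsum, h2, h.starCoord hy i₀] at hlt2
    have hle : t' - t < y (f i₀) := by linarith
    have hff : f i₀ ≠ f j₀ := fun h => hij (f.injective h)
    have hy' := edgeShift_mem hff (sub_pos.2 htt).le hy hle.le
    have hpos' : ∀ a, 0 < edgeShift (f i₀) (f j₀) (t' - t) y (f a) := fun a => by
      by_cases hi : a = i₀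
      · rw [hi, edgeShift_left hff]; linarith
      · by_cases hj : a = j₀
        · rw [hj, edgeShift_right hff]; linarith [hpos j₀]
        · rw [edgeShift_of_ne (fun h => hi (f.injective h)) fun h => hj (f.injective h)]
          exact hpos a
    have hsrc : s (edgeShift (f i₀) (f j₀) (t' - t) y) ∈ A.source := by
      rw [hAs]
      exact ⟨l, s, f, h, _, hy', hpos', rfl⟩
    have hA' : A (s (edgeShift (f i₀) (f j₀) (t' - t) y)) = (e, t') := by
      rw [hA, h.coneCoord_edgeShift hy hpos hy' hpos']
      refine Prod.ext ?_ ?_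
      · rw [← h1]
        refine Prod.ext (funext fun i => ?_) rfl
        simp only [h.starCoord hy, h.starCoord hy']
        exact edgeShift_of_ne (fun h => i.2.1 (f.injective h)) (fun h => i.2.2 (f.injective h)) _ _
      · simp only
        rw [h.starCoord hy', edgeShift_right hff, ← h.starCoord hy, h2]
        ring
    rw [← hA', A.left_inv hsrc]
    have hv : ∀ i, s (Pi.single (f i) 1) = s₀ (Pi.single i 1) := fun i => by
      rw [← faceMap_single, h.face _ (single_mem_stdSimplex ℝ i)]
    refine hF.lt_edgeShift h.mem (sub_pos.2 htt) hy hy' ?_ ?_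
    · rw [hv]; exact hFI.1
    · rw [hv]; exact hFI.2
  obtain ⟨S, hS, hS'⟩ := exists_straightening hN hφ hmono ⟨_, hwN⟩
  -- Of the `k + 1` coordinates at `s₀` all but two remain, and `(k - 1) + d = m`.
  have hrank : Module.finrank ℝ (({i // i ≠ i₀ ∧ i ≠ j₀} → ℝ) × EuclideanSpace ℝ (Fin d)) =
      Module.finrank ℝ (EuclideanSpace ℝ (Fin m)) := by
    have := Fin.sum_eq_add_add_sum_subtype hij fun _ => 1
    simp only [Finset.sum_const, Finset.card_univ, nsmul_eq_mul, mul_one, Fintype.card_fin] at this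
    rw [Module.finrank_prod, Module.finrank_fintype_fun_eq_card, finrank_euclideanSpace_fin,
      finrank_euclideanSpace_fin]
    have h2 : k + 1 = 1 + 1 + Fintype.card {i // i ≠ i₀ ∧ i ≠ j₀} := by exact_mod_cast this
    omega
  let L := ContinuousLinearEquiv.ofFinrankEq hrank
  refine ⟨(A.trans S).transHomeomorph (L.toHomeomorph.prodCongr (Homeomorph.refl ℝ)), ?_, ?_⟩
  · change s₀ w ∈ (A.trans S).source
    rw [OpenPartialHomeomorph.trans_source, hS]
    exact ⟨hwS, hwN⟩
  · intro x hx
    change x ∈ (A.trans S).source at hx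
    rw [OpenPartialHomeomorph.trans_source, hS] at hx
    change (S (A x)).2 = F x
    rw [hS']
    simp only
    rw [A.left_inv hx.1]

end LabelledComplex

/-! ### Stars and links in the covering space. -/

namespace Triangulation

variable {M X : Type*} [TopologicalSpace M] [TopologicalSpace X] {p : X → M}
  {T : Triangulation M} {v : M} (hvertex : T.HasUniqueVertex v) (hess : T.IsEssential v)
  [SimplyConnectedSpace X] [T2Space M] (cov : IsCoveringMap p) (x₀ : p ⁻¹' {v})

section Star

variable {k : ℕ} {σ₀ : T.Cell k} {s₀ : (Fin (k + 1) → ℝ) → X} (hs₀ : T.IsLift p σ₀ s₀)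
include hs₀

omit [SimplyConnectedSpace X] [T2Space M] in
theorem IsLift.char_faceMap {l : ℕ} {τ : T.Cell l} {s : (Fin (l + 1) → ℝ) → X} (hs : T.IsLift p τ s)
    {f : Fin (k + 1) ↪ Fin (l + 1)}
    (hf : ∀ w ∈ stdSimplex ℝ (Fin (k + 1)), s (faceMap f w) = s₀ w) :
    ∀ w ∈ stdSimplex ℝ (Fin (k + 1)), T.char τ (faceMap f w) = T.char σ₀ w := fun w hw => by
  rw [← hs.2 _ (faceMap_mem f hw), hf w hw, hs₀.2 w hw]

omit [SimplyConnectedSpace X] [T2Space M] in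
include cov in
/-- A simplex having a face `σ₀` lifts to a simplex having a given lift of `σ₀` as a face. -/
theorem IsLift.exists_coface {l : ℕ} {τ : T.Cell l} {f : Fin (k + 1) ↪ Fin (l + 1)}
    (hf : ∀ w ∈ stdSimplex ℝ (Fin (k + 1)), T.char τ (faceMap f w) = T.char σ₀ w) :
    ∃ s, T.IsLift p τ s ∧ ∀ w ∈ stdSimplex ℝ (Fin (k + 1)), s (faceMap f w) = s₀ w := by
  have hw := single_mem_stdSimplex ℝ (0 : Fin (k + 1))
  obtain ⟨s, hs, hsw⟩ := T.exists_isLift cov τ (faceMap_mem f hw) (x := s₀ (Pi.single 0 1))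
    (by rw [hf _ hw, hs₀.2 _ hw])
  refine ⟨s, hs, IsLift.eqOn T cov ⟨?_, fun w hw => ?_⟩ hs₀ hw hsw⟩
  · exact hs.1.comp (continuous_faceMap f).continuousOn fun w hw => faceMap_mem f hw
  · rw [hs.2 _ (faceMap_mem f hw), hf w hw]

/-- A coface of `s₀` is determined by its cell and the position of the face in it, by unique
lifting; there are finitely many such pairs. -/
theorem isCompact_closedStar : IsCompact ((T.liftComplex cov x₀ hvertex hess).closedStar s₀) := by
  have := T.finite_cells
  let ι := {q : Σ c : (Σ l, T.Cell l), (Fin (k + 1) ↪ Fin (c.1 + 1)) //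
    ∀ w ∈ stdSimplex ℝ (Fin (k + 1)), T.char q.1.2 (faceMap q.2 w) = T.char σ₀ w}
  choose s hs hsf using fun i : ι => hs₀.exists_coface cov i.2
  have h : (T.liftComplex cov x₀ hvertex hess).closedStar s₀ =
      ⋃ i : ι, s i '' stdSimplex ℝ (Fin (i.1.1.1 + 1)) := by
    ext x
    rw [mem_iUnion]
    constructor
    · rintro ⟨l, s', f, ⟨⟨τ, hs'⟩, hf⟩, y, hy, rfl⟩
      let i : ι := ⟨⟨⟨l, τ⟩, f⟩, hs₀.char_faceMap hs' hf⟩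
      have hw := single_mem_stdSimplex ℝ (0 : Fin (k + 1))
      exact ⟨i, y, hy, IsLift.eqOn T cov (hs i) hs' (faceMap_mem f hw)
        ((hsf i _ hw).trans (hf _ hw).symm) hy⟩
    · rintro ⟨i, y, hy, rfl⟩
      exact ⟨_, s i, _, ⟨⟨_, hs i⟩, hsf i⟩, y, hy, rfl⟩
  rw [h]
  exact isCompact_iUnion fun i => (isCompact_stdSimplex ℝ _).image_of_continuousOn (hs i).1

/-- Injectivity is the point, since several faces of one simplex may be glued to `σ₀`. The large
weights `2 / (2 * k + 3)` mark one face of the carrier of a link point, so two lifts of the carrier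
having `s₀` as a face there must coincide. -/
theorem bijOn_link : BijOn p ((T.liftComplex cov x₀ hvertex hess).linkSet s₀) (T.link σ₀) := by
  refine ⟨?_, ?_, ?_⟩
  · rintro _ ⟨l, s, f, ⟨⟨τ, hs⟩, hf⟩, y, hy, hyf, rfl⟩
    exact ⟨l, τ, f, hs₀.char_faceMap hs hf, y, hy, hyf, (hs.2 y hy).symm⟩
  · rintro _ ⟨l, s, f, h, y, hy, hyf, rfl⟩ _ ⟨l', s', f', h', y', hy', hyf', rfl⟩ heq
    obtain ⟨τ, hs⟩ := h.mem
    obtain ⟨τ', hs'⟩ := h'.mem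
    obtain ⟨⟨d, σ₁⟩, ⟨w₁, hw₁, hx⟩, -⟩ := T.existsUnique_cell (p (s y))
    have key : ∀ {l : ℕ} {s : (Fin (l + 1) → ℝ) → X} {f : Fin (k + 1) ↪ Fin (l + 1)}
        (h : (T.liftComplex cov x₀ hvertex hess).IsCoface s₀ s f) {y : Fin (l + 1) → ℝ}
        (hy : y ∈ stdSimplex ℝ (Fin (l + 1))) (hyf : ∀ i, y (f i) = 2 / (2 * (k : ℝ) + 3))
        (hx : T.char σ₁ w₁ = p (s y)), ∃ s₁, T.IsLift p σ₁ s₁ ∧ s₁ w₁ = s y ∧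
          ∃ f₁ : Fin (k + 1) ↪ Fin (d + 1), (∀ i, w₁ (f₁ i) = 2 / (2 * (k : ℝ) + 3)) ∧
          ∀ w ∈ stdSimplex ℝ (Fin (k + 1)), s₁ (faceMap f₁ w) = s₀ w := by
      intro l s f h y hy hyf hx
      obtain ⟨τ, hs⟩ := h.mem
      obtain ⟨d', j, w, hw, rfl⟩ := exists_faceMap_eq hy
      obtain ⟨g, hgw, hg⟩ := T.exists_face_perm τ j hw σ₁ hw₁ (by rw [hx, hs.2 _ hy])
      have hs₁ : T.IsLift p σ₁ fun w => s (faceMap g w) :=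
        ⟨hs.1.comp (continuous_faceMap g).continuousOn fun y hy => faceMap_mem g hy,
          fun y hy => by rw [hs.2 _ (faceMap_mem g hy), hg y hy]⟩
      obtain ⟨f₁, hf₁, h₁⟩ := h.exists_factor (s₁ := fun w => s (faceMap g w)) (w := w₁)
        ⟨σ₁, hs₁⟩ (fun _ _ => rfl) fun i => by
          rw [hgw, hyf]; exact LabelledComplex.linkWeight_pos k
      refine ⟨_, hs₁, by simp only [hgw], f₁, fun i => ?_, h₁.face⟩
      rw [← hyf, hf₁, ← hgw, faceMap_apply]
    obtain ⟨s₁, hs₁, hsy, f₁, hw, hf₁⟩ := key h hy hyf hx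
    obtain ⟨s₂, hs₂, hsy', f₂, hw', hf₂⟩ := key h' hy' hyf' (hx.trans heq)
    -- One more coordinate of this size would make the total at least `(2 * k + 4) / (2 * k + 3)`,
    -- which exceeds `1`.
    have hrange : ∀ {f₁ f₂ : Fin (k + 1) ↪ Fin (d + 1)},
        (∀ i, w₁ (f₁ i) = 2 / (2 * (k : ℝ) + 3)) → (∀ i, w₁ (f₂ i) = 2 / (2 * (k : ℝ) + 3)) →
        range f₂ ⊆ range f₁ := by
      rintro f₁ f₂ h1 h2 _ ⟨i, rfl⟩
      by_contra hne
      have hsum := Finset.sum_le_sum_of_subset_of_nonneg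
        (Finset.subset_univ (insert (f₂ i) (Finset.univ.map f₁))) fun i _ _ => hw₁.1.1 i
      rw [hw₁.1.2, Finset.sum_insert (by simpa using hne), Finset.sum_map, h2] at hsum
      simp only [h1, Finset.sum_const, Finset.card_univ, Fintype.card_fin, nsmul_eq_mul] at hsum
      have hpos : (0 : ℝ) < 2 * k + 3 := by positivity
      rw [← mul_div_assoc, ← add_div, div_le_one hpos] at hsum
      push_cast at hsum
      linarith
    -- Two embeddings with the same range might differ by a permutation; the barycentre does not see
    -- it.
    let b : Fin (k + 1) → ℝ := fun _ => 1 / ((k : ℝ) + 1)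
    have hb : b ∈ stdSimplex ℝ (Fin (k + 1)) := by
      refine ⟨fun _ => by positivity, ?_⟩
      have : (k : ℝ) + 1 ≠ 0 := by positivity
      simp [b, this]
    have hfb : faceMap f₁ b = faceMap f₂ b := by
      funext i
      by_cases hi : i ∈ range f₁
      · obtain ⟨j, hj⟩ := hrange hw' hw hi
        obtain ⟨i, rfl⟩ := hi
        rw [faceMap_apply, ← hj, faceMap_apply]
      · rw [faceMap_apply_of_notMem f₁ _ hi,
          faceMap_apply_of_notMem f₂ _ fun h => hi (hrange hw hw' h)]
    have := IsLift.eqOn T cov hs₁ hs₂ (faceMap_mem f₁ hb) (by rw [hf₁ b hb, hfb, hf₂ b hb]) hw₁.1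
    rw [← hsy, ← hsy', this]
  · rintro _ ⟨l, τ, f, hf, y, hy, hyf, rfl⟩
    obtain ⟨s, hs, hsf⟩ := hs₀.exists_coface cov hf
    exact ⟨s y, ⟨l, s, f, ⟨⟨τ, hs⟩, hsf⟩, y, hy, hyf, rfl⟩, hs.2 y hy⟩

end Star

variable [LinearOrder (FundamentalGroup M v)] {F : X → ℝ}

theorem exists_levelChart {m : ℕ} (hlinks : T.HasSphericalLinks (m + 1))
    (hF : (T.liftComplex cov x₀ hvertex hess).IsTransverseMap F) {x : X} (hx : p x ≠ v) :
    ∃ ψ : OpenPartialHomeomorph X (EuclideanSpace ℝ (Fin m) × ℝ),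
      x ∈ ψ.source ∧ ∀ y ∈ ψ.source, (ψ y).2 = F y := by
  classical
  have := cov.t2Space
  obtain ⟨k, σ₀, s₀, hs₀, w₀, hw₀, rfl, -⟩ := T.lift_carrier cov x
  have hk : 0 < k := by
    refine Nat.pos_of_ne_zero ?_
    rintro rfl
    exact hx (by rw [hs₀.2 _ hw₀.1, hvertex _ _ hw₀.1])
  obtain ⟨d, hd, ⟨e⟩⟩ := hlinks k σ₀
  have hbij := bijOn_link hvertex hess cov x₀ hs₀
  let H : X → EuclideanSpace ℝ (Fin d) := fun x =>
    if h : p x ∈ T.link σ₀ then (e ⟨p x, h⟩ : EuclideanSpace ℝ (Fin d)) else 0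
  have hHe : ∀ x (h : p x ∈ T.link σ₀), H x = e ⟨p x, h⟩ := fun x h => dif_pos h
  refine hF.exists_levelChart ⟨σ₀, hs₀⟩ hk (isCompact_closedStar hvertex hess cov x₀ hs₀) hd
    (H := H) ⟨fun x hx => ?_, fun x hx y hy hxy => ?_, fun z hz => ?_⟩ ?_ hw₀
  · rw [hHe x (hbij.mapsTo hx)]
    exact (e _).2
  · rw [hHe x (hbij.mapsTo hx), hHe y (hbij.mapsTo hy)] at hxy
    have := e.injective (Subtype.ext hxy)
    exact hbij.injOn hx hy (congr_arg Subtype.val this)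
  · obtain ⟨x, hx, hxz⟩ := hbij.surjOn (e.symm ⟨z, hz⟩).2
    refine ⟨x, hx, ?_⟩
    rw [hHe x (hbij.mapsTo hx)]
    simp only [hxz, Subtype.coe_eta, Homeomorph.apply_symm_apply]
  · rw [continuousOn_iff_continuous_domRestrict]
    have : Continuous fun x : (T.liftComplex cov x₀ hvertex hess).linkSet s₀ =>
        (e ⟨p x, hbij.mapsTo x.2⟩ : EuclideanSpace ℝ (Fin d)) :=
      continuous_subtype_val.comp (e.continuous.comp
        ((cov.continuous.comp continuous_subtype_val).subtype_mk _))
    exact this.congr fun x => (hHe x (hbij.mapsTo x.2)).symm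

end Triangulation

/-! ### From level sets to a foliation of the quotient. -/

section Foliation

variable {m : ℕ} {M X : Type*} [TopologicalSpace M] [TopologicalSpace X] {p : X → M} {S : Set M}
  {F : X → ℝ}

/-- The plaques of the chart `e` lift to pieces of level sets of `F`. -/
def IsLevelAdapted (p : X → M) (F : X → ℝ)
    (e : OpenPartialHomeomorph M (EuclideanSpace ℝ (Fin m) × ℝ)) : Prop :=
  ∀ x : X, p x ∈ e.source →
    ∃ U ∈ 𝓝 x, ∀ y ∈ U, ∀ z ∈ U, (F y = F z ↔ (e (p y)).2 = (e (p z)).2)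

theorem IsLevelAdapted.compatible (hp : IsLocalHomeomorph p) (hsurj : Function.Surjective p)
    {e e' : OpenPartialHomeomorph M (EuclideanSpace ℝ (Fin m) × ℝ)} (he : IsLevelAdapted p F e)
    (he' : IsLevelAdapted p F e') {x : M} (hx : x ∈ e.source ∩ e'.source) :
    ∃ U ∈ 𝓝 x, ∀ y ∈ U, ∀ z ∈ U, ((e y).2 = (e z).2 ↔ (e' y).2 = (e' z).2) := by
  obtain ⟨x, rfl⟩ := hsurj x
  obtain ⟨U, hU, h⟩ := he x hx.1
  obtain ⟨U', hU', h'⟩ := he' x hx.2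
  refine ⟨p '' (U ∩ U'), hp.isOpenMap.image_mem_nhds (Filter.inter_mem hU hU'), ?_⟩
  rintro _ ⟨y, hy, rfl⟩ _ ⟨z, hz, rfl⟩
  rw [← h y hy.1 z hz.1, h' y hy.2 z hz.2]

/-- Take all adapted charts. Charts adapted to the same function are compatible, so this atlas is
maximal; and any atlas inducing the level sets consists of adapted charts, hence equals it by its
own maximality. -/
theorem exists_singularFoliation (hp : IsLocalHomeomorph p) (hsurj : Function.Surjective p)
    (hcov : ∀ x ∈ Sᶜ, ∃ e : OpenPartialHomeomorph M (EuclideanSpace ℝ (Fin m) × ℝ),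
      e.source ⊆ Sᶜ ∧ IsLevelAdapted p F e ∧ x ∈ e.source) :
    ∃ 𝓕 : SingularFoliation m M S, 𝓕.IsInducedBy p F ∧
      ∀ 𝓕' : SingularFoliation m M S, 𝓕'.IsInducedBy p F → 𝓕' = 𝓕 := by
  refine ⟨{
    atlas := {e | e.source ⊆ Sᶜ ∧ IsLevelAdapted p F e}
    source_subset := fun e he => he.1
    covers := fun x hx => by
      obtain ⟨e, h1, h2, h3⟩ := hcov x hx
      exact ⟨e, ⟨h1, h2⟩, h3⟩
    compatible := fun e he e' he' x hx => he.2.compatible hp hsurj he'.2 hx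
    maximal := fun e he hcomp => ⟨he, fun x hx => ?_⟩ }, fun e he => he.2, fun 𝓕' h𝓕' => ?_⟩
  · obtain ⟨e', h1, h2, h3⟩ := hcov (p x) (he hx)
    obtain ⟨U, hU, h⟩ := hcomp e' ⟨h1, h2⟩ (p x) ⟨hx, h3⟩
    obtain ⟨U', hU', h'⟩ := h2 x h3
    refine ⟨p ⁻¹' U ∩ U', Filter.inter_mem (hp.continuous.continuousAt hU) hU', ?_⟩
    intro y hy z hz
    rw [h' y hy.2 z hz.2, h _ hy.1 _ hz.1]
  · have hatlas : 𝓕'.atlas = {e | e.source ⊆ Sᶜ ∧ IsLevelAdapted p F e} := by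
      ext e
      refine ⟨fun he => ⟨𝓕'.source_subset e he, h𝓕' e he⟩, fun he => 𝓕'.maximal e he.1 ?_⟩
      intro e' he' x hx
      exact he.2.compatible hp hsurj (h𝓕' e' he') hx
    cases 𝓕'
    simp only at hatlas
    subst hatlas
    rfl

end Foliation

namespace Triangulation

variable {M X : Type*} [TopologicalSpace M] [TopologicalSpace X] {p : X → M}
  {T : Triangulation M} {v : M} (hvertex : T.HasUniqueVertex v) (hess : T.IsEssential v)
  [SimplyConnectedSpace X] [LocallyPathConnectedSpace X] [T2Space M] (cov : IsCoveringMap p)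
  (x₀ : p ⁻¹' {v}) [LinearOrder (FundamentalGroup M v)]
  {ρ : FundamentalGroup M v →* (ℝ ≃o ℝ)} {F : X → ℝ}

omit [SimplyConnectedSpace X] [LocallyPathConnectedSpace X] [T2Space M]
  [LinearOrder (FundamentalGroup M v)] in
include hvertex cov x₀ in
theorem surjective_of_isCoveringMap : Function.Surjective p := by
  intro y
  obtain ⟨⟨k, σ⟩, ⟨w, hw, hy⟩, -⟩ := T.existsUnique_cell y
  obtain ⟨s, hs, -⟩ := T.exists_isLift cov σ (single_mem_stdSimplex ℝ 0) (x := (x₀ : X))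
    (by rw [T.char_single hvertex]; exact x₀.2)
  exact ⟨s w, by rw [hs.2 w hw.1, hy]⟩

omit [LinearOrder (FundamentalGroup M v)] [T2Space M] in
include hvertex in
theorem _root_.IsDevelopingMap.deck_eq_iff (hF : IsDevelopingMap T cov x₀ ρ F) {τ : X ≃ₜ X}
    (hτ : ∀ x, p (τ x) = p x) (y z : X) : F (τ y) = F (τ z) ↔ F y = F z := by
  obtain ⟨g, hg⟩ := exists_isDeck_of_deck cov x₀ hτ
  rw [hF.equivariant hvertex cov x₀ hg, hF.equivariant hvertex cov x₀ hg, (ρ g).injective.eq_iff]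

-- A level chart is pushed down by a local inverse of `p`. At other points of the fibre a deck
-- transformation leads back to the chosen sheet, and it maps levels of `F` to levels.
include hvertex hess in
theorem _root_.IsDevelopingMap.exists_adaptedChart (hρ : StrictMono fun g => ρ g 0)
    (hF : IsDevelopingMap T cov x₀ ρ F) {m : ℕ} (hlinks : T.HasSphericalLinks (m + 1)) {y : M}
    (hy : y ∈ ({v}ᶜ : Set M)) :
    ∃ e : OpenPartialHomeomorph M (EuclideanSpace ℝ (Fin m) × ℝ),
      e.source ⊆ {v}ᶜ ∧ IsLevelAdapted p F e ∧ y ∈ e.source := by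
  obtain ⟨x, rfl⟩ := surjective_of_isCoveringMap hvertex cov x₀ y
  obtain ⟨ψ, hxψ, hψ⟩ := exists_levelChart hvertex hess cov x₀ hlinks
    (hF.isTransverseMap hvertex hess cov x₀ hρ) hy
  obtain ⟨q, hxq, hpq⟩ := cov.isLocalHomeomorph x
  have hsymm : ∀ z ∈ q.source, q.symm (p z) = z := fun z hz => by rw [hpq, q.left_inv hz]
  let e := (q.symm.trans ψ).restrOpen {v}ᶜ isOpen_compl_singleton
  have hsource : e.source = (q.target ∩ q.symm ⁻¹' ψ.source) ∩ {v}ᶜ := rfl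
  refine ⟨e, fun z hz => hz.2, fun x' hx' => ?_, ?_⟩
  · rw [hsource] at hx'
    have hpx : p (q.symm (p x')) = p x' := by
      have := q.right_inv hx'.1.1
      rwa [← hpq] at this
    obtain ⟨τ, hτ, hτx⟩ := cov.exists_deck hpx
    have hU : q.source ∩ ψ.source ∈ 𝓝 (τ.symm x') := by
      rw [← hτx, τ.symm_apply_apply]
      exact Filter.inter_mem (q.open_source.mem_nhds (q.map_target hx'.1.1))
        (ψ.open_source.mem_nhds hx'.1.2)
    refine ⟨τ.symm ⁻¹' (q.source ∩ ψ.source), τ.symm.continuous.continuousAt hU, ?_⟩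
    have hval : ∀ y, τ.symm y ∈ q.source ∩ ψ.source → (e (p y)).2 = F (τ.symm y) := fun y hy => by
      change (ψ (q.symm (p y))).2 = _
      rw [← hψ _ hy.2]
      conv_lhs => rw [← τ.apply_symm_apply y, hτ, hsymm _ hy.1]
    intro y hy z hz
    rw [hval y hy, hval z hz, ← hF.deck_eq_iff hvertex cov x₀ hτ (τ.symm y), τ.apply_symm_apply,
      τ.apply_symm_apply]
  · rw [hsource]
    refine ⟨⟨?_, ?_⟩, hy⟩
    · rw [hpq]; exact q.map_source hxq
    · rw [mem_preimage, hsymm x hxq]; exact hxψ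

include hvertex hess in
theorem _root_.IsDevelopingMap.isNormalTo (hρ : StrictMono fun g => ρ g 0)
    (hF : IsDevelopingMap T cov x₀ ρ F) {m : ℕ} {𝓕 : SingularFoliation m M {v}}
    (h𝓕 : 𝓕.IsInducedBy p F) {k : ℕ} (hk : 0 < k) (σ : T.Cell k) : 𝓕.IsNormalTo T σ := by
  obtain ⟨s, hs, -⟩ := T.exists_isLift cov σ (single_mem_stdSimplex ℝ 0) (x := (x₀ : X))
    (by rw [T.char_single hvertex]; exact x₀.2)
  have hT := (hF.isTransverseMap hvertex hess cov x₀ hρ).transverse s ⟨σ, hs⟩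
  refine ⟨fun y => F (s y), hT.continuousOn, hF.injOn_segment cov x₀ hs, fun t _ => ?_, ?_⟩
  · obtain ⟨c, hc⟩ := hT.exists_form t
    refine ⟨c, ?_, ?_⟩
    · rintro rfl
      have h : ∀ i, F (s (Pi.single i 1)) = t := fun i =>
        (hc.eq_zero_iff (single_mem_stdSimplex ℝ i)).1 (by simp)
      have hne : (0 : Fin (k + 1)) ≠ Fin.last k := by simp [Fin.ext_iff, hk.ne]
      have := hF.injOn_segment cov x₀ hs _ _ hne (left_mem_segment ℝ _ _) (right_mem_segment ℝ _ _)
        ((h _).trans (h _).symm)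
      have := congr_fun this 0
      simp [hne] at this
    · ext y
      exact and_congr_right fun hy => (hc.eq_zero_iff hy).symm
  · intro e he x hx hxe
    rw [← hs.2 x hx] at hxe
    obtain ⟨U, hU, h⟩ := h𝓕 e he (s x) hxe
    obtain ⟨V, hV, hVU⟩ := mem_nhdsWithin_iff_exists_mem_nhds_inter.1 (hs.1 x hx hU)
    refine ⟨V, hV, fun y hy z hz => ?_⟩
    rw [← hs.2 y hy.2, ← hs.2 z hz.2]
    exact h _ (hVU hy) _ (hVU hz)

end Triangulation

/-! ### The main theorem. -/

theorem mainTheorem1 {m : ℕ} {M X : Type*}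
    [TopologicalSpace M] [T2Space M] [CompactSpace M]
    [ChartedSpace (EuclideanSpace ℝ (Fin (m + 1))) M]
    (T : Triangulation M) (hlinks : T.HasSphericalLinks (m + 1))
    (v : M) (hvertex : T.HasUniqueVertex v) (hess : T.IsEssential v)
    [TopologicalSpace X] [SimplyConnectedSpace X] {p : X → M} (cov : IsCoveringMap p)
    (x₀ : p ⁻¹' {v})
    [LinearOrder (FundamentalGroup M v)] [MulLeftStrictMono (FundamentalGroup M v)] :
    -- the canonical action: minimal embeddings of the ordered group, for all its enumerations
    (∃ s : ℕ ≃ FundamentalGroup M v, s 0 = 1) ∧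
    (∀ s : ℕ ≃ FundamentalGroup M v, s 0 = 1 →
      ∃ (i : FundamentalGroup M v → ℝ) (ρ : FundamentalGroup M v →* (ℝ ≃o ℝ)),
        IsMinimalEmbedding s i ∧ StrictMono i ∧ IsActionOfEmbedding i ρ) ∧
    -- the foliation given by an action on the line that realizes the order
    (∀ ρ : FundamentalGroup M v →* (ℝ ≃o ℝ), StrictMono (fun g => ρ g 0) →
      (∃ F : X → ℝ, IsDevelopingMap T cov x₀ ρ F ∧
        (m + 1 ≤ 2 → IsAffineOnBaseEdges T p x₀ F)) ∧
      ∀ F : X → ℝ, IsDevelopingMap T cov x₀ ρ F →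
        (∀ g τ, IsDeck cov x₀ g τ → ∀ x, F (τ x) = ρ g (F x)) ∧
        ∃ 𝓕 : SingularFoliation m M {v}, 𝓕.IsInducedBy p F ∧
          (∀ 𝓕' : SingularFoliation m M {v}, 𝓕'.IsInducedBy p F → 𝓕' = 𝓕) ∧
          ∀ σ : T.Cell (m + 1), 𝓕.IsNormalTo T σ) ∧
    -- dependence on the order only, up to strips of parallel leaves
    (∀ (ρ ρ₀ : FundamentalGroup M v →* (ℝ ≃o ℝ)) (s : ℕ ≃ FundamentalGroup M v) (F F₀ : X → ℝ),
      StrictMono (fun g => ρ g 0) → StrictMono (fun g => ρ₀ g 0) →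
      s 0 = 1 → IsMinimalEmbedding s (fun g => ρ₀ g 0) →
      IsDevelopingMap T cov x₀ ρ F → IsDevelopingMap T cov x₀ ρ₀ F₀ →
      ∃ (f : ℝ → ℝ) (κ : X → X), IsStripCollapse T p v F F₀ f κ) := by
  have := ChartedSpace.locallyPathConnectedSpace (EuclideanSpace ℝ (Fin (m + 1))) M
  have := cov.locallyPathConnectedSpace
  have := T.nontrivial_fundamentalGroup hvertex hess cov x₀ hlinks
  have := T.countable_fundamentalGroup hvertex cov x₀ hess
  have := noMaxOrder_of_nontrivial (G := FundamentalGroup M v)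
  have : Infinite (FundamentalGroup M v) := NoMaxOrder.infinite
  refine ⟨exists_equiv_nat_zero 1, fun s _ => ?_, fun ρ hρ => ⟨?_, fun F hF => ⟨?_, ?_⟩⟩, ?_⟩
  · obtain ⟨i, hmin, hi⟩ := exists_minimalEmbedding s
    obtain ⟨ρ, hρ⟩ := exists_isActionOfEmbedding hmin hi
    exact ⟨i, ρ, hmin, hi, hρ⟩
  -- Edge forms give the affine normalization in dimension at most two; otherwise vertex forms are
  -- used and the extra condition is void.
  · by_cases hm : m + 1 ≤ 2
    · obtain ⟨F, hF, haff⟩ := Triangulation.exists_isDevelopingMap_isAffineOnBaseEdges hvertex hess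
        cov x₀ (fun k σ => (hlinks.le σ).trans hm) hρ
      exact ⟨F, hF, fun _ => haff⟩
    · obtain ⟨F, hF⟩ := Triangulation.exists_isDevelopingMap hvertex hess cov x₀ hρ
      exact ⟨F, hF, fun h => absurd h hm⟩
  · exact fun g τ hτ => hF.equivariant hvertex cov x₀ hτ
  · obtain ⟨𝓕, h𝓕, huniq⟩ := exists_singularFoliation cov.isLocalHomeomorph
      (Triangulation.surjective_of_isCoveringMap hvertex cov x₀)
      fun y hy => hF.exists_adaptedChart hvertex hess cov x₀ hρ hlinks hy
    exact ⟨𝓕, h𝓕, huniq, fun σ => hF.isNormalTo hvertex hess cov x₀ hρ h𝓕 m.succ_pos σ⟩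
  · intro ρ ρ₀ s F F₀ hρ hρ₀ _ hmin hF hF₀
    exact Triangulation.exists_isStripCollapse hvertex hess cov x₀ hρ hρ₀ hmin hF hF₀
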